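/- Let $d\ge 2$, let $\alpha:(0,\infty)\to(0,\infty)$ be differentiable and let $b:[-1,1]\to[0,\infty)$ be measurable with \[ \int_{S^{d-1}} (1-(\sigma\cdot\sigma')^2)\,b(\sigma\cdot\sigma')\,d\sigma'<\infty \qquad\text{for all }\sigma\in S^{d-1}. \] For functions on the sphere put \[ \mathcal B F(\sigma)=\int_{S^{d-1}}\bigl(F(\sigma')-F(\sigma)\bigr)\,b(\sigma'\cdot\sigma)\,d\sigma',\qquad \Gamma_\Delta(F,G)=\nabla_\sigma F\cdot\nabla_\sigma G, \] \[ \Gamma^2_{\mathcal B,\Delta}(F,G)=\tfrac12\bigl(\mathcal B(\Gamma_\Delta(F,G))-\Gamma_\Delta(\mathcal BF,G)-\Gamma_\Delta(F,\mathcal BG)\bigr), \] and let $\Lambda_b\in[0,\infty]$ be the largest constant such that, for all smooth $F:S^{d-1}\to(0,\infty)$ with $F(-\sigma)=F(\sigma)$, \[ \int_{S^{d-1}}\Gamma^2_{\mathcal B,\Delta}(\log F,\log F)\,F\,d\sigma\;\ge\;\Lambda_b\iint_{S^{d-1}\times S^{d-1}}\frac{(F(\sigma')-F(\sigma))^2}{F(\sigma')+F(\sigma)}\,b(\sigma'\cdot\sigma)\,d\sigma'\,d\sigma.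 \] Assume that \[ \frac{r|\alpha'(r)|}{2\alpha(r)}\le\sqrt{\Lambda_b}\qquad\text{for all } r>0. \] Let $T\in(0,\infty]$ and let $f\ge 0$ be a classical solution on $(0,T)\times\mathbb R^d$ of the space-homogeneous Boltzmann equation $\partial_t f=Q(f,f)$ with collision kernel $B(r,c)=\alpha(r/2)\,b(c)$, that is, \[ Q(f,f)(v)=\int_{\mathbb R^d}\int_{S^{d-1}}\bigl(f(v')f(w')-f(v)f(w)\bigr)\,B(|v-w|,\sigma\cdot\sigma')\,d\sigma'\,dw, \] \[ v'=\tfrac{v+w}2+\tfrac{|v-w|}2\sigma',\qquad w'=\tfrac{v+w}2-\tfrac{|v-w|}2\sigma',\qquad \sigma=\tfrac{v-w}{|v-w|}. \] Then the Fisher information \[ I(f(t))=\int_{\mathbb R^d}|\nabla\log f(t,v)|^2 f(t,v)\,dv \] is a non-increasing function of $t\in(0,T)$. Here a classical solution is a function that is $C^\infty$ in $v$, whose $v$-derivatives of all orders are bounded by $C(1+|v|)^{-q}$ with some $q>3d+5$, locally uniformly in $t$ (in particular all solutions that are locally uniformly in $t$ of Schwartz class are allowed), for which the integral defining $Q(f,f)(v)$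 converges, and which satisfies the equation at every $(t,v)$. The integrals over $\sigma'$ in $\mathcal B$ and $Q$ are understood in the principal value sense around the axis of $\sigma$, that is, the integrand is averaged over $\sigma'$ and its mirror image $2(\sigma\cdot\sigma')\sigma-\sigma'$; convergence is absolute convergence after this averaging. -/

import Mathlib

open MeasureTheory Metric Set
open scoped ENNReal NNReal

noncomputable section

namespace Boltzmann

/-- The space of velocities `ℝᵈ` with its Euclidean norm. -/
abbrev Vel (d : ℕ) : Type := EuclideanSpace ℝ (Fin d)

/-- The surface measure on the unit sphere `S^{d-1}` of `ℝᵈ` (not normalised). -/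
def surf (d : ℕ) : Measure (sphere (0 : Vel d) 1) :=
  (volume : Measure (Vel d)).toSphere

/-- For a unit vector `σ`: the reflection `c σ + s e ↦ c σ - s e` (with `e` orthogonal to `σ`) through
the axis spanned by `σ`. It maps the sphere to itself, preserves the surface measure, and satisfies
`σ ⬝ (axisRefl σ σ') = σ ⬝ σ'`. -/
def axisRefl {d : ℕ} (σ x : Vel d) : Vel d := (2 * inner ℝ σ x) • σ - x

/-! ### Calculus on the sphere

A function on the sphere is represented by a function `F : ℝᵈ → ℝ`, of which only the values on the
unit sphere are used. -/

/-- The extension of a function on the sphere that is constant along rays, `x ↦ F (x / |x|)`. -/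
def radialExt {d : ℕ} (F : Vel d → ℝ) : Vel d → ℝ := fun x => F (‖x‖⁻¹ • x)

/-- `F` is a smooth (`C^∞`) function on the sphere. -/
def SmoothOnSphere {d : ℕ} (F : Vel d → ℝ) : Prop :=
  ContDiffOn ℝ (⊤ : ℕ∞) (radialExt F) {0}ᶜ

/-- The gradient `∇_σ F` on the sphere, as a vector of `ℝᵈ` tangent to the sphere at `σ`. -/
def sphGrad {d : ℕ} (F : Vel d → ℝ) (σ : Vel d) : Vel d := gradient (radialExt F) σ

/-- The carré du champ `Γ_Δ(F, G) = ∇_σ F ⬝ ∇_σ G` of the Laplacian of the sphere. -/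
def gammaLaplace {d : ℕ} (F G : Vel d → ℝ) (σ : Vel d) : ℝ :=
  inner ℝ (sphGrad F σ) (sphGrad G σ)

/-- The spherical linear Boltzmann operator
`ℬ F (σ) = ∫ (F(σ') - F(σ)) b(σ' ⬝ σ) dσ'`.
For the singular kernels `b` the integral is a principal value around the axis of `σ`: `σ'` is
averaged with its mirror image through that axis, which does not change the value when the plain
integral converges absolutely and makes the integral absolutely convergent for all smooth even `F`
as soon as `(1 - c²) b(c)` is integrable. -/
def sphBoltzmann {d : ℕ} (b : ℝ → ℝ) (F : Vel d → ℝ) (σ : Vel d) : ℝ :=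
  ∫ σ' : sphere (0 : Vel d) 1,
    ((F σ' + F (axisRefl σ σ')) / 2 - F σ) * b (inner ℝ (σ' : Vel d) σ) ∂(surf d)

/-- `Γ²_{ℬ,Δ}(F, G) = ½ (ℬ(Γ_Δ(F, G)) - Γ_Δ(ℬ F, G) - Γ_Δ(F, ℬ G))`. -/
def gammaTwo {d : ℕ} (b : ℝ → ℝ) (F G : Vel d → ℝ) (σ : Vel d) : ℝ :=
  (1 / 2) * (sphBoltzmann b (gammaLaplace F G) σ
    - gammaLaplace (sphBoltzmann b F) G σ - gammaLaplace F (sphBoltzmann b G) σ)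

/-- The integrability condition on the angular kernel:
`∫ (1 - (σ ⬝ σ')²) b(σ ⬝ σ') dσ' < ∞` for every `σ` in the sphere. -/
def LevyCondition (d : ℕ) (b : ℝ → ℝ) : Prop :=
  ∀ σ ∈ sphere (0 : Vel d) 1,
    Integrable (fun σ' : sphere (0 : Vel d) 1 =>
      (1 - (inner ℝ σ (σ' : Vel d)) ^ 2) * b (inner ℝ σ (σ' : Vel d))) (surf d)

/-- The inequality of log-Sobolev type on `S^{d-1}` with constant `L`: for all smooth positive even
functions `F` on the sphere,
`∫ Γ²_{ℬ,Δ}(log F, log F) F dσ ≥ L ∬ (F(σ') - F(σ))² / (F(σ') + F(σ)) b(σ' ⬝ σ) dσ' dσ`. -/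
def LogSobolev (d : ℕ) (b : ℝ → ℝ) (L : ℝ≥0) : Prop :=
  ∀ F : Vel d → ℝ, SmoothOnSphere F →
    (∀ σ ∈ sphere (0 : Vel d) 1, 0 < F σ) →
    (∀ σ ∈ sphere (0 : Vel d) 1, F (-σ) = F σ) →
    (L : ℝ) * ∫ σ : sphere (0 : Vel d) 1, ∫ σ' : sphere (0 : Vel d) 1,
        (F σ' - F σ) ^ 2 / (F σ' + F σ) * b (inner ℝ (σ' : Vel d) (σ : Vel d)) ∂(surf d) ∂(surf d)
      ≤ ∫ σ : sphere (0 : Vel d) 1,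
        gammaTwo b (fun x => Real.log (F x)) (fun x => Real.log (F x)) σ * F σ ∂(surf d)

/-- The best constant `Λ_b ∈ [0, ∞]` in the inequality of log-Sobolev type (it is `∞` only for
kernels `b` that vanish almost everywhere). -/
def bestLogSobolev (d : ℕ) (b : ℝ → ℝ) : ℝ≥0∞ :=
  ⨆ (L : ℝ≥0) (_ : LogSobolev d b L), (L : ℝ≥0∞)

/-! ### The Boltzmann equation -/

/-- The product `f(v') f(w')` of post-collisional values, where
`v' = (v+w)/2 + (|v-w|/2) σ'` and `w' = (v+w)/2 - (|v-w|/2) σ'`. -/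
def postProd {d : ℕ} (f : Vel d → ℝ) (v w σ' : Vel d) : ℝ :=
  f ((1 / 2 : ℝ) • (v + w) + (‖v - w‖ / 2) • σ') * f ((1 / 2 : ℝ) • (v + w) - (‖v - w‖ / 2) • σ')

/-- The direction `σ = (v - w) / |v - w|`. -/
def relDir {d : ℕ} (v w : Vel d) : Vel d := ‖v - w‖⁻¹ • (v - w)

/-- The integrand `(f(v') f(w') - f(v) f(w)) B(|v - w|, σ ⬝ σ')` of the collision operator, averaged
over `σ'` and its mirror image through the axis of `σ`, as in `sphBoltzmann`. -/
def collisionIntegrand {d : ℕ} (B : ℝ → ℝ → ℝ) (f : Vel d → ℝ) (v w σ' : Vel d) : ℝ :=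
  ((postProd f v w σ' + postProd f v w (axisRefl (relDir v w) σ')) / 2 - f v * f w)
    * B ‖v - w‖ (inner ℝ (relDir v w) σ')

/-- Boltzmann's collision operator `Q(f, f)` with collision kernel `B(r, c)`. -/
def collision {d : ℕ} (B : ℝ → ℝ → ℝ) (f : Vel d → ℝ) (v : Vel d) : ℝ :=
  ∫ w : Vel d, ∫ σ' : sphere (0 : Vel d) 1, collisionIntegrand B f v w σ' ∂(surf d)

/-- The time interval `(0, T)`, where `T` may be `⊤`. -/
def timeInterval (T : EReal) : Set ℝ := {t : ℝ | 0 < t ∧ (t : EReal) < T}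

/-- `f` is a (classical, non-negative) solution of the space-homogeneous Boltzmann equation
`∂ₜ f = Q(f, f)` on `(0, T) × ℝᵈ` with collision kernel `B`: smooth in `v`, with polynomial decay of
all derivatives locally uniformly in time, with a convergent collision integral, and satisfying the
equation pointwise. -/
structure IsSolution {d : ℕ} (B : ℝ → ℝ → ℝ) (T : EReal) (f : ℝ → Vel d → ℝ) : Prop where
  nonneg : ∀ t ∈ timeInterval T, ∀ v, 0 ≤ f t v
  smooth : ∀ t ∈ timeInterval T, ContDiff ℝ (⊤ : ℕ∞) (f t)
  decay : ∀ t₁ ∈ timeInterval T, ∀ t₂ ∈ timeInterval T,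
    ∃ q : ℝ, 3 * (d : ℝ) + 5 < q ∧
      ∀ k : ℕ, ∃ C : ℝ, ∀ t ∈ Icc t₁ t₂, ∀ v : Vel d,
        (1 + ‖v‖) ^ q * ‖iteratedFDeriv ℝ k (f t) v‖ ≤ C
  convergent : ∀ t ∈ timeInterval T, ∀ v : Vel d,
    Integrable (fun p : Vel d × sphere (0 : Vel d) 1 => collisionIntegrand B (f t) v p.1 p.2)
      ((volume : Measure (Vel d)).prod (surf d))
  equation : ∀ t ∈ timeInterval T, ∀ v : Vel d,
    HasDerivAt (fun s => f s v) (collision B (f t) v) t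

/-- The Fisher information `I(f) = ∫ |∇ log f|² f dv ∈ [0, ∞]` (the integrand is `0` where
`f = 0`). -/
def fisher {d : ℕ} (f : Vel d → ℝ) : ℝ≥0∞ :=
  ∫⁻ v : Vel d, ENNReal.ofReal (‖gradient (fun x => Real.log (f x)) v‖ ^ 2 * f v)

end Boltzmann

end

/-!
# Monotonicity of the Fisher information along the Boltzmann equation

In the coordinates `v = z + y`, `w = z - y`, `y = e^s σ` of a pair of particles, a collision moves
only `σ`, by the spherical operator `sphBoltzmann b` at the rate `α (e^s)`. The dissipation of the
Fisher information is therefore governed, for the pair density `F = exp H`, where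
`H = l (z + y) + l (z - y)` and `l = log f`, by the Dirichlet form `dirForm b` of functions of `σ`,
and it splits into three parts.

* The derivatives in `z` contribute a nonpositive term
  (`CollisionKernel.integral_centre_nonpos`).
* The derivatives in `σ` contribute `-2 α ∫ Γ²_{ℬ,Δ}(log F, log F) F dσ`. The commutator of the
  Laplacian of the sphere with the spherical Boltzmann operator is computed with the rotation fields
  (`AngularKernel.dirForm_mul_identity`), so that the definition of `Λ_b` applies to it.
* The derivatives in `s` produce, besides a nonpositive term and an exact derivative, a term with
  the derivative of `α`. Completing the square, the inequality `r |α'| ≤ 2 √Λ_b α` is exactly what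
  is needed to absorb it into the angular part (`AngularKernel.radial_dissipation_le`).

After integration this is `CollisionKernel.integral_fisherPotential_mul_nonneg`, for smooth positive
densities with bounded derivatives of `log f`.

A solution need not be positive, and the derivatives of `log f` need not be bounded. The solution is
replaced by `lift ε f = f + ε G` with the polynomial weight `G`. The Fisher information is convex in
the density, so that it lies above its tangents; with the equation for `f` this bounds the time
derivative of the Fisher information of `f + ε G` by an error that only involves collisions with
`ε G` (`Flow.deriv_liftFisher_le`, `CollisionKernel.dissipation_lift_le`). The error is bounded,
because `|∇u|² ≤ C G u` for nonnegative `u` (`DecayBound.pd_sq_le`), and vanishes in the limit,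
because the second derivatives of `f` vanish almost everywhere on the set `{f = 0}`. Lower
semicontinuity and subadditivity of the Fisher information conclude (`Flow.fisher_le`).

This needs convergence of the collision integrals of pairs of densities, after integration in all
variables. At large relative speed it holds because `Λ_b ≤ 2 d` for nontrivial `b`
(`AngularKernel.bestLogSobolev_le`, by testing with perturbations of constants in the direction of a
harmonic of degree two), which bounds the growth of `α`. At small relative speed it can only fail
together with the convergence of the collision integral of the solution at a point, unless the
Hessian of `log f` is a multiple of the identity (`AngularKernel.dirForm_logHessian_eq_zero`,
`AngularKernel.bilinear_eq_zero`). In that case `log f` is a quadratic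
polynomial whose Hessian is a multiple of the identity and the collision operator of `f` is `0`
(`ScalarLogHessian.collision_eq_zero`), so that the solution is constant in time, as it is for
kernels `b` that vanish almost everywhere.
-/

open MeasureTheory Metric Set
open scoped ENNReal NNReal

noncomputable section

namespace Boltzmann

variable {d : ℕ}

/-! ### The surface measure of the sphere -/

/-- The unit sphere of the space of velocities. -/
abbrev Sph (d : ℕ) : Type := sphere (0 : Vel d) 1

instance : IsFiniteMeasure (surf d) := by unfold surf; infer_instance

theorem Sph.norm_eq (σ : Sph d) : ‖(σ : Vel d)‖ = 1 := mem_sphere_zero_iff_norm.1 σ.2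

/-- The action of a linear isometry on the unit sphere. -/
def sphMap (R : Vel d ≃ₗᵢ[ℝ] Vel d) (σ : Sph d) : Sph d :=
  ⟨R σ, by rw [mem_sphere_zero_iff_norm, R.norm_map, σ.norm_eq]⟩

@[simp] theorem sphMap_coe (R : Vel d ≃ₗᵢ[ℝ] Vel d) (σ : Sph d) :
    ((sphMap R σ : Sph d) : Vel d) = R σ := rfl

theorem continuous_sphMap (R : Vel d ≃ₗᵢ[ℝ] Vel d) : Continuous (sphMap R) :=
  Continuous.subtype_mk (R.continuous.comp continuous_subtype_val) _

open scoped Pointwise in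
/-- The surface measure is invariant under linear isometries. -/
theorem measurePreserving_sphMap (R : Vel d ≃ₗᵢ[ℝ] Vel d) :
    MeasurePreserving (sphMap R) (surf d) (surf d) := by
  refine ⟨(continuous_sphMap R).measurable, ?_⟩
  ext s hs
  rw [Measure.map_apply (continuous_sphMap R).measurable hs]
  unfold surf
  rw [Measure.toSphere_apply' _ hs,
    Measure.toSphere_apply' _ ((continuous_sphMap R).measurable hs)]
  congr 1
  have h : (Ioo (0 : ℝ) 1 • (Subtype.val '' (sphMap R ⁻¹' s)) : Set (Vel d))
      = R ⁻¹' (Ioo (0 : ℝ) 1 • (Subtype.val '' s)) := by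
    ext x
    simp only [Set.mem_smul, mem_image, mem_preimage]
    constructor
    · rintro ⟨r, hr, y, ⟨σ, hσ, rfl⟩, rfl⟩
      exact ⟨r, hr, _, ⟨_, hσ, rfl⟩, by simp⟩
    · rintro ⟨r, hr, y, ⟨σ, hσ, rfl⟩, h⟩
      refine ⟨r, hr, _, ⟨sphMap R.symm σ, ?_, rfl⟩, ?_⟩
      · have : sphMap R (sphMap R.symm σ) = σ := by ext1; simp
        rwa [this]
      · apply R.injective
        rw [← h]; simp
  rw [h, R.measurePreserving.measure_preimage_emb R.toMeasurableEquiv.measurableEmbedding]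

theorem measurableEmbedding_sphMap (R : Vel d ≃ₗᵢ[ℝ] Vel d) : MeasurableEmbedding (sphMap R) := by
  have h : Topology.IsClosedEmbedding (sphMap R) :=
    (continuous_sphMap R).isClosedEmbedding
      (fun x y h => Subtype.ext (R.injective (congrArg Subtype.val h)))
  exact h.measurableEmbedding

theorem integral_sphMap (R : Vel d ≃ₗᵢ[ℝ] Vel d) (h : Sph d → ℝ) :
    ∫ σ, h (sphMap R σ) ∂(surf d) = ∫ σ, h σ ∂(surf d) :=
  (measurePreserving_sphMap R).integral_comp (measurableEmbedding_sphMap R) h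

theorem measurePreserving_sphMap_prod (R : Vel d ≃ₗᵢ[ℝ] Vel d) :
    MeasurePreserving (Prod.map (sphMap R) (sphMap R)) ((surf d).prod (surf d))
      ((surf d).prod (surf d)) :=
  (measurePreserving_sphMap R).prod (measurePreserving_sphMap R)

theorem measurableEmbedding_sphMap_prod (R : Vel d ≃ₗᵢ[ℝ] Vel d) :
    MeasurableEmbedding (Prod.map (sphMap R) (sphMap R)) := by
  have h : Topology.IsClosedEmbedding (Prod.map (sphMap R) (sphMap R)) :=
    ((continuous_sphMap R).prodMap (continuous_sphMap R)).isClosedEmbedding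
      (Function.Injective.prodMap (fun x y h => Subtype.ext (R.injective (congrArg Subtype.val h)))
        (fun x y h => Subtype.ext (R.injective (congrArg Subtype.val h))))
  exact h.measurableEmbedding

theorem integral_sphMap_prod (R : Vel d ≃ₗᵢ[ℝ] Vel d) (h : Sph d × Sph d → ℝ) :
    ∫ p, h (sphMap R p.1, sphMap R p.2) ∂((surf d).prod (surf d))
      = ∫ p, h p ∂((surf d).prod (surf d)) :=
  (measurePreserving_sphMap_prod R).integral_comp (measurableEmbedding_sphMap_prod R) h

theorem axisRefl_eq_reflection {σ : Vel d} (hσ : ‖σ‖ = 1) (x : Vel d) :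
    axisRefl σ x = (Submodule.span ℝ {σ}).reflection x := by
  rw [Submodule.reflection_singleton_apply, hσ]
  simp [axisRefl, two_smul, mul_smul]

/-- Reflection through the axis of a unit vector, as a linear isometry. -/
def axisIso (σ : Vel d) : Vel d ≃ₗᵢ[ℝ] Vel d := (Submodule.span ℝ {σ}).reflection

theorem axisIso_apply {σ : Vel d} (hσ : ‖σ‖ = 1) (x : Vel d) : axisIso σ x = axisRefl σ x :=
  (axisRefl_eq_reflection hσ x).symm

theorem norm_axisRefl {σ : Vel d} (hσ : ‖σ‖ = 1) (x : Vel d) : ‖axisRefl σ x‖ = ‖x‖ := by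
  rw [← axisIso_apply hσ]; exact (axisIso σ).norm_map x

theorem inner_axisRefl {σ : Vel d} (hσ : ‖σ‖ = 1) (x : Vel d) :
    inner ℝ σ (axisRefl σ x) = inner ℝ σ x := by
  simp [axisRefl, inner_sub_right, inner_smul_right, hσ]; ring

theorem axisRefl_neg (σ x : Vel d) : axisRefl σ (-x) = -axisRefl σ x := by
  simp [axisRefl]; abel

theorem axisRefl_neg_axis (σ x : Vel d) : axisRefl (-σ) x = axisRefl σ x := by
  simp [axisRefl]

theorem axisRefl_map (R : Vel d ≃ₗᵢ[ℝ] Vel d) (σ x : Vel d) :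
    axisRefl (R σ) (R x) = R (axisRefl σ x) := by
  simp [axisRefl, R.inner_map_map]

/-! ### Logarithmic polar coordinates -/

/-- The measure with density `e^{ds}` on the real line. It is the radial part of Lebesgue measure
in the polar coordinates `y = e^s σ`. -/
def expMeasure (d : ℕ) : Measure ℝ :=
  volume.withDensity (fun s => ENNReal.ofReal (Real.exp (d * s)))

instance : SigmaFinite (expMeasure d) := by
  unfold expMeasure
  apply SigmaFinite.withDensity_ofReal

theorem measurePreserving_exp (hd : 1 ≤ d) :
    MeasurePreserving Real.expOrderIso.toHomeomorph (expMeasure d)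
      (Measure.volumeIoiPow (d - 1)) := by
  have hm := Real.expOrderIso.toHomeomorph.measurable
  refine ⟨hm, ?_⟩
  ext A hA
  rw [Measure.map_apply hm hA, expMeasure, withDensity_apply _ (hm hA), Measure.volumeIoiPow,
    withDensity_apply _ hA,
    setLIntegral_subtype measurableSet_Ioi _ fun a : ℝ ↦ ENNReal.ofReal (a ^ (d - 1))]
  have hset : (Subtype.val '' A : Set ℝ) = Real.exp '' (Real.expOrderIso.toHomeomorph ⁻¹' A) := by
    ext x
    simp only [mem_image, mem_preimage]
    constructor
    · rintro ⟨a, ha, rfl⟩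
      refine ⟨Real.log a, ?_, Real.exp_log a.2⟩
      have : Real.expOrderIso.toHomeomorph (Real.log a) = a := by
        ext1; exact Real.exp_log a.2
      rwa [this]
    · rintro ⟨s, hs, rfl⟩
      exact ⟨_, hs, rfl⟩
  rw [hset, lintegral_image_eq_lintegral_abs_deriv_mul (hm hA)
    (fun x _ => (Real.hasDerivAt_exp x).hasDerivWithinAt) (Real.exp_injective.injOn)]
  refine lintegral_congr fun s => ?_
  rw [← ENNReal.ofReal_mul (abs_nonneg _), abs_of_pos (Real.exp_pos s), ← Real.exp_nat_mul,
    ← Real.exp_add]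
  congr 2
  rw [Nat.cast_sub hd]; push_cast; ring

/-- The map `(σ, s) ↦ e^s σ` of logarithmic polar coordinates. -/
def polarMap (p : Sph d × ℝ) : Vel d := Real.exp p.2 • (p.1 : Vel d)

theorem polarMap_eq (p : Sph d × ℝ) : polarMap p = ((homeomorphUnitSphereProd (Vel d)).symm
    ((Prod.map id Real.expOrderIso.toHomeomorph) p) : Vel d) := by
  simp [polarMap]

theorem measurableEmbedding_polarMap : MeasurableEmbedding (polarMap (d := d)) := by
  have h : (polarMap (d := d)) = Subtype.val ∘ (homeomorphUnitSphereProd (Vel d)).symm ∘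
      ((Homeomorph.refl (Sph d)).prodCongr Real.expOrderIso.toHomeomorph) := by
    funext p; rw [polarMap_eq]; rfl
  rw [h]
  exact (MeasurableEmbedding.subtype_coe (measurableSet_singleton _).compl).comp
    ((Homeomorph.measurableEmbedding _).comp (Homeomorph.measurableEmbedding _))

theorem measurePreserving_polarMap (hd : 1 ≤ d) :
    MeasurePreserving (polarMap (d := d)) ((surf d).prod (expMeasure d)) volume := by
  have : NeZero d := ⟨by omega⟩
  have h1 : MeasurePreserving (Subtype.val : ({0}ᶜ : Set (Vel d)) → Vel d)
      (Measure.comap Subtype.val volume) volume := by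
    have := measurePreserving_subtype_coe (μa := (volume : Measure (Vel d)))
      (measurableSet_singleton (0 : Vel d)).compl
    rwa [restrict_compl_singleton] at this
  have h2 := (volume : Measure (Vel d)).measurePreserving_homeomorphUnitSphereProd
  rw [finrank_euclideanSpace_fin] at h2
  have h3 : MeasurePreserving (homeomorphUnitSphereProd (Vel d)).symm
      ((surf d).prod (Measure.volumeIoiPow (d - 1))) (Measure.comap Subtype.val volume) :=
    MeasurePreserving.symm (homeomorphUnitSphereProd (Vel d)).toMeasurableEquiv h2
  have h4 := (MeasurePreserving.id (surf d)).prod (measurePreserving_exp hd)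
  have h5 := h1.comp (h3.comp h4)
  have h : (polarMap (d := d)) = Subtype.val ∘ (homeomorphUnitSphereProd (Vel d)).symm ∘
      (Prod.map id Real.expOrderIso.toHomeomorph) := by
    funext p; rw [polarMap_eq]; rfl
  rw [h]; exact h5

/-! ### Differences along great circles -/

section GreatCircle

variable {V : Type*} [NormedAddCommGroup V] [NormedSpace ℝ V]

/-- The great circle through `σ` in the direction `e`. -/
def greatCircle (σ e : Vel d) (t : ℝ) : Vel d := Real.cos t • σ + Real.sin t • e

theorem norm_greatCircle {σ e : Vel d} (hσ : ‖σ‖ = 1) (he : ‖e‖ = 1) (hσe : inner ℝ σ e = 0)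
    (t : ℝ) : ‖greatCircle σ e t‖ = 1 := by
  have h : ‖greatCircle σ e t‖ ^ 2 = 1 := by
    rw [greatCircle, ← real_inner_self_eq_norm_sq]
    simp only [inner_add_left, inner_add_right, inner_smul_left, inner_smul_right,
      real_inner_self_eq_norm_sq, hσ, he, hσe, real_inner_comm σ e]
    have := Real.sin_sq_add_cos_sq t
    simp; nlinarith
  have h0 := norm_nonneg (greatCircle σ e t)
  nlinarith

theorem hasDerivAt_greatCircle (σ e : Vel d) (t : ℝ) :
    HasDerivAt (greatCircle σ e) (greatCircle e (-σ) t) t := by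
  unfold greatCircle
  have h := ((Real.hasDerivAt_cos t).smul_const σ).add ((Real.hasDerivAt_sin t).smul_const e)
  refine h.congr_deriv ?_
  simp; abel

theorem sq_le_of_cos_nonneg {θ : ℝ} (h0 : 0 ≤ θ) (h1 : θ ≤ Real.pi / 2) :
    θ ^ 2 ≤ 3 * (1 - Real.cos θ ^ 2) := by
  have h := Real.mul_le_sin h0 h1
  have hs : Real.sin θ ^ 2 = 1 - Real.cos θ ^ 2 := Real.sin_sq θ
  rw [← hs]
  have hpi := Real.pi_pos
  have h2 : θ ≤ Real.pi / 2 * Real.sin θ := by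
    have := mul_le_mul_of_nonneg_left h (by positivity : 0 ≤ Real.pi / 2)
    calc θ = Real.pi / 2 * (2 / Real.pi * θ) := by field_simp
      _ ≤ _ := this
  have h3 : Real.pi / 2 ≤ 1.6 := by have := Real.pi_lt_d2; linarith
  have hsn : 0 ≤ Real.sin θ := Real.sin_nonneg_of_nonneg_of_le_pi h0 (by linarith)
  have h4 : θ ≤ 1.6 * Real.sin θ := h2.trans (mul_le_mul_of_nonneg_right h3 hsn)
  nlinarith

/-- Two unit vectors at an acute angle lie on a great circle. -/
theorem exists_greatCircle {σ x : Vel d} (hσ : ‖σ‖ = 1) (hx : ‖x‖ = 1)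
    (hc : 0 ≤ (inner ℝ σ x : ℝ)) (hne : x ≠ σ) :
    ∃ e : Vel d, ∃ θ : ℝ, ‖e‖ = 1 ∧ inner ℝ σ e = 0 ∧ 0 ≤ θ ∧
      θ ^ 2 ≤ 3 * (1 - (inner ℝ σ x) ^ 2) ∧ greatCircle σ e θ = x ∧
      greatCircle σ e (-θ) = axisRefl σ x := by
  set c : ℝ := inner ℝ σ x with hcdef
  have hc1 : c ≤ 1 := by
    have := real_inner_le_norm σ x
    rwa [hσ, hx, one_mul] at this
  set w : Vel d := x - c • σ with hw
  have hw2 : ‖w‖ ^ 2 = 1 - c ^ 2 := by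
    rw [hw, norm_sub_sq_real, norm_smul, hσ, hx, inner_smul_right, real_inner_comm, ← hcdef]
    simp; ring
  have hw0 : w ≠ 0 := by
    intro h
    have h1 : c ^ 2 = 1 := by rw [h] at hw2; simp at hw2; linarith
    have h2 : c = 1 := by nlinarith
    rw [h2, one_smul] at hw
    exact hne (sub_eq_zero.1 (hw.symm.trans h))
  have hwn : ‖w‖ ≠ 0 := norm_ne_zero_iff.2 hw0
  refine ⟨‖w‖⁻¹ • w, Real.arccos c, ?_, ?_, Real.arccos_nonneg c, ?_, ?_, ?_⟩
  · rw [norm_smul, norm_inv, norm_norm, inv_mul_cancel₀ hwn]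
  · rw [inner_smul_right, hw, inner_sub_right, inner_smul_right, real_inner_self_eq_norm_sq, hσ,
      ← hcdef]; simp
  · have h := sq_le_of_cos_nonneg (Real.arccos_nonneg c) (Real.arccos_le_pi_div_two.2 hc)
    rwa [Real.cos_arccos (by linarith) hc1] at h
  all_goals
    have hs : Real.sin (Real.arccos c) = ‖w‖ := by
      rw [Real.sin_arccos, ← hw2, Real.sqrt_sq (norm_nonneg _)]
  · rw [greatCircle, Real.cos_arccos (by linarith) hc1, hs, smul_smul, mul_inv_cancel₀ hwn, one_smul,
      hw]; abel
  · rw [greatCircle, Real.cos_neg, Real.sin_neg, Real.cos_arccos (by linarith) hc1, hs, neg_smul,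
      smul_smul, mul_inv_cancel₀ hwn, one_smul, hw, axisRefl, ← hcdef, mul_smul, two_smul]; abel

/-- The difference between the mean of `h` at `x` and at its mirror image, and the value of `h`
on the axis `σ`. -/
def mirrorDiff (h : Vel d → V) (σ x : Vel d) : V :=
  (1 / 2 : ℝ) • (h x + h (axisRefl σ x)) - h σ

theorem hasDerivAt_comp_greatCircle {h : Vel d → V} (hd : Differentiable ℝ h) (σ e : Vel d)
    (t : ℝ) : HasDerivAt (fun t => h (greatCircle σ e t))
      (fderiv ℝ h (greatCircle σ e t) (greatCircle e (-σ) t)) t :=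
  (hd _).hasFDerivAt.comp_hasDerivAt t (hasDerivAt_greatCircle σ e t)

theorem hasDerivAt_comp_greatCircle_two {h : Vel d → V} (hd : ContDiff ℝ 2 h) (σ e : Vel d)
    (t : ℝ) : HasDerivAt (fun t => fderiv ℝ h (greatCircle σ e t) (greatCircle e (-σ) t))
      (fderiv ℝ (fderiv ℝ h) (greatCircle σ e t) (greatCircle e (-σ) t) (greatCircle e (-σ) t)
        + fderiv ℝ h (greatCircle σ e t) (greatCircle (-σ) (-e) t)) t := by
  have h1 : ContDiff ℝ 1 (fderiv ℝ h) := hd.fderiv_right (by norm_num)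
  have h2 := hasDerivAt_comp_greatCircle (h1.differentiable (by norm_num)) σ e t
  exact h2.clm_apply (hasDerivAt_greatCircle e (-σ) t)

/-- First differences of an even function on the sphere vanish on the axis at the rate of the sine
of the angle; evenness accounts for the antipode of `σ`. -/
theorem norm_sub_sq_le {h : Vel d → V} (hd : Differentiable ℝ h) (he : ∀ x, h (-x) = h x) {C : ℝ}
    (hC : ∀ x, ‖x‖ = 1 → ‖fderiv ℝ h x‖ ≤ C) {σ x : Vel d} (hσ : ‖σ‖ = 1) (hx : ‖x‖ = 1) :
    ‖h x - h σ‖ ^ 2 ≤ 3 * C ^ 2 * (1 - (inner ℝ σ x) ^ 2) := by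
  wlog hc : 0 ≤ (inner ℝ σ x : ℝ) generalizing x
  · have := this (x := -x) (by rwa [norm_neg]) (by rw [inner_neg_right]; linarith)
    rwa [he, inner_neg_right, neg_sq] at this
  by_cases hne : x = σ
  · subst hne; simp [hσ]
  obtain ⟨e, θ, hen, hσe, hθ0, hθ, hγ, -⟩ := exists_greatCircle hσ hx hc hne
  have h1 : ∀ t ∈ Icc (0 : ℝ) θ, HasDerivWithinAt (fun t => h (greatCircle σ e t))
      (fderiv ℝ h (greatCircle σ e t) (greatCircle e (-σ) t)) (Icc 0 θ) t := fun t _ =>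
    (hasDerivAt_comp_greatCircle hd σ e t).hasDerivWithinAt
  have hC0 : 0 ≤ C := (norm_nonneg _).trans (hC σ hσ)
  have h2 : ∀ t ∈ Ico (0 : ℝ) θ, ‖fderiv ℝ h (greatCircle σ e t) (greatCircle e (-σ) t)‖ ≤ C := by
    intro t _
    refine (ContinuousLinearMap.le_opNorm _ _).trans ?_
    rw [norm_greatCircle hen (by rwa [norm_neg])
      (by rw [inner_neg_right, real_inner_comm, hσe, neg_zero]), mul_one]
    exact hC _ (norm_greatCircle hσ hen hσe t)
  have h3 := norm_image_sub_le_of_norm_deriv_le_segment' h1 h2 θ (right_mem_Icc.2 hθ0)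
  have h4 : greatCircle σ e 0 = σ := by simp [greatCircle]
  rw [hγ, h4, sub_zero] at h3
  calc ‖h x - h σ‖ ^ 2 ≤ (C * θ) ^ 2 := pow_le_pow_left₀ (norm_nonneg _) h3 2
    _ = C ^ 2 * θ ^ 2 := by ring
    _ ≤ C ^ 2 * (3 * (1 - (inner ℝ σ x) ^ 2)) := mul_le_mul_of_nonneg_left hθ (sq_nonneg C)
    _ = _ := by ring

theorem mirrorDiff_neg {h : Vel d → V} (he : ∀ x, h (-x) = h x) (σ x : Vel d) :
    mirrorDiff h σ (-x) = mirrorDiff h σ x := by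
  simp only [mirrorDiff, axisRefl_neg, he]

/-- Second differences of an even function on the sphere vanish on the axis at the rate of the
squared sine of the angle. -/
theorem norm_mirrorDiff_le {h : Vel d → V} (hd : ContDiff ℝ 2 h) (he : ∀ x, h (-x) = h x) {C : ℝ}
    (hC1 : ∀ x, ‖x‖ = 1 → ‖fderiv ℝ h x‖ ≤ C)
    (hC2 : ∀ x, ‖x‖ = 1 → ‖fderiv ℝ (fderiv ℝ h) x‖ ≤ C) {σ x : Vel d}
    (hσ : ‖σ‖ = 1) (hx : ‖x‖ = 1) :
    ‖mirrorDiff h σ x‖ ≤ 6 * C * (1 - (inner ℝ σ x) ^ 2) := by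
  wlog hc : 0 ≤ (inner ℝ σ x : ℝ) generalizing x
  · have := this (x := -x) (by rwa [norm_neg]) (by rw [inner_neg_right]; linarith)
    rwa [mirrorDiff_neg he, inner_neg_right, neg_sq] at this
  by_cases hne : x = σ
  · subst hne
    have : axisRefl x x = x := by simp [axisRefl, hσ, two_smul]
    simp [mirrorDiff, this, ← two_smul ℝ, hσ]
  obtain ⟨e, θ, hen, hσe, hθ0, hθ, hγ, hγ'⟩ := exists_greatCircle hσ hx hc hne
  have hC0 : 0 ≤ C := (norm_nonneg _).trans (hC1 σ hσ)
  have hσn : ‖-σ‖ = 1 := by rwa [norm_neg]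
  have henn : ‖-e‖ = 1 := by rwa [norm_neg]
  have hi1 : inner ℝ e (-σ) = (0 : ℝ) := by rw [inner_neg_right, real_inner_comm, hσe, neg_zero]
  have hi2 : inner ℝ (-σ) (-e) = (0 : ℝ) := by rw [inner_neg_neg, hσe]
  set p' : ℝ → V := fun t => fderiv ℝ h (greatCircle σ e t) (greatCircle e (-σ) t) with hp'
  have hp'lip : ∀ s t : ℝ, ‖p' t - p' s‖ ≤ 2 * C * ‖t - s‖ := by
    intro s t
    refine convex_univ.norm_image_sub_le_of_norm_hasDerivWithin_le
      (fun u _ => (hasDerivAt_comp_greatCircle_two hd σ e u).hasDerivWithinAt) ?_ trivial trivial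
    intro u _
    refine (norm_add_le _ _).trans ?_
    have a1 : ‖fderiv ℝ (fderiv ℝ h) (greatCircle σ e u) (greatCircle e (-σ) u)
        (greatCircle e (-σ) u)‖ ≤ C := by
      refine (ContinuousLinearMap.le_opNorm₂ _ _ _).trans ?_
      rw [norm_greatCircle hen hσn hi1, mul_one, mul_one]
      exact hC2 _ (norm_greatCircle hσ hen hσe u)
    have a2 : ‖fderiv ℝ h (greatCircle σ e u) (greatCircle (-σ) (-e) u)‖ ≤ C := by
      refine (ContinuousLinearMap.le_opNorm _ _).trans ?_
      rw [norm_greatCircle hσn henn hi2, mul_one]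
      exact hC1 _ (norm_greatCircle hσ hen hσe u)
    linarith
  have hdiff := hd.differentiable (by norm_num)
  set m : ℝ → V := fun t => (1 / 2 : ℝ) • (h (greatCircle σ e t) + h (greatCircle σ e (-t))) - h σ
    with hm
  have hm' : ∀ t, HasDerivAt m ((1 / 2 : ℝ) • (p' t - p' (-t))) t := by
    intro t
    have b1 := hasDerivAt_comp_greatCircle hdiff σ e t
    have b2 := (hasDerivAt_comp_greatCircle hdiff σ e (-t)).scomp t (hasDerivAt_neg t)
    have b3 := ((b1.add b2).const_smul (1 / 2 : ℝ)).sub_const (h σ)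
    refine b3.congr_deriv ?_
    simp [hp', sub_eq_add_neg]
  have h3 := norm_image_sub_le_of_norm_deriv_le_segment' (C := 2 * C * θ)
    (fun t _ => (hm' t).hasDerivWithinAt (s := Icc 0 θ)) (fun t ht => by
      rw [norm_smul]
      have := hp'lip (-t) t
      have e1 : ‖t - -t‖ = 2 * t := by
        rw [Real.norm_eq_abs, abs_of_nonneg (by linarith [ht.1])]; ring
      rw [e1] at this
      have e2 : ‖(1 / 2 : ℝ)‖ = 1 / 2 := by norm_num
      rw [e2]
      have := ht.2
      have h5 : C * t ≤ C * θ := mul_le_mul_of_nonneg_left ht.2.le hC0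
      linarith) θ (right_mem_Icc.2 hθ0)
  have h4 : m 0 = 0 := by simp [hm, greatCircle, ← two_smul ℝ]
  have h5 : m θ = mirrorDiff h σ x := by simp only [hm, mirrorDiff, hγ, hγ']
  rw [h4, h5, sub_zero, sub_zero] at h3
  calc ‖mirrorDiff h σ x‖ ≤ 2 * C * θ * θ := h3
    _ = 2 * C * θ ^ 2 := by ring
    _ ≤ 2 * C * (3 * (1 - (inner ℝ σ x) ^ 2)) := mul_le_mul_of_nonneg_left hθ (by linarith)
    _ = _ := by ring

end GreatCircle

/-! ### Smooth even functions -/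

/-- Smooth even functions on the space of velocities. Their restrictions are the test functions on
the sphere. -/
structure SmoothEven (φ : Vel d → ℝ) : Prop where
  smooth : ContDiff ℝ (⊤ : ℕ∞) φ
  even : ∀ x, φ (-x) = φ x

namespace SmoothEven

variable {φ ψ : Vel d → ℝ}

theorem contDiff (h : SmoothEven φ) (n : ℕ) : ContDiff ℝ n φ := h.smooth.of_le (mod_cast le_top)

theorem differentiable (h : SmoothEven φ) : Differentiable ℝ φ :=
  h.smooth.differentiable (by simp)

theorem continuous (h : SmoothEven φ) : Continuous φ := h.smooth.continuous

theorem add (h : SmoothEven φ) (h' : SmoothEven ψ) : SmoothEven (fun x => φ x + ψ x) :=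
  ⟨h.smooth.add h'.smooth, fun x => by rw [h.even, h'.even]⟩

theorem mul (h : SmoothEven φ) (h' : SmoothEven ψ) : SmoothEven (fun x => φ x * ψ x) :=
  ⟨h.smooth.mul h'.smooth, fun x => by rw [h.even, h'.even]⟩

theorem const_mul (h : SmoothEven φ) (c : ℝ) : SmoothEven (fun x => c * φ x) :=
  ⟨contDiff_const.mul h.smooth, fun x => by rw [h.even]⟩

theorem pow (h : SmoothEven φ) (n : ℕ) : SmoothEven (fun x => φ x ^ n) :=
  ⟨h.smooth.pow n, fun x => by rw [h.even]⟩

theorem sum {ι : Type*} {s : Finset ι} {φ : ι → Vel d → ℝ} (h : ∀ i ∈ s, SmoothEven (φ i)) :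
    SmoothEven (fun x => ∑ i ∈ s, φ i x) :=
  ⟨ContDiff.sum fun i hi => (h i hi).smooth, fun x => Finset.sum_congr rfl fun i hi =>
    (h i hi).even x⟩

theorem log (h : SmoothEven φ) (hpos : ∀ x, 0 < φ x) : SmoothEven (fun x => Real.log (φ x)) :=
  ⟨h.smooth.log fun x => (hpos x).ne', fun x => by rw [h.even]⟩

theorem exp (h : SmoothEven φ) : SmoothEven (fun x => Real.exp (φ x)) :=
  ⟨h.smooth.exp, fun x => by rw [h.even]⟩

theorem comp_smul (h : SmoothEven φ) (r : ℝ) : SmoothEven (fun x => φ (r • x)) :=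
  ⟨h.smooth.comp (contDiff_const_smul r), fun x => by rw [smul_neg, h.even]⟩

theorem comp_iso (h : SmoothEven φ) (R : Vel d ≃ₗᵢ[ℝ] Vel d) : SmoothEven (fun x => φ (R x)) :=
  ⟨h.smooth.comp R.contDiff, fun x => by rw [map_neg, h.even]⟩

theorem fderiv_neg (h : SmoothEven φ) (x v : Vel d) : fderiv ℝ φ (-x) v = -fderiv ℝ φ x v := by
  have h1 : HasFDerivAt (fun x => φ (-x)) ((fderiv ℝ φ (-x)).comp
      (-(ContinuousLinearMap.id ℝ (Vel d)))) x :=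
    (h.differentiable (-x)).hasFDerivAt.comp x (hasFDerivAt_id x).neg
  have h2 : (fun x => φ (-x)) = φ := funext h.even
  rw [h2] at h1
  rw [h1.fderiv]; simp

theorem exists_bound (h : SmoothEven φ) : ∃ C : ℝ, 0 ≤ C ∧ ∀ x, ‖x‖ = 1 →
    |φ x| ≤ C ∧ ‖fderiv ℝ φ x‖ ≤ C ∧ ‖fderiv ℝ (fderiv ℝ φ) x‖ ≤ C := by
  have hK : IsCompact (sphere (0 : Vel d) 1) := isCompact_sphere _ _
  have c1 : Continuous (fderiv ℝ φ) := h.smooth.continuous_fderiv (by simp)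
  have c2 : Continuous fun x => ‖fderiv ℝ (fderiv ℝ φ) x‖ :=
    (((h.contDiff 2).fderiv_right (m := 1) (by norm_num)).continuous_fderiv (by norm_num)).norm
  obtain ⟨C0, h0⟩ := hK.exists_bound_of_continuousOn h.continuous.continuousOn
  obtain ⟨C1, h1⟩ := hK.exists_bound_of_continuousOn c1.continuousOn
  obtain ⟨C2, h2⟩ := hK.exists_bound_of_continuousOn c2.continuousOn
  refine ⟨max (max |C0| |C1|) |C2|, by positivity, fun x hx => ?_⟩
  have hx' : x ∈ sphere (0 : Vel d) 1 := mem_sphere_zero_iff_norm.2 hx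
  refine ⟨(h0 x hx').trans ((le_abs_self _).trans ?_), (h1 x hx').trans ((le_abs_self _).trans ?_),
    ((le_abs_self _).trans (h2 x hx')).trans ((le_abs_self _).trans ?_)⟩
  · exact (le_max_left _ _).trans (le_max_left _ _)
  · exact (le_max_right _ _).trans (le_max_left _ _)
  · exact le_max_right _ _

end SmoothEven

/-! ### The angular kernel and its Dirichlet form -/

/-- The hypotheses on the angular kernel `b`. -/
structure AngularKernel (d : ℕ) (b : ℝ → ℝ) : Prop where
  meas : Measurable b
  nonneg : ∀ c ∈ Icc (-1 : ℝ) 1, 0 ≤ b c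
  levy : LevyCondition d b

/-- The weight `(1 - c²) b(c)`, `c = σ ⬝ σ'`, on pairs of points of the sphere. -/
def levyWeight (b : ℝ → ℝ) (p : Sph d × Sph d) : ℝ :=
  (1 - (inner ℝ (p.1 : Vel d) (p.2 : Vel d)) ^ 2) * b (inner ℝ (p.2 : Vel d) (p.1 : Vel d))

theorem Sph.inner_mem_Icc (σ σ' : Sph d) : inner ℝ (σ : Vel d) (σ' : Vel d) ∈ Icc (-1 : ℝ) 1 := by
  have h := abs_real_inner_le_norm (σ : Vel d) (σ' : Vel d)
  rw [σ.norm_eq, σ'.norm_eq, one_mul] at h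
  exact abs_le.1 h

theorem Sph.one_sub_inner_sq_nonneg (σ σ' : Sph d) :
    0 ≤ 1 - (inner ℝ (σ : Vel d) (σ' : Vel d) : ℝ) ^ 2 := by
  have h := Sph.inner_mem_Icc σ σ'
  nlinarith [h.1, h.2]

namespace AngularKernel

variable {b : ℝ → ℝ} (hb : AngularKernel d b)
include hb

theorem nonneg_inner (σ σ' : Sph d) : 0 ≤ b (inner ℝ (σ : Vel d) (σ' : Vel d)) :=
  hb.nonneg _ (Sph.inner_mem_Icc σ σ')

theorem levyWeight_nonneg (p : Sph d × Sph d) : 0 ≤ levyWeight b p :=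
  mul_nonneg (Sph.one_sub_inner_sq_nonneg _ _) (hb.nonneg_inner _ _)

theorem measurable_inner : Measurable (fun p : Sph d × Sph d =>
    b (inner ℝ (p.2 : Vel d) (p.1 : Vel d))) :=
  hb.meas.comp (by fun_prop : Continuous fun p : Sph d × Sph d =>
    (inner ℝ (p.2 : Vel d) (p.1 : Vel d) : ℝ)).measurable

theorem measurable_levyWeight : Measurable (levyWeight b : Sph d × Sph d → ℝ) :=
  (by fun_prop : Continuous fun p : Sph d × Sph d =>
    1 - (inner ℝ (p.1 : Vel d) (p.2 : Vel d) : ℝ) ^ 2).measurable.mul hb.measurable_inner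

theorem integrable_levyWeight_right (σ : Sph d) :
    Integrable (fun σ' => levyWeight b (σ, σ')) (surf d) := by
  have := hb.levy σ σ.2
  refine this.congr (Filter.Eventually.of_forall fun σ' => ?_)
  simp only [levyWeight]
  rw [real_inner_comm (σ : Vel d) (σ' : Vel d)]

end AngularKernel

/-- Linear isometries act transitively on the sphere. -/
theorem exists_isometry_map_eq {x y : Vel d} (h : ‖x‖ = ‖y‖) :
    ∃ R : Vel d ≃ₗᵢ[ℝ] Vel d, R x = y :=
  ⟨(Submodule.span ℝ {x - y})ᗮ.reflection, Submodule.reflection_sub h⟩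

theorem levyWeight_sphMap (b : ℝ → ℝ) (R : Vel d ≃ₗᵢ[ℝ] Vel d) (σ σ' : Sph d) :
    levyWeight b (sphMap R σ, sphMap R σ') = levyWeight b (σ, σ') := by
  simp [levyWeight, R.inner_map_map]

theorem integral_levyWeight_right_eq (b : ℝ → ℝ) (σ τ : Sph d) :
    ∫ σ', levyWeight b (σ, σ') ∂(surf d) = ∫ σ', levyWeight b (τ, σ') ∂(surf d) := by
  obtain ⟨R, hR⟩ := exists_isometry_map_eq (x := (σ : Vel d)) (y := (τ : Vel d))
    (by rw [σ.norm_eq, τ.norm_eq])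
  have hτ : sphMap R σ = τ := Subtype.ext hR
  rw [← integral_sphMap R (fun σ' => levyWeight b (τ, σ')), ← hτ]
  simp_rw [levyWeight_sphMap]

theorem AngularKernel.integrable_levyWeight {b : ℝ → ℝ} (hb : AngularKernel d b) :
    Integrable (levyWeight b) ((surf d).prod (surf d)) := by
  rcases isEmpty_or_nonempty (Sph d) with h | ⟨⟨τ⟩⟩
  · exact Integrable.of_finite
  rw [integrable_prod_iff hb.measurable_levyWeight.aestronglyMeasurable]
  refine ⟨Filter.Eventually.of_forall hb.integrable_levyWeight_right, ?_⟩
  have : (fun σ : Sph d => ∫ σ', ‖levyWeight b (σ, σ')‖ ∂(surf d))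
      = fun _ => ∫ σ', levyWeight b (τ, σ') ∂(surf d) := by
    funext σ
    simp_rw [Real.norm_of_nonneg (hb.levyWeight_nonneg _)]
    exact integral_levyWeight_right_eq b σ τ
  rw [this]
  exact integrable_const _

/-- The total mass of `(1 - c²) b(c)`, seen from any point of the sphere. -/
theorem AngularKernel.exists_levyMass {b : ℝ → ℝ} (hb : AngularKernel d b) :
    ∃ β : ℝ, 0 ≤ β ∧ ∀ σ : Sph d, ∫ σ', levyWeight b (σ, σ') ∂(surf d) = β := by
  rcases isEmpty_or_nonempty (Sph d) with h | ⟨⟨τ⟩⟩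
  · exact ⟨0, le_rfl, fun σ => h.elim σ⟩
  · exact ⟨∫ σ', levyWeight b (τ, σ') ∂(surf d), integral_nonneg fun σ' => hb.levyWeight_nonneg _,
      fun σ => integral_levyWeight_right_eq b σ τ⟩

/-- The integrand of the Dirichlet form of `b`. -/
def dirInt (b : ℝ → ℝ) (φ ψ : Vel d → ℝ) (p : Sph d × Sph d) : ℝ :=
  (φ p.2 - φ p.1) * (ψ p.2 - ψ p.1) * b (inner ℝ (p.2 : Vel d) (p.1 : Vel d))

/-- The Dirichlet form `½ ∬ (φ' - φ)(ψ' - ψ) b(σ' ⬝ σ) dσ' dσ` of the spherical Boltzmann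
operator. -/
def dirForm (b : ℝ → ℝ) (φ ψ : Vel d → ℝ) : ℝ :=
  (1 / 2) * ∫ p, dirInt b φ ψ p ∂((surf d).prod (surf d))

theorem dirInt_comm (b : ℝ → ℝ) (φ ψ : Vel d → ℝ) (p : Sph d × Sph d) :
    dirInt b φ ψ p = dirInt b ψ φ p := by
  simp only [dirInt]; ring

theorem dirForm_comm (b : ℝ → ℝ) (φ ψ : Vel d → ℝ) : dirForm b φ ψ = dirForm b ψ φ := by
  simp only [dirForm, dirInt_comm b φ ψ]

theorem abs_sub_mul_sub_le {φ ψ : Vel d → ℝ} (hφ : Differentiable ℝ φ) (hφe : ∀ x, φ (-x) = φ x)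
    (hψ : Differentiable ℝ ψ) (hψe : ∀ x, ψ (-x) = ψ x) {C C' : ℝ}
    (hC : ∀ x, ‖x‖ = 1 → ‖fderiv ℝ φ x‖ ≤ C) (hC' : ∀ x, ‖x‖ = 1 → ‖fderiv ℝ ψ x‖ ≤ C')
    (σ σ' : Sph d) : |(φ σ' - φ σ) * (ψ σ' - ψ σ)|
      ≤ 3 * C * C' * (1 - (inner ℝ (σ : Vel d) (σ' : Vel d)) ^ 2) := by
  have h1 := norm_sub_sq_le hφ hφe hC σ.norm_eq σ'.norm_eq
  have h2 := norm_sub_sq_le hψ hψe hC' σ.norm_eq σ'.norm_eq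
  have hC0 : 0 ≤ C := (norm_nonneg _).trans (hC σ σ.norm_eq)
  have hC0' : 0 ≤ C' := (norm_nonneg _).trans (hC' σ σ.norm_eq)
  have hk := Sph.one_sub_inner_sq_nonneg σ σ'
  rw [Real.norm_eq_abs, sq_abs] at h1 h2
  refine abs_le_of_sq_le_sq ?_ (by positivity)
  calc ((φ σ' - φ σ) * (ψ σ' - ψ σ)) ^ 2 = (φ σ' - φ σ) ^ 2 * (ψ σ' - ψ σ) ^ 2 := by ring
    _ ≤ (3 * C ^ 2 * (1 - (inner ℝ (σ : Vel d) (σ' : Vel d)) ^ 2))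
        * (3 * C' ^ 2 * (1 - (inner ℝ (σ : Vel d) (σ' : Vel d)) ^ 2)) :=
      mul_le_mul h1 h2 (sq_nonneg _) (by positivity)
    _ = _ := by ring

namespace AngularKernel

variable {b : ℝ → ℝ} (hb : AngularKernel d b)
include hb

theorem abs_dirInt_le {φ ψ : Vel d → ℝ} (hφ : Differentiable ℝ φ) (hφe : ∀ x, φ (-x) = φ x)
    (hψ : Differentiable ℝ ψ) (hψe : ∀ x, ψ (-x) = ψ x) {C C' : ℝ}
    (hC : ∀ x, ‖x‖ = 1 → ‖fderiv ℝ φ x‖ ≤ C) (hC' : ∀ x, ‖x‖ = 1 → ‖fderiv ℝ ψ x‖ ≤ C')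
    (p : Sph d × Sph d) : |dirInt b φ ψ p| ≤ 3 * C * C' * levyWeight b p := by
  have h := abs_sub_mul_sub_le hφ hφe hψ hψe hC hC' p.1 p.2
  rw [dirInt, abs_mul, abs_of_nonneg (hb.nonneg_inner p.2 p.1), levyWeight, ← mul_assoc]
  exact mul_le_mul_of_nonneg_right h (hb.nonneg_inner p.2 p.1)

theorem measurable_dirInt {φ ψ : Vel d → ℝ} (hφ : Continuous φ) (hψ : Continuous ψ) :
    Measurable (dirInt b φ ψ : Sph d × Sph d → ℝ) := by
  refine Measurable.mul (Continuous.measurable ?_) hb.measurable_inner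
  fun_prop

theorem integrable_dirInt {φ ψ : Vel d → ℝ} (hφ : SmoothEven φ) (hψ : SmoothEven ψ) :
    Integrable (dirInt b φ ψ) ((surf d).prod (surf d)) := by
  obtain ⟨C, -, hC⟩ := hφ.exists_bound
  obtain ⟨C', -, hC'⟩ := hψ.exists_bound
  refine (hb.integrable_levyWeight.const_mul (3 * C * C')).mono'
    (hb.measurable_dirInt hφ.continuous hψ.continuous).aestronglyMeasurable
    (Filter.Eventually.of_forall fun p => ?_)
  exact hb.abs_dirInt_le hφ.differentiable hφ.even hψ.differentiable hψ.even
    (fun x hx => (hC x hx).2.1) (fun x hx => (hC' x hx).2.1) p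

theorem abs_dirForm_le {φ ψ : Vel d → ℝ} (hφ : SmoothEven φ) (hψ : SmoothEven ψ) {C C' : ℝ}
    (hC : ∀ x, ‖x‖ = 1 → ‖fderiv ℝ φ x‖ ≤ C) (hC' : ∀ x, ‖x‖ = 1 → ‖fderiv ℝ ψ x‖ ≤ C') :
    |dirForm b φ ψ| ≤ 3 * C * C' * ∫ p, levyWeight b p ∂((surf d).prod (surf d)) := by
  rcases isEmpty_or_nonempty (Sph d) with he | ⟨⟨τ⟩⟩
  · simp [dirForm, Measure.eq_zero_of_isEmpty]
  have h0 : 0 ≤ ∫ p, levyWeight b p ∂((surf d).prod (surf d)) :=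
    integral_nonneg fun p => hb.levyWeight_nonneg p
  have h1 : |∫ p, dirInt b φ ψ p ∂((surf d).prod (surf d))|
      ≤ ∫ p, 3 * C * C' * levyWeight b p ∂((surf d).prod (surf d)) := by
    rw [← Real.norm_eq_abs]
    refine norm_integral_le_of_norm_le (hb.integrable_levyWeight.const_mul _)
      (Filter.Eventually.of_forall fun p => ?_)
    exact hb.abs_dirInt_le hφ.differentiable hφ.even hψ.differentiable hψ.even hC hC' p
  rw [integral_const_mul] at h1
  rw [dirForm, abs_mul, abs_of_pos (by norm_num : (0 : ℝ) < 1 / 2)]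
  have := abs_nonneg (∫ p, dirInt b φ ψ p ∂((surf d).prod (surf d)))
  linarith

theorem dirForm_add_left {φ φ' ψ : Vel d → ℝ} (hφ : SmoothEven φ) (hφ' : SmoothEven φ')
    (hψ : SmoothEven ψ) :
    dirForm b (fun x => φ x + φ' x) ψ = dirForm b φ ψ + dirForm b φ' ψ := by
  rw [dirForm, dirForm, dirForm, ← mul_add,
    ← integral_add (hb.integrable_dirInt hφ hψ) (hb.integrable_dirInt hφ' hψ)]
  congr 2; funext p; simp only [dirInt]; ring

theorem dirForm_sum_left {ι : Type*} (s : Finset ι) {φ : ι → Vel d → ℝ} {ψ : Vel d → ℝ}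
    (hφ : ∀ i ∈ s, SmoothEven (φ i)) (hψ : SmoothEven ψ) :
    dirForm b (fun x => ∑ i ∈ s, φ i x) ψ = ∑ i ∈ s, dirForm b (φ i) ψ := by
  simp only [dirForm]
  rw [← Finset.mul_sum, ← integral_finsetSum _ fun i hi => hb.integrable_dirInt (hφ i hi) hψ]
  congr 2; funext p
  simp only [dirInt, ← Finset.sum_sub_distrib, Finset.sum_mul]

end AngularKernel

theorem dirForm_const_mul_left (b : ℝ → ℝ) (c : ℝ) (φ ψ : Vel d → ℝ) :
    dirForm b (fun x => c * φ x) ψ = c * dirForm b φ ψ := by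
  have h : ∀ p, dirInt b (fun x => c * φ x) ψ p = c * dirInt b φ ψ p := fun p => by
    simp only [dirInt]; ring
  simp only [dirForm, h, integral_const_mul]; ring

theorem dirForm_comp_iso (b : ℝ → ℝ) (φ ψ : Vel d → ℝ) (R : Vel d ≃ₗᵢ[ℝ] Vel d) :
    dirForm b (fun x => φ (R x)) (fun x => ψ (R x)) = dirForm b φ ψ := by
  rw [dirForm, dirForm, ← integral_sphMap_prod R (dirInt b φ ψ)]
  congr 2; funext p
  simp [dirInt, R.inner_map_map]

/-! ### Symmetry of the spherical Boltzmann operator -/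

/-- The kernel `b` with the grazing collisions removed. -/
def cutKernel (b : ℝ → ℝ) (n : ℕ) (c : ℝ) : ℝ :=
  if 1 / ((n : ℝ) + 1) < 1 - c ^ 2 then b c else 0

theorem tendsto_cutKernel (b : ℝ → ℝ) {c : ℝ} (hc : 0 < 1 - c ^ 2) :
    Filter.Tendsto (fun n => cutKernel b n c) Filter.atTop (nhds (b c)) := by
  have h : ∀ᶠ n : ℕ in Filter.atTop, 1 / ((n : ℝ) + 1) < 1 - c ^ 2 :=
    tendsto_one_div_add_atTop_nhds_zero_nat.eventually_lt_const hc
  refine tendsto_const_nhds.congr' ?_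
  filter_upwards [h] with n hn
  rw [cutKernel, if_pos hn]

theorem sphBoltzmann_eq (b : ℝ → ℝ) (ψ : Vel d → ℝ) (σ : Vel d) :
    sphBoltzmann b ψ σ = ∫ σ' : Sph d, mirrorDiff ψ σ σ' * b (inner ℝ (σ' : Vel d) σ) ∂(surf d) := by
  rw [sphBoltzmann]; congr 1; funext σ'; rw [mirrorDiff, smul_eq_mul]; ring

theorem continuous_axisRefl_sph :
    Continuous fun p : Sph d × Sph d => axisRefl (p.1 : Vel d) (p.2 : Vel d) := by
  unfold axisRefl; fun_prop

theorem measurable_mirrorDiff {ψ : Vel d → ℝ} (hψ : Continuous ψ) :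
    Measurable (fun p : Sph d × Sph d => mirrorDiff ψ (p.1 : Vel d) p.2) :=
  ((((hψ.comp (continuous_subtype_val.comp continuous_snd)).add
    (hψ.comp continuous_axisRefl_sph)).const_smul (1 / 2 : ℝ)).sub
    (hψ.comp (continuous_subtype_val.comp continuous_fst))).measurable

theorem abs_mul_mirrorDiff_le {b : ℝ → ℝ} {φ ψ : Vel d → ℝ} (hψ : SmoothEven ψ) {C C' : ℝ}
    (hC : ∀ x, ‖x‖ = 1 → |φ x| ≤ C) (hC1 : ∀ x, ‖x‖ = 1 → ‖fderiv ℝ ψ x‖ ≤ C')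
    (hC2 : ∀ x, ‖x‖ = 1 → ‖fderiv ℝ (fderiv ℝ ψ) x‖ ≤ C') (p : Sph d × Sph d) {k : ℝ}
    (hk0 : 0 ≤ k) (hk : k ≤ b (inner ℝ (p.2 : Vel d) (p.1 : Vel d))) :
    |φ p.1 * mirrorDiff ψ p.1 p.2 * k| ≤ 6 * C * C' * levyWeight b p := by
  have h1 := norm_mirrorDiff_le (hψ.contDiff 2) hψ.even hC1 hC2 p.1.norm_eq p.2.norm_eq
  have h2 := hC p.1 p.1.norm_eq
  have h3 := Sph.one_sub_inner_sq_nonneg p.1 p.2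
  have hC0 : 0 ≤ C := (abs_nonneg _).trans h2
  have hC0' : 0 ≤ C' := (norm_nonneg _).trans (hC1 p.1 p.1.norm_eq)
  rw [Real.norm_eq_abs] at h1
  rw [abs_mul, abs_mul, abs_of_nonneg hk0]
  calc |φ p.1| * |mirrorDiff ψ p.1 p.2| * k
      ≤ C * (6 * C' * (1 - (inner ℝ (p.1 : Vel d) (p.2 : Vel d)) ^ 2))
        * b (inner ℝ (p.2 : Vel d) (p.1 : Vel d)) := by gcongr
    _ = _ := by rw [levyWeight]; ring

namespace AngularKernel

variable {b : ℝ → ℝ} (hb : AngularKernel d b)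
include hb

theorem measurable_cutKernel (n : ℕ) : Measurable (cutKernel b n) :=
  Measurable.ite (measurableSet_lt measurable_const (by fun_prop)) hb.meas measurable_const

theorem cutKernel_nonneg (n : ℕ) (σ σ' : Sph d) :
    0 ≤ cutKernel b n (inner ℝ (σ : Vel d) (σ' : Vel d)) := by
  rw [cutKernel]; split_ifs
  · exact hb.nonneg_inner σ σ'
  · exact le_rfl

theorem cutKernel_le (n : ℕ) (σ σ' : Sph d) :
    cutKernel b n (inner ℝ (σ : Vel d) (σ' : Vel d)) ≤ b (inner ℝ (σ : Vel d) (σ' : Vel d)) := by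
  rw [cutKernel]; split_ifs
  · exact le_rfl
  · exact hb.nonneg_inner σ σ'

theorem cutKernel_le_levyWeight (n : ℕ) (p : Sph d × Sph d) :
    cutKernel b n (inner ℝ (p.2 : Vel d) (p.1 : Vel d)) ≤ ((n : ℝ) + 1) * levyWeight b p := by
  have hn : (0 : ℝ) < (n : ℝ) + 1 := by positivity
  rw [cutKernel]; split_ifs with h
  · rw [levyWeight, ← mul_assoc]
    rw [real_inner_comm (p.1 : Vel d) (p.2 : Vel d)] at *
    have h1 := (div_lt_iff₀' hn).1 h
    nlinarith [hb.nonneg_inner p.1 p.2]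
  · exact mul_nonneg hn.le (hb.levyWeight_nonneg p)

/-- Without grazing collisions no principal value is needed, and the operator is symmetric by the
exchange of `σ` and `σ'`. -/
theorem integral_mul_mirrorDiff_cutKernel (n : ℕ) {φ ψ : Vel d → ℝ} (hφ : SmoothEven φ)
    (hψ : SmoothEven ψ) :
    ∫ p : Sph d × Sph d, φ p.1 * mirrorDiff ψ p.1 p.2 *
        cutKernel b n (inner ℝ (p.2 : Vel d) (p.1 : Vel d)) ∂((surf d).prod (surf d))
      = -dirForm (cutKernel b n) φ ψ := by
  set μ := (surf d).prod (surf d)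
  set k : Sph d × Sph d → ℝ := fun p => cutKernel b n (inner ℝ (p.2 : Vel d) (p.1 : Vel d)) with hk
  have hkm : Measurable k := (hb.measurable_cutKernel n).comp
    (by fun_prop : Continuous fun p : Sph d × Sph d =>
      (inner ℝ (p.2 : Vel d) (p.1 : Vel d) : ℝ)).measurable
  have hki : Integrable k μ := by
    refine (hb.integrable_levyWeight.const_mul ((n : ℝ) + 1)).mono' hkm.aestronglyMeasurable
      (Filter.Eventually.of_forall fun p => ?_)
    rw [Real.norm_of_nonneg (hb.cutKernel_nonneg n _ _)]
    exact hb.cutKernel_le_levyWeight n p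
  have hcint : ∀ f : Sph d × Sph d → ℝ, Continuous f → Integrable (fun p => f p * k p) μ := by
    intro f hf
    obtain ⟨C, hC⟩ := isCompact_univ.exists_bound_of_continuousOn hf.continuousOn
    exact hki.bdd_mul hf.aestronglyMeasurable (c := C) (Filter.Eventually.of_forall fun p => hC p trivial)
  have hcφ := hφ.continuous
  have hcψ := hψ.continuous
  have hv1 : Continuous fun p : Sph d × Sph d => (p.1 : Vel d) :=
    continuous_subtype_val.comp continuous_fst
  have hv2 : Continuous fun p : Sph d × Sph d => (p.2 : Vel d) :=
    continuous_subtype_val.comp continuous_snd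
  have i1 := hcint (fun p => φ p.1 * ψ p.2) ((hcφ.comp hv1).mul (hcψ.comp hv2))
  have i2 := hcint (fun p => φ p.1 * ψ (axisRefl (p.1 : Vel d) (p.2 : Vel d)))
    ((hcφ.comp hv1).mul (hcψ.comp continuous_axisRefl_sph))
  have i3 := hcint (fun p => φ p.1 * ψ p.1) ((hcφ.comp hv1).mul (hcψ.comp hv1))
  have i4 := hcint (fun p => φ p.2 * ψ p.1) ((hcφ.comp hv2).mul (hcψ.comp hv1))
  have i5 := hcint (fun p => φ p.2 * ψ p.2) ((hcφ.comp hv2).mul (hcψ.comp hv2))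
  have e2 : ∫ p, φ p.1 * ψ (axisRefl (p.1 : Vel d) (p.2 : Vel d)) * k p ∂μ
      = ∫ p, φ p.1 * ψ p.2 * k p ∂μ := by
    rw [integral_prod _ i2, integral_prod _ i1]
    congr 1; funext σ
    rw [← integral_sphMap (axisIso (σ : Vel d)) (fun σ' => φ (σ, σ').1 * ψ (σ, σ').2 * k (σ, σ'))]
    congr 1; funext σ'
    simp only [sphMap_coe, axisIso_apply σ.norm_eq, hk]
    rw [real_inner_comm (σ : Vel d) (axisRefl (σ : Vel d) σ'), inner_axisRefl σ.norm_eq,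
      real_inner_comm (σ : Vel d) (σ' : Vel d)]
  have hks : ∀ p, k p.swap = k p := fun p => by
    simp only [hk, Prod.fst_swap, Prod.snd_swap]; rw [real_inner_comm]
  have e4 : ∫ p, φ p.2 * ψ p.1 * k p ∂μ = ∫ p, φ p.1 * ψ p.2 * k p ∂μ := by
    rw [← integral_prod_swap]
    simp only [hks, Prod.fst_swap, Prod.snd_swap]; rfl
  have e5 : ∫ p, φ p.2 * ψ p.2 * k p ∂μ = ∫ p, φ p.1 * ψ p.1 * k p ∂μ := by
    rw [← integral_prod_swap]
    simp only [hks, Prod.snd_swap]; rfl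
  have l1 : ∫ p : Sph d × Sph d, φ p.1 * mirrorDiff ψ p.1 p.2 * k p ∂μ
      = (1 / 2) * (∫ p, φ p.1 * ψ p.2 * k p ∂μ)
        + (1 / 2) * (∫ p, φ p.1 * ψ (axisRefl (p.1 : Vel d) (p.2 : Vel d)) * k p ∂μ)
        - ∫ p, φ p.1 * ψ p.1 * k p ∂μ := by
    have i12 : Integrable (fun p : Sph d × Sph d => (1 / 2) * (φ p.1 * ψ p.2 * k p)
        + (1 / 2) * (φ p.1 * ψ (axisRefl (p.1 : Vel d) (p.2 : Vel d)) * k p)) μ :=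
      (i1.const_mul _).add (i2.const_mul _)
    rw [← integral_const_mul, ← integral_const_mul,
      ← integral_add (i1.const_mul _) (i2.const_mul _), ← integral_sub i12 i3]
    congr 1; funext p; simp only [mirrorDiff, smul_eq_mul]; ring
  have l2 : ∫ p : Sph d × Sph d, dirInt (cutKernel b n) φ ψ p ∂μ
      = (∫ p, φ p.2 * ψ p.2 * k p ∂μ) - (∫ p, φ p.2 * ψ p.1 * k p ∂μ)
        - (∫ p, φ p.1 * ψ p.2 * k p ∂μ) + ∫ p, φ p.1 * ψ p.1 * k p ∂μ := by
    have i54 : Integrable (fun p : Sph d × Sph d => φ p.2 * ψ p.2 * k p - φ p.2 * ψ p.1 * k p) μ :=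
      i5.sub i4
    have i541 : Integrable (fun p : Sph d × Sph d => φ p.2 * ψ p.2 * k p - φ p.2 * ψ p.1 * k p
        - φ p.1 * ψ p.2 * k p) μ := i54.sub i1
    rw [← integral_sub i5 i4, ← integral_sub i54 i1, ← integral_add i541 i3]
    congr 1; funext p; simp only [dirInt, hk]; ring
  rw [l1, e2, dirForm, l2, e4, e5]; ring

/-- The spherical Boltzmann operator is symmetric, with Dirichlet form `dirForm`. -/
theorem integral_mul_sphBoltzmann {φ ψ : Vel d → ℝ} (hφ : SmoothEven φ) (hψ : SmoothEven ψ) :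
    Integrable (fun σ : Sph d => φ σ * sphBoltzmann b ψ σ) (surf d) ∧
    ∫ σ : Sph d, φ σ * sphBoltzmann b ψ σ ∂(surf d) = -dirForm b φ ψ := by
  obtain ⟨C, -, hC⟩ := hφ.exists_bound
  obtain ⟨C', -, hC'⟩ := hψ.exists_bound
  have hm : ∀ k : ℝ → ℝ, Measurable k → AEStronglyMeasurable (fun p : Sph d × Sph d =>
      φ p.1 * mirrorDiff ψ p.1 p.2 * k (inner ℝ (p.2 : Vel d) (p.1 : Vel d)))
      ((surf d).prod (surf d)) := fun k hk =>
    (((hφ.continuous.measurable.comp (by fun_prop)).mul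
      (measurable_mirrorDiff hψ.continuous)).mul
      (hk.comp (by fun_prop : Continuous fun p : Sph d × Sph d =>
        (inner ℝ (p.2 : Vel d) (p.1 : Vel d) : ℝ)).measurable)).aestronglyMeasurable
  have hbd := hb.integrable_levyWeight.const_mul (6 * C * C')
  have hint : Integrable (fun p : Sph d × Sph d =>
      φ p.1 * mirrorDiff ψ p.1 p.2 * b (inner ℝ (p.2 : Vel d) (p.1 : Vel d)))
      ((surf d).prod (surf d)) :=
    hbd.mono' (hm b hb.meas) (Filter.Eventually.of_forall fun p =>
      abs_mul_mirrorDiff_le hψ (fun x hx => (hC x hx).1) (fun x hx => (hC' x hx).2.1)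
        (fun x hx => (hC' x hx).2.2) p (hb.nonneg_inner _ _) le_rfl)
  have hin : ∀ σ : Sph d, ∫ σ' : Sph d, φ σ * mirrorDiff ψ σ σ' *
      b (inner ℝ (σ' : Vel d) (σ : Vel d)) ∂(surf d) = φ σ * sphBoltzmann b ψ σ := by
    intro σ
    rw [sphBoltzmann_eq, ← integral_const_mul]
    congr 1; funext σ'; ring
  constructor
  · have := hint.integral_prod_left
    simpa only [hin] using this
  have hlim : ∀ p : Sph d × Sph d, levyWeight b p ≠ 0 →
      Filter.Tendsto (fun n => cutKernel b n (inner ℝ (p.2 : Vel d) (p.1 : Vel d))) Filter.atTop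
        (nhds (b (inner ℝ (p.2 : Vel d) (p.1 : Vel d)))) := by
    intro p hp
    refine tendsto_cutKernel b (lt_of_le_of_ne (Sph.one_sub_inner_sq_nonneg _ _) fun h => hp ?_)
    rw [levyWeight, real_inner_comm, ← h, zero_mul]
  have t1 : Filter.Tendsto (fun n => ∫ p : Sph d × Sph d, φ p.1 * mirrorDiff ψ p.1 p.2 *
        cutKernel b n (inner ℝ (p.2 : Vel d) (p.1 : Vel d)) ∂((surf d).prod (surf d))) Filter.atTop
      (nhds (∫ p : Sph d × Sph d, φ p.1 * mirrorDiff ψ p.1 p.2 *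
        b (inner ℝ (p.2 : Vel d) (p.1 : Vel d)) ∂((surf d).prod (surf d)))) := by
    refine tendsto_integral_of_dominated_convergence _ (fun n => hm _ (hb.measurable_cutKernel n))
      hbd (fun n => Filter.Eventually.of_forall fun p =>
        abs_mul_mirrorDiff_le hψ (fun x hx => (hC x hx).1) (fun x hx => (hC' x hx).2.1)
        (fun x hx => (hC' x hx).2.2) p (hb.cutKernel_nonneg n _ _) (hb.cutKernel_le n _ _))
      (Filter.Eventually.of_forall fun p => ?_)
    by_cases hp : levyWeight b p = 0
    · have h0 : ∀ k, 0 ≤ k → k ≤ b (inner ℝ (p.2 : Vel d) (p.1 : Vel d)) →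
          φ p.1 * mirrorDiff ψ p.1 p.2 * k = 0 := fun k h0 hk => by
        have := abs_mul_mirrorDiff_le hψ (fun x hx => (hC x hx).1) (fun x hx => (hC' x hx).2.1)
          (fun x hx => (hC' x hx).2.2) p h0 hk
        rw [hp, mul_zero] at this
        exact abs_nonpos_iff.1 this
      simp_rw [h0 _ (hb.nonneg_inner p.2 p.1) le_rfl,
        fun n => h0 _ (hb.cutKernel_nonneg n p.2 p.1) (hb.cutKernel_le n p.2 p.1)]
      exact tendsto_const_nhds
    · exact (hlim p hp).const_mul _
  have t2 : Filter.Tendsto (fun n => ∫ p, dirInt (cutKernel b n) φ ψ p ∂((surf d).prod (surf d)))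
      Filter.atTop (nhds (∫ p, dirInt b φ ψ p ∂((surf d).prod (surf d)))) := by
    refine tendsto_integral_of_dominated_convergence (fun p => |dirInt b φ ψ p|) (fun n => ?_)
      (hb.integrable_dirInt hφ hψ).abs
      (fun n => Filter.Eventually.of_forall fun p => ?_) (Filter.Eventually.of_forall fun p => ?_)
    · have hc1 := hφ.continuous
      have hc2 := hψ.continuous
      refine (Measurable.mul (Continuous.measurable ?_) ((hb.measurable_cutKernel n).comp
        (by fun_prop : Continuous fun p : Sph d × Sph d =>
        (inner ℝ (p.2 : Vel d) (p.1 : Vel d) : ℝ)).measurable)).aestronglyMeasurable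
      fun_prop
    · rw [Real.norm_eq_abs, dirInt, dirInt, abs_mul, abs_mul _ (b _),
        abs_of_nonneg (hb.cutKernel_nonneg n p.2 p.1), abs_of_nonneg (hb.nonneg_inner p.2 p.1)]
      exact mul_le_mul_of_nonneg_left (hb.cutKernel_le n p.2 p.1) (abs_nonneg _)
    · by_cases hp : levyWeight b p = 0
      · have h0 : (φ p.2 - φ p.1) * (ψ p.2 - ψ p.1) = 0 ∨
            b (inner ℝ (p.2 : Vel d) (p.1 : Vel d)) = 0 := by
          rcases mul_eq_zero.1 hp with h | h
          · left
            have := abs_sub_mul_sub_le hφ.differentiable hφ.even hψ.differentiable hψ.even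
              (fun x hx => (hC x hx).2.1) (fun x hx => (hC' x hx).2.1) p.1 p.2
            rw [h, mul_zero] at this
            exact abs_nonpos_iff.1 this
          · exact Or.inr h
        have h1 : ∀ n, dirInt (cutKernel b n) φ ψ p = 0 := fun n => by
          rcases h0 with h | h
          · rw [dirInt, h, zero_mul]
          · rw [dirInt, cutKernel, h, ite_self, mul_zero]
        have h2 : dirInt b φ ψ p = 0 := by
          rcases h0 with h | h
          · rw [dirInt, h, zero_mul]
          · rw [dirInt, h, mul_zero]
        simp_rw [h1, h2]
        exact tendsto_const_nhds
      · exact (hlim p hp).const_mul _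
  have t3 : Filter.Tendsto (fun n => ∫ p : Sph d × Sph d, φ p.1 * mirrorDiff ψ p.1 p.2 *
        cutKernel b n (inner ℝ (p.2 : Vel d) (p.1 : Vel d)) ∂((surf d).prod (surf d))) Filter.atTop
      (nhds (-dirForm b φ ψ)) := by
    simp_rw [fun n => hb.integral_mul_mirrorDiff_cutKernel n hφ hψ]
    exact (t2.const_mul (1 / 2)).neg
  rw [← tendsto_nhds_unique t1 t3, integral_prod _ hint]
  exact integral_congr_ae (Filter.Eventually.of_forall fun σ => (hin σ).symm)

end AngularKernel

/-! ### Derivatives of the Dirichlet form along families and rotations -/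

theorem infty_add_one_le : ((⊤ : ℕ∞) : WithTop ℕ∞) + 1 ≤ ((⊤ : ℕ∞) : WithTop ℕ∞) := by
  exact_mod_cast le_top

/-- A smooth one-parameter family of even functions. -/
structure EvenFamily (Φ : ℝ → Vel d → ℝ) : Prop where
  smooth : ContDiff ℝ (⊤ : ℕ∞) (fun q : ℝ × Vel d => Φ q.1 q.2)
  even : ∀ t x, Φ t (-x) = Φ t x

namespace EvenFamily

variable {Φ Ψ : ℝ → Vel d → ℝ}

theorem smoothEven (h : EvenFamily Φ) (t : ℝ) : SmoothEven (Φ t) :=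
  ⟨h.smooth.comp (contDiff_const.prodMk contDiff_id), h.even t⟩

theorem hasDerivAt (h : EvenFamily Φ) (t : ℝ) (x : Vel d) :
    HasDerivAt (fun s => Φ s x) (deriv (fun s => Φ s x) t) t := by
  have : ContDiff ℝ (⊤ : ℕ∞) (fun s => Φ s x) := h.smooth.comp (contDiff_id.prodMk contDiff_const)
  exact (this.differentiable (by simp) t).hasDerivAt

theorem deriv (h : EvenFamily Φ) : EvenFamily (fun t x => deriv (fun s => Φ s x) t) := by
  refine ⟨?_, fun t x => by simp only [h.even]⟩
  have h1 : ContDiff ℝ (⊤ : ℕ∞) (fun q : ℝ × Vel d => fderiv ℝ (fun s => Φ s q.2) q.1 1) := by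
    refine ContDiff.fderiv_apply (m := (⊤ : ℕ∞)) (f := fun (q : ℝ × Vel d) s => Φ s q.2) ?_
      contDiff_fst contDiff_const infty_add_one_le
    exact h.smooth.comp (contDiff_snd.prodMk (contDiff_snd.comp contDiff_fst))
  exact h1

theorem exists_bound (h : EvenFamily Φ) (t₀ : ℝ) : ∃ C : ℝ, 0 ≤ C ∧ ∀ t ∈ closedBall t₀ 1,
    ∀ x : Vel d, ‖x‖ = 1 → ‖fderiv ℝ (Φ t) x‖ ≤ C := by
  have h1 : ContDiff ℝ (⊤ : ℕ∞) (fun q : ℝ × Vel d => fderiv ℝ (Φ q.1) q.2) := by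
    refine ContDiff.fderiv (m := (⊤ : ℕ∞)) (f := fun (q : ℝ × Vel d) x => Φ q.1 x) ?_
      contDiff_snd infty_add_one_le
    exact h.smooth.comp ((contDiff_fst.comp contDiff_fst).prodMk contDiff_snd)
  obtain ⟨C, hC⟩ := ((isCompact_closedBall t₀ 1).prod
    (isCompact_sphere (0 : Vel d) 1)).exists_bound_of_continuousOn h1.continuous.continuousOn
  exact ⟨|C|, abs_nonneg C, fun t ht x hx =>
    (hC (t, x) ⟨ht, mem_sphere_zero_iff_norm.2 hx⟩).trans (le_abs_self C)⟩

end EvenFamily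

/-- Differentiation of the Dirichlet form along smooth families of functions. -/
theorem AngularKernel.hasDerivAt_dirForm {b : ℝ → ℝ} (hb : AngularKernel d b)
    {Φ Ψ : ℝ → Vel d → ℝ} (hΦ : EvenFamily Φ) (hΨ : EvenFamily Ψ) (t : ℝ) :
    HasDerivAt (fun t => dirForm b (Φ t) (Ψ t))
      (dirForm b (fun x => deriv (fun s => Φ s x) t) (Ψ t)
        + dirForm b (Φ t) (fun x => deriv (fun s => Ψ s x) t)) t := by
  obtain ⟨C₁, hC₁0, hC₁⟩ := hΦ.exists_bound t
  obtain ⟨C₂, hC₂0, hC₂⟩ := hΨ.exists_bound t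
  obtain ⟨C₁', hC₁'0, hC₁'⟩ := hΦ.deriv.exists_bound t
  obtain ⟨C₂', hC₂'0, hC₂'⟩ := hΨ.deriv.exists_bound t
  have i1 := hb.integrable_dirInt (hΦ.deriv.smoothEven t) (hΨ.smoothEven t)
  have i2 := hb.integrable_dirInt (hΦ.smoothEven t) (hΨ.deriv.smoothEven t)
  have key := hasDerivAt_integral_of_dominated_loc_of_deriv_le (μ := (surf d).prod (surf d))
    (F := fun t p => dirInt b (Φ t) (Ψ t) p)
    (F' := fun t p => dirInt b (fun x => deriv (fun s => Φ s x) t) (Ψ t) p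
      + dirInt b (Φ t) (fun x => deriv (fun s => Ψ s x) t) p) (x₀ := t)
    (bound := fun p => 3 * (C₁' * C₂ + C₁ * C₂') * levyWeight b p)
    (closedBall_mem_nhds t one_pos)
    (Filter.Eventually.of_forall fun s => (hb.measurable_dirInt (hΦ.smoothEven s).continuous
      (hΨ.smoothEven s).continuous).aestronglyMeasurable)
    (hb.integrable_dirInt (hΦ.smoothEven t) (hΨ.smoothEven t))
    (i1.add i2).aestronglyMeasurable
    (Filter.Eventually.of_forall fun p s hs => ?_)
    (hb.integrable_levyWeight.const_mul _)
    (Filter.Eventually.of_forall fun p s hs => ?_)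
  · have := key.2.const_mul (1 / 2 : ℝ)
    rw [integral_add i1 i2, mul_add] at this
    exact this
  · have a1 := hb.abs_dirInt_le (hΦ.deriv.smoothEven s).differentiable (hΦ.deriv.even s)
      (hΨ.smoothEven s).differentiable (hΨ.even s) (hC₁' s hs) (hC₂ s hs) p
    have a2 := hb.abs_dirInt_le (hΦ.smoothEven s).differentiable (hΦ.even s)
      (hΨ.deriv.smoothEven s).differentiable (hΨ.deriv.even s) (hC₁ s hs) (hC₂' s hs) p
    refine (norm_add_le _ _).trans ((add_le_add a1 a2).trans (le_of_eq ?_))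
    ring
  · have a1 := (hΦ.hasDerivAt s p.2).sub (hΦ.hasDerivAt s p.1)
    have a2 := (hΨ.hasDerivAt s p.2).sub (hΨ.hasDerivAt s p.1)
    have a3 := (a1.mul a2).mul_const (b (inner ℝ (p.2 : Vel d) (p.1 : Vel d)))
    refine a3.congr_deriv ?_
    simp only [dirInt, Pi.sub_apply]; ring

/-- The rotation by the angle `θ` in the plane spanned by the orthonormal vectors `a`, `e`. -/
def rotFun (a e : Vel d) (θ : ℝ) (x : Vel d) : Vel d :=
  x + (Real.cos θ - 1) • ((inner ℝ a x : ℝ) • a + (inner ℝ e x : ℝ) • e)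
    + Real.sin θ • ((inner ℝ a x : ℝ) • e - (inner ℝ e x : ℝ) • a)

/-- A rotation is the composition of two reflections. -/
theorem axisRefl_axisRefl {a e : Vel d} (ha : ‖a‖ = 1) (hae : inner ℝ a e = 0)
    (θ : ℝ) (x : Vel d) :
    axisRefl (greatCircle a e (θ / 2)) (axisRefl a x) = rotFun a e θ x := by
  have hea : inner ℝ e a = (0 : ℝ) := by rw [real_inner_comm, hae]
  have h1 : Real.cos θ = 2 * Real.cos (θ / 2) ^ 2 - 1 := by
    rw [← Real.cos_two_mul]; congr 1; ring
  have h2 : Real.sin θ = 2 * Real.sin (θ / 2) * Real.cos (θ / 2) := by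
    rw [← Real.sin_two_mul]; congr 1; ring
  have h3 := Real.sin_sq_add_cos_sq (θ / 2)
  have hi : inner ℝ (greatCircle a e (θ / 2)) (axisRefl a x)
      = Real.cos (θ / 2) * inner ℝ a x - Real.sin (θ / 2) * inner ℝ e x := by
    simp only [greatCircle, axisRefl, inner_add_left, inner_smul_left, inner_sub_right,
      inner_smul_right, real_inner_self_eq_norm_sq, ha, hea]
    simp; ring
  rw [axisRefl, hi, rotFun, h1, h2, greatCircle, axisRefl]
  match_scalars
  · ring
  · linear_combination (-2 * inner ℝ e x : ℝ) * h3
  · ring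

/-- The rotation by the angle `θ` as a linear isometry. -/
def rotIso (a e : Vel d) (θ : ℝ) : Vel d ≃ₗᵢ[ℝ] Vel d :=
  (axisIso a).trans (axisIso (greatCircle a e (θ / 2)))

theorem rotIso_apply {a e : Vel d} (ha : ‖a‖ = 1) (he : ‖e‖ = 1) (hae : inner ℝ a e = 0)
    (θ : ℝ) (x : Vel d) : rotIso a e θ x = rotFun a e θ x := by
  rw [← axisRefl_axisRefl ha hae, ← axisIso_apply (norm_greatCircle ha he hae _),
    ← axisIso_apply ha]; rfl

theorem hasDerivAt_rotFun_zero (a e x : Vel d) :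
    HasDerivAt (fun θ => rotFun a e θ x) ((inner ℝ a x : ℝ) • e - (inner ℝ e x : ℝ) • a) 0 := by
  have h1 := ((Real.hasDerivAt_cos 0).sub_const 1).smul_const
    ((inner ℝ a x : ℝ) • a + (inner ℝ e x : ℝ) • e)
  have h2 := (Real.hasDerivAt_sin 0).smul_const ((inner ℝ a x : ℝ) • e - (inner ℝ e x : ℝ) • a)
  refine ((h1.const_add x).add h2).congr_deriv ?_
  simp

/-- The derivative of `φ` along the rotations in the oriented plane of `a` and `e`. -/
def rotDeriv (a e : Vel d) (φ : Vel d → ℝ) (x : Vel d) : ℝ :=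
  fderiv ℝ φ x ((inner ℝ a x : ℝ) • e - (inner ℝ e x : ℝ) • a)

theorem SmoothEven.rotDeriv {φ : Vel d → ℝ} (h : SmoothEven φ) (a e : Vel d) :
    SmoothEven (rotDeriv a e φ) := by
  refine ⟨?_, fun x => ?_⟩
  · have h1 : ContDiff ℝ (⊤ : ℕ∞) (fderiv ℝ φ) := h.smooth.fderiv_right infty_add_one_le
    unfold Boltzmann.rotDeriv
    exact h1.clm_apply (((contDiff_const.inner ℝ contDiff_id).smul contDiff_const).sub
      ((contDiff_const.inner ℝ contDiff_id).smul contDiff_const))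
  · rw [Boltzmann.rotDeriv, h.fderiv_neg, Boltzmann.rotDeriv, ← map_neg]
    congr 1
    simp only [inner_neg_right, neg_smul]; abel

theorem hasDerivAt_comp_rotFun {φ : Vel d → ℝ} (h : Differentiable ℝ φ) (a e x : Vel d) :
    HasDerivAt (fun θ => φ (rotFun a e θ x)) (rotDeriv a e φ x) 0 := by
  have h0 : rotFun a e 0 x = x := by simp [rotFun]
  have h1 := (h (rotFun a e 0 x)).hasFDerivAt.comp_hasDerivAt (0 : ℝ) (hasDerivAt_rotFun_zero a e x)
  rw [h0] at h1
  exact h1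

theorem SmoothEven.evenFamily_rot {φ : Vel d → ℝ} (h : SmoothEven φ) (a e : Vel d) :
    EvenFamily (fun θ x => φ (rotFun a e θ x)) := by
  refine ⟨h.smooth.comp ?_, fun t x => ?_⟩
  · have ia : ContDiff ℝ (⊤ : ℕ∞) fun q : ℝ × Vel d => (inner ℝ a q.2 : ℝ) :=
      contDiff_const.inner ℝ contDiff_snd
    have ie : ContDiff ℝ (⊤ : ℕ∞) fun q : ℝ × Vel d => (inner ℝ e q.2 : ℝ) :=
      contDiff_const.inner ℝ contDiff_snd
    unfold rotFun
    fun_prop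
  · rw [← h.even]; congr 1
    simp only [rotFun, inner_neg_right, neg_smul]; module

/-- Rotational derivatives are antisymmetric for the Dirichlet form, since it is invariant under
rotations. -/
theorem AngularKernel.dirForm_rotDeriv {b : ℝ → ℝ} (hb : AngularKernel d b) {φ ψ : Vel d → ℝ}
    (hφ : SmoothEven φ) (hψ : SmoothEven ψ) {a e : Vel d} (ha : ‖a‖ = 1) (he : ‖e‖ = 1)
    (hae : inner ℝ a e = 0) :
    dirForm b (rotDeriv a e φ) ψ = -dirForm b φ (rotDeriv a e ψ) := by
  have h1 := hb.hasDerivAt_dirForm (hφ.evenFamily_rot a e) (hψ.evenFamily_rot a e) 0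
  have h2 : (fun θ => dirForm b (fun x => φ (rotFun a e θ x)) (fun x => ψ (rotFun a e θ x)))
      = fun _ => dirForm b φ ψ := by
    funext θ
    simp only [← rotIso_apply ha he hae]
    exact dirForm_comp_iso b φ ψ _
  rw [h2] at h1
  have h3 := h1.unique (hasDerivAt_const 0 _)
  have h0 : ∀ x, rotFun a e 0 x = x := fun x => by simp [rotFun]
  have e1 : (fun x => deriv (fun θ => φ (rotFun a e θ x)) 0) = rotDeriv a e φ :=
    funext fun x => (hasDerivAt_comp_rotFun hφ.differentiable a e x).deriv
  have e2 : (fun x => deriv (fun θ => ψ (rotFun a e θ x)) 0) = rotDeriv a e ψ :=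
    funext fun x => (hasDerivAt_comp_rotFun hψ.differentiable a e x).deriv
  simp only [e1, e2, h0] at h3
  linarith

/-! ### Differentiability of the spherical Boltzmann operator -/

theorem two_le_infty : (2 : WithTop ℕ∞) ≤ ((⊤ : ℕ∞) : WithTop ℕ∞) := by
  have h : ∀ n : ℕ, (n : WithTop ℕ∞) ≤ ((⊤ : ℕ∞) : WithTop ℕ∞) := fun n => mod_cast le_top
  exact h 2

section Parametric

variable {P : Type*} [NormedAddCommGroup P] [NormedSpace ℝ P]
  {V : Type*} [NormedAddCommGroup V] [NormedSpace ℝ V]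

theorem contDiffAt_fderiv_snd {H : P × Vel d → V} {q : P × Vel d}
    (h : ContDiffAt ℝ (⊤ : ℕ∞) H q) :
    ContDiffAt ℝ (⊤ : ℕ∞) (fun q : P × Vel d => fderiv ℝ (fun x => H (q.1, x)) q.2) q := by
  refine ContDiffAt.fderiv (n := (⊤ : ℕ∞)) (f := fun (q : P × Vel d) x => H (q.1, x)) ?_
    contDiffAt_snd infty_add_one_le
  exact ContDiffAt.comp (g := H) (f := fun r : (P × Vel d) × Vel d => (r.1.1, r.2)) (q, q.2) h
    ((contDiffAt_fst.comp _ contDiffAt_fst).prodMk contDiffAt_snd)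

theorem contDiffAt_fderiv_fst {H : P × Vel d → V} {q : P × Vel d}
    (h : ContDiffAt ℝ (⊤ : ℕ∞) H q) :
    ContDiffAt ℝ (⊤ : ℕ∞) (fun q : P × Vel d => fderiv ℝ (fun p => H (p, q.2)) q.1) q := by
  refine ContDiffAt.fderiv (n := (⊤ : ℕ∞)) (f := fun (q : P × Vel d) p => H (p, q.2)) ?_
    contDiffAt_fst infty_add_one_le
  exact ContDiffAt.comp (g := H) (f := fun r : (P × Vel d) × P => (r.2, r.1.2)) (q, q.1) h
    (contDiffAt_snd.prodMk (contDiffAt_snd.comp _ contDiffAt_fst))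

/-- On a compact set of parameters, the first two derivatives of a smooth family are bounded along
the sphere. -/
theorem exists_bound_fderiv_two {H : P × Vel d → V} {K : Set P} (hK : IsCompact K)
    (h : ∀ p ∈ K, ∀ x, ContDiffAt ℝ (⊤ : ℕ∞) H (p, x)) :
    ∃ C : ℝ, ∀ p ∈ K, ∀ x : Vel d, ‖x‖ = 1 → ‖fderiv ℝ (fun x => H (p, x)) x‖ ≤ C ∧
      ‖fderiv ℝ (fderiv ℝ (fun x => H (p, x))) x‖ ≤ C := by
  have hc := hK.prod (isCompact_sphere (0 : Vel d) 1)
  have c1 : ContinuousOn (fun q : P × Vel d => ‖fderiv ℝ (fun x => H (q.1, x)) q.2‖)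
      (K ×ˢ sphere (0 : Vel d) 1) := fun q hq =>
    (contDiffAt_fderiv_snd (h q.1 hq.1 q.2)).continuousAt.norm.continuousWithinAt
  have c2 : ContinuousOn (fun q : P × Vel d => ‖fderiv ℝ (fderiv ℝ (fun x => H (q.1, x))) q.2‖)
      (K ×ˢ sphere (0 : Vel d) 1) := fun q hq =>
    (contDiffAt_fderiv_snd (contDiffAt_fderiv_snd
      (h q.1 hq.1 q.2))).continuousAt.norm.continuousWithinAt
  obtain ⟨C1, h1⟩ := hc.exists_bound_of_continuousOn c1
  obtain ⟨C2, h2⟩ := hc.exists_bound_of_continuousOn c2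
  refine ⟨max C1 C2, fun p hp x hx => ?_⟩
  have hq : (p, x) ∈ K ×ˢ sphere (0 : Vel d) 1 := ⟨hp, mem_sphere_zero_iff_norm.2 hx⟩
  exact ⟨((le_abs_self _).trans (h1 _ hq)).trans (le_max_left _ _),
    ((le_abs_self _).trans (h2 _ hq)).trans (le_max_right _ _)⟩

/-- Differentiation of the principal value integral with respect to a parameter. -/
theorem AngularKernel.hasFDerivAt_integral_mirrorDiff [ProperSpace P] {b : ℝ → ℝ} (hb : AngularKernel d b)
    {H : P × Vel d → ℝ} {O : Set P} (hO : IsOpen O) {p₀ : P} (hp₀ : p₀ ∈ O)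
    (hH : ∀ p ∈ O, ∀ x, ContDiffAt ℝ (⊤ : ℕ∞) H (p, x))
    (he : ∀ p x, H (p, -x) = H (p, x)) (σ : Sph d) :
    ∃ L : P →L[ℝ] ℝ, HasFDerivAt (fun p => ∫ σ' : Sph d, mirrorDiff (fun x => H (p, x)) σ σ'
        * b (inner ℝ (σ' : Vel d) (σ : Vel d)) ∂(surf d)) L p₀ ∧
      ∀ v, L v = ∫ σ' : Sph d, mirrorDiff (fun x => fderiv ℝ (fun p => H (p, x)) p₀ v) σ σ'
        * b (inner ℝ (σ' : Vel d) (σ : Vel d)) ∂(surf d) := by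
  obtain ⟨δ, hδ, hδO⟩ := Metric.isOpen_iff.1 hO p₀ hp₀
  set K := closedBall p₀ (δ / 2) with hKdef
  have hKO : K ⊆ O := (closedBall_subset_ball (by linarith)).trans hδO
  have hK : IsCompact K := isCompact_closedBall _ _
  set H' : P × Vel d → (P →L[ℝ] ℝ) := fun q => fderiv ℝ (fun p => H (p, q.2)) q.1 with hH'
  have hH's : ∀ p ∈ O, ∀ x, ContDiffAt ℝ (⊤ : ℕ∞) H' (p, x) := fun p hp x =>
    contDiffAt_fderiv_fst (hH p hp x)
  have hsec : ∀ p ∈ O, ContDiff ℝ (⊤ : ℕ∞) (fun x => H (p, x)) := fun p hp =>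
    contDiff_iff_contDiffAt.2 fun x => ContDiffAt.comp (g := H) x (hH p hp x)
      (contDiffAt_const.prodMk contDiffAt_id)
  have hsec' : ∀ p ∈ O, ContDiff ℝ (⊤ : ℕ∞) (fun x => H' (p, x)) := fun p hp =>
    contDiff_iff_contDiffAt.2 fun x => ContDiffAt.comp (g := H') x (hH's p hp x)
      (contDiffAt_const.prodMk contDiffAt_id)
  have he' : ∀ p x, H' (p, -x) = H' (p, x) := fun p x => by simp only [hH', he]
  obtain ⟨C, hC⟩ := exists_bound_fderiv_two hK (fun p hp x => hH p (hKO hp) x)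
  obtain ⟨C', hC'⟩ := exists_bound_fderiv_two hK (fun p hp x => hH's p (hKO hp) x)
  have hp₀K : p₀ ∈ K := mem_closedBall_self (by linarith)
  have hbm : Measurable fun σ' : Sph d => b (inner ℝ (σ' : Vel d) (σ : Vel d)) :=
    hb.meas.comp (by fun_prop : Continuous fun σ' : Sph d =>
      (inner ℝ (σ' : Vel d) (σ : Vel d) : ℝ)).measurable
  have hrefl : Continuous fun σ' : Sph d => axisRefl (σ : Vel d) (σ' : Vel d) := by
    unfold axisRefl; fun_prop
  have hmeas : ∀ p ∈ O, AEStronglyMeasurable (fun σ' : Sph d => mirrorDiff (fun x => H (p, x)) σ σ'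
      * b (inner ℝ (σ' : Vel d) (σ : Vel d))) (surf d) := fun p hp => by
    have hc := (hsec p hp).continuous
    have : Continuous fun σ' : Sph d => mirrorDiff (fun x => H (p, x)) σ σ' :=
      (((hc.comp continuous_subtype_val).add (hc.comp hrefl)).const_smul (1 / 2 : ℝ)).sub
        continuous_const
    exact (this.measurable.mul hbm).aestronglyMeasurable
  have hbd : ∀ p ∈ K, ∀ σ' : Sph d, ‖mirrorDiff (fun x => H (p, x)) σ σ'
      * b (inner ℝ (σ' : Vel d) (σ : Vel d))‖ ≤ 6 * C * levyWeight b (σ, σ') := by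
    intro p hp σ'
    have := norm_mirrorDiff_le ((hsec p (hKO hp)).of_le two_le_infty) (he p)
      (fun x hx => (hC p hp x hx).1) (fun x hx => (hC p hp x hx).2) σ.norm_eq σ'.norm_eq
    rw [norm_mul, Real.norm_of_nonneg (hb.nonneg_inner σ' σ), levyWeight, ← mul_assoc]
    exact mul_le_mul_of_nonneg_right this (hb.nonneg_inner σ' σ)
  have hbd' : ∀ p ∈ K, ∀ σ' : Sph d, ‖b (inner ℝ (σ' : Vel d) (σ : Vel d)) •
      mirrorDiff (fun x => H' (p, x)) σ σ'‖ ≤ 6 * C' * levyWeight b (σ, σ') := by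
    intro p hp σ'
    have := norm_mirrorDiff_le ((hsec' p (hKO hp)).of_le two_le_infty) (he' p)
      (fun x hx => (hC' p hp x hx).1) (fun x hx => (hC' p hp x hx).2) σ.norm_eq σ'.norm_eq
    rw [norm_smul, mul_comm, Real.norm_of_nonneg (hb.nonneg_inner σ' σ), levyWeight, ← mul_assoc]
    exact mul_le_mul_of_nonneg_right this (hb.nonneg_inner σ' σ)
  have hbi := (hb.integrable_levyWeight_right σ).const_mul (6 * C)
  have hbi' := (hb.integrable_levyWeight_right σ).const_mul (6 * C')
  have hmeas' : AEStronglyMeasurable (fun σ' : Sph d => b (inner ℝ (σ' : Vel d) (σ : Vel d)) •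
      mirrorDiff (fun x => H' (p₀, x)) σ σ') (surf d) := by
    have hc := (hsec' p₀ hp₀).continuous
    have : Continuous fun σ' : Sph d => mirrorDiff (fun x => H' (p₀, x)) σ σ' :=
      (((hc.comp continuous_subtype_val).add (hc.comp hrefl)).const_smul (1 / 2 : ℝ)).sub
        continuous_const
    exact hbm.aestronglyMeasurable.smul this.aestronglyMeasurable
  have hdiff : ∀ p ∈ O, ∀ x, HasFDerivAt (fun p => H (p, x)) (H' (p, x)) p := fun p hp x => by
    have h1 : ContDiffAt ℝ (⊤ : ℕ∞) (fun p => H (p, x)) p :=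
      ContDiffAt.comp (g := H) p (hH p hp x) (contDiffAt_id.prodMk contDiffAt_const)
    exact (h1.differentiableAt (by simp)).hasFDerivAt
  have key := hasFDerivAt_integral_of_dominated_of_fderiv_le (μ := surf d)
    (F := fun p (σ' : Sph d) => mirrorDiff (fun x => H (p, x)) σ σ'
      * b (inner ℝ (σ' : Vel d) (σ : Vel d)))
    (F' := fun p (σ' : Sph d) => b (inner ℝ (σ' : Vel d) (σ : Vel d)) •
      mirrorDiff (fun x => H' (p, x)) σ σ') (x₀ := p₀) (s := K)
    (closedBall_mem_nhds p₀ (by linarith))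
    (Filter.eventually_of_mem (hO.mem_nhds hp₀) hmeas)
    (hbi.mono' (hmeas p₀ hp₀) (Filter.Eventually.of_forall fun σ' => hbd p₀ hp₀K σ')) hmeas'
    (Filter.Eventually.of_forall fun σ' p hp => hbd' p hp σ') hbi'
    (Filter.Eventually.of_forall fun σ' p hp => by
      have a := (((hdiff p (hKO hp) σ').add (hdiff p (hKO hp) (axisRefl (σ : Vel d) σ'))).const_smul
        (1 / 2 : ℝ)).sub (hdiff p (hKO hp) σ)
      exact a.mul_const (b (inner ℝ (σ' : Vel d) (σ : Vel d))))
  refine ⟨_, key, fun v => ?_⟩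
  rw [ContinuousLinearMap.integral_apply (hbi'.mono' hmeas'
    (Filter.Eventually.of_forall fun σ' => hbd' p₀ hp₀K σ'))]
  congr 1; funext σ'
  simp [mirrorDiff, hH']; ring

end Parametric

/-! ### Derivatives on the sphere -/

theorem hasFDerivAt_normalize {σ : Vel d} (hσ : ‖σ‖ = 1) :
    HasFDerivAt (fun x : Vel d => ‖x‖⁻¹ • x)
      (ContinuousLinearMap.id ℝ (Vel d) - (innerSL ℝ σ).smulRight σ) σ := by
  have h1 : HasFDerivAt (fun x : Vel d => ‖x‖) (innerSL ℝ σ) σ := by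
    have h := (hasStrictFDerivAt_norm_sq σ).hasFDerivAt.sqrt (by rw [hσ]; norm_num)
    have e : (fun x : Vel d => √(‖x‖ ^ 2)) = fun x => ‖x‖ := by
      funext x; exact Real.sqrt_sq (norm_nonneg x)
    rw [e] at h
    refine h.congr_fderiv ?_
    ext v
    simp [hσ]
  have h2 : HasFDerivAt (fun x : Vel d => ‖x‖⁻¹) (-(innerSL ℝ σ)) σ := by
    have h := (hasDerivAt_inv (x := ‖σ‖) (by rw [hσ]; norm_num)).comp_hasFDerivAt σ h1
    refine h.congr_fderiv ?_
    simp [hσ]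
  refine (h2.smul (hasFDerivAt_id σ)).congr_fderiv ?_
  ext v
  simp [hσ, sub_eq_add_neg]

theorem fderiv_radialExt {φ : Vel d → ℝ} {σ : Vel d} (hσ : ‖σ‖ = 1)
    (h : DifferentiableAt ℝ φ σ) (v : Vel d) :
    fderiv ℝ (radialExt φ) σ v = fderiv ℝ φ σ (v - (inner ℝ σ v : ℝ) • σ) := by
  have h0 : ‖σ‖⁻¹ • σ = σ := by rw [hσ]; simp
  have h1 : HasFDerivAt φ (fderiv ℝ φ σ) ((fun x : Vel d => ‖x‖⁻¹ • x) σ) := by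
    simp only [h0]; exact h.hasFDerivAt
  have h2 := HasFDerivAt.comp (g := φ) (f := fun x : Vel d => ‖x‖⁻¹ • x) σ h1
    (hasFDerivAt_normalize hσ)
  have h3 : HasFDerivAt (radialExt φ) _ σ := h2
  rw [h3.fderiv]; simp

theorem sphGrad_eq {φ : Vel d → ℝ} {σ : Vel d} (hσ : ‖σ‖ = 1)
    (h : DifferentiableAt ℝ φ σ) :
    sphGrad φ σ = gradient φ σ - (inner ℝ σ (gradient φ σ) : ℝ) • σ := by
  refine ext_inner_right ℝ fun v => ?_
  rw [sphGrad, inner_gradient_left, fderiv_radialExt hσ h, inner_sub_left, inner_smul_left,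
    inner_gradient_left, map_sub, map_smul, ← inner_gradient_left (y := σ), real_inner_comm σ]
  simp; ring

theorem fderiv_radialExt_sphBoltzmann {b : ℝ → ℝ} (hb : AngularKernel d b) {g : Vel d → ℝ}
    (hg : SmoothEven g) (σ : Sph d) {e : Vel d} (he : ‖e‖ = 1) (hσe : inner ℝ (σ : Vel d) e = 0) :
    DifferentiableAt ℝ (radialExt (sphBoltzmann b g)) σ ∧
    fderiv ℝ (radialExt (sphBoltzmann b g)) σ e = sphBoltzmann b (rotDeriv σ e g) σ := by
  -- the points near `σ` are the images of `σ` under the reflections through the bisectors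
  set m : Vel d → Vel d := fun y => ‖y‖⁻¹ • y + σ with hm
  set U : Vel d → Vel d → Vel d := fun y x => (2 * inner ℝ (m y) x / ‖m y‖ ^ 2) • m y - x with hU
  set O : Set (Vel d) := {y | 0 < (inner ℝ y (σ : Vel d) : ℝ)} with hOdef
  have hO : IsOpen O := isOpen_lt continuous_const (by fun_prop)
  have hσ := σ.norm_eq
  have hσO : (σ : Vel d) ∈ O := by simp [hOdef, hσ]
  have hy0 : ∀ y ∈ O, y ≠ 0 := fun y hy h => by rw [h] at hy; simp [hOdef] at hy
  have hm2 : ∀ y ∈ O, ‖m y‖ ^ 2 = 2 + 2 * (‖y‖⁻¹ * inner ℝ y (σ : Vel d)) := fun y hy => by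
    have hn : ‖y‖ ≠ 0 := norm_ne_zero_iff.2 (hy0 y hy)
    simp only [hm]
    rw [norm_add_sq_real, norm_smul, norm_inv, norm_norm, inv_mul_cancel₀ hn, hσ, inner_smul_left]
    simp; ring
  have hm2pos : ∀ y ∈ O, 0 < ‖m y‖ ^ 2 := fun y hy => by
    rw [hm2 y hy]
    have : 0 < ‖y‖⁻¹ * inner ℝ y (σ : Vel d) :=
      mul_pos (inv_pos.2 (norm_pos_iff.2 (hy0 y hy))) hy
    linarith
  have hmn : ∀ y ∈ O, ‖m y‖ ≠ 0 := fun y hy h => by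
    have := hm2pos y hy; rw [h] at this; simp at this
  have hunit : ∀ y ∈ O, ‖‖m y‖⁻¹ • m y‖ = 1 := fun y hy => by
    rw [norm_smul, norm_inv, norm_norm, inv_mul_cancel₀ (hmn y hy)]
  have hUrefl : ∀ y ∈ O, ∀ x, U y x = axisIso (‖m y‖⁻¹ • m y) x := fun y hy x => by
    rw [axisIso_apply (hunit y hy), axisRefl, inner_smul_left, smul_smul]
    simp only [hU]
    congr 2
    have := hmn y hy
    simp; field_simp
  have hUσ : ∀ y ∈ O, U y σ = ‖y‖⁻¹ • y := fun y hy => by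
    have h1 : inner ℝ (m y) (σ : Vel d) = ‖y‖⁻¹ * inner ℝ y (σ : Vel d) + 1 := by
      simp only [hm, inner_add_left, inner_smul_left, real_inner_self_eq_norm_sq, hσ]; simp
    have h2 : 2 * inner ℝ (m y) (σ : Vel d) / ‖m y‖ ^ 2 = 1 := by
      rw [div_eq_one_iff_eq (hm2pos y hy).ne', h1, hm2 y hy]; ring
    simp only [hU, h2, one_smul]
    simp only [hm]; abel
  set H : Vel d × Vel d → ℝ := fun q => g (U q.1 q.2) with hH
  have hHs : ∀ p ∈ O, ∀ x, ContDiffAt ℝ (⊤ : ℕ∞) H (p, x) := fun p hp x => by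
    have hm' : ContDiffAt ℝ (⊤ : ℕ∞) (fun q : Vel d × Vel d => m q.1) (p, x) := by
      have h1 : ContDiffAt ℝ (⊤ : ℕ∞) (fun q : Vel d × Vel d => ‖q.1‖) (p, x) :=
        contDiffAt_fst.norm ℝ (hy0 p hp)
      exact ((h1.inv (norm_ne_zero_iff.2 (hy0 p hp))).smul contDiffAt_fst).add contDiffAt_const
    have hUs : ContDiffAt ℝ (⊤ : ℕ∞) (fun q : Vel d × Vel d => U q.1 q.2) (p, x) :=
      (((contDiffAt_const.mul (hm'.inner ℝ contDiffAt_snd)).div (hm'.norm_sq ℝ)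
        (hm2pos p hp).ne').smul hm').sub contDiffAt_snd
    exact hg.smooth.contDiffAt.comp _ hUs
  have hHe : ∀ p x, H (p, -x) = H (p, x) := fun p x => by
    simp only [hH, hU]
    rw [← hg.even]; congr 1
    rw [inner_neg_right, mul_neg, neg_div, neg_smul]; abel
  obtain ⟨L, hL, hLv⟩ := hb.hasFDerivAt_integral_mirrorDiff hO hσO hHs hHe σ
  have hloc : radialExt (sphBoltzmann b g) =ᶠ[nhds (σ : Vel d)] fun p => ∫ σ' : Sph d,
      mirrorDiff (fun x => H (p, x)) σ σ' * b (inner ℝ (σ' : Vel d) (σ : Vel d)) ∂(surf d) := by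
    filter_upwards [hO.mem_nhds hσO] with y hy
    rw [radialExt, ← hUσ y hy, sphBoltzmann_eq, hUrefl y hy]
    rw [← integral_sphMap (axisIso (‖m y‖⁻¹ • m y))]
    congr 1; funext σ'
    simp only [sphMap_coe, LinearIsometryEquiv.inner_map_map, mirrorDiff, hH, hUrefl y hy,
      axisRefl_map]
  have hfd := hL.congr_of_eventuallyEq hloc
  refine ⟨hfd.differentiableAt, ?_⟩
  rw [hfd.fderiv, hLv, sphBoltzmann_eq]
  have hderiv : ∀ x, fderiv ℝ (fun p => H (p, x)) (σ : Vel d) e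
      = rotDeriv (σ : Vel d) e g (axisRefl (σ : Vel d) x) := by
    intro x
    have d1 : HasFDerivAt (fun p => H (p, x)) (fderiv ℝ (fun p => H (p, x)) (σ : Vel d))
        (greatCircle (σ : Vel d) e 0) := by
      have h1 : ContDiffAt ℝ (⊤ : ℕ∞) (fun p => H (p, x)) (σ : Vel d) :=
        ContDiffAt.comp (g := H) (σ : Vel d) (hHs σ hσO x) (contDiffAt_id.prodMk contDiffAt_const)
      have : greatCircle (σ : Vel d) e 0 = σ := by simp [greatCircle]
      rw [this]
      exact (h1.differentiableAt (by simp)).hasFDerivAt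
    have d2 := d1.comp_hasDerivAt (0 : ℝ) (hasDerivAt_greatCircle (σ : Vel d) e 0)
    have d3 : greatCircle e (-(σ : Vel d)) 0 = e := by simp [greatCircle]
    rw [d3] at d2
    have d4 : (fun p => H (p, x)) ∘ greatCircle (σ : Vel d) e
        =ᶠ[nhds 0] fun θ => g (rotFun (σ : Vel d) e θ (axisRefl (σ : Vel d) x)) := by
      have hcont : ContinuousAt Real.cos 0 := Real.continuous_cos.continuousAt
      have hpos : ∀ᶠ θ : ℝ in nhds 0, 0 < Real.cos θ :=
        hcont.eventually_const_lt (by rw [Real.cos_zero]; norm_num)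
      filter_upwards [hpos] with θ hθ
      have hθO : greatCircle (σ : Vel d) e θ ∈ O := by
        simp only [hOdef, mem_ofPred_eq, greatCircle, inner_add_left, inner_smul_left,
          real_inner_self_eq_norm_sq, hσ, real_inner_comm (σ : Vel d) e, hσe]
        simpa using hθ
      have hbis : ‖m (greatCircle (σ : Vel d) e θ)‖⁻¹ • m (greatCircle (σ : Vel d) e θ)
          = greatCircle (σ : Vel d) e (θ / 2) ∨
          ‖m (greatCircle (σ : Vel d) e θ)‖⁻¹ • m (greatCircle (σ : Vel d) e θ)
          = -greatCircle (σ : Vel d) e (θ / 2) := by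
        have q1 : m (greatCircle (σ : Vel d) e θ)
            = (2 * Real.cos (θ / 2)) • greatCircle (σ : Vel d) e (θ / 2) := by
          simp only [hm, norm_greatCircle hσ he hσe, inv_one, one_smul]
          have t1 : Real.cos θ = 2 * Real.cos (θ / 2) ^ 2 - 1 := by
            rw [← Real.cos_two_mul]; congr 1; ring
          have t2 : Real.sin θ = 2 * Real.sin (θ / 2) * Real.cos (θ / 2) := by
            rw [← Real.sin_two_mul]; congr 1; ring
          simp only [greatCircle, t1, t2]
          module
        have q2 := hmn _ hθO
        rw [q1] at q2 ⊢
        rw [norm_smul, norm_greatCircle hσ he hσe, mul_one, smul_smul, Real.norm_eq_abs] at *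
        rcases abs_cases (2 * Real.cos (θ / 2)) with ⟨h, -⟩ | ⟨h, -⟩
        · left; rw [h] at q2 ⊢; rw [inv_mul_cancel₀ q2, one_smul]
        · right
          rw [h] at q2 ⊢
          rw [← neg_one_smul ℝ (greatCircle _ _ _)]
          congr 1
          have q3 : Real.cos (θ / 2) ≠ 0 := fun h0 => q2 (by rw [h0]; simp)
          field_simp
      simp only [Function.comp, hH]
      congr 1
      rw [hUrefl _ hθO, axisIso_apply (hunit _ hθO), ← axisRefl_axisRefl hσ hσe]
      have hinv : axisRefl (σ : Vel d) (axisRefl (σ : Vel d) x) = x := by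
        rw [← axisIso_apply hσ, ← axisIso_apply hσ]
        exact Submodule.reflection_reflection _ _
      rw [hinv]
      rcases hbis with h | h
      · rw [h]
      · rw [h, axisRefl_neg_axis]
    have d5 := d2.congr_of_eventuallyEq d4.symm
    exact d5.unique (hasDerivAt_comp_rotFun hg.differentiable _ _ _)
  congr 1; funext σ'
  have hinv : ∀ x, axisRefl (σ : Vel d) (axisRefl (σ : Vel d) x) = x := fun x => by
    rw [← axisIso_apply hσ, ← axisIso_apply hσ]
    exact Submodule.reflection_reflection _ _
  have hfix : axisRefl (σ : Vel d) (σ : Vel d) = σ := by simp [axisRefl, hσ, two_smul]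
  simp only [mirrorDiff, hderiv, hinv, hfix]
  rw [add_comm (rotDeriv (σ : Vel d) e g (axisRefl (σ : Vel d) (σ' : Vel d)))]

/-! ### Rotational derivatives in coordinates -/

/-- The standard basis vectors. -/
def bvec (i : Fin d) : Vel d := EuclideanSpace.single i (1 : ℝ)

@[simp] theorem inner_bvec (i : Fin d) (x : Vel d) : (inner ℝ (bvec i) x : ℝ) = x i := by
  simp [bvec, EuclideanSpace.inner_single_left]

@[simp] theorem norm_bvec (i : Fin d) : ‖(bvec i : Vel d)‖ = 1 := by simp [bvec]

theorem bvec_apply (i j : Fin d) : (bvec i : Vel d) j = if j = i then 1 else 0 := by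
  simp [bvec]

theorem sum_smul_bvec (x : Vel d) : ∑ i, x i • bvec i = x := by
  ext k; simp [bvec_apply]

/-- The generator of the rotations in the plane of the `i`-th and `j`-th coordinates. -/
def rotVec (i j : Fin d) (x : Vel d) : Vel d := x i • bvec j - x j • bvec i

/-- The derivative along the rotations in the plane of the `i`-th and `j`-th coordinates. -/
def rotL (i j : Fin d) (φ : Vel d → ℝ) (x : Vel d) : ℝ := fderiv ℝ φ x (rotVec i j x)

theorem rotL_eq (i j : Fin d) (φ : Vel d → ℝ) : rotL i j φ = rotDeriv (bvec i) (bvec j) φ := by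
  funext x; simp [rotL, rotDeriv, rotVec]

theorem SmoothEven.rotL {φ : Vel d → ℝ} (h : SmoothEven φ) (i j : Fin d) :
    SmoothEven (rotL i j φ) := by
  rw [rotL_eq]; exact h.rotDeriv _ _

/-- The Laplacian of the sphere, extended to a rotation invariant operator on `ℝᵈ`. -/
def sphLap (φ : Vel d → ℝ) (x : Vel d) : ℝ := (1 / 2) * ∑ i, ∑ j, rotL i j (rotL i j φ) x

/-- The squared length of the spherical gradient, `½ ∑ (L_ij φ)²`. -/
def sphGamma (φ : Vel d → ℝ) (x : Vel d) : ℝ := (1 / 2) * ∑ i, ∑ j, rotL i j φ x ^ 2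

theorem SmoothEven.sphLap {φ : Vel d → ℝ} (h : SmoothEven φ) : SmoothEven (sphLap φ) :=
  (SmoothEven.sum fun i _ => SmoothEven.sum fun j _ => (h.rotL i j).rotL i j).const_mul _

theorem SmoothEven.sphGamma {φ : Vel d → ℝ} (h : SmoothEven φ) : SmoothEven (sphGamma φ) :=
  (SmoothEven.sum fun i _ => SmoothEven.sum fun j _ => (h.rotL i j).pow 2).const_mul _

theorem AngularKernel.dirForm_rotL {b : ℝ → ℝ} (hb : AngularKernel d b) {φ ψ : Vel d → ℝ}
    (hφ : SmoothEven φ) (hψ : SmoothEven ψ) (i j : Fin d) :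
    dirForm b (rotL i j φ) ψ = -dirForm b φ (rotL i j ψ) := by
  by_cases hij : i = j
  · subst hij
    have h : ∀ φ : Vel d → ℝ, rotL i i φ = fun _ => 0 := fun φ => by
      funext x; simp [rotL, rotVec]
    simp [h, dirForm, dirInt]
  · rw [rotL_eq, rotL_eq]
    refine hb.dirForm_rotDeriv hφ hψ (norm_bvec i) (norm_bvec j) ?_
    rw [inner_bvec, bvec_apply, if_neg hij]

theorem sum_inner_rotVec (w σ x : Vel d) :
    (1 / 2 : ℝ) • ∑ i, ∑ j, (inner ℝ w (rotVec i j σ) : ℝ) • rotVec i j x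
      = (inner ℝ σ x : ℝ) • w - (inner ℝ w x : ℝ) • σ := by
  have hw : ∀ i, (inner ℝ w (bvec i) : ℝ) = w i := fun i => by rw [real_inner_comm, inner_bvec]
  ext k
  simp only [rotVec, inner_sub_right, inner_smul_right, hw, PiLp.smul_apply, PiLp.sub_apply,
    smul_eq_mul, WithLp.ofLp_sum, Finset.sum_apply, bvec_apply, PiLp.inner_apply,
    RCLike.inner_apply, conj_trivial]
  have h1 : ∑ i, ∑ j, (σ i * w j - σ j * w i) * (x i * (if k = j then 1 else 0)
      - x j * (if k = i then 1 else 0))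
      = 2 * ∑ i, (σ i * w k - σ k * w i) * x i := by
    have e1 : ∀ i j, (σ i * w j - σ j * w i) * (x i * (if k = j then 1 else 0)
        - x j * (if k = i then 1 else 0))
        = (if k = j then (σ i * w j - σ j * w i) * x i else 0)
          - (if k = i then (σ i * w j - σ j * w i) * x j else 0) := fun i j => by
      split_ifs <;> ring
    simp only [e1, Finset.sum_sub_distrib]
    rw [Finset.sum_comm (f := fun i j => if k = i then (σ i * w j - σ j * w i) * x j else 0)]
    simp only [Finset.sum_ite_eq, Finset.mem_univ, if_true]
    rw [two_mul, sub_eq_add_neg, ← Finset.sum_neg_distrib]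
    congr 1
    refine Finset.sum_congr rfl fun i _ => by ring
  rw [h1, Finset.sum_mul, Finset.sum_mul, ← Finset.sum_sub_distrib]
  rw [← mul_assoc, show (1 / 2 : ℝ) * 2 = 1 by norm_num, one_mul]
  exact Finset.sum_congr rfl fun i _ => by ring

theorem rotL_eq_inner (i j : Fin d) (φ : Vel d → ℝ) (x : Vel d) :
    rotL i j φ x = inner ℝ (gradient φ x) (rotVec i j x) := by
  rw [rotL, inner_gradient_left]

theorem inner_sphGrad {φ : Vel d → ℝ} {σ : Vel d} (hσ : ‖σ‖ = 1) (h : DifferentiableAt ℝ φ σ) :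
    inner ℝ σ (sphGrad φ σ) = (0 : ℝ) := by
  rw [sphGrad_eq hσ h, inner_sub_right, inner_smul_right, real_inner_self_eq_norm_sq, hσ]; ring

theorem sphGrad_eq_sum {φ : Vel d → ℝ} {σ : Vel d} (hσ : ‖σ‖ = 1) (h : DifferentiableAt ℝ φ σ) :
    sphGrad φ σ = (1 / 2 : ℝ) • ∑ i, ∑ j, rotL i j φ σ • rotVec i j σ := by
  simp only [rotL_eq_inner]
  rw [sum_inner_rotVec, sphGrad_eq hσ h, real_inner_self_eq_norm_sq, hσ,
    real_inner_comm σ (gradient φ σ)]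
  simp

theorem gammaLaplace_eq {φ ψ : Vel d → ℝ} {σ : Vel d} (hσ : ‖σ‖ = 1)
    (hφ : DifferentiableAt ℝ φ σ) (hψ : DifferentiableAt ℝ ψ σ) :
    gammaLaplace φ ψ σ = (1 / 2) * ∑ i, ∑ j, rotL i j ψ σ * rotL i j φ σ := by
  have h0 := inner_sphGrad hσ hψ
  have h1 : gammaLaplace φ ψ σ = fderiv ℝ (radialExt φ) σ (sphGrad ψ σ) := by
    rw [gammaLaplace]; nth_rewrite 1 [sphGrad]; rw [inner_gradient_left]
  rw [h1, fderiv_radialExt hσ hφ, h0, zero_smul, sub_zero, sphGrad_eq_sum hσ hψ]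
  simp only [map_smul, map_sum, smul_eq_mul, rotL]

theorem gammaLaplace_self {φ : Vel d → ℝ} {σ : Vel d} (hσ : ‖σ‖ = 1)
    (hφ : DifferentiableAt ℝ φ σ) : gammaLaplace φ φ σ = sphGamma φ σ := by
  rw [gammaLaplace_eq hσ hφ hφ, sphGamma]
  simp only [sq]

theorem sphBoltzmann_const_mul (b : ℝ → ℝ) (c : ℝ) (φ : Vel d → ℝ) (σ : Vel d) :
    sphBoltzmann b (fun x => c * φ x) σ = c * sphBoltzmann b φ σ := by
  rw [sphBoltzmann, sphBoltzmann, ← integral_const_mul]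
  congr 1; funext σ'; ring

theorem rotL_log {F : Vel d → ℝ} (hF : SmoothEven F) (hpos : ∀ x, 0 < F x) (i j : Fin d) :
    rotL i j F = fun x => F x * rotL i j (fun x => Real.log (F x)) x := by
  funext x
  simp only [rotL]
  rw [((hF.differentiable x).hasFDerivAt.log (hpos x).ne').fderiv]
  have := (hpos x).ne'
  simp; field_simp

namespace AngularKernel

variable {b : ℝ → ℝ} (hb : AngularKernel d b)
include hb

theorem integrable_mirrorDiff {ψ : Vel d → ℝ} (hψ : SmoothEven ψ) (σ : Sph d) :
    Integrable (fun σ' : Sph d => mirrorDiff ψ σ σ' * b (inner ℝ (σ' : Vel d) (σ : Vel d)))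
      (surf d) := by
  obtain ⟨C, -, hC⟩ := hψ.exists_bound
  have hm : Measurable fun p : Sph d × Sph d => mirrorDiff ψ (p.1 : Vel d) p.2 *
      b (inner ℝ (p.2 : Vel d) (p.1 : Vel d)) :=
    (measurable_mirrorDiff hψ.continuous).mul hb.measurable_inner
  refine ((hb.integrable_levyWeight_right σ).const_mul (6 * 1 * C)).mono'
    (hm.comp (measurable_const.prodMk measurable_id) :
      Measurable fun σ' : Sph d => _).aestronglyMeasurable
    (Filter.Eventually.of_forall fun σ' => ?_)
  have := abs_mul_mirrorDiff_le (φ := fun _ => (1 : ℝ)) (C := 1) hψ (by simp)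
    (fun x hx => (hC x hx).2.1) (fun x hx => (hC x hx).2.2) (σ, σ') (hb.nonneg_inner σ' σ) le_rfl
  simpa using this

theorem sphBoltzmann_sum {ι : Type*} (s : Finset ι) {φ : ι → Vel d → ℝ}
    (hφ : ∀ i ∈ s, SmoothEven (φ i)) (σ : Sph d) :
    sphBoltzmann b (fun x => ∑ i ∈ s, φ i x) σ = ∑ i ∈ s, sphBoltzmann b (φ i) σ := by
  simp only [sphBoltzmann_eq]
  rw [← integral_finsetSum _ fun i hi => hb.integrable_mirrorDiff (hφ i hi) σ]
  congr 1; funext σ'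
  simp only [mirrorDiff, smul_eq_mul, ← Finset.sum_mul, Finset.sum_sub_distrib,
    ← Finset.mul_sum, Finset.sum_add_distrib]

/-- The spherical Boltzmann operator commutes with rotations, hence with their generators. -/
theorem fderiv_radialExt_sphBoltzmann_orthogonal {g : Vel d → ℝ} (hg : SmoothEven g) (σ : Sph d)
    {τ : Vel d} (hτ : inner ℝ (σ : Vel d) τ = (0 : ℝ)) :
    fderiv ℝ (radialExt (sphBoltzmann b g)) σ τ = sphBoltzmann b (rotDeriv σ τ g) σ := by
  by_cases h0 : τ = 0
  · subst h0
    have : rotDeriv (σ : Vel d) 0 g = fun _ => 0 := by funext x; simp [rotDeriv]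
    simp [this, sphBoltzmann]
  · have hn : ‖τ‖ ≠ 0 := norm_ne_zero_iff.2 h0
    have h1 := (fderiv_radialExt_sphBoltzmann hb hg σ (e := ‖τ‖⁻¹ • τ)
      (by rw [norm_smul, norm_inv, norm_norm, inv_mul_cancel₀ hn])
      (by rw [inner_smul_right, hτ, mul_zero])).2
    have h2 : rotDeriv (σ : Vel d) τ g = fun x => ‖τ‖ * rotDeriv (σ : Vel d) (‖τ‖⁻¹ • τ) g x := by
      funext x
      simp only [rotDeriv]
      rw [← smul_eq_mul, ← map_smul]
      congr 1
      rw [inner_smul_left, smul_sub, smul_smul, smul_smul, smul_smul]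
      simp only [conj_trivial]
      congr 2
      · field_simp
      · field_simp
    rw [h2, sphBoltzmann_const_mul, ← h1, map_smul, smul_eq_mul, ← mul_assoc, mul_inv_cancel₀ hn,
      one_mul]

theorem gammaLaplace_sphBoltzmann {φ ψ : Vel d → ℝ} (hφ : SmoothEven φ)
    (hψ : SmoothEven ψ) (σ : Sph d) :
    gammaLaplace (sphBoltzmann b φ) ψ σ
      = (1 / 2) * ∑ i, ∑ j, rotL i j ψ σ * sphBoltzmann b (rotL i j φ) σ := by
  have hσ := σ.norm_eq
  have hd := hψ.differentiable (σ : Vel d)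
  have h1 : gammaLaplace (sphBoltzmann b φ) ψ σ
      = fderiv ℝ (radialExt (sphBoltzmann b φ)) σ (sphGrad ψ σ) := by
    rw [gammaLaplace]; nth_rewrite 1 [sphGrad]; rw [inner_gradient_left]
  rw [h1, hb.fderiv_radialExt_sphBoltzmann_orthogonal hφ σ (inner_sphGrad hσ hd)]
  have h2 : rotDeriv (σ : Vel d) (sphGrad ψ σ) φ
      = fun x => (1 / 2) * ∑ i, ∑ j, rotL i j ψ σ * rotL i j φ x := by
    funext x
    have h3 : (inner ℝ (σ : Vel d) x : ℝ) • sphGrad ψ σ - (inner ℝ (sphGrad ψ σ) x : ℝ) • (σ : Vel d)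
        = (1 / 2 : ℝ) • ∑ i, ∑ j, rotL i j ψ σ • rotVec i j x := by
      simp only [rotL_eq_inner]
      rw [sum_inner_rotVec, sphGrad_eq hσ hd, inner_sub_left, inner_smul_left]
      simp only [conj_trivial]
      module
    rw [rotDeriv, h3]
    simp only [map_smul, map_sum, smul_eq_mul, rotL]
  rw [h2, sphBoltzmann_const_mul, hb.sphBoltzmann_sum _ fun i _ => SmoothEven.sum fun j _ =>
    (hφ.rotL i j).const_mul _]
  congr 1
  refine Finset.sum_congr rfl fun i _ => ?_
  rw [hb.sphBoltzmann_sum _ fun j _ => (hφ.rotL i j).const_mul _]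
  exact Finset.sum_congr rfl fun j _ => sphBoltzmann_const_mul _ _ _ _

theorem gammaTwo_eq {g : Vel d → ℝ} (hg : SmoothEven g) (σ : Sph d) :
    gammaTwo b g g σ = (1 / 2) * sphBoltzmann b (sphGamma g) σ
      - (1 / 2) * ∑ i, ∑ j, rotL i j g σ * sphBoltzmann b (rotL i j g) σ := by
  have h1 : sphBoltzmann b (gammaLaplace g g) σ = sphBoltzmann b (sphGamma g) σ := by
    simp only [sphBoltzmann]
    congr 1; funext (σ' : Sph d)
    rw [gammaLaplace_self σ.norm_eq (hg.differentiable _),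
      gammaLaplace_self σ'.norm_eq (hg.differentiable _),
      gammaLaplace_self (by rw [norm_axisRefl σ.norm_eq, σ'.norm_eq]) (hg.differentiable _)]
  have h2 : gammaLaplace g (sphBoltzmann b g) σ = gammaLaplace (sphBoltzmann b g) g σ := by
    rw [gammaLaplace, gammaLaplace, real_inner_comm]
  rw [gammaTwo, h1, h2, hb.gammaLaplace_sphBoltzmann hg hg]
  ring

theorem integral_gammaTwo_mul {g F : Vel d → ℝ} (hg : SmoothEven g) (hF : SmoothEven F) :
    ∫ σ : Sph d, gammaTwo b g g σ * F σ ∂(surf d)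
      = -(1 / 2) * dirForm b F (sphGamma g)
        + (1 / 2) * ∑ i, ∑ j, dirForm b (fun x => F x * rotL i j g x) (rotL i j g) := by
  have i1 := hb.integral_mul_sphBoltzmann hF hg.sphGamma
  have i2 := fun i j => hb.integral_mul_sphBoltzmann (hF.mul (hg.rotL i j)) (hg.rotL i j)
  have e : ∀ σ : Sph d, gammaTwo b g g σ * F σ = (1 / 2) * (F σ * sphBoltzmann b (sphGamma g) σ)
      - (1 / 2) * ∑ i, ∑ j, (F σ * rotL i j g σ) * sphBoltzmann b (rotL i j g) σ := fun σ => by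
    rw [hb.gammaTwo_eq hg, sub_mul, mul_assoc, mul_assoc, Finset.sum_mul]
    simp only [Finset.sum_mul]
    congr 1
    · ring
    · congr 1
      exact Finset.sum_congr rfl fun i _ => Finset.sum_congr rfl fun j _ => by ring
  simp only [e]
  have i3 : Integrable (fun σ : Sph d => ∑ i, ∑ j, (F σ * rotL i j g σ) *
      sphBoltzmann b (rotL i j g) σ) (surf d) :=
    integrable_finsetSum _ fun i _ => integrable_finsetSum _ fun j _ => (i2 i j).1
  rw [integral_sub (i1.1.const_mul _) (i3.const_mul _), integral_const_mul, integral_const_mul,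
    i1.2, integral_finsetSum _ fun i _ => integrable_finsetSum _ fun j _ => (i2 i j).1]
  simp only [integral_finsetSum _ fun j _ => (i2 _ j).1, (i2 _ _).2, Finset.sum_neg_distrib]
  ring

/-- The dissipation of the spherical Fisher information by the spherical Boltzmann operator is the
integral of `Γ²`. -/
theorem dirForm_sphLap_log {F : Vel d → ℝ} (hF : SmoothEven F) (hpos : ∀ x, 0 < F x) :
    2 * dirForm b (sphLap fun x => Real.log (F x)) F
        + dirForm b (sphGamma fun x => Real.log (F x)) F
      = -2 * ∫ σ : Sph d, gammaTwo b (fun x => Real.log (F x)) (fun x => Real.log (F x)) σ * F σ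
        ∂(surf d) := by
  have hg := hF.log hpos
  set g := fun x => Real.log (F x)
  have h1 : dirForm b (sphLap g) F = (1 / 2) * ∑ i, ∑ j, dirForm b (rotL i j (rotL i j g)) F := by
    unfold sphLap
    rw [dirForm_const_mul_left, hb.dirForm_sum_left _ (fun i _ => SmoothEven.sum fun j _ =>
      (hg.rotL i j).rotL i j) hF]
    congr 1
    exact Finset.sum_congr rfl fun i _ => hb.dirForm_sum_left _ (fun j _ =>
      (hg.rotL i j).rotL i j) hF
  have h2 : ∀ i j, dirForm b (rotL i j (rotL i j g)) F
      = -dirForm b (fun x => F x * rotL i j g x) (rotL i j g) := fun i j => by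
    rw [hb.dirForm_rotL (hg.rotL i j) hF, rotL_log hF hpos, dirForm_comm]
  rw [hb.integral_gammaTwo_mul hg hF, h1]
  simp only [h2, Finset.sum_neg_distrib]
  rw [dirForm_comm b (sphGamma g) F]
  ring

/-- The elementary identity behind the contraction of Fisher information by jump processes. -/
theorem dirForm_mul_identity {F u : Vel d → ℝ} (hF : SmoothEven F) (hu : SmoothEven u) :
    Integrable (fun p : Sph d × Sph d => (F p.2 + F p.1) * (u p.2 - u p.1) ^ 2
      * b (inner ℝ (p.2 : Vel d) (p.1 : Vel d))) ((surf d).prod (surf d)) ∧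
    -2 * dirForm b u (fun x => F x * u x) + dirForm b (fun x => u x ^ 2) F
      = -(1 / 2) * ∫ p : Sph d × Sph d, (F p.2 + F p.1) * (u p.2 - u p.1) ^ 2
        * b (inner ℝ (p.2 : Vel d) (p.1 : Vel d)) ∂((surf d).prod (surf d)) := by
  have i1 := hb.integrable_dirInt hu (hF.mul hu)
  have i2 := hb.integrable_dirInt (hu.pow 2) hF
  have e : (fun p : Sph d × Sph d => (F p.2 + F p.1) * (u p.2 - u p.1) ^ 2
      * b (inner ℝ (p.2 : Vel d) (p.1 : Vel d)))
      = fun p => 2 * dirInt b u (fun x => F x * u x) p - dirInt b (fun x => u x ^ 2) F p := by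
    funext p; simp only [dirInt]; ring
  rw [e]
  refine ⟨(i1.const_mul 2).sub i2, ?_⟩
  rw [integral_sub (i1.const_mul 2) i2, integral_const_mul, dirForm, dirForm]
  ring

end AngularKernel

/-! ### Products of two linear forms -/

/-- The quadratic form `x ↦ ⟨a, x⟩ ⟨e, x⟩`, for orthogonal `a` and `e` a spherical harmonic of
degree two. -/
def prodForm (a e : Vel d) (x : Vel d) : ℝ := inner ℝ a x * inner ℝ e x

theorem SmoothEven.prodForm (a e : Vel d) : SmoothEven (prodForm a e) :=
  ⟨(contDiff_const.inner ℝ contDiff_id).mul (contDiff_const.inner ℝ contDiff_id),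
    fun x => by simp [Boltzmann.prodForm]⟩

theorem hasFDerivAt_prodForm (a e x : Vel d) :
    HasFDerivAt (prodForm a e)
      ((inner ℝ a x : ℝ) • innerSL ℝ e + (inner ℝ e x : ℝ) • innerSL ℝ a) x :=
  ((innerSL ℝ a).hasFDerivAt (x := x)).mul ((innerSL ℝ e).hasFDerivAt (x := x))

theorem inner_rotVec_right (i j : Fin d) (a x : Vel d) :
    (inner ℝ a (rotVec i j x) : ℝ) = -inner ℝ (rotVec i j a) x := by
  have h : ∀ i, (inner ℝ a (bvec i) : ℝ) = a i := fun i => by rw [real_inner_comm, inner_bvec]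
  simp only [rotVec, inner_sub_right, inner_sub_left, inner_smul_right, inner_smul_left, h,
    inner_bvec, conj_trivial]
  ring

theorem rotL_prodForm (i j : Fin d) (a e : Vel d) :
    rotL i j (prodForm a e)
      = fun x => -(prodForm (rotVec i j a) e x + prodForm a (rotVec i j e) x) := by
  funext x
  rw [rotL, (hasFDerivAt_prodForm a e x).fderiv]
  simp [prodForm, inner_rotVec_right]
  ring

theorem rotL_rotL_prodForm (i j : Fin d) (a e x : Vel d) :
    rotL i j (rotL i j (prodForm a e)) x
      = -inner ℝ (rotVec i j a) (rotVec i j x) * inner ℝ e x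
        - inner ℝ a x * inner ℝ (rotVec i j e) (rotVec i j x)
        + 2 * (inner ℝ a (rotVec i j x) * inner ℝ (rotVec i j x) e) := by
  rw [rotL_prodForm, rotL,
    ((hasFDerivAt_prodForm _ _ x).fun_add (hasFDerivAt_prodForm _ _ x)).fun_neg.fderiv]
  simp only [add_apply, smul_apply, innerSL_apply_apply, smul_eq_mul, neg_apply, inner_rotVec_right i j a,
    inner_rotVec_right i j e, real_inner_comm e (rotVec i j x)]
  ring

theorem sum_inner_rotVec_rotVec (a x : Vel d) :
    ∑ i, ∑ j, (inner ℝ (rotVec i j a) (rotVec i j x) : ℝ) = 2 * ((d : ℝ) - 1) * inner ℝ a x := by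
  have h0 : ∀ (a : Vel d) i, (inner ℝ a (bvec i) : ℝ) = a i := fun a i => by
    rw [real_inner_comm, inner_bvec]
  have h : ∀ i j : Fin d, (inner ℝ (rotVec i j a) (rotVec i j x) : ℝ)
      = a i * x i + a j * x j - (if i = j then a i * x j + a j * x i else 0) := fun i j => by
    simp only [rotVec, inner_sub_right, inner_smul_right, h0]
    by_cases hij : i = j
    · subst hij; simp
    · simp [bvec_apply, hij, Ne.symm hij]; ring
  have hi : (inner ℝ a x : ℝ) = ∑ i, a i * x i := by
    simp [PiLp.inner_apply, mul_comm]
  simp only [h, Finset.sum_sub_distrib, Finset.sum_add_distrib, Finset.sum_ite_eq,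
    Finset.mem_univ, if_true, Finset.sum_const, Finset.card_univ, Fintype.card_fin, nsmul_eq_mul,
    hi, ← Finset.mul_sum]
  ring

/-- The product of two orthogonal linear forms is an eigenfunction of the Laplacian of the sphere. -/
theorem sphLap_prodForm {a e : Vel d} (hae : inner ℝ a e = (0 : ℝ)) (x : Vel d) :
    sphLap (prodForm a e) x = -(2 * d) * prodForm a e x := by
  have h1 : ∑ i, ∑ j, (inner ℝ a (rotVec i j x) * inner ℝ (rotVec i j x) e : ℝ)
      = -2 * (inner ℝ a x * inner ℝ e x) := by
    have h := congrArg (fun y => (inner ℝ y e : ℝ)) (sum_inner_rotVec a x x)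
    simp only [inner_smul_left, sum_inner, inner_sub_left, conj_trivial, hae] at h
    rw [real_inner_comm e x] at h
    linarith
  rw [sphLap]
  simp only [rotL_rotL_prodForm, Finset.sum_add_distrib, Finset.sum_sub_distrib, ← Finset.mul_sum,
    ← Finset.sum_mul, Finset.sum_neg_distrib, h1, sum_inner_rotVec_rotVec]
  rw [prodForm]; ring

theorem exists_isometry_map_pair {a e a' e' : Vel d} (ha : ‖a‖ = 1) (he : ‖e‖ = 1)
    (hae : inner ℝ a e = (0 : ℝ)) (ha' : ‖a'‖ = 1) (he' : ‖e'‖ = 1)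
    (hae' : inner ℝ a' e' = (0 : ℝ)) :
    ∃ R : Vel d ≃ₗᵢ[ℝ] Vel d, R a = a' ∧ R e = e' := by
  obtain ⟨R, hR⟩ := exists_isometry_map_eq (ha.trans ha'.symm)
  have h1 : ‖R e‖ = ‖e'‖ := by rw [R.norm_map, he, he']
  refine ⟨R.trans (Submodule.span ℝ {R e - e'})ᗮ.reflection, ?_, ?_⟩
  · rw [LinearIsometryEquiv.trans_apply, hR]
    refine Submodule.reflection_mem_subspace_eq_self ?_
    rw [Submodule.mem_orthogonal_singleton_iff_inner_right, inner_sub_left, ← hR, R.inner_map_map,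
      real_inner_comm, hae, hR, real_inner_comm, hae', sub_zero]
  · rw [LinearIsometryEquiv.trans_apply]; exact Submodule.reflection_sub h1

theorem dirForm_prodForm_eq (b : ℝ → ℝ) {a e a' e' : Vel d} (ha : ‖a‖ = 1) (he : ‖e‖ = 1)
    (hae : inner ℝ a e = (0 : ℝ)) (ha' : ‖a'‖ = 1) (he' : ‖e'‖ = 1)
    (hae' : inner ℝ a' e' = (0 : ℝ)) :
    dirForm b (prodForm a' e') (prodForm a' e') = dirForm b (prodForm a e) (prodForm a e) := by
  obtain ⟨R, rfl, rfl⟩ := exists_isometry_map_pair ha he hae ha' he' hae'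
  rw [← dirForm_comp_iso b _ _ R]
  simp only [prodForm, R.inner_map_map]
  rfl

namespace AngularKernel

variable {b : ℝ → ℝ} (hb : AngularKernel d b)
include hb

theorem dirInt_self_nonneg (φ : Vel d → ℝ) (p : Sph d × Sph d) : 0 ≤ dirInt b φ φ p := by
  have := hb.nonneg_inner p.2 p.1
  rw [dirInt, ← sq]; positivity

theorem dirForm_self_nonneg (φ : Vel d → ℝ) : 0 ≤ dirForm b φ φ :=
  mul_nonneg (by norm_num) (integral_nonneg (hb.dirInt_self_nonneg φ))

theorem sub_sq_mul_ae_eq_zero {φ : Vel d → ℝ} (hφ : SmoothEven φ) (h : dirForm b φ φ = 0) :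
    ∀ᵐ p : Sph d × Sph d ∂((surf d).prod (surf d)),
      b (inner ℝ (p.2 : Vel d) (p.1 : Vel d)) = 0 ∨ φ p.2 = φ p.1 := by
  have h1 : ∫ p, dirInt b φ φ p ∂((surf d).prod (surf d)) = 0 := by
    rw [dirForm] at h; linarith
  have h2 := (integral_eq_zero_iff_of_nonneg (hb.dirInt_self_nonneg φ)
    (hb.integrable_dirInt hφ hφ)).1 h1
  filter_upwards [h2] with p hp
  simp only [dirInt, Pi.zero_apply, mul_eq_zero, or_self, sub_eq_zero] at hp
  tauto

/-- If the Dirichlet form of `b` vanishes on a single harmonic of degree two, then it vanishes. -/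
theorem levyWeight_ae_eq_zero {a e : Vel d} (ha : ‖a‖ = 1)
    (he : ‖e‖ = 1) (hae : inner ℝ a e = (0 : ℝ))
    (h : dirForm b (prodForm a e) (prodForm a e) = 0) :
    ∀ᵐ p : Sph d × Sph d ∂((surf d).prod (surf d)), levyWeight b p = 0 := by
  have hall : ∀ a' e' : Vel d, ‖a'‖ = 1 → ‖e'‖ = 1 → inner ℝ a' e' = (0 : ℝ) →
      ∀ᵐ p : Sph d × Sph d ∂((surf d).prod (surf d)),
        b (inner ℝ (p.2 : Vel d) (p.1 : Vel d)) = 0 ∨ prodForm a' e' p.2 = prodForm a' e' p.1 :=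
    fun a' e' ha' he' hae' => hb.sub_sq_mul_ae_eq_zero (SmoothEven.prodForm a' e')
      (by rw [dirForm_prodForm_eq b ha he hae ha' he' hae', h])
  have hbv : ∀ i j : Fin d, i ≠ j → inner ℝ (bvec i : Vel d) (bvec j) = (0 : ℝ) := fun i j hij => by
    rw [inner_bvec, bvec_apply, if_neg hij]
  have hbv1 : ∀ i : Fin d, inner ℝ (bvec i : Vel d) (bvec i) = (1 : ℝ) := fun i => by
    rw [inner_bvec, bvec_apply, if_pos rfl]
  -- off-diagonal entries of `σ ⊗ σ`
  have h1 : ∀ᵐ p : Sph d × Sph d ∂((surf d).prod (surf d)), ∀ i j : Fin d, i ≠ j →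
      b (inner ℝ (p.2 : Vel d) (p.1 : Vel d)) = 0 ∨
        (p.2 : Vel d) i * (p.2 : Vel d) j = (p.1 : Vel d) i * (p.1 : Vel d) j := by
    refine ae_all_iff.2 fun i => ae_all_iff.2 fun j => ?_
    by_cases hij : i = j
    · simp [hij]
    filter_upwards [hall (bvec i) (bvec j) (norm_bvec i) (norm_bvec j) (hbv i j hij)] with p hp _
    simpa only [prodForm, inner_bvec] using hp
  -- differences of diagonal entries of `σ ⊗ σ`
  have h2 : ∀ᵐ p : Sph d × Sph d ∂((surf d).prod (surf d)), ∀ i j : Fin d, i ≠ j →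
      b (inner ℝ (p.2 : Vel d) (p.1 : Vel d)) = 0 ∨
        (p.2 : Vel d) i ^ 2 - (p.2 : Vel d) j ^ 2 = (p.1 : Vel d) i ^ 2 - (p.1 : Vel d) j ^ 2 := by
    refine ae_all_iff.2 fun i => ae_all_iff.2 fun j => ?_
    by_cases hij : i = j
    · simp [hij]
    have hs : (Real.sqrt 2)⁻¹ * (Real.sqrt 2)⁻¹ = 1 / 2 := by
      rw [← mul_inv, Real.mul_self_sqrt (by norm_num)]; norm_num
    have hji := hbv j i (Ne.symm hij)
    have hn : ∀ c : ℝ, c ^ 2 = 1 → ‖(Real.sqrt 2)⁻¹ • (bvec i + c • bvec j : Vel d)‖ = 1 := by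
      intro c hc
      rw [← sq_eq_sq₀ (norm_nonneg _) zero_le_one, ← real_inner_self_eq_norm_sq]
      simp only [inner_smul_left, inner_smul_right, inner_add_left, inner_add_right, hbv1,
        hbv i j hij, hji, conj_trivial]
      linear_combination (1 + c ^ 2) * hs + hc / 2
    have ho : inner ℝ ((Real.sqrt 2)⁻¹ • (bvec i + (1 : ℝ) • bvec j : Vel d))
        ((Real.sqrt 2)⁻¹ • (bvec i + (-1 : ℝ) • bvec j : Vel d)) = (0 : ℝ) := by
      simp only [inner_smul_left, inner_smul_right, inner_add_left, inner_add_right, hbv1,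
        hbv i j hij, hji, conj_trivial]
      ring
    filter_upwards [hall _ _ (hn 1 (by norm_num)) (hn (-1) (by norm_num)) ho] with p hp _
    refine hp.imp_right fun hp => ?_
    simp only [prodForm, inner_smul_left, inner_add_left, inner_bvec, conj_trivial] at hp
    have e : ∀ x y : ℝ, (Real.sqrt 2)⁻¹ * (x + 1 * y) * ((Real.sqrt 2)⁻¹ * (x + -1 * y))
        = (1 / 2) * (x ^ 2 - y ^ 2) := fun x y => by rw [← hs]; ring
    rw [e, e] at hp
    linarith
  filter_upwards [h1, h2] with p hp1 hp2
  rw [levyWeight]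
  by_cases h0 : b (inner ℝ (p.2 : Vel d) (p.1 : Vel d)) = 0
  · rw [h0, mul_zero]
  simp only [h0, false_or] at hp1 hp2
  have hsq : ∀ σ : Sph d, ∑ i, (σ : Vel d) i ^ 2 = 1 := fun σ => by
    rw [← EuclideanSpace.real_norm_sq_eq, σ.norm_eq, one_pow]
  have hdiag : ∀ i, (p.2 : Vel d) i ^ 2 = (p.1 : Vel d) i ^ 2 := by
    intro i
    have hc : ∀ j, (p.2 : Vel d) j ^ 2 - (p.1 : Vel d) j ^ 2
        = (p.2 : Vel d) i ^ 2 - (p.1 : Vel d) i ^ 2 := fun j => by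
      by_cases hij : i = j
      · rw [hij]
      · linarith [hp2 i j hij]
    have hsum : ∑ j, ((p.2 : Vel d) j ^ 2 - (p.1 : Vel d) j ^ 2) = 0 := by
      rw [Finset.sum_sub_distrib, hsq, hsq, sub_self]
    simp only [hc, Finset.sum_const, Finset.card_univ, Fintype.card_fin, nsmul_eq_mul] at hsum
    rcases mul_eq_zero.1 hsum with h | h
    · have : d = 0 := by exact_mod_cast h
      subst this; exact i.elim0
    · linarith
  have hij : ∀ i j, (p.2 : Vel d) i * (p.2 : Vel d) j = (p.1 : Vel d) i * (p.1 : Vel d) j := by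
    intro i j
    by_cases hij : i = j
    · subst hij; rw [← sq, ← sq, hdiag]
    · exact hp1 i j hij
  have hc : (inner ℝ (p.1 : Vel d) (p.2 : Vel d) : ℝ) ^ 2 = 1 := by
    have e1 : ∀ σ σ' : Sph d, (inner ℝ (σ : Vel d) (σ' : Vel d) : ℝ)
        = ∑ i, (σ : Vel d) i * (σ' : Vel d) i := fun σ σ' => by
      simp [PiLp.inner_apply, mul_comm]
    have e2 : ∀ σ σ' : Sph d, (inner ℝ (σ : Vel d) (σ' : Vel d) : ℝ) ^ 2
        = ∑ i, ∑ j, ((σ : Vel d) i * (σ : Vel d) j) * ((σ' : Vel d) i * (σ' : Vel d) j) := by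
      intro σ σ'
      rw [sq, e1, Finset.sum_mul_sum]
      exact Finset.sum_congr rfl fun i _ => Finset.sum_congr rfl fun j _ => by ring
    rw [e2]
    simp only [hij]
    rw [← e2, real_inner_self_eq_norm_sq, p.1.norm_eq]
    norm_num
  rw [hc]; ring

end AngularKernel

/-! ### The constant of the inequality of log-Sobolev type -/

theorem SmoothEven.smoothOnSphere {F : Vel d → ℝ} (hF : SmoothEven F) : SmoothOnSphere F := by
  intro x hx
  have hx : x ≠ 0 := hx
  have h : ContDiffAt ℝ (⊤ : ℕ∞) (fun x : Vel d => ‖x‖⁻¹ • x) x :=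
    ((contDiffAt_norm ℝ hx).inv (norm_ne_zero_iff.2 hx)).smul contDiffAt_id
  exact (hF.smooth.contDiffAt.comp x h).contDiffWithinAt

/-- The right-hand side `∬ (F' - F)² / (F' + F) b` of the inequality of log-Sobolev type. -/
def jumpFisher (b : ℝ → ℝ) (F : Vel d → ℝ) : ℝ :=
  ∫ p : Sph d × Sph d, (F p.2 - F p.1) ^ 2 / (F p.2 + F p.1)
    * b (inner ℝ (p.2 : Vel d) (p.1 : Vel d)) ∂((surf d).prod (surf d))

namespace AngularKernel

variable {b : ℝ → ℝ} (hb : AngularKernel d b)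
include hb

theorem integrable_jumpFisher {F : Vel d → ℝ} (hF : SmoothEven F) (hpos : ∀ x, 0 < F x) :
    Integrable (fun p : Sph d × Sph d => (F p.2 - F p.1) ^ 2 / (F p.2 + F p.1)
      * b (inner ℝ (p.2 : Vel d) (p.1 : Vel d))) ((surf d).prod (surf d)) := by
  obtain ⟨K, hK⟩ := (isCompact_sphere (0 : Vel d) 1).exists_bound_of_continuousOn
    (f := fun x => (F x)⁻¹) (hF.continuous.inv₀ fun x => (hpos x).ne').continuousOn
  have hm1 : Measurable fun p : Sph d × Sph d => F p.1 :=
    (hF.continuous.comp (continuous_subtype_val.comp continuous_fst)).measurable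
  have hm2 : Measurable fun p : Sph d × Sph d => F p.2 :=
    (hF.continuous.comp (continuous_subtype_val.comp continuous_snd)).measurable
  refine ((hb.integrable_dirInt hF hF).const_mul K).mono'
    (((((hm2.sub hm1).pow_const 2).div (hm2.add hm1)).mul hb.measurable_inner)).aestronglyMeasurable
    (Filter.Eventually.of_forall fun p => ?_)
  have h1 := hpos p.1
  have h2 := hpos p.2
  have h3 := hb.nonneg_inner p.2 p.1
  have h4 : (F p.1)⁻¹ ≤ K := by
    have := hK p.1 p.1.2
    rwa [Real.norm_of_nonneg (by positivity)] at this
  have h5 : (F p.2 + F p.1)⁻¹ ≤ K := le_trans (by gcongr; linarith) h4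
  rw [Real.norm_of_nonneg (by positivity), dirInt]
  calc (F p.2 - F p.1) ^ 2 / (F p.2 + F p.1) * b (inner ℝ (p.2 : Vel d) (p.1 : Vel d))
      = (F p.2 + F p.1)⁻¹ * ((F p.2 - F p.1) ^ 2 * b (inner ℝ (p.2 : Vel d) (p.1 : Vel d))) := by
        rw [div_eq_inv_mul]; ring
    _ ≤ K * ((F p.2 - F p.1) ^ 2 * b (inner ℝ (p.2 : Vel d) (p.1 : Vel d))) := by gcongr
    _ = _ := by ring

theorem jumpFisher_nonneg {F : Vel d → ℝ} (hpos : ∀ x, 0 < F x) : 0 ≤ jumpFisher b F := by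
  refine integral_nonneg fun p => ?_
  have h1 := hpos p.1
  have h2 := hpos p.2
  have h3 := hb.nonneg_inner p.2 p.1
  positivity

theorem mul_jumpFisher_le {L : ℝ≥0} (hL : LogSobolev d b L) {F : Vel d → ℝ} (hF : SmoothEven F)
    (hpos : ∀ x, 0 < F x) :
    (L : ℝ) * jumpFisher b F ≤ ∫ σ : Sph d,
      gammaTwo b (fun x => Real.log (F x)) (fun x => Real.log (F x)) σ * F σ ∂(surf d) := by
  have := hL F hF.smoothOnSphere (fun σ _ => hpos σ) (fun σ _ => hF.even σ)
  rw [jumpFisher, integral_prod _ (hb.integrable_jumpFisher hF hpos)]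
  exact this

/-- The flow of a jump process contracts the Fisher information `∫ u² F`, `u` a logarithmic
derivative of `F`. -/
theorem dirForm_mul_nonpos {F u : Vel d → ℝ} (hF : SmoothEven F) (hpos : ∀ x, 0 < F x)
    (hu : SmoothEven u) :
    -2 * dirForm b u (fun x => F x * u x) + dirForm b (fun x => u x ^ 2) F ≤ 0 := by
  rw [(hb.dirForm_mul_identity hF hu).2]
  have : 0 ≤ ∫ p : Sph d × Sph d, (F p.2 + F p.1) * (u p.2 - u p.1) ^ 2
        * b (inner ℝ (p.2 : Vel d) (p.1 : Vel d)) ∂((surf d).prod (surf d)) := by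
    refine integral_nonneg fun p => ?_
    have h1 := hpos p.1
    have h2 := hpos p.2
    have h3 := hb.nonneg_inner p.2 p.1
    positivity
  linarith

theorem integral_gammaTwo_log_nonneg {F : Vel d → ℝ} (hF : SmoothEven F) (hpos : ∀ x, 0 < F x) :
    0 ≤ ∫ σ : Sph d,
      gammaTwo b (fun x => Real.log (F x)) (fun x => Real.log (F x)) σ * F σ ∂(surf d) := by
  have hg := hF.log hpos
  have h0 := hb.dirForm_sphLap_log hF hpos
  set g := fun x => Real.log (F x)
  have e1 : dirForm b (sphLap g) F = (1 / 2) * ∑ i, ∑ j, dirForm b (rotL i j (rotL i j g)) F := by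
    unfold sphLap
    rw [dirForm_const_mul_left, hb.dirForm_sum_left _ (fun i _ => SmoothEven.sum fun j _ =>
      (hg.rotL i j).rotL i j) hF]
    congr 1
    exact Finset.sum_congr rfl fun i _ => hb.dirForm_sum_left _ (fun j _ =>
      (hg.rotL i j).rotL i j) hF
  have e2 : dirForm b (sphGamma g) F
      = (1 / 2) * ∑ i, ∑ j, dirForm b (fun x => rotL i j g x ^ 2) F := by
    unfold sphGamma
    rw [dirForm_const_mul_left, hb.dirForm_sum_left _ (fun i _ => SmoothEven.sum fun j _ =>
      (hg.rotL i j).pow 2) hF]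
    congr 1
    exact Finset.sum_congr rfl fun i _ => hb.dirForm_sum_left _ (fun j _ =>
      (hg.rotL i j).pow 2) hF
  have e3 : ∀ i j, 2 * dirForm b (rotL i j (rotL i j g)) F
      + dirForm b (fun x => rotL i j g x ^ 2) F ≤ 0 := fun i j => by
    rw [hb.dirForm_rotL (hg.rotL i j) hF, rotL_log hF hpos]
    have := hb.dirForm_mul_nonpos hF hpos (hg.rotL i j)
    linarith
  have e4 : ∑ i, ∑ j, (2 * dirForm b (rotL i j (rotL i j g)) F
      + dirForm b (fun x => rotL i j g x ^ 2) F) ≤ 0 :=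
    Finset.sum_nonpos fun i _ => Finset.sum_nonpos fun j _ => e3 i j
  simp only [Finset.sum_add_distrib, ← Finset.mul_sum] at e4
  rw [e1, e2] at h0
  linarith

/-- The inequality of log-Sobolev type holds with the best constant. -/
theorem sq_mul_jumpFisher_le {ξ : ℝ} (hξ0 : 0 ≤ ξ)
    (hξ : ENNReal.ofReal ξ ≤ bestLogSobolev d b ^ (1 / 2 : ℝ)) {F : Vel d → ℝ} (hF : SmoothEven F)
    (hpos : ∀ x, 0 < F x) :
    ξ ^ 2 * jumpFisher b F ≤ ∫ σ : Sph d,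
      gammaTwo b (fun x => Real.log (F x)) (fun x => Real.log (F x)) σ * F σ ∂(surf d) := by
  have hR := hb.integral_gammaTwo_log_nonneg hF hpos
  have hD := hb.jumpFisher_nonneg hpos
  set R := ∫ σ : Sph d,
    gammaTwo b (fun x => Real.log (F x)) (fun x => Real.log (F x)) σ * F σ ∂(surf d) with hRdef
  have h1 : ENNReal.ofReal (ξ ^ 2) ≤ bestLogSobolev d b := by
    have h := ENNReal.rpow_le_rpow hξ (by norm_num : (0 : ℝ) ≤ 2)
    rw [← ENNReal.rpow_mul] at h
    norm_num at h
    rwa [ENNReal.ofReal_pow hξ0]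
  have h2 : ∀ c : ℝ, 0 ≤ c → c < ξ ^ 2 → c * jumpFisher b F ≤ R := by
    intro c hc0 hc
    have h3 : ENNReal.ofReal c < bestLogSobolev d b :=
      ((ENNReal.ofReal_lt_ofReal_iff (hc0.trans_lt hc)).2 hc).trans_le h1
    rw [bestLogSobolev] at h3
    obtain ⟨L, h4⟩ := lt_iSup_iff.1 h3
    obtain ⟨hL, h5⟩ := lt_iSup_iff.1 h4
    have h6 : c < L := by
      rw [← ENNReal.ofReal_coe_nnreal] at h5
      exact (ENNReal.ofReal_lt_ofReal_iff_of_nonneg hc0).1 h5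
    exact (mul_le_mul_of_nonneg_right h6.le hD).trans (hb.mul_jumpFisher_le hL hF hpos)
  by_contra hlt
  rw [not_le] at hlt
  have hD0 : 0 < jumpFisher b F := by
    rcases hD.eq_or_lt with h | h
    · rw [← h, mul_zero] at hlt; linarith
    · exact h
  have h3 : R / jumpFisher b F < ξ ^ 2 := (div_lt_iff₀ hD0).2 hlt
  have h4 := h2 ((R / jumpFisher b F + ξ ^ 2) / 2) (by positivity) (by linarith)
  have h5 : R = R / jumpFisher b F * jumpFisher b F := by field_simp
  nlinarith

/-- The differential inequality on a single sphere. Here `u` stands for the radial derivative of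
`log F`, and `a'` for the radial derivative of the collision rate `a`. -/
theorem radial_inequality {a a' : ℝ} (ha : 0 < a)
    (ha' : ENNReal.ofReal (|a'| / (2 * a)) ≤ bestLogSobolev d b ^ (1 / 2 : ℝ))
    {F u : Vel d → ℝ} (hF : SmoothEven F) (hpos : ∀ x, 0 < F x) (hu : SmoothEven u) :
    -2 * a' * dirForm b u F
      + a * (-2 * dirForm b u (fun x => F x * u x) + dirForm b (fun x => u x ^ 2) F)
      + a * (2 * dirForm b (sphLap fun x => Real.log (F x)) F
        + dirForm b (sphGamma fun x => Real.log (F x)) F) ≤ 0 := by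
  have h1 := hb.sq_mul_jumpFisher_le (by positivity) ha' hF hpos
  obtain ⟨i1, h2⟩ := hb.dirForm_mul_identity hF hu
  rw [h2, hb.dirForm_sphLap_log hF hpos]
  have i2 := hb.integrable_jumpFisher hF hpos
  set X := ∫ p : Sph d × Sph d, (F p.2 + F p.1) * (u p.2 - u p.1) ^ 2
        * b (inner ℝ (p.2 : Vel d) (p.1 : Vel d)) ∂((surf d).prod (surf d)) with hX
  have h3 : -2 * a' * dirForm b u F ≤ a / 2 * X + a' ^ 2 / (2 * a) * jumpFisher b F := by
    rw [dirForm, hX, jumpFisher, ← integral_const_mul, ← integral_const_mul, ← integral_const_mul,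
      ← integral_const_mul, ← integral_add (i1.const_mul _) (i2.const_mul _)]
    refine integral_mono (((hb.integrable_dirInt hu hF).const_mul _).const_mul _)
      ((i1.const_mul _).add (i2.const_mul _)) fun p => ?_
    have hS : 0 < F p.2 + F p.1 := add_pos (hpos _) (hpos _)
    have hbp := hb.nonneg_inner p.2 p.1
    simp only [dirInt]
    have key : -(a' * (u p.2 - u p.1) * (F p.2 - F p.1))
        ≤ a / 2 * ((F p.2 + F p.1) * (u p.2 - u p.1) ^ 2)
          + a' ^ 2 / (2 * a) * ((F p.2 - F p.1) ^ 2 / (F p.2 + F p.1)) := by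
      have e : a / 2 * ((F p.2 + F p.1) * (u p.2 - u p.1) ^ 2)
          + a' ^ 2 / (2 * a) * ((F p.2 - F p.1) ^ 2 / (F p.2 + F p.1))
          + a' * (u p.2 - u p.1) * (F p.2 - F p.1)
          = (a * (F p.2 + F p.1) * (u p.2 - u p.1) + a' * (F p.2 - F p.1)) ^ 2
            / (2 * a * (F p.2 + F p.1)) := by
        field_simp; ring
      have : 0 ≤ (a * (F p.2 + F p.1) * (u p.2 - u p.1) + a' * (F p.2 - F p.1)) ^ 2
            / (2 * a * (F p.2 + F p.1)) := by positivity
      linarith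
    have := mul_le_mul_of_nonneg_right key hbp
    linarith
  have h4 : (|a'| / (2 * a)) ^ 2 = a' ^ 2 / (2 * a) / (2 * a) := by
    rw [div_pow, sq_abs]; field_simp
  rw [h4] at h1
  have h5 : a' ^ 2 / (2 * a) * jumpFisher b F
      = 2 * a * (a' ^ 2 / (2 * a) / (2 * a) * jumpFisher b F) := by field_simp
  rw [h5] at h3
  nlinarith

end AngularKernel

/-! ### The upper bound `Λ ≤ 2d` -/

theorem rotL_const_mul {φ : Vel d → ℝ} (hφ : Differentiable ℝ φ) (c : ℝ) (i j : Fin d) :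
    rotL i j (fun x => c * φ x) = fun x => c * rotL i j φ x := by
  funext x
  rw [rotL, fderiv_const_mul (hφ x)]; rfl

theorem EvenFamily.const {φ : Vel d → ℝ} (h : SmoothEven φ) : EvenFamily (fun _ : ℝ => φ) :=
  ⟨h.smooth.comp contDiff_snd, fun _ x => h.even x⟩

theorem EvenFamily.exp_mul {φ ψ : Vel d → ℝ} (h : SmoothEven φ) (hψ : SmoothEven ψ) :
    EvenFamily (fun (t : ℝ) x => Real.exp (t * φ x) * ψ x) :=
  ⟨((contDiff_fst.mul (h.smooth.comp contDiff_snd)).exp).mul (hψ.smooth.comp contDiff_snd),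
    fun t x => by simp only [h.even, hψ.even]⟩

theorem abs_prodForm_le {a e x : Vel d} (ha : ‖a‖ = 1) (he : ‖e‖ = 1) (hx : ‖x‖ = 1) :
    |prodForm a e x| ≤ 1 := by
  have h1 := abs_real_inner_le_norm a x
  have h2 := abs_real_inner_le_norm e x
  rw [ha, hx] at h1
  rw [he, hx] at h2
  rw [prodForm, abs_mul]
  nlinarith [abs_nonneg (inner ℝ a x : ℝ), abs_nonneg (inner ℝ e x : ℝ)]

theorem sq_mul_exp_le {ε x y : ℝ} (hε : 0 ≤ ε) (hx : |x| ≤ 1) (hy : |y| ≤ 1) :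
    ε ^ 2 * (Real.exp (-3 * ε) / 2) * (y - x) ^ 2
      ≤ (Real.exp (ε * y) - Real.exp (ε * x)) ^ 2 / (Real.exp (ε * y) + Real.exp (ε * x)) := by
  have key : ∀ x y : ℝ, |x| ≤ 1 → x ≤ y →
      Real.exp (-ε) * (ε * (y - x)) ≤ Real.exp (ε * y) - Real.exp (ε * x) := by
    intro x y hx hxy
    have h1 : Real.exp (ε * y) - Real.exp (ε * x)
        = Real.exp (ε * x) * (Real.exp (ε * (y - x)) - 1) := by
      rw [mul_sub, ← Real.exp_add, mul_one]; ring_nf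
    rw [h1]
    have h2 : Real.exp (-ε) ≤ Real.exp (ε * x) := by
      apply Real.exp_le_exp.2; nlinarith [abs_le.1 hx]
    have h3 : ε * (y - x) ≤ Real.exp (ε * (y - x)) - 1 := by
      linarith [Real.add_one_le_exp (ε * (y - x))]
    have h4 : 0 ≤ ε * (y - x) := mul_nonneg hε (by linarith)
    gcongr
  have h1 : (Real.exp (-ε) * (ε * (y - x))) ^ 2 ≤ (Real.exp (ε * y) - Real.exp (ε * x)) ^ 2 := by
    rcases le_total x y with h | h
    · have h0 : 0 ≤ Real.exp (-ε) * (ε * (y - x)) :=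
        mul_nonneg (Real.exp_pos _).le (mul_nonneg hε (by linarith))
      exact pow_le_pow_left₀ h0 (key x y hx h) 2
    · have h0 : 0 ≤ Real.exp (-ε) * (ε * (x - y)) :=
        mul_nonneg (Real.exp_pos _).le (mul_nonneg hε (by linarith))
      have := pow_le_pow_left₀ h0 (key y x hy h) 2
      nlinarith
  have hle : ∀ z : ℝ, |z| ≤ 1 → Real.exp (ε * z) ≤ Real.exp ε := fun z hz =>
    Real.exp_le_exp.2 (by nlinarith [abs_le.1 hz])
  have h2 : Real.exp (ε * y) + Real.exp (ε * x) ≤ 2 * Real.exp ε := by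
    linarith [hle x hx, hle y hy]
  have hp : 0 < Real.exp (ε * y) + Real.exp (ε * x) := by positivity
  rw [le_div_iff₀ hp]
  have e1 : Real.exp (-3 * ε) * Real.exp ε = Real.exp (-ε) ^ 2 := by
    rw [← Real.exp_add, ← Real.exp_nat_mul]; ring_nf
  calc ε ^ 2 * (Real.exp (-3 * ε) / 2) * (y - x) ^ 2 * (Real.exp (ε * y) + Real.exp (ε * x))
      ≤ ε ^ 2 * (Real.exp (-3 * ε) / 2) * (y - x) ^ 2 * (2 * Real.exp ε) := by gcongr
    _ = (Real.exp (-3 * ε) * Real.exp ε) * (ε * (y - x)) ^ 2 := by ring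
    _ = (Real.exp (-ε) * (ε * (y - x))) ^ 2 := by rw [e1]; ring
    _ ≤ _ := h1

/-- The side with `Γ²_{ℬ,Δ}` of the inequality that defines `Λ_b`, for `exp (ε h)`, divided by
`ε²`. -/
def expDissipation (b : ℝ → ℝ) (h : Vel d → ℝ) (ε : ℝ) : ℝ :=
  -(1 / 2) * dirForm b (fun x => Real.exp (ε * h x) * 1) (sphGamma h)
    + (1 / 2) * ∑ i, ∑ j, dirForm b (fun x => Real.exp (ε * h x) * rotL i j h x) (rotL i j h)

namespace AngularKernel

variable {b : ℝ → ℝ} (hb : AngularKernel d b)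
include hb

theorem mul_exp_mul_dirForm_le {L : ℝ≥0} (hL : LogSobolev d b L) {h : Vel d → ℝ}
    (hh : SmoothEven h) (h1 : ∀ x, ‖x‖ = 1 → |h x| ≤ 1) {ε : ℝ} (hε : 0 < ε) :
    L * (Real.exp (-3 * ε) * dirForm b h h) ≤ expDissipation b h ε := by
  have hF : SmoothEven (fun x => Real.exp (ε * h x)) := (hh.const_mul ε).exp
  have hFp : ∀ x, 0 < Real.exp (ε * h x) := fun x => Real.exp_pos _
  have k1 := hb.mul_jumpFisher_le hL hF hFp
  simp only [Real.log_exp] at k1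
  rw [hb.integral_gammaTwo_mul (hh.const_mul ε) hF] at k1
  have k2 : sphGamma (fun x => ε * h x) = fun x => ε ^ 2 * sphGamma h x := by
    funext x
    simp only [sphGamma, rotL_const_mul hh.differentiable, mul_pow, ← Finset.mul_sum]
    ring
  have k3 : ∀ i j, dirForm b (fun x => Real.exp (ε * h x) * rotL i j (fun x => ε * h x) x)
      (rotL i j fun x => ε * h x)
      = ε ^ 2 * dirForm b (fun x => Real.exp (ε * h x) * rotL i j h x) (rotL i j h) := by
    intro i j
    rw [rotL_const_mul hh.differentiable]
    have : (fun x => Real.exp (ε * h x) * (ε * rotL i j h x))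
        = fun x => ε * (Real.exp (ε * h x) * rotL i j h x) := by funext x; ring
    rw [this, dirForm_const_mul_left, dirForm_comm, dirForm_const_mul_left, dirForm_comm]
    ring
  rw [k2, dirForm_comm, dirForm_const_mul_left, dirForm_comm] at k1
  simp only [k3, ← Finset.mul_sum] at k1
  have k4 : ε ^ 2 * (Real.exp (-3 * ε) * dirForm b h h)
      ≤ jumpFisher b (fun x => Real.exp (ε * h x)) := by
    rw [dirForm, jumpFisher, ← integral_const_mul, ← integral_const_mul, ← integral_const_mul]
    have i1 := (((hb.integrable_dirInt hh hh).const_mul (1 / 2)).const_mul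
      (Real.exp (-3 * ε))).const_mul (ε ^ 2)
    have i2 := hb.integrable_jumpFisher hF hFp
    refine integral_mono i1 i2 fun p => ?_
    have := mul_le_mul_of_nonneg_right (sq_mul_exp_le hε.le (h1 (p.1 : Vel d) (Sph.norm_eq p.1))
      (h1 (p.2 : Vel d) (Sph.norm_eq p.2))) (hb.nonneg_inner p.2 p.1)
    simp only [dirInt]
    refine le_trans (le_of_eq ?_) this
    ring
  have k5 := (mul_le_mul_of_nonneg_left k4 L.2).trans k1
  have k6 : ε ^ 2 * (L * (Real.exp (-3 * ε) * dirForm b h h)) ≤ ε ^ 2 * expDissipation b h ε := by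
    simp only [expDissipation, mul_one]
    have : (NNReal.toReal L) = L.1 := rfl
    rw [this]
    linarith
  exact le_of_mul_le_mul_left k6 (by positivity)

/-- Linearisation of the inequality of log-Sobolev type around the constants, in the direction of a
spherical harmonic of degree two. -/
theorem bestLogSobolev_le {a e : Vel d} (ha : ‖a‖ = 1) (he : ‖e‖ = 1)
    (hae : inner ℝ a e = (0 : ℝ)) (hpos : dirForm b (prodForm a e) (prodForm a e) ≠ 0) :
    bestLogSobolev d b ≤ ENNReal.ofReal (2 * d) := by
  refine iSup₂_le fun L hL => ?_
  rw [← ENNReal.ofReal_coe_nnreal]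
  refine ENNReal.ofReal_le_ofReal ?_
  have hh := SmoothEven.prodForm a e
  have hlap := sphLap_prodForm hae
  have hbd := fun x hx => abs_prodForm_le ha he (x := x) hx
  generalize prodForm a e = h at *
  have hE : 0 < dirForm b h h := lt_of_le_of_ne (hb.dirForm_self_nonneg h) hpos.symm
  set R := expDissipation b h with hR
  have h1 : ∀ ε : ℝ, 0 < ε → L * (Real.exp (-3 * ε) * dirForm b h h) ≤ R ε := fun ε hε =>
    hb.mul_exp_mul_dirForm_le hL hh hbd hε
  have h2 : ContinuousAt R 0 := by
    have c1 : ∀ {φ ψ : Vel d → ℝ}, SmoothEven φ → SmoothEven ψ →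
        ContinuousAt (fun ε : ℝ => dirForm b (fun x => Real.exp (ε * h x) * φ x) ψ) 0 :=
      fun hφ hψ => (hb.hasDerivAt_dirForm (EvenFamily.exp_mul hh hφ) (EvenFamily.const hψ)
        0).continuousAt
    refine (continuousAt_const.mul (c1 (φ := fun _ => 1) ⟨contDiff_const, fun _ => rfl⟩
      hh.sphGamma)).add (continuousAt_const.mul ?_)
    refine tendsto_finsetSum _ fun i _ => tendsto_finsetSum _ fun j _ =>
      c1 (hh.rotL i j) (hh.rotL i j)
  have h3 : R 0 = 2 * d * dirForm b h h := by
    have k1 : dirForm b (fun _ => (1 : ℝ)) (sphGamma h) = 0 := by simp [dirForm, dirInt]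
    have k2 : dirForm b (sphLap h) h = (1 / 2) * ∑ i, ∑ j, dirForm b (rotL i j (rotL i j h)) h := by
      unfold sphLap
      rw [dirForm_const_mul_left, hb.dirForm_sum_left _ (fun i _ => SmoothEven.sum fun j _ =>
        (hh.rotL i j).rotL i j) hh]
      congr 1
      exact Finset.sum_congr rfl fun i _ => hb.dirForm_sum_left _ (fun j _ =>
        (hh.rotL i j).rotL i j) hh
    have k3 : dirForm b (sphLap h) h = -(2 * d) * dirForm b h h := by
      rw [← dirForm_const_mul_left]
      congr 1; funext x; exact hlap x
    simp only [hb.dirForm_rotL (hh.rotL _ _) hh, Finset.sum_neg_distrib] at k2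
    simp only [hR, expDissipation, zero_mul, Real.exp_zero, one_mul, k1]
    linarith
  have h4 : ContinuousAt (fun ε : ℝ => (L : ℝ) * (Real.exp (-3 * ε) * dirForm b h h)) 0 := by
    fun_prop
  have h5 : (L : ℝ) * (Real.exp (-3 * 0) * dirForm b h h) ≤ R 0 := by
    refine le_of_tendsto_of_tendsto (b := nhdsWithin (0 : ℝ) (Ioi 0))
      (h4.tendsto.mono_left nhdsWithin_le_nhds) (h2.tendsto.mono_left nhdsWithin_le_nhds) ?_
    filter_upwards [self_mem_nhdsWithin] with ε hε using h1 ε hε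
  rw [h3] at h5
  simp only [mul_zero, Real.exp_zero, one_mul] at h5
  exact le_of_mul_le_mul_right h5 hE

end AngularKernel

/-! ### Polynomial weights -/

/-- The weight `(1 + r²)^(-p/2)`. -/
def polyWeight (p r : ℝ) : ℝ := (1 + r ^ 2) ^ (-p / 2)

theorem polyWeight_pos (p r : ℝ) : 0 < polyWeight p r := Real.rpow_pos_of_pos (by positivity) _

theorem polyWeight_le_one {p : ℝ} (hp : 0 ≤ p) (r : ℝ) : polyWeight p r ≤ 1 :=
  Real.rpow_le_one_of_one_le_of_nonpos (by nlinarith [sq_nonneg r]) (by linarith)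

theorem continuous_polyWeight (p : ℝ) : Continuous (polyWeight p) :=
  (by fun_prop : Continuous fun r : ℝ => 1 + r ^ 2).rpow_const
    fun r => Or.inl (by positivity : (0 : ℝ) < 1 + r ^ 2).ne'

/-- The decay of the distribution functions. -/
def weight (v : Vel d) : ℝ := polyWeight (3 * d + 5) ‖v‖

/-- The decay in the centre of mass `z` of a pair of particles. -/
def centreWeight (z : Vel d) : ℝ := polyWeight (d + 1 / 2) ‖z‖

/-- The decay in half of the relative speed of a pair of particles. -/
def relWeight (d : ℕ) (r : ℝ) : ℝ := polyWeight (2 * d + 9 / 2) r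

theorem weight_pos (v : Vel d) : 0 < weight v := polyWeight_pos _ _
theorem centreWeight_pos (z : Vel d) : 0 < centreWeight z := polyWeight_pos _ _
theorem relWeight_pos (r : ℝ) : 0 < relWeight d r := polyWeight_pos _ _

theorem relWeight_le_one (r : ℝ) : relWeight d r ≤ 1 := polyWeight_le_one (by positivity) r

theorem integrable_centreWeight : Integrable (centreWeight (d := d)) := by
  refine integrable_rpow_neg_one_add_norm_sq (r := (d : ℝ) + 1 / 2) ?_
  rw [finrank_euclideanSpace_fin]; linarith

theorem weight_mul_weight_le (z y : Vel d) :
    weight (z + y) * weight (z - y) ≤ centreWeight z * relWeight d ‖y‖ := by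
  set X := (1 + ‖z + y‖ ^ 2) * (1 + ‖z - y‖ ^ 2) with hX
  have hpar : ‖z + y‖ ^ 2 + ‖z - y‖ ^ 2 = 2 * (‖z‖ ^ 2 + ‖y‖ ^ 2) := by
    have := parallelogram_law_with_norm ℝ z y; nlinarith
  have h0 : 0 ≤ ‖z + y‖ ^ 2 * ‖z - y‖ ^ 2 := by positivity
  have hz : 1 + ‖z‖ ^ 2 ≤ X := by nlinarith [sq_nonneg ‖y‖, sq_nonneg ‖z‖]
  have hy : 1 + ‖y‖ ^ 2 ≤ X := by nlinarith [sq_nonneg ‖y‖, sq_nonneg ‖z‖]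
  have hX0 : 0 < X := by positivity
  have e1 : weight (z + y) * weight (z - y) = X ^ (-(3 * (d : ℝ) + 5) / 2) := by
    rw [weight, weight, polyWeight, polyWeight, ← Real.mul_rpow (by positivity) (by positivity)]
  have e2 : -(3 * (d : ℝ) + 5) / 2 = -((d : ℝ) + 1 / 2) / 2 + -(2 * (d : ℝ) + 9 / 2) / 2 := by ring
  rw [e1, e2, Real.rpow_add hX0]
  refine mul_le_mul ?_ ?_ (by positivity) (centreWeight_pos z).le
  · exact Real.rpow_le_rpow_of_nonpos (by positivity) hz (by
      have : (0 : ℝ) ≤ d := Nat.cast_nonneg d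
      linarith)
  · exact Real.rpow_le_rpow_of_nonpos (by positivity) hy (by
      have : (0 : ℝ) ≤ d := Nat.cast_nonneg d
      linarith)

theorem one_le_mul_relWeight {r : ℝ} (h0 : 0 ≤ r) (hr : r ≤ 1) :
    1 ≤ 2 ^ ((2 * (d : ℝ) + 9 / 2) / 2) * relWeight d r := by
  have h1 : (2 : ℝ) ^ (-(2 * (d : ℝ) + 9 / 2) / 2) ≤ relWeight d r :=
    Real.rpow_le_rpow_of_nonpos (by positivity) (by nlinarith) (by
      have : (0 : ℝ) ≤ d := Nat.cast_nonneg d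
      linarith)
  calc (1 : ℝ) = 2 ^ ((2 * (d : ℝ) + 9 / 2) / 2) * 2 ^ (-(2 * (d : ℝ) + 9 / 2) / 2) := by
        rw [← Real.rpow_add (by norm_num)]; ring_nf; simp
    _ ≤ _ := by gcongr

/-! ### Second derivatives -/

theorem norm_fderiv_fderiv (f : Vel d → ℝ) (x : Vel d) :
    ‖fderiv ℝ (fderiv ℝ f) x‖ = ‖iteratedFDeriv ℝ 2 f x‖ := by
  rw [← norm_iteratedFDeriv_one, norm_iteratedFDeriv_fderiv]

theorem norm_fderiv_mul_le {f g : Vel d → ℝ} (hf : Differentiable ℝ f) (hg : Differentiable ℝ g)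
    (x : Vel d) :
    ‖fderiv ℝ (fun x => f x * g x) x‖ ≤ |f x| * ‖fderiv ℝ g x‖ + |g x| * ‖fderiv ℝ f x‖ := by
  rw [fderiv_fun_mul (hf x) (hg x)]
  exact (ContinuousLinearMap.opNorm_add_le _ _).trans (by rw [norm_smul, norm_smul, Real.norm_eq_abs, Real.norm_eq_abs])

theorem norm_fderiv_fderiv_mul_le {f g : Vel d → ℝ} (hf : ContDiff ℝ 2 f) (hg : ContDiff ℝ 2 g)
    (x : Vel d) :
    ‖fderiv ℝ (fderiv ℝ fun x => f x * g x) x‖ ≤ |f x| * ‖fderiv ℝ (fderiv ℝ g) x‖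
      + 2 * (‖fderiv ℝ f x‖ * ‖fderiv ℝ g x‖) + |g x| * ‖fderiv ℝ (fderiv ℝ f) x‖ := by
  have h := norm_iteratedFDeriv_mul_le hf hg x (n := 2) le_rfl
  rw [← norm_fderiv_fderiv] at h
  simp only [Finset.sum_range_succ, Finset.range_zero, Finset.sum_empty, zero_add,
    norm_iteratedFDeriv_zero, norm_iteratedFDeriv_one, ← norm_fderiv_fderiv, Nat.choose_zero_right,
    Nat.cast_one, Nat.sub_zero, Nat.choose_one_right, Nat.choose_self, Nat.reduceSub,
    Real.norm_eq_abs, Nat.cast_ofNat, one_mul] at h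
  linarith

theorem norm_fderiv_exp {g : Vel d → ℝ} (hg : Differentiable ℝ g) (x : Vel d) :
    ‖fderiv ℝ (fun x => Real.exp (g x)) x‖ = Real.exp (g x) * ‖fderiv ℝ g x‖ := by
  rw [fderiv_exp (hg x), norm_smul, Real.norm_of_nonneg (Real.exp_pos _).le]

theorem norm_fderiv_fderiv_exp_le {g : Vel d → ℝ} (hg : ContDiff ℝ 2 g) (x : Vel d) :
    ‖fderiv ℝ (fderiv ℝ fun x => Real.exp (g x)) x‖
      ≤ Real.exp (g x) * (‖fderiv ℝ (fderiv ℝ g) x‖ + ‖fderiv ℝ g x‖ ^ 2) := by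
  have hd : Differentiable ℝ g := hg.differentiable (by norm_num)
  have hd2 : Differentiable ℝ (fderiv ℝ g) :=
    (hg.fderiv_right (m := 1) (by norm_num)).differentiable (by norm_num)
  have e : (fderiv ℝ fun x => Real.exp (g x)) = fun x => Real.exp (g x) • fderiv ℝ g x :=
    funext fun x => fderiv_exp (hd x)
  rw [e, fderiv_fun_smul (hd x).exp (hd2 x)]
  refine (ContinuousLinearMap.opNorm_add_le _ _).trans ?_
  rw [norm_smul, ContinuousLinearMap.norm_smulRight_apply, norm_fderiv_exp hd,
    Real.norm_of_nonneg (Real.exp_pos _).le]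
  exact le_of_eq (by ring)

theorem norm_fderiv_log {f : Vel d → ℝ} (hf : Differentiable ℝ f) (hpos : ∀ x, 0 < f x)
    (x : Vel d) : ‖fderiv ℝ (fun x => Real.log (f x)) x‖ = (f x)⁻¹ * ‖fderiv ℝ f x‖ := by
  rw [fderiv.log (hf x) (hpos x).ne', norm_smul, Real.norm_of_nonneg (inv_pos.2 (hpos x)).le]

theorem norm_fderiv_fderiv_log_le {f : Vel d → ℝ} (hf : ContDiff ℝ 2 f) (hpos : ∀ x, 0 < f x)
    (x : Vel d) :
    ‖fderiv ℝ (fderiv ℝ fun x => Real.log (f x)) x‖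
      ≤ (f x)⁻¹ * ‖fderiv ℝ (fderiv ℝ f) x‖ + ((f x)⁻¹ * ‖fderiv ℝ f x‖) ^ 2 := by
  have hd : Differentiable ℝ f := hf.differentiable (by norm_num)
  have hd2 : Differentiable ℝ (fderiv ℝ f) :=
    (hf.fderiv_right (m := 1) (by norm_num)).differentiable (by norm_num)
  have e : (fderiv ℝ fun x => Real.log (f x)) = fun x => (f x)⁻¹ • fderiv ℝ f x :=
    funext fun x => fderiv.log (hd x) (hpos x).ne'
  have hi : HasFDerivAt (fun x => (f x)⁻¹) (-(f x ^ 2)⁻¹ • fderiv ℝ f x) x :=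
    (hasDerivAt_inv (hpos x).ne').comp_hasFDerivAt x (hd x).hasFDerivAt
  rw [e, fderiv_fun_smul hi.differentiableAt (hd2 x), hi.fderiv]
  refine (ContinuousLinearMap.opNorm_add_le _ _).trans ?_
  rw [norm_smul, ContinuousLinearMap.norm_smulRight_apply, norm_smul, norm_neg,
    Real.norm_of_nonneg (inv_pos.2 (hpos x)).le,
    Real.norm_of_nonneg (inv_pos.2 (pow_pos (hpos x) 2)).le]
  refine le_of_eq ?_
  have := (hpos x).ne'
  field_simp

/-- The derivative of an even function vanishes at the origin. -/
theorem SmoothEven.norm_fderiv_le {H : Vel d → ℝ} (hH : SmoothEven H) {K R : ℝ}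
    (hK : ∀ y, ‖y‖ ≤ R → ‖fderiv ℝ (fderiv ℝ H) y‖ ≤ K) {y : Vel d} (hy : ‖y‖ ≤ R) :
    ‖fderiv ℝ H y‖ ≤ K * ‖y‖ := by
  have h0 : fderiv ℝ H 0 = 0 := by
    ext v
    have := hH.fderiv_neg 0 v
    rw [neg_zero] at this
    simp only [zero_apply]
    linarith
  have hd2 : Differentiable ℝ (fderiv ℝ H) :=
    ((hH.contDiff 2).fderiv_right (m := 1) (by norm_num)).differentiable (by norm_num)
  have := (convex_closedBall (0 : Vel d) R).norm_image_sub_le_of_norm_fderiv_le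
    (f := fderiv ℝ H) (C := K) (fun x _ => hd2 x) (fun x hx => hK x (mem_closedBall_zero_iff.1 hx))
    (mem_closedBall_self ((norm_nonneg y).trans hy)) (mem_closedBall_zero_iff.2 hy)
  simpa [h0] using this

theorem norm_fderiv_comp_smul (H : Vel d → ℝ) {r : ℝ} (hr : 0 ≤ r) (x : Vel d) :
    ‖fderiv ℝ (fun x => H (r • x)) x‖ = r * ‖fderiv ℝ H (r • x)‖ := by
  rw [fderiv_comp_smul, norm_smul, Real.norm_of_nonneg hr]

theorem norm_fderiv_fderiv_comp_smul {H : Vel d → ℝ} (hH : ContDiff ℝ 2 H) {r : ℝ} (hr : 0 ≤ r)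
    (x : Vel d) :
    ‖fderiv ℝ (fderiv ℝ fun x => H (r • x)) x‖ = r ^ 2 * ‖fderiv ℝ (fderiv ℝ H) (r • x)‖ := by
  rw [norm_fderiv_fderiv, norm_fderiv_fderiv, iteratedFDeriv_comp_const_smul r hH, norm_smul,
    Real.norm_of_nonneg (by positivity)]

/-! ### Pairs of particles -/

/-- A smooth function that is bounded, together with its first two derivatives, by a multiple of
the weight. -/
structure DecayBound (f : Vel d → ℝ) (C : ℝ) : Prop where
  smooth : ContDiff ℝ (⊤ : ℕ∞) f
  le : ∀ v, |f v| ≤ C * weight v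
  le_fderiv : ∀ v, ‖fderiv ℝ f v‖ ≤ C * weight v
  le_fderiv_two : ∀ v, ‖fderiv ℝ (fderiv ℝ f) v‖ ≤ C * weight v

theorem DecayBound.nonneg {f : Vel d → ℝ} {C : ℝ} (h : DecayBound f C) : 0 ≤ C :=
  nonneg_of_mul_nonneg_left ((abs_nonneg _).trans (h.le 0)) (weight_pos 0)

theorem DecayBound.mono {f : Vel d → ℝ} {C C' : ℝ} (h : DecayBound f C) (hC : C ≤ C') :
    DecayBound f C' :=
  have hw : ∀ v : Vel d, C * weight v ≤ C' * weight v := fun v => by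
    have := (weight_pos v).le; gcongr
  ⟨h.smooth, fun v => (h.le v).trans (hw v), fun v => (h.le_fderiv v).trans (hw v),
    fun v => (h.le_fderiv_two v).trans (hw v)⟩

theorem DecayBound.add_const_mul {f g : Vel d → ℝ} {A B : ℝ} (hf : DecayBound f A)
    (hg : DecayBound g B) {c : ℝ} (hc : 0 ≤ c) : DecayBound (fun v => f v + c * g v) (A + c * B) := by
  have hfd := hf.smooth.differentiable (by simp)
  have hgd := hg.smooth.differentiable (by simp)
  have hfd2 : Differentiable ℝ (fderiv ℝ f) :=
    ((hf.smooth.of_le two_le_infty).fderiv_right (m := 1) (by norm_num)).differentiable (by norm_num)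
  have hgd2 : Differentiable ℝ (fderiv ℝ g) :=
    ((hg.smooth.of_le two_le_infty).fderiv_right (m := 1) (by norm_num)).differentiable (by norm_num)
  have e1 : (fderiv ℝ fun v => f v + c * g v) = fun v => fderiv ℝ f v + c • fderiv ℝ g v := by
    funext v
    rw [fderiv_fun_add (hfd v) ((hgd v).const_mul c), fderiv_const_mul (hgd v)]
  have e2 : ∀ v, fderiv ℝ (fderiv ℝ fun v => f v + c * g v) v
      = fderiv ℝ (fderiv ℝ f) v + c • fderiv ℝ (fderiv ℝ g) v := by
    intro v
    rw [e1, fderiv_fun_add (hfd2 v) ((hgd2 v).fun_const_smul c), fderiv_fun_const_smul (hgd2 v)]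
  refine ⟨hf.smooth.add (contDiff_const.mul hg.smooth), fun v => ?_, fun v => ?_, fun v => ?_⟩
  · refine (abs_add_le _ _).trans ?_
    rw [abs_mul, abs_of_nonneg hc]
    nlinarith [hf.le v, mul_le_mul_of_nonneg_left (hg.le v) hc]
  · rw [e1]
    refine (ContinuousLinearMap.opNorm_add_le _ _).trans ?_
    rw [norm_smul, Real.norm_of_nonneg hc]
    nlinarith [hf.le_fderiv v, mul_le_mul_of_nonneg_left (hg.le_fderiv v) hc]
  · rw [e2]
    refine (ContinuousLinearMap.opNorm_add_le _ _).trans ?_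
    rw [norm_smul, Real.norm_of_nonneg hc]
    nlinarith [hf.le_fderiv_two v, mul_le_mul_of_nonneg_left (hg.le_fderiv_two v) hc]

/-- The symmetrised tensor product of two distribution functions, in terms of the centre of mass `z`
and half of the relative velocity `y`. -/
def pairFun (f g : Vel d → ℝ) (z y : Vel d) : ℝ := f (z + y) * g (z - y) + g (z + y) * f (z - y)

theorem SmoothEven.pairFun {f g : Vel d → ℝ} (hf : ContDiff ℝ (⊤ : ℕ∞) f)
    (hg : ContDiff ℝ (⊤ : ℕ∞) g) (z : Vel d) : SmoothEven (pairFun f g z) := by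
  refine ⟨?_, fun y => by simp only [Boltzmann.pairFun, sub_neg_eq_add, ← sub_eq_add_neg]; ring⟩
  have h1 : ContDiff ℝ (⊤ : ℕ∞) fun y : Vel d => z + y := contDiff_const.add contDiff_id
  have h2 : ContDiff ℝ (⊤ : ℕ∞) fun y : Vel d => z - y := contDiff_const.sub contDiff_id
  exact ((hf.comp h1).mul (hg.comp h2)).add ((hg.comp h1).mul (hf.comp h2))

theorem norm_iteratedFDeriv_comp_const_sub (f : Vel d → ℝ) (z y : Vel d) (n : ℕ) :
    ‖iteratedFDeriv ℝ n (fun y => f (z - y)) y‖ = ‖iteratedFDeriv ℝ n f (z - y)‖ := by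
  have e : (fun y => f (z - y)) = (fun y => f (z + y)) ∘ (LinearIsometryEquiv.neg ℝ (E := Vel d)) := by
    funext y; simp [sub_eq_add_neg]
  rw [e, LinearIsometryEquiv.norm_iteratedFDeriv_comp_right, iteratedFDeriv_comp_add_left]
  simp [sub_eq_add_neg]

theorem DecayBound.norm_pairFun_le {f g : Vel d → ℝ} {A B : ℝ} (hf : DecayBound f A)
    (hg : DecayBound g B) (z y : Vel d) :
    ‖fderiv ℝ (pairFun f g z) y‖ ≤ 8 * A * B * (centreWeight z * relWeight d ‖y‖) ∧
    ‖fderiv ℝ (fderiv ℝ (pairFun f g z)) y‖ ≤ 8 * A * B * (centreWeight z * relWeight d ‖y‖) := by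
  have hA := hf.nonneg
  have hB := hg.nonneg
  have key : ∀ {f g : Vel d → ℝ} {A B : ℝ}, DecayBound f A → DecayBound g B →
      ‖fderiv ℝ (fun y => f (z + y) * g (z - y)) y‖
        ≤ 4 * A * B * (centreWeight z * relWeight d ‖y‖) ∧
      ‖fderiv ℝ (fderiv ℝ fun y => f (z + y) * g (z - y)) y‖
        ≤ 4 * A * B * (centreWeight z * relWeight d ‖y‖) := by
    intro f g A B hf hg
    have hA := hf.nonneg
    have hB := hg.nonneg
    have h1 : ContDiff ℝ 2 fun y : Vel d => f (z + y) :=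
      (hf.smooth.of_le two_le_infty).comp (contDiff_const.add contDiff_id)
    have h2 : ContDiff ℝ 2 fun y : Vel d => g (z - y) :=
      (hg.smooth.of_le two_le_infty).comp (contDiff_const.sub contDiff_id)
    have a1 : ‖fderiv ℝ (fun y => f (z + y)) y‖ ≤ A * weight (z + y) := by
      rw [fderiv_comp_add_left]; exact hf.le_fderiv _
    have a2 : ‖fderiv ℝ (fderiv ℝ fun y => f (z + y)) y‖ ≤ A * weight (z + y) := by
      rw [norm_fderiv_fderiv, iteratedFDeriv_comp_add_left, ← norm_fderiv_fderiv]
      exact hf.le_fderiv_two _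
    have b1 : ‖fderiv ℝ (fun y => g (z - y)) y‖ ≤ B * weight (z - y) := by
      rw [← norm_iteratedFDeriv_one, norm_iteratedFDeriv_comp_const_sub, norm_iteratedFDeriv_one]
      exact hg.le_fderiv _
    have b2 : ‖fderiv ℝ (fderiv ℝ fun y => g (z - y)) y‖ ≤ B * weight (z - y) := by
      rw [norm_fderiv_fderiv, norm_iteratedFDeriv_comp_const_sub, ← norm_fderiv_fderiv]
      exact hg.le_fderiv_two _
    have a0 := hf.le (z + y)
    have b0 := hg.le (z - y)
    have hw1 := (weight_pos (z + y)).le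
    have hw2 := (weight_pos (z - y)).le
    have hw : A * weight (z + y) * (B * weight (z - y))
        ≤ A * B * (centreWeight z * relWeight d ‖y‖) := by
      calc A * weight (z + y) * (B * weight (z - y))
          = A * B * (weight (z + y) * weight (z - y)) := by ring
        _ ≤ _ := mul_le_mul_of_nonneg_left (weight_mul_weight_le z y) (by positivity)
    have hw0 : 0 ≤ A * weight (z + y) * (B * weight (z - y)) := by positivity
    constructor
    · refine (norm_fderiv_mul_le (h1.differentiable (by norm_num)) (h2.differentiable (by norm_num))
        y).trans ?_
      have t1 : |f (z + y)| * ‖fderiv ℝ (fun y => g (z - y)) y‖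
          ≤ A * weight (z + y) * (B * weight (z - y)) := by gcongr
      have t2 : |g (z - y)| * ‖fderiv ℝ (fun y => f (z + y)) y‖
          ≤ B * weight (z - y) * (A * weight (z + y)) := by gcongr
      nlinarith
    · refine (norm_fderiv_fderiv_mul_le h1 h2 y).trans ?_
      have t1 : |f (z + y)| * ‖fderiv ℝ (fderiv ℝ fun y => g (z - y)) y‖
          ≤ A * weight (z + y) * (B * weight (z - y)) := by gcongr
      have t2 : |g (z - y)| * ‖fderiv ℝ (fderiv ℝ fun y => f (z + y)) y‖
          ≤ B * weight (z - y) * (A * weight (z + y)) := by gcongr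
      have t3 : ‖fderiv ℝ (fun y => f (z + y)) y‖ * ‖fderiv ℝ (fun y => g (z - y)) y‖
          ≤ A * weight (z + y) * (B * weight (z - y)) := by gcongr
      nlinarith
  have hs : ∀ {f g : Vel d → ℝ} {A B : ℝ}, DecayBound f A → DecayBound g B →
      ContDiff ℝ 2 fun y : Vel d => f (z + y) * g (z - y) := fun hf hg =>
    ((hf.smooth.of_le two_le_infty).comp (contDiff_const.add contDiff_id)).mul
      ((hg.smooth.of_le two_le_infty).comp (contDiff_const.sub contDiff_id))
  have d1 : ∀ {F : Vel d → ℝ}, ContDiff ℝ 2 F → Differentiable ℝ F := fun h =>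
    h.differentiable (by norm_num)
  have d2 : ∀ {F : Vel d → ℝ}, ContDiff ℝ 2 F → Differentiable ℝ (fderiv ℝ F) := fun h =>
    (h.fderiv_right (m := 1) (by norm_num)).differentiable (by norm_num)
  have e1 : fderiv ℝ (pairFun f g z) = fun y => fderiv ℝ (fun y => f (z + y) * g (z - y)) y
      + fderiv ℝ (fun y => g (z + y) * f (z - y)) y := by
    funext y
    exact fderiv_fun_add (d1 (hs hf hg) y) (d1 (hs hg hf) y)
  have k1 := key hf hg
  have k2 := key hg hf
  constructor
  · rw [e1]
    refine (ContinuousLinearMap.opNorm_add_le _ _).trans ?_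
    linarith [k1.1, k2.1]
  · rw [e1, fderiv_fun_add (d2 (hs hf hg) y) (d2 (hs hg hf) y)]
    refine (ContinuousLinearMap.opNorm_add_le _ _).trans ?_
    linarith [k1.2, k2.2]

/-- The constant in the bounds of pairs of distribution functions. -/
def pairConst (d : ℕ) : ℝ := 8 * 2 ^ ((2 * (d : ℝ) + 9 / 2) / 2)

theorem pairConst_nonneg : 0 ≤ pairConst d := by unfold pairConst; positivity

/-- On the sphere of radius `e^s`, a pair of distribution functions is constant up to an error of
the order `e^(2s)` by evenness. -/
theorem DecayBound.norm_pairFun_smul_le {f g : Vel d → ℝ} {A B : ℝ} (hf : DecayBound f A)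
    (hg : DecayBound g B) (z : Vel d) (s : ℝ) {x : Vel d} (hx : ‖x‖ = 1) :
    ‖fderiv ℝ (fun x => pairFun f g z (Real.exp s • x)) x‖
        ≤ pairConst d * A * B * (Real.exp s ^ 2 * (centreWeight z * relWeight d (Real.exp s))) ∧
    ‖fderiv ℝ (fderiv ℝ fun x => pairFun f g z (Real.exp s • x)) x‖
        ≤ pairConst d * A * B * (Real.exp s ^ 2 * (centreWeight z * relWeight d (Real.exp s))) := by
  have hr := Real.exp_pos s
  set r := Real.exp s
  have hA := hf.nonneg
  have hB := hg.nonneg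
  have hc := (centreWeight_pos z).le
  have hw := (relWeight_pos (d := d) r).le
  have hn : ‖r • x‖ = r := by rw [norm_smul, hx, mul_one, Real.norm_of_nonneg hr.le]
  have hk := hf.norm_pairFun_le hg z (r • x)
  rw [hn] at hk
  have h8 : 8 ≤ pairConst d := by
    have : (1 : ℝ) ≤ 2 ^ ((2 * (d : ℝ) + 9 / 2) / 2) :=
      Real.one_le_rpow (by norm_num) (by positivity)
    unfold pairConst; linarith
  have h8' : 8 * A * B * (centreWeight z * relWeight d r)
      ≤ pairConst d * A * B * (centreWeight z * relWeight d r) := by gcongr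
  constructor
  · rw [norm_fderiv_comp_smul _ hr.le]
    have key : ‖fderiv ℝ (pairFun f g z) (r • x)‖
        ≤ pairConst d * A * B * (centreWeight z * relWeight d r) * r := by
      rcases le_total r 1 with h | h
      · have h1 : ∀ y : Vel d, ‖y‖ ≤ 1 → ‖fderiv ℝ (fderiv ℝ (pairFun f g z)) y‖
            ≤ 8 * A * B * (centreWeight z * 1) := fun y _ => by
          refine (hf.norm_pairFun_le hg z y).2.trans ?_
          gcongr
          exact relWeight_le_one _
        have h2 := (SmoothEven.pairFun hf.smooth hg.smooth z).norm_fderiv_le h1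
          (y := r • x) (by rw [hn]; exact h)
        rw [hn] at h2
        refine h2.trans ?_
        have h3 := one_le_mul_relWeight (d := d) hr.le h
        calc 8 * A * B * (centreWeight z * 1) * r
            ≤ 8 * A * B * (centreWeight z * (2 ^ ((2 * (d : ℝ) + 9 / 2) / 2) * relWeight d r)) * r := by
              gcongr
          _ = _ := by rw [pairConst]; ring
      · refine (hk.1.trans h8').trans ?_
        have : 0 ≤ pairConst d * A * B * (centreWeight z * relWeight d r) := by
          have := pairConst_nonneg (d := d); positivity
        nlinarith
    calc r * ‖fderiv ℝ (pairFun f g z) (r • x)‖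
        ≤ r * (pairConst d * A * B * (centreWeight z * relWeight d r) * r) := by gcongr
      _ = _ := by ring
  · rw [norm_fderiv_fderiv_comp_smul
      ((SmoothEven.pairFun hf.smooth hg.smooth z).contDiff 2) hr.le]
    calc r ^ 2 * ‖fderiv ℝ (fderiv ℝ (pairFun f g z)) (r • x)‖
        ≤ r ^ 2 * (pairConst d * A * B * (centreWeight z * relWeight d r)) := by
          gcongr; exact hk.2.trans h8'
      _ = _ := by ring

/-! ### Centre of mass and polar coordinates for pairs of particles -/

/-- The linear change of variables `(z, y) ↦ (z + y, z - y)`. -/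
def pairEquiv (d : ℕ) : (Vel d × Vel d) ≃ₗ[ℝ] (Vel d × Vel d) where
  toFun p := (p.1 + p.2, p.1 - p.2)
  invFun p := ((1 / 2 : ℝ) • (p.1 + p.2), (1 / 2 : ℝ) • (p.1 - p.2))
  map_add' p q := by ext1 <;> simp <;> abel
  map_smul' c p := by ext1 <;> simp [smul_sub]
  left_inv p := by ext1 <;> simp <;> module
  right_inv p := by ext1 <;> simp <;> module

/-- The Jacobian of the change of variables `pairEquiv`, to the power `-1`. -/
def pairScale (d : ℕ) : ℝ :=
  |(LinearMap.det (pairEquiv d : (Vel d × Vel d) →ₗ[ℝ] (Vel d × Vel d)))⁻¹|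

theorem pairScale_pos : 0 < pairScale d :=
  abs_pos.2 (inv_ne_zero (LinearEquiv.isUnit_det' (pairEquiv d)).ne_zero)

theorem continuous_pairEquiv : Continuous (pairEquiv d) := by
  change Continuous fun p : Vel d × Vel d => (p.1 + p.2, p.1 - p.2)
  fun_prop

theorem measurePreserving_pairEquiv :
    MeasurePreserving (pairEquiv d) volume (ENNReal.ofReal (pairScale d) • volume) :=
  have : (volume : Measure (Vel d × Vel d)).IsAddHaarMeasure :=
    inferInstanceAs ((volume : Measure (Vel d)).prod (volume : Measure (Vel d))).IsAddHaarMeasure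
  ⟨continuous_pairEquiv.measurable, Measure.map_linearMap_addHaar_eq_smul_addHaar volume
    (LinearEquiv.isUnit_det' (pairEquiv d)).ne_zero⟩

theorem measurableEmbedding_pairEquiv : MeasurableEmbedding (pairEquiv d) :=
  ((pairEquiv d).toContinuousLinearEquiv.toHomeomorph).measurableEmbedding

/-- The coordinates `((s, z), σ)` of the pair of velocities `z ± e^s σ`. -/
def coordMap (p : (ℝ × Vel d) × Sph d) : Vel d × Vel d :=
  (p.1.2 + Real.exp p.1.1 • (p.2 : Vel d), p.1.2 - Real.exp p.1.1 • (p.2 : Vel d))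

/-- The Lebesgue measure on pairs of velocities, up to a factor, in the coordinates `coordMap`. -/
def coordMeasure (d : ℕ) : Measure ((ℝ × Vel d) × Sph d) :=
  ((expMeasure d).prod volume).prod (surf d)

theorem coordMap_eq : (coordMap (d := d)) = (pairEquiv d) ∘ (Prod.map id polarMap) ∘
    MeasurableEquiv.prodAssoc ∘ Prod.swap ∘ MeasurableEquiv.prodAssoc := rfl

theorem measurableEmbedding_coordMap : MeasurableEmbedding (coordMap (d := d)) := by
  rw [coordMap_eq]
  exact measurableEmbedding_pairEquiv.comp
    ((MeasurableEmbedding.id.prodMap measurableEmbedding_polarMap).comp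
      ((MeasurableEquiv.measurableEmbedding _).comp
        (MeasurableEquiv.prodComm.measurableEmbedding.comp
          (MeasurableEquiv.measurableEmbedding _))))

theorem measurePreserving_coordMap (hd : 1 ≤ d) :
    MeasurePreserving (coordMap (d := d)) (coordMeasure d)
      (ENNReal.ofReal (pairScale d) • volume) := by
  rw [coordMap_eq]
  exact measurePreserving_pairEquiv.comp
    (((MeasurePreserving.id (volume : Measure (Vel d))).prod (measurePreserving_polarMap hd)).comp
      ((measurePreserving_prodAssoc (volume : Measure (Vel d)) (surf d) (expMeasure d)).comp
        (Measure.measurePreserving_swap.comp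
          (measurePreserving_prodAssoc (expMeasure d) (volume : Measure (Vel d)) (surf d)))))

theorem integrable_comp_coordMap (hd : 1 ≤ d) {q : Vel d × Vel d → ℝ} :
    Integrable (fun p => q (coordMap p)) (coordMeasure d) ↔ Integrable q := by
  have h := (measurePreserving_coordMap hd).integrable_comp_emb measurableEmbedding_coordMap (g := q)
  rw [integrable_smul_measure (ENNReal.ofReal_pos.2 pairScale_pos).ne' ENNReal.ofReal_ne_top] at h
  exact h

theorem integral_comp_coordMap (hd : 1 ≤ d) (q : Vel d × Vel d → ℝ) :
    ∫ p, q (coordMap p) ∂(coordMeasure d) = pairScale d * ∫ p, q p := by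
  rw [(measurePreserving_coordMap hd).integral_comp measurableEmbedding_coordMap q,
    integral_smul_measure, ENNReal.toReal_ofReal pairScale_pos.le, smul_eq_mul]

/-! ### The collision operator on pairs of particles -/

theorem sphBoltzmann_neg (b : ℝ → ℝ) {H : Vel d → ℝ} (hH : ∀ x, H (-x) = H x) (σ : Vel d) :
    sphBoltzmann b H (-σ) = sphBoltzmann b H σ := by
  rw [sphBoltzmann_eq, sphBoltzmann_eq, ← integral_sphMap (LinearIsometryEquiv.neg ℝ)]
  congr 1; funext σ'
  simp only [sphMap_coe, LinearIsometryEquiv.coe_neg, inner_neg_neg]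
  rw [mirrorDiff_neg hH]
  simp only [mirrorDiff, axisRefl_neg_axis, hH]

namespace AngularKernel

variable {b : ℝ → ℝ} (hb : AngularKernel d b)
include hb

theorem abs_sphBoltzmann_le {β : ℝ} (hβ : ∀ σ : Sph d, ∫ σ', levyWeight b (σ, σ') ∂(surf d) = β)
    {H : Vel d → ℝ} (hH : SmoothEven H) {C : ℝ} (h1 : ∀ x, ‖x‖ = 1 → ‖fderiv ℝ H x‖ ≤ C)
    (h2 : ∀ x, ‖x‖ = 1 → ‖fderiv ℝ (fderiv ℝ H) x‖ ≤ C) (σ : Sph d) :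
    |sphBoltzmann b H σ| ≤ 6 * C * β := by
  rw [sphBoltzmann_eq, ← hβ σ, ← integral_const_mul, ← Real.norm_eq_abs]
  refine norm_integral_le_of_norm_le ((hb.integrable_levyWeight_right σ).const_mul _)
    (Filter.Eventually.of_forall fun σ' => ?_)
  have := abs_mul_mirrorDiff_le (φ := fun _ => (1 : ℝ)) (C := 1) hH (by simp) h1 h2 (σ, σ')
    (hb.nonneg_inner σ' σ) le_rfl
  simpa using this

theorem sphBoltzmann_add {φ ψ : Vel d → ℝ} (hφ : SmoothEven φ) (hψ : SmoothEven ψ) (σ : Sph d) :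
    sphBoltzmann b (fun x => φ x + ψ x) σ = sphBoltzmann b φ σ + sphBoltzmann b ψ σ := by
  rw [sphBoltzmann_eq, sphBoltzmann_eq, sphBoltzmann_eq,
    ← integral_add (hb.integrable_mirrorDiff hφ σ) (hb.integrable_mirrorDiff hψ σ)]
  congr 1; funext σ'
  simp only [mirrorDiff, smul_eq_mul]; ring

/-- Joint measurability of the spherical Boltzmann operator for families of functions. -/
theorem stronglyMeasurable_sphBoltzmann {X : Type*} [TopologicalSpace X] [MeasurableSpace X]
    [BorelSpace X] [SecondCountableTopology X] {H : X → Vel d → ℝ}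
    (hH : Continuous fun p : X × Vel d => H p.1 p.2) :
    StronglyMeasurable fun p : X × Sph d => sphBoltzmann b (H p.1) p.2 := by
  simp only [sphBoltzmann_eq]
  have hm : Measurable fun q : (X × Sph d) × Sph d => mirrorDiff (H q.1.1) q.1.2 q.2 *
      b (inner ℝ (q.2 : Vel d) (q.1.2 : Vel d)) := by
    refine Measurable.mul ?_ (hb.meas.comp (by fun_prop : Continuous fun q : (X × Sph d) × Sph d =>
      (inner ℝ (q.2 : Vel d) (q.1.2 : Vel d) : ℝ)).measurable)
    unfold mirrorDiff
    have c1 : Continuous fun q : (X × Sph d) × Sph d => H q.1.1 q.2 :=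
      hH.comp ((continuous_fst.comp continuous_fst).prodMk
        (continuous_subtype_val.comp continuous_snd))
    have c2 : Continuous fun q : (X × Sph d) × Sph d => H q.1.1 (axisRefl (q.1.2 : Vel d) q.2) :=
      hH.comp ((continuous_fst.comp continuous_fst).prodMk
        (continuous_axisRefl_sph.comp ((continuous_snd.comp continuous_fst).prodMk continuous_snd)))
    have c3 : Continuous fun q : (X × Sph d) × Sph d => H q.1.1 (q.1.2 : Vel d) :=
      hH.comp ((continuous_fst.comp continuous_fst).prodMk
        (continuous_subtype_val.comp (continuous_snd.comp continuous_fst)))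
    exact (((c1.add c2).const_smul (1 / 2 : ℝ)).sub c3).measurable
  exact hm.stronglyMeasurable.integral_prod_right

end AngularKernel

/-- The collision rate `α` and the kernel `b` are such that collisions of distribution functions
with the decay `weight` are absolutely convergent after integration over the velocities. -/
structure CollisionKernel (d : ℕ) (α b : ℝ → ℝ) : Prop where
  angular : AngularKernel d b
  pos : ∀ r, 0 < r → 0 < α r
  diff : ∀ r, 0 < r → DifferentiableAt ℝ α r
  integrable : Integrable (fun s => α (Real.exp s) * (Real.exp s ^ 2 * relWeight d (Real.exp s)))
    (expMeasure d)

/-- The collision operator acting on the symmetrised tensor product of `f` and `g`. -/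
def pairCollision (α b : ℝ → ℝ) (f g : Vel d → ℝ) (p : Vel d × Vel d) : ℝ :=
  α (‖p.1 - p.2‖ / 2) * sphBoltzmann b
    (fun x => pairFun f g ((1 / 2 : ℝ) • (p.1 + p.2)) ((‖p.1 - p.2‖ / 2) • x)) (relDir p.1 p.2)

theorem collision_eq (α b : ℝ → ℝ) (f : Vel d → ℝ) (v : Vel d) :
    collision (fun r c => α (r / 2) * b c) f v
      = ∫ w, (1 / 2) * pairCollision α b f f (v, w) := by
  rw [collision]
  congr 1; funext w
  rw [pairCollision, sphBoltzmann, ← integral_const_mul, ← integral_const_mul]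
  congr 1; funext σ'
  have h : (‖v - w‖ / 2) • relDir v w = (1 / 2 : ℝ) • (v - w) := by
    by_cases h0 : v - w = 0
    · simp [relDir, h0]
    · rw [relDir, smul_smul]
      congr 1
      have := norm_ne_zero_iff.2 h0
      field_simp
  have e1 : (1 / 2 : ℝ) • (v + w) + (1 / 2 : ℝ) • (v - w) = v := by module
  have e2 : (1 / 2 : ℝ) • (v + w) - (1 / 2 : ℝ) • (v - w) = w := by module
  simp only [collisionIntegrand, postProd, pairFun, h, e1, e2, real_inner_comm]
  ring

theorem pairCollision_swap (α b : ℝ → ℝ) (f g : Vel d → ℝ) (v w : Vel d) :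
    pairCollision α b f g (w, v) = pairCollision α b f g (v, w) := by
  have h1 : relDir w v = -relDir v w := by
    rw [relDir, relDir, norm_sub_rev, ← smul_neg, neg_sub]
  rw [pairCollision, pairCollision]
  simp only [norm_sub_rev w v, add_comm w v, h1]
  rw [sphBoltzmann_neg]
  intro x
  simp only [pairFun, smul_neg, sub_neg_eq_add, ← sub_eq_add_neg]; ring

theorem pairCollision_coordMap (α b : ℝ → ℝ) (f g : Vel d → ℝ) (s : ℝ) (z : Vel d) (σ : Sph d) :
    pairCollision α b f g (coordMap ((s, z), σ))
      = α (Real.exp s) * sphBoltzmann b (fun x => pairFun f g z (Real.exp s • x)) σ := by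
  have e1 : z + Real.exp s • (σ : Vel d) - (z - Real.exp s • (σ : Vel d))
      = (2 * Real.exp s) • (σ : Vel d) := by module
  have e2 : ‖(2 * Real.exp s) • (σ : Vel d)‖ = 2 * Real.exp s := by
    rw [norm_smul, Sph.norm_eq σ, mul_one, Real.norm_of_nonneg (by positivity)]
  have e3 : (1 / 2 : ℝ) • (z + Real.exp s • (σ : Vel d) + (z - Real.exp s • (σ : Vel d))) = z := by
    module
  have e4 : 2 * Real.exp s / 2 = Real.exp s := by ring
  have e5 : (2 * Real.exp s)⁻¹ * (2 * Real.exp s) = 1 := by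
    have := Real.exp_pos s; field_simp
  simp only [pairCollision, coordMap, relDir, e1, e2, e3, e4, smul_smul, e5, one_smul]

theorem pairCollision_diag (α b : ℝ → ℝ) (f g : Vel d → ℝ) (v : Vel d) :
    pairCollision α b f g (v, v) = 0 := by
  simp [pairCollision, sphBoltzmann]

/-- Off the diagonal, every pair of velocities has coordinates `coordMap`. -/
theorem exists_coordMap_eq {v w : Vel d} (h : v ≠ w) : ∃ p, coordMap p = (v, w) := by
  have h0 : ‖v - w‖ ≠ 0 := norm_ne_zero_iff.2 (sub_ne_zero.2 h)
  have hp : 0 < ‖v - w‖ / 2 := by positivity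
  refine ⟨((Real.log (‖v - w‖ / 2), (1 / 2 : ℝ) • (v + w)),
    ⟨relDir v w, mem_sphere_zero_iff_norm.2 ?_⟩), ?_⟩
  · rw [relDir, norm_smul, norm_inv, norm_norm, inv_mul_cancel₀ h0]
  · have e : (‖v - w‖ / 2) • relDir v w = (1 / 2 : ℝ) • (v - w) := by
      rw [relDir, smul_smul]; congr 1; field_simp
    simp only [coordMap, Real.exp_log hp, e]
    ext1 <;> module

theorem continuous_pairFun_smul {f g : Vel d → ℝ} (hf : Continuous f) (hg : Continuous g) :
    Continuous fun q : (ℝ × Vel d) × Vel d => pairFun f g q.1.2 (Real.exp q.1.1 • q.2) := by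
  unfold pairFun; fun_prop

namespace CollisionKernel

variable {α b : ℝ → ℝ} (hk : CollisionKernel d α b)
include hk

theorem continuous_rate : Continuous fun s => α (Real.exp s) :=
  continuous_iff_continuousAt.2 fun s =>
    ((hk.diff _ (Real.exp_pos s)).continuousAt.comp (f := Real.exp) Real.continuous_exp.continuousAt)

theorem stronglyMeasurable_pairCollision {f g : Vel d → ℝ} (hf : Continuous f) (hg : Continuous g) :
    StronglyMeasurable fun p : (ℝ × Vel d) × Sph d => pairCollision α b f g (coordMap p) := by
  have h := hk.angular.stronglyMeasurable_sphBoltzmann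
    (H := fun (q : ℝ × Vel d) x => pairFun f g q.2 (Real.exp q.1 • x))
    (continuous_pairFun_smul hf hg)
  have h2 : StronglyMeasurable fun p : (ℝ × Vel d) × Sph d => α (Real.exp p.1.1) :=
    (hk.continuous_rate.comp (continuous_fst.comp continuous_fst)).stronglyMeasurable
  have e : (fun p : (ℝ × Vel d) × Sph d => pairCollision α b f g (coordMap p))
      = fun p => α (Real.exp p.1.1) *
        sphBoltzmann b (fun x => pairFun f g p.1.2 (Real.exp p.1.1 • x)) p.2 :=
    funext fun p => pairCollision_coordMap α b f g p.1.1 p.1.2 p.2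
  rw [e]
  exact h2.mul h

/-- The dominating function of the collision operator. -/
theorem exists_abs_pairCollision_le : ∃ C : ℝ, 0 ≤ C ∧ ∀ {f g : Vel d → ℝ} {A B : ℝ},
    DecayBound f A → DecayBound g B → ∀ p, |pairCollision α b f g (coordMap p)|
      ≤ C * A * B * (α (Real.exp p.1.1) * (Real.exp p.1.1 ^ 2 * relWeight d (Real.exp p.1.1))
        * centreWeight p.1.2) := by
  obtain ⟨β, hβ0, hβ⟩ := hk.angular.exists_levyMass
  have hP := pairConst_nonneg (d := d)
  refine ⟨6 * pairConst d * β, by positivity, fun {f g A B} hf hg p => ?_⟩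
  obtain ⟨⟨s, z⟩, σ⟩ := p
  rw [pairCollision_coordMap, abs_mul, abs_of_pos (hk.pos _ (Real.exp_pos s))]
  have h := hk.angular.abs_sphBoltzmann_le hβ
    ((SmoothEven.pairFun hf.smooth hg.smooth z).comp_smul (Real.exp s))
    (fun x hx => (hf.norm_pairFun_smul_le hg z s hx).1)
    (fun x hx => (hf.norm_pairFun_smul_le hg z s hx).2) σ
  refine (mul_le_mul_of_nonneg_left h (hk.pos _ (Real.exp_pos s)).le).trans (le_of_eq ?_)
  ring

theorem integrable_bound : Integrable (fun p : (ℝ × Vel d) × Sph d =>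
    α (Real.exp p.1.1) * (Real.exp p.1.1 ^ 2 * relWeight d (Real.exp p.1.1)) * centreWeight p.1.2)
    (coordMeasure d) := by
  have h1 := hk.integrable.mul_prod (integrable_centreWeight (d := d))
  have : IsFiniteMeasure (surf d) := by unfold surf; infer_instance
  exact h1.comp_fst (surf d)

theorem integrable_pairCollision_comp {f g : Vel d → ℝ} {A B : ℝ}
    (hf : DecayBound f A) (hg : DecayBound g B) :
    Integrable (fun p => pairCollision α b f g (coordMap p)) (coordMeasure d) := by
  obtain ⟨C, -, hC⟩ := hk.exists_abs_pairCollision_le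
  exact ((hk.integrable_bound).const_mul (C * A * B)).mono'
    (hk.stronglyMeasurable_pairCollision hf.smooth.continuous
      hg.smooth.continuous).aestronglyMeasurable (Filter.Eventually.of_forall (hC hf hg))

theorem integrable_pairCollision (hd : 1 ≤ d) {f g : Vel d → ℝ} {A B : ℝ}
    (hf : DecayBound f A) (hg : DecayBound g B) : Integrable (pairCollision α b f g) :=
  (integrable_comp_coordMap hd).1 (hk.integrable_pairCollision_comp hf hg)

/-- The collision operators of all functions with given decay are dominated by one integrable
function. -/
theorem exists_dominating (hd : 1 ≤ d) {A : ℝ} : ∃ q : Vel d × Vel d → ℝ, Integrable q ∧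
    ∀ f g : Vel d → ℝ, DecayBound f A → DecayBound g A → ∀ p, |pairCollision α b f g p| ≤ q p := by
  obtain ⟨C, hC0, hC⟩ := hk.exists_abs_pairCollision_le
  set q : Vel d × Vel d → ℝ := fun p => C * A * A * (α (‖p.1 - p.2‖ / 2)
    * ((‖p.1 - p.2‖ / 2) ^ 2 * relWeight d (‖p.1 - p.2‖ / 2))
    * centreWeight ((1 / 2 : ℝ) • (p.1 + p.2))) with hq
  have hqc : ∀ s z (σ : Sph d), q (coordMap ((s, z), σ)) = C * A * A *
      (α (Real.exp s) * (Real.exp s ^ 2 * relWeight d (Real.exp s)) * centreWeight z) := by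
    intro s z σ
    have e1 : z + Real.exp s • (σ : Vel d) - (z - Real.exp s • (σ : Vel d))
        = (2 * Real.exp s) • (σ : Vel d) := by module
    have e2 : ‖(2 * Real.exp s) • (σ : Vel d)‖ = 2 * Real.exp s := by
      rw [norm_smul, Sph.norm_eq σ, mul_one, Real.norm_of_nonneg (by positivity)]
    have e3 : (1 / 2 : ℝ) • (z + Real.exp s • (σ : Vel d) + (z - Real.exp s • (σ : Vel d))) = z := by
      module
    have e4 : 2 * Real.exp s / 2 = Real.exp s := by ring
    simp only [hq, coordMap, e1, e2, e3, e4]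
  refine ⟨q, (integrable_comp_coordMap hd).1 ?_, fun f g hf hg p => ?_⟩
  · have e : (fun p => q (coordMap p)) = fun p : (ℝ × Vel d) × Sph d => C * A * A *
      (α (Real.exp p.1.1) * (Real.exp p.1.1 ^ 2 * relWeight d (Real.exp p.1.1))
        * centreWeight p.1.2) := funext fun p => hqc p.1.1 p.1.2 p.2
    rw [e]
    exact (hk.integrable_bound).const_mul _
  · by_cases h : p.1 = p.2
    · obtain ⟨v, w⟩ := p
      simp only at h
      subst h
      rw [pairCollision_diag, abs_zero]
      simp [hq]
    · obtain ⟨⟨⟨s, z⟩, σ⟩, hp⟩ := exists_coordMap_eq h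
      have := hC hf hg ((s, z), σ)
      rw [← hqc s z σ, hp] at this
      exact this

/-- Weak formulation of the collision operator. -/
theorem integral_mul_collision (hd : 1 ≤ d) {f : Vel d → ℝ} {A : ℝ} (hf : DecayBound f A)
    {φ : Vel d → ℝ} (hφ : Continuous φ) {M : ℝ} (hM : ∀ v, |φ v| ≤ M) :
    ∫ v, φ v * collision (fun r c => α (r / 2) * b c) f v
      = (1 / 2) * ∫ p : Vel d × Vel d, φ p.1 * pairCollision α b f f p := by
  have hi : Integrable (fun p : Vel d × Vel d => φ p.1 * pairCollision α b f f p) :=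
    (hk.integrable_pairCollision hd hf hf).bdd_mul
      (hφ.comp continuous_fst).aestronglyMeasurable (c := M) (Filter.Eventually.of_forall
        fun p => hM p.1)
  rw [Measure.volume_eq_prod, integral_prod _ (by rwa [← Measure.volume_eq_prod]),
    ← integral_const_mul]
  congr 1; funext v
  rw [collision_eq, integral_const_mul]
  simp only [integral_const_mul]
  ring

/-- Symmetrisation in the two particles. -/
theorem integral_mul_pairCollision (hd : 1 ≤ d) {f g : Vel d → ℝ} {A B : ℝ} (hf : DecayBound f A)
    (hg : DecayBound g B) {φ : Vel d → ℝ} (hφ : Continuous φ) {M : ℝ} (hM : ∀ v, |φ v| ≤ M) :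
    ∫ p : Vel d × Vel d, (φ p.1 + φ p.2) * pairCollision α b f g p
      = 2 * ∫ p : Vel d × Vel d, φ p.1 * pairCollision α b f g p := by
  have hi := hk.integrable_pairCollision hd hf hg
  have h1 : Integrable (fun p : Vel d × Vel d => φ p.1 * pairCollision α b f g p) :=
    hi.bdd_mul (hφ.comp continuous_fst).aestronglyMeasurable (c := M)
      (Filter.Eventually.of_forall fun p => hM p.1)
  have h2 : Integrable (fun p : Vel d × Vel d => φ p.2 * pairCollision α b f g p) :=
    hi.bdd_mul (hφ.comp continuous_snd).aestronglyMeasurable (c := M)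
      (Filter.Eventually.of_forall fun p => hM p.2)
  have h3 : ∫ p : Vel d × Vel d, φ p.2 * pairCollision α b f g p
      = ∫ p : Vel d × Vel d, φ p.1 * pairCollision α b f g p := by
    rw [Measure.volume_eq_prod, ← integral_prod_swap]
    congr 1; funext p
    simp only [Prod.snd_swap]
    rw [show p.swap = (p.2, p.1) from rfl, pairCollision_swap]
  simp only [add_mul]
  rw [integral_add h1 h2, h3]; ring

theorem pairCollision_add_const_mul {f g : Vel d → ℝ} (hf : ContDiff ℝ (⊤ : ℕ∞) f)
    (hg : ContDiff ℝ (⊤ : ℕ∞) g) (ε : ℝ) (p : Vel d × Vel d) :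
    pairCollision α b (fun v => f v + ε * g v) (fun v => f v + ε * g v) p
      = pairCollision α b f f p
        + ε * pairCollision α b g (fun v => 2 * f v + ε * g v) p := by
  obtain ⟨v, w⟩ := p
  by_cases h : v = w
  · subst h; simp only [pairCollision_diag]; ring
  · obtain ⟨⟨⟨s, z⟩, σ⟩, hp⟩ := exists_coordMap_eq h
    rw [← hp, pairCollision_coordMap, pairCollision_coordMap, pairCollision_coordMap]
    have e : (fun x => pairFun (fun v => f v + ε * g v) (fun v => f v + ε * g v) z (Real.exp s • x))
        = fun x => pairFun f f z (Real.exp s • x)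
          + ε * pairFun g (fun v => 2 * f v + ε * g v) z (Real.exp s • x) := by
      funext x; simp only [pairFun]; ring
    have h2 : ContDiff ℝ (⊤ : ℕ∞) fun v => 2 * f v + ε * g v :=
      (contDiff_const.mul hf).add (contDiff_const.mul hg)
    rw [e, hk.angular.sphBoltzmann_add ((SmoothEven.pairFun hf hf z).comp_smul _)
      (((SmoothEven.pairFun hg h2 z).comp_smul _).const_mul ε), sphBoltzmann_const_mul]
    ring

end CollisionKernel

/-! ### The Laplacian in polar coordinates -/

/-- The partial derivative in the direction of the `i`-th coordinate. -/
def pd (i : Fin d) (φ : Vel d → ℝ) (x : Vel d) : ℝ := fderiv ℝ φ x (bvec i)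

/-- The Laplacian. -/
def lap (φ : Vel d → ℝ) (x : Vel d) : ℝ := ∑ i, pd i (pd i φ) x

/-- The squared length of the gradient. -/
def gradSq (φ : Vel d → ℝ) (x : Vel d) : ℝ := ∑ i, pd i φ x ^ 2

/-- The Euler operator `x ⬝ ∇`. -/
def euler (φ : Vel d → ℝ) (x : Vel d) : ℝ := fderiv ℝ φ x x

theorem _root_.ContDiff.fderiv_infty {φ : Vel d → ℝ} (h : ContDiff ℝ (⊤ : ℕ∞) φ) :
    ContDiff ℝ (⊤ : ℕ∞) (fderiv ℝ φ) := h.fderiv_right infty_add_one_le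

theorem _root_.ContDiff.pd {φ : Vel d → ℝ} (h : ContDiff ℝ (⊤ : ℕ∞) φ) (i : Fin d) :
    ContDiff ℝ (⊤ : ℕ∞) (pd i φ) := h.fderiv_infty.clm_apply contDiff_const

theorem _root_.ContDiff.euler {φ : Vel d → ℝ} (h : ContDiff ℝ (⊤ : ℕ∞) φ) :
    ContDiff ℝ (⊤ : ℕ∞) (euler φ) := h.fderiv_infty.clm_apply contDiff_id

theorem _root_.ContDiff.lap {φ : Vel d → ℝ} (h : ContDiff ℝ (⊤ : ℕ∞) φ) :
    ContDiff ℝ (⊤ : ℕ∞) (lap φ) := ContDiff.sum fun i _ => (h.pd i).pd i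

theorem _root_.ContDiff.gradSq {φ : Vel d → ℝ} (h : ContDiff ℝ (⊤ : ℕ∞) φ) :
    ContDiff ℝ (⊤ : ℕ∞) (gradSq φ) := ContDiff.sum fun i _ => (h.pd i).pow 2

theorem hasFDerivAt_fderiv {φ : Vel d → ℝ} (h : ContDiff ℝ (⊤ : ℕ∞) φ) (x : Vel d) :
    HasFDerivAt (fderiv ℝ φ) (fderiv ℝ (fderiv ℝ φ) x) x :=
  (h.fderiv_infty.differentiable (by simp) x).hasFDerivAt

theorem fderiv_pd {φ : Vel d → ℝ} (h : ContDiff ℝ (⊤ : ℕ∞) φ) (i : Fin d) (x v : Vel d) :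
    fderiv ℝ (pd i φ) x v = fderiv ℝ (fderiv ℝ φ) x v (bvec i) := by
  have := ((hasFDerivAt_fderiv h x).clm_apply (hasFDerivAt_const (bvec i) x)).fderiv
  change fderiv ℝ (fun x => fderiv ℝ φ x (bvec i)) x v = _
  rw [this]; simp

theorem fderiv_euler {φ : Vel d → ℝ} (h : ContDiff ℝ (⊤ : ℕ∞) φ) (x v : Vel d) :
    fderiv ℝ (euler φ) x v = fderiv ℝ (fderiv ℝ φ) x v x + fderiv ℝ φ x v := by
  have := ((hasFDerivAt_fderiv h x).clm_apply (hasFDerivAt_id x)).fderiv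
  change fderiv ℝ (fun x => fderiv ℝ φ x (id x)) x v = _
  rw [this]; simp [add_comm]

theorem continuous_rotVec (i j : Fin d) : Continuous (rotVec i j : Vel d → Vel d) := by
  unfold rotVec; fun_prop

/-- `rotVec` as a linear map. -/
def rotVecL (i j : Fin d) : Vel d →L[ℝ] Vel d where
  toFun := rotVec i j
  map_add' x y := by simp only [rotVec, PiLp.add_apply]; module
  map_smul' c x := by simp only [rotVec, PiLp.smul_apply, smul_eq_mul, RingHom.id_apply]; module
  cont := continuous_rotVec i j

theorem fderiv_rotL {φ : Vel d → ℝ} (h : ContDiff ℝ (⊤ : ℕ∞) φ) (i j : Fin d) (x v : Vel d) :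
    fderiv ℝ (rotL i j φ) x v
      = fderiv ℝ (fderiv ℝ φ) x v (rotVec i j x) + fderiv ℝ φ x (rotVec i j v) := by
  have := ((hasFDerivAt_fderiv h x).clm_apply ((rotVecL i j).hasFDerivAt (x := x))).fderiv
  change fderiv ℝ (fun x => fderiv ℝ φ x (rotVecL i j x)) x v = _
  rw [this]
  simp [rotVecL, add_comm]

theorem sum_rotVec_rotVec (x : Vel d) :
    ∑ i, ∑ j, rotVec i j (rotVec i j x) = -(2 * ((d : ℝ) - 1)) • x := by
  refine ext_inner_left ℝ fun w => ?_
  simp only [inner_sum, inner_rotVec_right _ _ w]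
  simp only [Finset.sum_neg_distrib, sum_inner_rotVec_rotVec, inner_smul_right]
  ring

/-- The sum over all planes of the squared rotations. -/
theorem sum_bilin_rotVec (B : Vel d →L[ℝ] Vel d →L[ℝ] ℝ) (x : Vel d) :
    ∑ i, ∑ j, B (rotVec i j x) (rotVec i j x)
      = 2 * (‖x‖ ^ 2 * ∑ i, B (bvec i) (bvec i) - B x x) := by
  have e : ∀ i j, B (rotVec i j x) (rotVec i j x) = x i ^ 2 * B (bvec j) (bvec j)
      + x j ^ 2 * B (bvec i) (bvec i) - x i * x j * B (bvec i) (bvec j)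
      - x j * x i * B (bvec j) (bvec i) := fun i j => by
    simp only [rotVec, map_sub, map_smul, sub_apply, smul_apply, smul_eq_mul]; ring
  have hB : B x x = ∑ i, ∑ j, x i * x j * B (bvec i) (bvec j) := by
    conv_lhs => rw [← sum_smul_bvec x]
    simp only [map_sum, map_smul, sum_apply, smul_apply, smul_eq_mul, Finset.mul_sum]
    rw [Finset.sum_comm]
    exact Finset.sum_congr rfl fun i _ => Finset.sum_congr rfl fun j _ => by ring
  have hn : ‖x‖ ^ 2 = ∑ i, x i ^ 2 := EuclideanSpace.real_norm_sq_eq x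
  have h1 : ∑ i, ∑ j, x i ^ 2 * B (bvec j) (bvec j) = ‖x‖ ^ 2 * ∑ i, B (bvec i) (bvec i) := by
    rw [hn, Finset.sum_mul_sum]
  have h2 : ∑ i, ∑ j, x j ^ 2 * B (bvec i) (bvec i) = ‖x‖ ^ 2 * ∑ i, B (bvec i) (bvec i) := by
    rw [Finset.sum_comm, h1]
  have h3 : ∑ i, ∑ j, x j * x i * B (bvec j) (bvec i) = B x x := by
    rw [Finset.sum_comm, hB]
  simp only [e, Finset.sum_sub_distrib, Finset.sum_add_distrib, h1, h2, h3, ← hB]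
  ring

/-- The Laplacian in polar coordinates. -/
theorem lap_eq_sphLap {φ : Vel d → ℝ} (h : ContDiff ℝ (⊤ : ℕ∞) φ) (x : Vel d) :
    ‖x‖ ^ 2 * lap φ x = euler (euler φ) x + ((d : ℝ) - 2) * euler φ x + sphLap φ x := by
  have h1 : sphLap φ x = (1 / 2) * ∑ i, ∑ j, (fderiv ℝ (fderiv ℝ φ) x (rotVec i j x) (rotVec i j x)
      + fderiv ℝ φ x (rotVec i j (rotVec i j x))) := by
    rw [sphLap]
    congr 1
    exact Finset.sum_congr rfl fun i _ => Finset.sum_congr rfl fun j _ => fderiv_rotL h i j x _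
  have h2 : ∑ i, ∑ j, fderiv ℝ φ x (rotVec i j (rotVec i j x))
      = -(2 * ((d : ℝ) - 1)) * euler φ x := by
    rw [euler, ← smul_eq_mul, ← map_smul, ← sum_rotVec_rotVec]
    simp only [map_sum]
  have h3 : euler (euler φ) x = fderiv ℝ (fderiv ℝ φ) x x x + euler φ x := fderiv_euler h x x
  have h4 : lap φ x = ∑ i, fderiv ℝ (fderiv ℝ φ) x (bvec i) (bvec i) :=
    Finset.sum_congr rfl fun i _ => fderiv_pd h i x _
  simp only [Finset.sum_add_distrib, sum_bilin_rotVec, h2] at h1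
  rw [h1, h3, h4]
  ring

/-- The gradient in polar coordinates. -/
theorem gradSq_eq_sphGamma (φ : Vel d → ℝ) (x : Vel d) :
    ‖x‖ ^ 2 * gradSq φ x = euler φ x ^ 2 + sphGamma φ x := by
  set B : Vel d →L[ℝ] Vel d →L[ℝ] ℝ := (fderiv ℝ φ x).smulRight (fderiv ℝ φ x) with hB
  have e : ∀ v, B v v = fderiv ℝ φ x v ^ 2 := fun v => by simp [hB, sq]
  have h := sum_bilin_rotVec B x
  simp only [e] at h
  have h1 : sphGamma φ x = (1 / 2) * ∑ i, ∑ j, fderiv ℝ φ x (rotVec i j x) ^ 2 := rfl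
  have h2 : gradSq φ x = ∑ i, fderiv ℝ φ x (bvec i) ^ 2 := rfl
  rw [h1, h, h2, euler]
  ring

namespace SmoothEven

variable {φ : Vel d → ℝ}

theorem euler (h : SmoothEven φ) : SmoothEven (euler φ) :=
  ⟨h.smooth.euler, fun x => by
    simp only [Boltzmann.euler]; rw [h.fderiv_neg, map_neg, neg_neg]⟩

theorem lap (h : SmoothEven φ) : SmoothEven (lap φ) := by
  refine ⟨h.smooth.lap, fun x => ?_⟩
  have e : ∀ i x, pd i φ (-x) = -pd i φ x := fun i x => h.fderiv_neg x _
  refine Finset.sum_congr rfl fun i _ => ?_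
  have e2 : (fun x => pd i φ (-x)) = fun x => -pd i φ x := funext (e i)
  have h1 : fderiv ℝ (fun x => pd i φ (-x)) x (bvec i) = -fderiv ℝ (pd i φ) (-x) (bvec i) := by
    have := (((h.smooth.pd i).differentiable (by simp) (-x)).hasFDerivAt.comp x
      (hasFDerivAt_id x).neg).fderiv
    change fderiv ℝ (pd i φ ∘ Neg.neg) x (bvec i) = _
    rw [this]; simp
  rw [e2, fderiv_fun_neg] at h1
  simp only [neg_apply, neg_inj] at h1
  exact h1.symm

theorem gradSq (h : SmoothEven φ) : SmoothEven (gradSq φ) :=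
  ⟨h.smooth.gradSq, fun x => Finset.sum_congr rfl fun i _ => by
    rw [show pd i φ (-x) = -pd i φ x from h.fderiv_neg x _, neg_sq]⟩

end SmoothEven

/-! ### Dilations -/

theorem euler_comp_smul (φ : Vel d → ℝ) (r : ℝ) (x : Vel d) :
    euler (fun x => φ (r • x)) x = euler φ (r • x) := by
  rw [euler, euler, fderiv_comp_smul, smul_apply, map_smul]

theorem pd_comp_smul (φ : Vel d → ℝ) (r : ℝ) (i : Fin d) :
    pd i (fun x => φ (r • x)) = fun x => r * pd i φ (r • x) := by
  funext x
  rw [pd, pd, fderiv_comp_smul, smul_apply, smul_eq_mul]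

theorem gradSq_comp_smul (φ : Vel d → ℝ) (r : ℝ) (x : Vel d) :
    gradSq (fun x => φ (r • x)) x = r ^ 2 * gradSq φ (r • x) := by
  simp only [gradSq, pd_comp_smul, mul_pow, Finset.mul_sum]

theorem lap_comp_smul {φ : Vel d → ℝ} (h : ContDiff ℝ (⊤ : ℕ∞) φ) (r : ℝ) (x : Vel d) :
    lap (fun x => φ (r • x)) x = r ^ 2 * lap φ (r • x) := by
  rw [lap, lap, Finset.mul_sum]
  refine Finset.sum_congr rfl fun i _ => ?_
  have hd : Differentiable ℝ (fun x => pd i φ (r • x)) :=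
    ((h.pd i).differentiable (by simp)).comp (differentiable_id.const_smul r)
  rw [pd_comp_smul, pd, fderiv_const_mul (hd x), fderiv_comp_smul, smul_apply, smul_apply, pd]
  simp only [smul_eq_mul]; ring

theorem hasDerivAt_comp_exp_smul {φ : Vel d → ℝ} (h : Differentiable ℝ φ) (x : Vel d) (s : ℝ) :
    HasDerivAt (fun s => φ (Real.exp s • x)) (euler φ (Real.exp s • x)) s :=
  (h (Real.exp s • x)).hasFDerivAt.comp_hasDerivAt s ((Real.hasDerivAt_exp s).smul_const x)

theorem SmoothEven.evenFamily_smul {φ : Vel d → ℝ} (h : SmoothEven φ) :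
    EvenFamily (fun s x => φ (Real.exp s • x)) :=
  ⟨h.smooth.comp ((Real.contDiff_exp.comp contDiff_fst).smul contDiff_snd),
    fun s x => by simp only [smul_neg, h.even]⟩

theorem AngularKernel.hasDerivAt_dirForm_smul {b : ℝ → ℝ} (hb : AngularKernel d b)
    {φ ψ : Vel d → ℝ} (hφ : SmoothEven φ) (hψ : SmoothEven ψ) (s : ℝ) :
    HasDerivAt (fun s => dirForm b (fun x => φ (Real.exp s • x)) (fun x => ψ (Real.exp s • x)))
      (dirForm b (fun x => euler φ (Real.exp s • x)) (fun x => ψ (Real.exp s • x))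
        + dirForm b (fun x => φ (Real.exp s • x)) (fun x => euler ψ (Real.exp s • x))) s := by
  have h := hb.hasDerivAt_dirForm hφ.evenFamily_smul hψ.evenFamily_smul s
  simp only [fun x => (hasDerivAt_comp_exp_smul hφ.differentiable x s).deriv,
    fun x => (hasDerivAt_comp_exp_smul hψ.differentiable x s).deriv] at h
  exact h

theorem dirForm_congr_left (b : ℝ → ℝ) {φ φ' : Vel d → ℝ} (ψ : Vel d → ℝ)
    (h : ∀ x, ‖x‖ = 1 → φ x = φ' x) : dirForm b φ ψ = dirForm b φ' ψ := by
  rw [dirForm, dirForm]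
  congr 2; funext p
  rw [dirInt, dirInt, h _ (Sph.norm_eq p.1), h _ (Sph.norm_eq p.2)]

theorem euler_exp {φ : Vel d → ℝ} (h : Differentiable ℝ φ) (x : Vel d) :
    euler (fun x => Real.exp (φ x)) x = Real.exp (φ x) * euler φ x := by
  rw [euler, fderiv_exp (h x), smul_apply, smul_eq_mul, euler]

/-- The radial part of the dissipation of the Fisher information is bounded by a total derivative
in the radial variable. -/
theorem AngularKernel.radial_dissipation_le {b : ℝ → ℝ} (hb : AngularKernel d b) {H : Vel d → ℝ}
    (hH : SmoothEven H) {a a' : ℝ} (ha : 0 < a)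
    (ha' : ENNReal.ofReal (|a'| / (2 * a)) ≤ bestLogSobolev d b ^ (1 / 2 : ℝ)) :
    a * dirForm b (fun x => 2 * lap H x + gradSq H x) (fun x => Real.exp (H x))
      ≤ 2 * (((d : ℝ) - 2) * a * dirForm b (euler H) (fun x => Real.exp (H x))
        + a' * dirForm b (euler H) (fun x => Real.exp (H x))
        + a * (dirForm b (euler (euler H)) (fun x => Real.exp (H x))
          + dirForm b (euler H) (fun x => Real.exp (H x) * euler H x))) := by
  have hF := hH.exp
  have hu := hH.euler
  have h1 := hb.radial_inequality ha ha' hF (fun x => Real.exp_pos _) hu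
  simp only [Real.log_exp] at h1
  have e : dirForm b (fun x => 2 * lap H x + gradSq H x) (fun x => Real.exp (H x))
      = dirForm b (fun x => 2 * (euler (euler H) x + ((d : ℝ) - 2) * euler H x + sphLap H x)
        + (euler H x ^ 2 + sphGamma H x)) (fun x => Real.exp (H x)) := by
    refine dirForm_congr_left b _ fun x hx => ?_
    rw [← lap_eq_sphLap hH.smooth, ← gradSq_eq_sphGamma, hx]; ring
  rw [e, hb.dirForm_add_left ((((hu.euler).add (hu.const_mul _)).add hH.sphLap).const_mul 2)
      ((hu.pow 2).add hH.sphGamma) hF, dirForm_const_mul_left,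
    hb.dirForm_add_left ((hu.euler).add (hu.const_mul _)) hH.sphLap hF,
    hb.dirForm_add_left hu.euler (hu.const_mul _) hF, dirForm_const_mul_left,
    hb.dirForm_add_left (hu.pow 2) hH.sphGamma hF]
  linarith

/-! ### Bounds of the dissipation on a sphere -/

theorem SmoothEven.norm_fderiv_euler_le {γ : Vel d → ℝ} (hγ : SmoothEven γ) {P : ℝ}
    (h1 : ∀ x, ‖x‖ = 1 → ‖fderiv ℝ γ x‖ ≤ P) (h2 : ∀ x, ‖x‖ = 1 → ‖fderiv ℝ (fderiv ℝ γ) x‖ ≤ P)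
    {x : Vel d} (hx : ‖x‖ = 1) : ‖fderiv ℝ (Boltzmann.euler γ) x‖ ≤ 2 * P := by
  have hP : 0 ≤ P := (norm_nonneg _).trans (h1 x hx)
  refine ContinuousLinearMap.opNorm_le_bound _ (by positivity) fun v => ?_
  rw [fderiv_euler hγ.smooth]
  have a1 : ‖fderiv ℝ (fderiv ℝ γ) x v x‖ ≤ P * ‖v‖ := by
    refine (ContinuousLinearMap.le_opNorm₂ _ _ _).trans ?_
    rw [hx, mul_one]
    exact mul_le_mul_of_nonneg_right (h2 x hx) (norm_nonneg v)
  have a2 : ‖fderiv ℝ γ x v‖ ≤ P * ‖v‖ :=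
    (ContinuousLinearMap.le_opNorm _ _).trans
      (mul_le_mul_of_nonneg_right (h1 x hx) (norm_nonneg v))
  refine (norm_add_le _ _).trans ?_
  linarith

theorem abs_euler_le {γ : Vel d → ℝ} {P : ℝ} {x : Vel d} (h1 : ‖fderiv ℝ γ x‖ ≤ P)
    (hx : ‖x‖ = 1) : |euler γ x| ≤ P := by
  have := (fderiv ℝ γ x).le_opNorm x
  rw [hx, mul_one] at this
  exact this.trans h1

/-- The surface of the sphere. -/
def sphArea (d : ℕ) : ℝ := (surf d).real univ

theorem sphArea_nonneg : 0 ≤ sphArea d := measureReal_nonneg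

namespace AngularKernel

variable {b : ℝ → ℝ} (hb : AngularKernel d b)
include hb

theorem abs_dirForm_le_area {β : ℝ}
    (hβ : ∀ σ : Sph d, ∫ σ', levyWeight b (σ, σ') ∂(surf d) = β) {φ ψ : Vel d → ℝ}
    (hφ : SmoothEven φ) (hψ : SmoothEven ψ) {K C : ℝ} (hK : ∀ x, ‖x‖ = 1 → |φ x| ≤ K)
    (h1 : ∀ x, ‖x‖ = 1 → ‖fderiv ℝ ψ x‖ ≤ C)
    (h2 : ∀ x, ‖x‖ = 1 → ‖fderiv ℝ (fderiv ℝ ψ) x‖ ≤ C) :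
    |dirForm b φ ψ| ≤ K * (6 * C * β) * sphArea d := by
  have h := (hb.integral_mul_sphBoltzmann hφ hψ).2
  have hf : IsFiniteMeasure (surf d) := by unfold surf; infer_instance
  have h3 : ‖∫ σ : Sph d, φ σ * sphBoltzmann b ψ σ ∂(surf d)‖ ≤ K * (6 * C * β) * sphArea d := by
    refine norm_integral_le_of_norm_le_const (Filter.Eventually.of_forall fun σ => ?_)
    rw [norm_mul, Real.norm_eq_abs, Real.norm_eq_abs]
    have hk := hK σ (Sph.norm_eq σ)
    exact mul_le_mul hk (hb.abs_sphBoltzmann_le hβ hψ h1 h2 σ) (abs_nonneg _)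
      ((abs_nonneg _).trans hk)
  rwa [h, norm_neg, Real.norm_eq_abs] at h3

theorem abs_dirForm_le_mass {β : ℝ}
    (hβ : ∀ σ : Sph d, ∫ σ', levyWeight b (σ, σ') ∂(surf d) = β) {φ ψ : Vel d → ℝ}
    (hφ : SmoothEven φ) (hψ : SmoothEven ψ) {C C' : ℝ} (hC : ∀ x, ‖x‖ = 1 → ‖fderiv ℝ φ x‖ ≤ C)
    (hC' : ∀ x, ‖x‖ = 1 → ‖fderiv ℝ ψ x‖ ≤ C') :
    |dirForm b φ ψ| ≤ 3 * C * C' * (β * sphArea d) := by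
  refine (hb.abs_dirForm_le hφ hψ hC hC').trans (le_of_eq ?_)
  have hf : IsFiniteMeasure (surf d) := by unfold surf; infer_instance
  rw [integral_prod _ hb.integrable_levyWeight]
  simp only [hβ, integral_const, smul_eq_mul, sphArea]
  ring

/-- Bounds for the terms in the radial dissipation. All are of second order in the bound `P` of
the derivatives of `log F`. -/
theorem radial_bounds {β : ℝ} (hβ0 : 0 ≤ β)
    (hβ : ∀ σ : Sph d, ∫ σ', levyWeight b (σ, σ') ∂(surf d) = β) {γ : Vel d → ℝ}
    (hγ : SmoothEven γ) {P w : ℝ} (h1 : ∀ x, ‖x‖ = 1 → ‖fderiv ℝ γ x‖ ≤ P)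
    (h1' : ∀ x, ‖x‖ = 1 → ‖fderiv ℝ γ x‖ ^ 2 ≤ P)
    (h2 : ∀ x, ‖x‖ = 1 → ‖fderiv ℝ (fderiv ℝ γ) x‖ ≤ P)
    (hw : ∀ x, ‖x‖ = 1 → Real.exp (γ x) ≤ w) :
    |dirForm b (euler γ) (fun x => Real.exp (γ x))| ≤ 24 * β * sphArea d * (w * P ^ 2) ∧
    |dirForm b (euler γ) (fun x => Real.exp (γ x) * euler γ x)| ≤ 24 * β * sphArea d * (w * P ^ 2) ∧
    |dirForm b (euler (euler γ)) (fun x => Real.exp (γ x))| ≤ 24 * β * sphArea d * (w * P ^ 2) ∧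
    ∀ {h : Vel d → ℝ} {K : ℝ}, SmoothEven h → (∀ x, ‖x‖ = 1 → |h x| ≤ K) →
      |dirForm b h (fun x => Real.exp (γ x))| ≤ 12 * β * sphArea d * K * (w * P) := by
  rcases isEmpty_or_nonempty (Sph d) with hS | ⟨⟨τ⟩⟩
  · have h0 : ∀ φ ψ : Vel d → ℝ, dirForm b φ ψ = 0 := fun φ ψ => by
      rw [dirForm, integral_of_isEmpty, mul_zero]
    have h3 : sphArea d = 0 := by
      rw [sphArea, univ_eq_empty_iff.2 hS]; simp
    simp [h0, h3]
  have hP : 0 ≤ P := (norm_nonneg _).trans (h1 τ τ.norm_eq)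
  have hw0 : 0 ≤ w := (Real.exp_pos _).le.trans (hw τ τ.norm_eq)
  have hS := sphArea_nonneg (d := d)
  have hF := hγ.exp
  have hu := hγ.euler
  have d1 : ∀ x, ‖x‖ = 1 → ‖fderiv ℝ (fun x => Real.exp (γ x)) x‖ ≤ w * P := fun x hx => by
    rw [norm_fderiv_exp hγ.differentiable]
    exact mul_le_mul (hw x hx) (h1 x hx) (norm_nonneg _) hw0
  have d2 : ∀ x, ‖x‖ = 1 → ‖fderiv ℝ (fderiv ℝ fun x => Real.exp (γ x)) x‖ ≤ w * (2 * P) :=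
    fun x hx => by
      refine (norm_fderiv_fderiv_exp_le (hγ.contDiff 2) x).trans ?_
      refine mul_le_mul (hw x hx) ?_ (by positivity) hw0
      linarith [h2 x hx, h1' x hx]
  have d3 : ∀ x, ‖x‖ = 1 → ‖fderiv ℝ (euler γ) x‖ ≤ 2 * P := fun x hx =>
    hγ.norm_fderiv_euler_le h1 h2 hx
  have d4 : ∀ x, ‖x‖ = 1 → ‖fderiv ℝ (fun x => Real.exp (γ x) * euler γ x) x‖ ≤ w * (3 * P) :=
    fun x hx => by
      refine (norm_fderiv_mul_le hF.differentiable hu.differentiable x).trans ?_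
      rw [norm_fderiv_exp hγ.differentiable, abs_of_pos (Real.exp_pos _)]
      have t1 : |euler γ x| * (Real.exp (γ x) * ‖fderiv ℝ γ x‖) ≤ w * P := by
        calc |euler γ x| * (Real.exp (γ x) * ‖fderiv ℝ γ x‖)
            ≤ ‖fderiv ℝ γ x‖ * (Real.exp (γ x) * ‖fderiv ℝ γ x‖) := by
              gcongr; exact abs_euler_le le_rfl hx
          _ = Real.exp (γ x) * ‖fderiv ℝ γ x‖ ^ 2 := by ring
          _ ≤ w * P := mul_le_mul (hw x hx) (h1' x hx) (by positivity) hw0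
      have t2 : Real.exp (γ x) * ‖fderiv ℝ (euler γ) x‖ ≤ w * (2 * P) :=
        mul_le_mul (hw x hx) (d3 x hx) (norm_nonneg _) hw0
      linarith
  have hn : 0 ≤ β * sphArea d * (w * P ^ 2) := by positivity
  refine ⟨?_, ?_, ?_, fun {h K} hh hK => ?_⟩
  · refine (hb.abs_dirForm_le_mass hβ hu hF d3 d1).trans ?_
    nlinarith
  · refine (hb.abs_dirForm_le_mass hβ hu (hF.mul hu) d3 d4).trans ?_
    nlinarith
  · refine (hb.abs_dirForm_le_area hβ hu.euler hF (K := 2 * P)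
      (fun x hx => abs_euler_le (d3 x hx) hx) (C := w * (2 * P))
      (fun x hx => (d1 x hx).trans (by nlinarith [mul_nonneg hw0 hP])) d2).trans ?_
    nlinarith
  · refine (hb.abs_dirForm_le_area hβ hh hF hK (C := w * (2 * P))
      (fun x hx => (d1 x hx).trans (by nlinarith [mul_nonneg hw0 hP])) d2).trans (le_of_eq ?_)
    ring

theorem stronglyMeasurable_dirForm {X : Type*} [TopologicalSpace X] [MeasurableSpace X]
    [BorelSpace X] [SecondCountableTopology X] {φ ψ : X → Vel d → ℝ}
    (hφ : Continuous fun p : X × Vel d => φ p.1 p.2)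
    (hψ : Continuous fun p : X × Vel d => ψ p.1 p.2) :
    StronglyMeasurable fun t => dirForm b (φ t) (ψ t) := by
  have hm : Measurable fun q : X × (Sph d × Sph d) => dirInt b (φ q.1) (ψ q.1) q.2 := by
    have c : ∀ {φ : X → Vel d → ℝ}, (Continuous fun p : X × Vel d => φ p.1 p.2) →
        Continuous fun q : X × (Sph d × Sph d) => φ q.1 q.2.2 - φ q.1 q.2.1 := fun {φ} hφ =>
      (hφ.comp (continuous_fst.prodMk (continuous_subtype_val.comp
        (continuous_snd.comp continuous_snd)))).sub
      (hφ.comp (continuous_fst.prodMk (continuous_subtype_val.comp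
        (continuous_fst.comp continuous_snd))))
    unfold dirInt
    exact ((c hφ).measurable.mul (c hψ).measurable).mul (hb.measurable_inner.comp measurable_snd)
  exact (hm.stronglyMeasurable.integral_prod_right (ν := (surf d).prod (surf d))).const_mul (1 / 2)

end AngularKernel

/-! ### Logarithms of distribution functions -/

/-- The sum of the values of `l` at two particles, in terms of the centre of mass `z` and half of the
relative velocity `y`. -/
def sumFun (l : Vel d → ℝ) (z y : Vel d) : ℝ := l (z + y) + l (z - y)

/-- A function with bounded first and second derivatives whose exponential decays. -/
structure LogBound (l : Vel d → ℝ) (M A : ℝ) : Prop where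
  smooth : ContDiff ℝ (⊤ : ℕ∞) l
  le_fderiv : ∀ v, ‖fderiv ℝ l v‖ ≤ M
  le_fderiv_two : ∀ v, ‖fderiv ℝ (fderiv ℝ l) v‖ ≤ M
  exp_le : ∀ v, Real.exp (l v) ≤ A * weight v

theorem SmoothEven.sumFun {l : Vel d → ℝ} (hl : ContDiff ℝ (⊤ : ℕ∞) l) (z : Vel d) :
    SmoothEven (sumFun l z) :=
  ⟨(hl.comp (contDiff_const.add contDiff_id)).add (hl.comp (contDiff_const.sub contDiff_id)),
    fun y => by simp only [Boltzmann.sumFun, sub_neg_eq_add, ← sub_eq_add_neg]; ring⟩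

theorem hasFDerivAt_sumFun {l : Vel d → ℝ} (hl : Differentiable ℝ l) (z y : Vel d) :
    HasFDerivAt (sumFun l z) (fderiv ℝ l (z + y) - fderiv ℝ l (z - y)) y := by
  have h1 : HasFDerivAt (fun y => l (z + y)) (fderiv ℝ l (z + y)) y := by
    have := (hl (z + y)).hasFDerivAt.comp (f := fun y => z + y) y ((hasFDerivAt_id y).const_add z)
    rw [ContinuousLinearMap.comp_id] at this
    exact this
  have h2 : HasFDerivAt (fun y => l (z - y)) (-fderiv ℝ l (z - y)) y := by
    have := (hl (z - y)).hasFDerivAt.comp (f := fun y => z - y) y ((hasFDerivAt_id y).const_sub z)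
    rw [ContinuousLinearMap.comp_neg, ContinuousLinearMap.comp_id] at this
    exact this
  rw [sub_eq_add_neg]
  exact h1.add h2

theorem norm_fderiv_fderiv_sumFun_le {l : Vel d → ℝ} (hl : ContDiff ℝ (⊤ : ℕ∞) l) (z y : Vel d)
    {M : ℝ} (hM : ∀ v, ‖fderiv ℝ (fderiv ℝ l) v‖ ≤ M) :
    ‖fderiv ℝ (fderiv ℝ (sumFun l z)) y‖ ≤ 2 * M := by
  have h1 : ContDiff ℝ 2 fun y : Vel d => l (z + y) :=
    (hl.of_le two_le_infty).comp (contDiff_const.add contDiff_id)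
  have h2 : ContDiff ℝ 2 fun y : Vel d => l (z - y) :=
    (hl.of_le two_le_infty).comp (contDiff_const.sub contDiff_id)
  rw [norm_fderiv_fderiv]
  change ‖iteratedFDeriv ℝ 2 ((fun y => l (z + y)) + fun y => l (z - y)) y‖ ≤ _
  rw [iteratedFDeriv_add_apply h1.contDiffAt h2.contDiffAt]
  refine (norm_add_le _ _).trans ?_
  rw [iteratedFDeriv_comp_add_left, norm_iteratedFDeriv_comp_const_sub, ← norm_fderiv_fderiv,
    ← norm_fderiv_fderiv]
  linarith [hM (z + y), hM (z - y)]

namespace LogBound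

variable {l : Vel d → ℝ} {M A : ℝ} (hl : LogBound l M A)
include hl

theorem nonneg : 0 ≤ M := (norm_nonneg _).trans (hl.le_fderiv 0)

theorem exp_sumFun_le (z : Vel d) {y : Vel d} {r : ℝ} (hy : ‖y‖ = r) :
    Real.exp (sumFun l z y) ≤ A ^ 2 * (centreWeight z * relWeight d r) := by
  have h1 := hl.exp_le (z + y)
  have h2 := hl.exp_le (z - y)
  rw [sumFun, Real.exp_add]
  refine (mul_le_mul h1 h2 (Real.exp_pos _).le ((Real.exp_pos _).le.trans h1)).trans ?_
  have := mul_le_mul_of_nonneg_left (weight_mul_weight_le z y) (sq_nonneg A)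
  rw [hy] at this
  linarith

/-- The bounds of the logarithm of a pair of distribution functions on the sphere of radius `r`. -/
theorem sphere_bounds (z : Vel d) {r : ℝ} (hr : 0 < r) {x : Vel d} (hx : ‖x‖ = 1) :
    ‖fderiv ℝ (fun x => sumFun l z (r • x)) x‖ ≤ (2 * M + (2 * M) ^ 2) * r ^ 2 ∧
    ‖fderiv ℝ (fun x => sumFun l z (r • x)) x‖ ^ 2 ≤ (2 * M + (2 * M) ^ 2) * r ^ 2 ∧
    ‖fderiv ℝ (fderiv ℝ fun x => sumFun l z (r • x)) x‖ ≤ (2 * M + (2 * M) ^ 2) * r ^ 2 ∧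
    Real.exp (sumFun l z (r • x)) ≤ A ^ 2 * (centreWeight z * relWeight d r) := by
  have hM := hl.nonneg
  have hn : ‖r • x‖ = r := by rw [norm_smul, hx, mul_one, Real.norm_of_nonneg hr.le]
  have hH := SmoothEven.sumFun hl.smooth z
  have h2 : ∀ y, ‖fderiv ℝ (fderiv ℝ (sumFun l z)) y‖ ≤ 2 * M := fun y =>
    norm_fderiv_fderiv_sumFun_le hl.smooth z y hl.le_fderiv_two
  have h1 : ‖fderiv ℝ (sumFun l z) (r • x)‖ ≤ 2 * M * r := by
    have := hH.norm_fderiv_le (fun y _ => h2 y) (le_refl ‖r • x‖)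
    rwa [hn] at this
  have h1' : ‖fderiv ℝ (sumFun l z) (r • x)‖ ≤ 2 * M := by
    rw [(hasFDerivAt_sumFun (hl.smooth.differentiable (by simp)) z (r • x)).fderiv]
    refine (ContinuousLinearMap.opNorm_le_bound _ (by positivity) fun v => ?_)
    rw [sub_apply]
    have a1 := (fderiv ℝ l (z + r • x)).le_of_opNorm_le (hl.le_fderiv _) v
    have a2 := (fderiv ℝ l (z - r • x)).le_of_opNorm_le (hl.le_fderiv _) v
    refine (norm_sub_le _ _).trans ?_
    linarith
  have hr2 : 0 ≤ r ^ 2 := sq_nonneg r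
  refine ⟨?_, ?_, ?_, hl.exp_sumFun_le z hn⟩
  · rw [norm_fderiv_comp_smul _ hr.le]
    nlinarith [mul_le_mul_of_nonneg_left h1 hr.le, sq_nonneg M]
  · rw [norm_fderiv_comp_smul _ hr.le, mul_pow]
    have : ‖fderiv ℝ (sumFun l z) (r • x)‖ ^ 2 ≤ (2 * M) ^ 2 :=
      pow_le_pow_left₀ (norm_nonneg _) h1' 2
    nlinarith [mul_le_mul_of_nonneg_left this hr2]
  · rw [norm_fderiv_fderiv_comp_smul (hH.contDiff 2) hr.le]
    nlinarith [mul_le_mul_of_nonneg_left (h2 (r • x)) hr2, sq_nonneg M]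

end LogBound

/-! ### Integration over the radius and over the centre of mass -/

theorem EvenFamily.exp {Φ : ℝ → Vel d → ℝ} (h : EvenFamily Φ) :
    EvenFamily (fun t x => Real.exp (Φ t x)) :=
  ⟨h.smooth.exp, fun t x => by simp only [h.even]⟩

theorem EvenFamily.sumFun {φ : Vel d → ℝ} (hφ : ContDiff ℝ (⊤ : ℕ∞) φ) (z e : Vel d) (r : ℝ) :
    EvenFamily (fun t x => sumFun φ (z + t • e) (r • x)) := by
  refine ⟨?_, fun t x => by
    simp only [Boltzmann.sumFun, smul_neg, sub_neg_eq_add, ← sub_eq_add_neg]; ring⟩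
  have h1 : ContDiff ℝ (⊤ : ℕ∞) fun q : ℝ × Vel d => z + q.1 • e :=
    contDiff_const.add (contDiff_fst.smul contDiff_const)
  have h2 : ContDiff ℝ (⊤ : ℕ∞) fun q : ℝ × Vel d => r • q.2 := contDiff_snd.const_smul r
  exact (hφ.comp (h1.add h2)).add (hφ.comp (h1.sub h2))

theorem hasDerivAt_sumFun_centre {φ : Vel d → ℝ} (hφ : Differentiable ℝ φ) (z y : Vel d)
    (i : Fin d) :
    HasDerivAt (fun t : ℝ => sumFun φ (z + t • bvec i) y) (sumFun (pd i φ) z y) 0 := by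
  have h1 : HasDerivAt (fun t : ℝ => z + t • (bvec i : Vel d)) (bvec i) 0 := by
    simpa using ((hasDerivAt_id (0 : ℝ)).smul_const (bvec i : Vel d)).const_add z
  have h2 := (hφ (z + (0 : ℝ) • bvec i + y)).hasFDerivAt.comp_hasDerivAt (0 : ℝ) (h1.add_const y)
  have h3 := (hφ (z + (0 : ℝ) • bvec i - y)).hasFDerivAt.comp_hasDerivAt (0 : ℝ) (h1.sub_const y)
  simp only [zero_smul, add_zero] at h2 h3
  exact h2.add h3

theorem AngularKernel.hasDerivAt_dirForm_centre {b : ℝ → ℝ} (hb : AngularKernel d b)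
    {φ l : Vel d → ℝ} (hφ : ContDiff ℝ (⊤ : ℕ∞) φ) (hl : ContDiff ℝ (⊤ : ℕ∞) l) (z : Vel d) (r : ℝ)
    (i : Fin d) :
    HasDerivAt (fun t : ℝ => dirForm b (fun x => sumFun φ (z + t • bvec i) (r • x))
        (fun x => Real.exp (sumFun l (z + t • bvec i) (r • x))))
      (dirForm b (fun x => sumFun (pd i φ) z (r • x)) (fun x => Real.exp (sumFun l z (r • x)))
        + dirForm b (fun x => sumFun φ z (r • x))
          (fun x => Real.exp (sumFun l z (r • x)) * sumFun (pd i l) z (r • x))) 0 := by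
  have h := hb.hasDerivAt_dirForm (EvenFamily.sumFun hφ z (bvec i) r)
    (EvenFamily.sumFun hl z (bvec i) r).exp 0
  have e1 : ∀ x, deriv (fun t : ℝ => sumFun φ (z + t • bvec i) (r • x)) 0
      = sumFun (pd i φ) z (r • x) := fun x =>
    (hasDerivAt_sumFun_centre (hφ.differentiable (by simp)) z (r • x) i).deriv
  have e2 : ∀ x, deriv (fun t : ℝ => Real.exp (sumFun l (z + t • bvec i) (r • x))) 0
      = Real.exp (sumFun l z (r • x)) * sumFun (pd i l) z (r • x) := fun x => by
    have := (hasDerivAt_sumFun_centre (hl.differentiable (by simp)) z (r • x) i).exp.deriv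
    simpa using this
  simp only [e1, e2, zero_smul, add_zero] at h
  exact h

/-- The integral of a directional derivative vanishes. -/
theorem integral_lineDeriv_eq_zero {f f' : Vel d → ℝ} {v : Vel d} (hf : Integrable f)
    (hf' : Integrable f') (h : ∀ x, HasLineDerivAt ℝ f (f' x) x v) : ∫ x, f' x = 0 := by
  have h2 := integral_bilinear_hasLineDerivAt_right_eq_neg_left_of_integrable (μ := volume)
    (f := fun _ : Vel d => (1 : ℝ)) (f' := fun _ => 0) (g := f) (g' := f') (v := v)
    (B := ContinuousLinearMap.mul ℝ ℝ) (by simp) (by simpa using hf') (by simpa using hf)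
    (fun x _ => by
      rw [HasLineDerivAt]; exact hasDerivAt_const 0 1) (fun x _ => h x)
  simpa using h2

theorem integral_expMeasure (f : ℝ → ℝ) :
    ∫ s, f s ∂(expMeasure d) = ∫ s, Real.exp (d * s) * f s := by
  rw [expMeasure, integral_withDensity_eq_integral_toReal_smul (by fun_prop)
    (Filter.Eventually.of_forall fun s => ENNReal.ofReal_lt_top)]
  congr 1; funext s
  rw [ENNReal.toReal_ofReal (Real.exp_pos _).le, smul_eq_mul]

theorem integrable_expMeasure_iff {f : ℝ → ℝ} :
    Integrable f (expMeasure d) ↔ Integrable fun s => Real.exp (d * s) * f s := by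
  rw [expMeasure, integrable_withDensity_iff_integrable_smul' (by fun_prop)
    (Filter.Eventually.of_forall fun s => ENNReal.ofReal_lt_top)]
  simp only [ENNReal.toReal_ofReal (Real.exp_pos _).le, smul_eq_mul]

/-- The Dirichlet form of a function `h` of a pair of particles and of the pair of distribution
functions `exp l`, on the sphere of radius `e^s` around the centre of mass, times the collision
rate. -/
def pairForm (α b : ℝ → ℝ) (l : Vel d → ℝ) (h : Vel d → Vel d → ℝ) (p : ℝ × Vel d) : ℝ :=
  α (Real.exp p.1) * dirForm b (fun x => h p.2 (Real.exp p.1 • x))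
    (fun x => Real.exp (sumFun l p.2 (Real.exp p.1 • x)))

theorem continuous_sumFun {l : Vel d → ℝ} (hl : Continuous l) :
    Continuous fun p : Vel d × Vel d => sumFun l p.1 p.2 := by
  unfold sumFun; fun_prop

namespace CollisionKernel

variable {α b : ℝ → ℝ} (hk : CollisionKernel d α b)
include hk

theorem integrable_pairForm {l : Vel d → ℝ} {M A : ℝ} (hl : LogBound l M A)
    {h : Vel d → Vel d → ℝ} (hc : Continuous fun p : Vel d × Vel d => h p.1 p.2)
    (hs : ∀ z, SmoothEven (h z)) {K : ℝ} (hK : ∀ z y, |h z y| ≤ K) :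
    Integrable (pairForm α b l h) ((expMeasure d).prod volume) := by
  obtain ⟨β, hβ0, hβ⟩ := hk.angular.exists_levyMass
  have h1 := hk.integrable.mul_prod (integrable_centreWeight (d := d))
  have hm : StronglyMeasurable (pairForm α b l h) := by
    refine ((hk.continuous_rate.comp continuous_fst).stronglyMeasurable).mul
      (hk.angular.stronglyMeasurable_dirForm (X := ℝ × Vel d)
        (φ := fun p x => h p.2 (Real.exp p.1 • x))
        (ψ := fun p x => Real.exp (sumFun l p.2 (Real.exp p.1 • x))) ?_ ?_)
    · exact hc.comp (by fun_prop : Continuous fun q : (ℝ × Vel d) × Vel d =>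
        (q.1.2, Real.exp q.1.1 • q.2))
    · exact Real.continuous_exp.comp ((continuous_sumFun hl.smooth.continuous).comp
        (by fun_prop : Continuous fun q : (ℝ × Vel d) × Vel d => (q.1.2, Real.exp q.1.1 • q.2)))
  refine (h1.const_mul (12 * β * sphArea d * K * (A ^ 2 * (2 * M + (2 * M) ^ 2)))).mono'
    hm.aestronglyMeasurable (Filter.Eventually.of_forall fun p => ?_)
  obtain ⟨s, z⟩ := p
  have hr := Real.exp_pos s
  have hsb := fun x hx => hl.sphere_bounds z hr (x := x) hx
  have hb := (hk.angular.radial_bounds hβ0 hβ ((SmoothEven.sumFun hl.smooth z).comp_smul _)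
    (fun x hx => (hsb x hx).1) (fun x hx => (hsb x hx).2.1) (fun x hx => (hsb x hx).2.2.1)
    (fun x hx => (hsb x hx).2.2.2)).2.2.2 ((hs z).comp_smul (Real.exp s)) (fun x _ => hK z _)
  rw [pairForm, Real.norm_eq_abs, abs_mul, abs_of_pos (hk.pos _ hr)]
  refine (mul_le_mul_of_nonneg_left hb (hk.pos _ hr).le).trans (le_of_eq ?_)
  ring

/-- The integral of the radial part of the dissipation over the radius. -/
theorem integral_radial_nonpos {l : Vel d → ℝ} {M A : ℝ} (hl : LogBound l M A) {N : ℝ}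
    (hN : ∀ r, 0 < r → r * |deriv α r| ≤ N * α r)
    (hα : ∀ r, 0 < r →
      ENNReal.ofReal (r * |deriv α r| / (2 * α r)) ≤ bestLogSobolev d b ^ (1 / 2 : ℝ)) (z : Vel d) :
    ∫ s, pairForm α b l (fun z y => 2 * lap (sumFun l z) y + gradSq (sumFun l z) y) (s, z)
      ∂(expMeasure d) ≤ 0 := by
  obtain ⟨β, hβ0, hβ⟩ := hk.angular.exists_levyMass
  have hb := hk.angular
  set H := sumFun l z with hHdef
  have hH : SmoothEven H := SmoothEven.sumFun hl.smooth z
  rw [integral_expMeasure]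
  by_cases hi : Integrable (fun s => Real.exp (d * s) * pairForm α b l
      (fun z y => 2 * lap (sumFun l z) y + gradSq (sumFun l z) y) (s, z))
  swap
  · rw [integral_undef hi]
  -- the three terms in the derivative of the flux
  set E₁ : ℝ → ℝ := fun s => dirForm b (fun x => euler H (Real.exp s • x))
    (fun x => Real.exp (H (Real.exp s • x))) with hE₁
  set E₂ : ℝ → ℝ := fun s => dirForm b (fun x => euler (euler H) (Real.exp s • x))
    (fun x => Real.exp (H (Real.exp s • x))) with hE₂
  set E₃ : ℝ → ℝ := fun s => dirForm b (fun x => euler H (Real.exp s • x))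
    (fun x => Real.exp (H (Real.exp s • x)) * euler H (Real.exp s • x)) with hE₃
  set a : ℝ → ℝ := fun s => α (Real.exp s) with ha
  set a' : ℝ → ℝ := fun s => deriv α (Real.exp s) * Real.exp s with ha'
  set V : ℝ → ℝ := fun s => Real.exp (((d : ℝ) - 2) * s) * (a s * E₁ s) with hV
  set V' : ℝ → ℝ := fun s => Real.exp (((d : ℝ) - 2) * s) *
    (((d : ℝ) - 2) * a s * E₁ s + a' s * E₁ s + a s * (E₂ s + E₃ s)) with hV'
  have hE₁d : ∀ s, HasDerivAt E₁ (E₂ s + E₃ s) s := fun s => by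
    have h := hb.hasDerivAt_dirForm_smul hH.euler hH.exp s
    simp only [euler_exp hH.differentiable] at h
    exact h
  have had : ∀ s, HasDerivAt a (a' s) s := fun s =>
    (hk.diff _ (Real.exp_pos s)).hasDerivAt.comp s (Real.hasDerivAt_exp s)
  have hVd : ∀ s, HasDerivAt V (V' s) s := fun s => by
    have h1 : HasDerivAt (fun s => Real.exp (((d : ℝ) - 2) * s))
        (Real.exp (((d : ℝ) - 2) * s) * ((d : ℝ) - 2)) s := by
      simpa using ((hasDerivAt_id s).const_mul ((d : ℝ) - 2)).exp
    refine (h1.mul ((had s).mul (hE₁d s))).congr_deriv ?_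
    simp only [hV', Pi.mul_apply]; ring
  have hap : ∀ s, 0 < a s := fun s => hk.pos _ (Real.exp_pos s)
  have ha'N : ∀ s, |a' s| ≤ N * a s := fun s => by
    have := hN _ (Real.exp_pos s)
    rw [ha', abs_mul, abs_of_pos (Real.exp_pos s)]; linarith
  set c : ℝ := 24 * β * sphArea d * (A ^ 2 * centreWeight z * (2 * M + (2 * M) ^ 2) ^ 2) with hc
  have hS := sphArea_nonneg (d := d)
  have hcz := (centreWeight_pos z).le
  have hc0 : 0 ≤ c := by positivity
  set G : ℝ → ℝ := fun s => a s * (Real.exp s ^ 2 * relWeight d (Real.exp s)) with hG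
  have hEb : ∀ s, |E₁ s| ≤ c * (Real.exp s ^ 4 * relWeight d (Real.exp s)) ∧
      |E₃ s| ≤ c * (Real.exp s ^ 4 * relWeight d (Real.exp s)) ∧
      |E₂ s| ≤ c * (Real.exp s ^ 4 * relWeight d (Real.exp s)) := fun s => by
    have hsb := fun x hx => hl.sphere_bounds z (Real.exp_pos s) (x := x) hx
    have h := hb.radial_bounds hβ0 hβ (hH.comp_smul (Real.exp s))
      (fun x hx => (hsb x hx).1) (fun x hx => (hsb x hx).2.1) (fun x hx => (hsb x hx).2.2.1)
      (fun x hx => (hsb x hx).2.2.2)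
    have e1 : euler (fun x => H (Real.exp s • x)) = fun x => euler H (Real.exp s • x) :=
      funext fun x => euler_comp_smul H _ x
    have e2 : euler (fun x => euler H (Real.exp s • x)) = fun x => euler (euler H) (Real.exp s • x) :=
      funext fun x => euler_comp_smul (euler H) _ x
    have e3 : 24 * β * sphArea d * (A ^ 2 * (centreWeight z * relWeight d (Real.exp s)) *
        ((2 * M + (2 * M) ^ 2) * Real.exp s ^ 2) ^ 2)
        = c * (Real.exp s ^ 4 * relWeight d (Real.exp s)) := by rw [hc]; ring
    rw [e1, e2, e3] at h
    exact ⟨h.1, h.2.1, h.2.2.1⟩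
  have hexp : ∀ s, Real.exp (((d : ℝ) - 2) * s) * Real.exp s ^ 2 = Real.exp (d * s) := fun s => by
    rw [← Real.exp_nat_mul, ← Real.exp_add]; congr 1; push_cast; ring
  have hGi : Integrable (fun s => Real.exp (d * s) * G s) := integrable_expMeasure_iff.1 hk.integrable
  have hGe : ∀ s, Real.exp (((d : ℝ) - 2) * s) * (a s * (c * (Real.exp s ^ 4 *
      relWeight d (Real.exp s)))) = c * (Real.exp (d * s) * G s) := fun s => by
    rw [← hexp, hG]; ring
  have hVi : Integrable V := by
    refine (hGi.const_mul c).mono' (continuous_iff_continuousAt.2 fun s =>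
      (hVd s).continuousAt).aestronglyMeasurable (Filter.Eventually.of_forall fun s => ?_)
    rw [Real.norm_eq_abs, abs_mul, abs_mul, abs_of_pos (Real.exp_pos _), abs_of_pos (hap s), ← hGe]
    have := (hEb s).1
    have := (hap s).le
    gcongr
  have hV'i : Integrable V' := by
    have hm : AEStronglyMeasurable V' := by
      have : V' = deriv V := funext fun s => (hVd s).deriv.symm
      rw [this]; exact (measurable_deriv V).aestronglyMeasurable
    refine (hGi.const_mul ((|(d : ℝ) - 2| + N + 2) * c)).mono' hm
      (Filter.Eventually.of_forall fun s => ?_)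
    rw [Real.norm_eq_abs, abs_mul, abs_of_pos (Real.exp_pos _)]
    obtain ⟨b1, b3, b2⟩ := hEb s
    set X := c * (Real.exp s ^ 4 * relWeight d (Real.exp s)) with hX
    have ha0 := (hap s).le
    have t1 : |((d : ℝ) - 2) * a s * E₁ s| ≤ |(d : ℝ) - 2| * (a s * X) := by
      rw [abs_mul, abs_mul, abs_of_pos (hap s), mul_assoc]; gcongr
    have t2 : |a' s * E₁ s| ≤ N * (a s * X) := by
      rw [abs_mul, ← mul_assoc]
      exact mul_le_mul (ha'N s) b1 (abs_nonneg _) ((abs_nonneg _).trans (ha'N s))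
    have t3 : |a s * (E₂ s + E₃ s)| ≤ 2 * (a s * X) := by
      rw [abs_mul, abs_of_pos (hap s)]
      have : |E₂ s + E₃ s| ≤ 2 * X := (abs_add_le _ _).trans (by linarith)
      nlinarith
    have t : |((d : ℝ) - 2) * a s * E₁ s + a' s * E₁ s + a s * (E₂ s + E₃ s)|
        ≤ (|(d : ℝ) - 2| + N + 2) * (a s * X) := by
      refine (abs_add_le _ _).trans ?_
      have := abs_add_le (((d : ℝ) - 2) * a s * E₁ s) (a' s * E₁ s)
      linarith
    refine (mul_le_mul_of_nonneg_left t (Real.exp_pos _).le).trans (le_of_eq ?_)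
    rw [mul_assoc, ← hGe s]; ring
  have hint := integral_eq_zero_of_hasDerivAt_of_integrable hVd hV'i hVi
  have hle : ∀ s, Real.exp (d * s) * pairForm α b l
      (fun z y => 2 * lap (sumFun l z) y + gradSq (sumFun l z) y) (s, z) ≤ 2 * V' s := fun s => by
    have hcond : ENNReal.ofReal (|a' s| / (2 * a s)) ≤ bestLogSobolev d b ^ (1 / 2 : ℝ) := by
      have := hα _ (Real.exp_pos s)
      have e : |a' s| = Real.exp s * |deriv α (Real.exp s)| := by
        rw [ha', abs_mul, abs_of_pos (Real.exp_pos s), mul_comm]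
      rw [e]; exact this
    have h := hb.radial_dissipation_le (hH.comp_smul (Real.exp s)) (hap s) hcond
    have e1 : euler (fun x => H (Real.exp s • x)) = fun x => euler H (Real.exp s • x) :=
      funext fun x => euler_comp_smul H _ x
    have e2 : euler (fun x => euler H (Real.exp s • x)) = fun x => euler (euler H) (Real.exp s • x) :=
      funext fun x => euler_comp_smul (euler H) _ x
    have e3 : (fun x => 2 * lap (fun x => H (Real.exp s • x)) x
        + gradSq (fun x => H (Real.exp s • x)) x)
        = fun x => Real.exp s ^ 2 * (2 * lap H (Real.exp s • x) + gradSq H (Real.exp s • x)) := by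
      funext x
      rw [lap_comp_smul hH.smooth, gradSq_comp_smul]; ring
    rw [e1, e2, e3, dirForm_const_mul_left] at h
    have h' := mul_le_mul_of_nonneg_left h (Real.exp_pos (((d : ℝ) - 2) * s)).le
    rw [pairForm, ← hexp]
    simp only [hV', hE₁, hE₂, hE₃]
    refine le_trans (le_of_eq ?_) (h'.trans (le_of_eq ?_))
    · ring
    · ring
  calc _ ≤ ∫ s, 2 * V' s := integral_mono hi (hV'i.const_mul 2) hle
    _ = 0 := by rw [integral_const_mul, hint, mul_zero]

end CollisionKernel

/-! ### The dissipation of the Fisher information -/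

theorem pd_sumFun {l : Vel d → ℝ} (hl : Differentiable ℝ l) (z : Vel d) (i : Fin d) :
    pd i (sumFun l z) = fun y => pd i l (z + y) - pd i l (z - y) := by
  funext y
  rw [pd, (hasFDerivAt_sumFun hl z y).fderiv, sub_apply, pd, pd]

theorem pd_pd_sumFun {l : Vel d → ℝ} (hl : ContDiff ℝ (⊤ : ℕ∞) l) (z : Vel d) (i : Fin d) :
    pd i (pd i (sumFun l z)) = sumFun (pd i (pd i l)) z := by
  funext y
  have hd := (hl.pd i).differentiable (by simp)
  rw [pd_sumFun (hl.differentiable (by simp))]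
  have h1 : HasFDerivAt (fun y => pd i l (z + y)) (fderiv ℝ (pd i l) (z + y)) y := by
    have := (hd (z + y)).hasFDerivAt.comp (f := fun y => z + y) y ((hasFDerivAt_id y).const_add z)
    rw [ContinuousLinearMap.comp_id] at this
    exact this
  have h2 : HasFDerivAt (fun y => pd i l (z - y)) (-fderiv ℝ (pd i l) (z - y)) y := by
    have := (hd (z - y)).hasFDerivAt.comp (f := fun y => z - y) y ((hasFDerivAt_id y).const_sub z)
    rw [ContinuousLinearMap.comp_neg, ContinuousLinearMap.comp_id] at this
    exact this
  rw [pd, (h1.fun_sub h2).fderiv]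
  simp [sumFun, pd]

namespace LogBound

variable {l : Vel d → ℝ} {M A : ℝ} (hl : LogBound l M A)
include hl

theorem abs_pd_le (i : Fin d) (v : Vel d) : |pd i l v| ≤ M := by
  have := (fderiv ℝ l v).le_of_opNorm_le (hl.le_fderiv v) (bvec i)
  rwa [norm_bvec, mul_one] at this

theorem norm_fderiv_pd_le (i : Fin d) (v : Vel d) : ‖fderiv ℝ (pd i l) v‖ ≤ M := by
  refine ContinuousLinearMap.opNorm_le_bound _ hl.nonneg fun w => ?_
  rw [fderiv_pd hl.smooth]
  refine (ContinuousLinearMap.le_opNorm₂ _ _ _).trans ?_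
  rw [norm_bvec, mul_one]
  exact mul_le_mul_of_nonneg_right (hl.le_fderiv_two v) (norm_nonneg w)

theorem abs_pd_pd_le (i : Fin d) (v : Vel d) : |pd i (pd i l) v| ≤ M := by
  have := (fderiv ℝ (pd i l) v).le_of_opNorm_le (hl.norm_fderiv_pd_le i v) (bvec i)
  rwa [norm_bvec, mul_one] at this

end LogBound

theorem abs_sumFun_le {φ : Vel d → ℝ} {K : ℝ} (h : ∀ v, |φ v| ≤ K) (z y : Vel d) :
    |sumFun φ z y| ≤ 2 * K :=
  (abs_add_le _ _).trans (by linarith [h (z + y), h (z - y)])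

theorem norm_fderiv_sumFun_smul_le {φ : Vel d → ℝ} (hφ : Differentiable ℝ φ) {K : ℝ}
    (h : ∀ v, ‖fderiv ℝ φ v‖ ≤ K) (z : Vel d) {r : ℝ} (hr : 0 ≤ r) (x : Vel d) :
    ‖fderiv ℝ (fun x => sumFun φ z (r • x)) x‖ ≤ 2 * K * r := by
  rw [norm_fderiv_comp_smul _ hr, (hasFDerivAt_sumFun hφ z (r • x)).fderiv]
  have hK : 0 ≤ K := (norm_nonneg _).trans (h 0)
  have : ‖fderiv ℝ φ (z + r • x) - fderiv ℝ φ (z - r • x)‖ ≤ 2 * K := by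
    refine ContinuousLinearMap.opNorm_le_bound _ (by positivity) fun v => ?_
    rw [sub_apply]
    have a1 := (fderiv ℝ φ (z + r • x)).le_of_opNorm_le (h _) v
    have a2 := (fderiv ℝ φ (z - r • x)).le_of_opNorm_le (h _) v
    refine (norm_sub_le _ _).trans ?_
    linarith
  nlinarith

/-- Minus the variational derivative of the Fisher information, in terms of the logarithm `l` of the
distribution function. -/
def fisherPotential (l : Vel d → ℝ) (v : Vel d) : ℝ := 2 * lap l v + gradSq l v

namespace CollisionKernel

variable {α b : ℝ → ℝ} (hk : CollisionKernel d α b)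
include hk

/-- The integral of the part of the dissipation along the centre of mass. -/
theorem integral_centre_nonpos {l : Vel d → ℝ} {M A : ℝ} (hl : LogBound l M A) (s : ℝ) (i : Fin d) :
    ∫ z, pairForm α b l (fun z y => 2 * sumFun (pd i (pd i l)) z y + sumFun (pd i l) z y ^ 2) (s, z)
      ≤ 0 := by
  obtain ⟨β, hβ0, hβ⟩ := hk.angular.exists_levyMass
  have hb := hk.angular
  have hM := hl.nonneg
  have hr := Real.exp_pos s
  by_cases hi : Integrable (fun z => pairForm α b l
      (fun z y => 2 * sumFun (pd i (pd i l)) z y + sumFun (pd i l) z y ^ 2) (s, z))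
  swap
  · rw [integral_undef hi]
  have hp := hl.smooth.pd i
  have hpp := hp.pd i
  simp only [pairForm] at hi ⊢
  set r := Real.exp s
  have sm : ∀ {φ : Vel d → ℝ}, ContDiff ℝ (⊤ : ℕ∞) φ → ∀ z, SmoothEven fun x => sumFun φ z (r • x) :=
    fun hφ z => (SmoothEven.sumFun hφ z).comp_smul r
  have hF : ∀ z, SmoothEven fun x => Real.exp (sumFun l z (r • x)) := fun z => (sm hl.smooth z).exp
  set W : Vel d → ℝ := fun z => dirForm b (fun x => sumFun (pd i l) z (r • x))
    (fun x => Real.exp (sumFun l z (r • x))) with hW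
  set W₁ : Vel d → ℝ := fun z => dirForm b (fun x => sumFun (pd i (pd i l)) z (r • x))
    (fun x => Real.exp (sumFun l z (r • x))) with hW₁
  set W₂ : Vel d → ℝ := fun z => dirForm b (fun x => sumFun (pd i l) z (r • x))
    (fun x => Real.exp (sumFun l z (r • x)) * sumFun (pd i l) z (r • x)) with hW₂
  have hline : ∀ z, HasLineDerivAt ℝ W (W₁ z + W₂ z) z (bvec i) := fun z =>
    hb.hasDerivAt_dirForm_centre hp hl.smooth z r i
  set P := (2 * M + (2 * M) ^ 2) * r ^ 2 with hP
  have hP0 : 0 ≤ P := by positivity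
  have hS := sphArea_nonneg (d := d)
  have hbd : ∀ {φ : Vel d → ℝ}, ContDiff ℝ (⊤ : ℕ∞) φ → (∀ v, |φ v| ≤ M) → ∀ z,
      |dirForm b (fun x => sumFun φ z (r • x)) (fun x => Real.exp (sumFun l z (r • x)))|
        ≤ 12 * β * sphArea d * (2 * M) * (A ^ 2 * (centreWeight z * relWeight d r) * P) := by
    intro φ hφ hφM z
    have hsb := fun x hx => hl.sphere_bounds z hr (x := x) hx
    exact (hb.radial_bounds hβ0 hβ (sm hl.smooth z)
      (fun x hx => (hsb x hx).1) (fun x hx => (hsb x hx).2.1) (fun x hx => (hsb x hx).2.2.1)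
      (fun x hx => (hsb x hx).2.2.2)).2.2.2 (sm hφ z) (fun x _ => abs_sumFun_le hφM z _)
  have hbd₂ : ∀ z, |W₂ z| ≤ 3 * (2 * M * r) * ((A ^ 2 * (centreWeight z * relWeight d r))
      * (2 * M * r) + 2 * M * (A ^ 2 * (centreWeight z * relWeight d r) * P)) * (β * sphArea d) := by
    intro z
    have d1 : ∀ x, ‖fderiv ℝ (fun x => sumFun (pd i l) z (r • x)) x‖ ≤ 2 * M * r := fun x =>
      norm_fderiv_sumFun_smul_le (hp.differentiable (by simp)) (hl.norm_fderiv_pd_le i) z hr.le x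
    refine hb.abs_dirForm_le_mass hβ (sm hp z) ((hF z).mul (sm hp z)) (fun x _ => d1 x)
      fun x hx => ?_
    obtain ⟨s1, -, -, s4⟩ := hl.sphere_bounds z hr hx
    have hw : 0 ≤ A ^ 2 * (centreWeight z * relWeight d r) := (Real.exp_pos _).le.trans s4
    refine (norm_fderiv_mul_le (hF z).differentiable (sm hp z).differentiable x).trans ?_
    rw [norm_fderiv_exp (sm hl.smooth z).differentiable, abs_of_pos (Real.exp_pos _)]
    refine add_le_add (mul_le_mul s4 (d1 x) (norm_nonneg _) hw) ?_
    exact mul_le_mul (abs_sumFun_le (hl.abs_pd_le i) z _)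
      (mul_le_mul s4 s1 (norm_nonneg _) hw) (by positivity) (by positivity)
  have hsc : ∀ {φ : Vel d → ℝ}, Continuous φ →
      Continuous fun p : Vel d × Vel d => sumFun φ p.1 (r • p.2) := fun hφ =>
    (continuous_sumFun hφ).comp (by fun_prop : Continuous fun p : Vel d × Vel d => (p.1, r • p.2))
  have hFc := Real.continuous_exp.comp (hsc hl.smooth.continuous)
  have hWi : Integrable W := by
    refine ((integrable_centreWeight (d := d)).const_mul
      (12 * β * sphArea d * (2 * M) * (A ^ 2 * relWeight d r * P))).mono'
      (hb.stronglyMeasurable_dirForm (hsc hp.continuous) hFc).aestronglyMeasurable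
      (Filter.Eventually.of_forall fun z => (hbd hp (hl.abs_pd_le i) z).trans (le_of_eq ?_))
    ring
  have hW₁i : Integrable W₁ := by
    refine ((integrable_centreWeight (d := d)).const_mul
      (12 * β * sphArea d * (2 * M) * (A ^ 2 * relWeight d r * P))).mono'
      (hb.stronglyMeasurable_dirForm (hsc hpp.continuous) hFc).aestronglyMeasurable
      (Filter.Eventually.of_forall fun z => (hbd hpp (hl.abs_pd_pd_le i) z).trans (le_of_eq ?_))
    ring
  have hW₂i : Integrable W₂ := by
    refine ((integrable_centreWeight (d := d)).const_mul
      (3 * (2 * M * r) * ((A ^ 2 * relWeight d r)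
      * (2 * M * r) + 2 * M * (A ^ 2 * relWeight d r * P)) * (β * sphArea d))).mono'
      (hb.stronglyMeasurable_dirForm (hsc hp.continuous)
        (hFc.mul (hsc hp.continuous))).aestronglyMeasurable
      (Filter.Eventually.of_forall fun z => (hbd₂ z).trans (le_of_eq ?_))
    ring
  have h0 := integral_lineDeriv_eq_zero hWi (hW₁i.add hW₂i) hline
  have ha := hk.pos r hr
  calc _ ≤ ∫ z, α r * (2 * (W₁ z + W₂ z)) := by
        refine integral_mono hi (((hW₁i.add hW₂i).const_mul 2).const_mul _) fun z => ?_
        refine mul_le_mul_of_nonneg_left ?_ ha.le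
        have h1 := hb.dirForm_mul_nonpos (hF z) (fun x => Real.exp_pos _) (sm hp z)
        rw [hb.dirForm_add_left ((sm hpp z).const_mul 2) ((sm hp z).pow 2) (hF z),
          dirForm_const_mul_left]
        simp only [hW₁, hW₂]
        linarith
    _ = 0 := by
        rw [integral_const_mul, integral_const_mul]
        simp only [Pi.add_apply] at h0
        rw [h0, mul_zero, mul_zero]

theorem pairForm_add {l : Vel d → ℝ} (hl : ContDiff ℝ (⊤ : ℕ∞) l) {h h' : Vel d → Vel d → ℝ}
    (hh : ∀ z, SmoothEven (h z)) (hh' : ∀ z, SmoothEven (h' z)) (p : ℝ × Vel d) :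
    pairForm α b l (fun z y => h z y + h' z y) p = pairForm α b l h p + pairForm α b l h' p := by
  rw [pairForm, hk.angular.dirForm_add_left ((hh _).comp_smul _) ((hh' _).comp_smul _)
    ((SmoothEven.sumFun hl _).comp_smul _).exp, mul_add]
  rfl

theorem pairForm_sum {l : Vel d → ℝ} (hl : ContDiff ℝ (⊤ : ℕ∞) l) {ι : Type*} (t : Finset ι)
    {h : ι → Vel d → Vel d → ℝ} (hh : ∀ i z, SmoothEven (h i z)) (p : ℝ × Vel d) :
    pairForm α b l (fun z y => ∑ i ∈ t, h i z y) p = ∑ i ∈ t, pairForm α b l (h i) p := by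
  rw [pairForm, hk.angular.dirForm_sum_left t (fun i _ => (hh i _).comp_smul _)
    ((SmoothEven.sumFun hl _).comp_smul _).exp, Finset.mul_sum]
  rfl

theorem integral_pairForm_nonpos {l : Vel d → ℝ} {M A : ℝ} (hl : LogBound l M A) {N : ℝ}
    (hN : ∀ r, 0 < r → r * |deriv α r| ≤ N * α r)
    (hα : ∀ r, 0 < r →
      ENNReal.ofReal (r * |deriv α r| / (2 * α r)) ≤ bestLogSobolev d b ^ (1 / 2 : ℝ)) :
    ∫ p, pairForm α b l (fun z y => 2 * sumFun (fisherPotential l) z y) p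
      ∂((expMeasure d).prod volume) ≤ 0 := by
  have hs := hl.smooth
  set hy : Vel d → Vel d → ℝ := fun z y => 2 * lap (sumFun l z) y + gradSq (sumFun l z) y with hhy
  set hz : Fin d → Vel d → Vel d → ℝ := fun i z y =>
    2 * sumFun (pd i (pd i l)) z y + sumFun (pd i l) z y ^ 2 with hhz
  have hyS : ∀ z, SmoothEven (hy z) := fun z =>
    ((SmoothEven.sumFun hs z).lap.const_mul 2).add (SmoothEven.sumFun hs z).gradSq
  have hzS : ∀ i z, SmoothEven (hz i z) := fun i z =>
    ((SmoothEven.sumFun ((hs.pd i).pd i) z).const_mul 2).add ((SmoothEven.sumFun (hs.pd i) z).pow 2)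
  have hyE : ∀ z y, hy z y = 2 * ∑ i, sumFun (pd i (pd i l)) z y
      + ∑ i, (pd i l (z + y) - pd i l (z - y)) ^ 2 := fun z y => by
    have e1 : lap (sumFun l z) y = ∑ i, sumFun (pd i (pd i l)) z y :=
      Finset.sum_congr rfl fun i _ => by rw [pd_pd_sumFun hs]
    have e2 : gradSq (sumFun l z) y = ∑ i, (pd i l (z + y) - pd i l (z - y)) ^ 2 :=
      Finset.sum_congr rfl fun i _ => by rw [pd_sumFun (hs.differentiable (by simp))]
    simp only [hhy, e1, e2]
  have hsplit : (fun z y => 2 * sumFun (fisherPotential l) z y)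
      = fun z y => hy z y + ∑ i, hz i z y := by
    funext z y
    rw [hyE]
    simp only [hhz, sumFun, fisherPotential, lap, gradSq, Finset.mul_sum, ← Finset.sum_add_distrib]
    exact Finset.sum_congr rfl fun i _ => by ring
  have hyc : Continuous fun p : Vel d × Vel d => hy p.1 p.2 := by
    simp only [hyE]
    have c1 := fun i => (hs.pd i).continuous
    refine (continuous_const.mul (continuous_finsetSum _ fun i _ =>
      continuous_sumFun ((hs.pd i).pd i).continuous)).add (continuous_finsetSum _ fun i _ => ?_)
    exact (((c1 i).comp (continuous_fst.add continuous_snd)).sub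
      ((c1 i).comp (continuous_fst.sub continuous_snd))).pow 2
  have hzc : ∀ i, Continuous fun p : Vel d × Vel d => hz i p.1 p.2 := fun i =>
    (continuous_const.mul (continuous_sumFun ((hs.pd i).pd i).continuous)).add
      ((continuous_sumFun (hs.pd i).continuous).pow 2)
  have hM := hl.nonneg
  have hyb : ∀ z y, |hy z y| ≤ 2 * ∑ _i : Fin d, 2 * M + ∑ _i : Fin d, (2 * M) ^ 2 := fun z y => by
    rw [hyE]
    refine (abs_add_le _ _).trans (add_le_add ?_ ?_)
    · rw [abs_mul, abs_two]
      gcongr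
      exact (Finset.abs_sum_le_sum_abs _ _).trans
        (Finset.sum_le_sum fun i _ => abs_sumFun_le (hl.abs_pd_pd_le i) z y)
    · refine (Finset.abs_sum_le_sum_abs _ _).trans (Finset.sum_le_sum fun i _ => ?_)
      rw [abs_pow]
      refine pow_le_pow_left₀ (abs_nonneg _) ((abs_sub _ _).trans ?_) 2
      linarith [hl.abs_pd_le i (z + y), hl.abs_pd_le i (z - y)]
  have hzb : ∀ i z y, |hz i z y| ≤ 2 * (2 * M) + (2 * M) ^ 2 := fun i z y => by
    refine (abs_add_le _ _).trans (add_le_add ?_ ?_)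
    · rw [abs_mul, abs_two]
      gcongr
      exact abs_sumFun_le (hl.abs_pd_pd_le i) z y
    · rw [abs_pow]
      exact pow_le_pow_left₀ (abs_nonneg _) (abs_sumFun_le (hl.abs_pd_le i) z y) 2
  have iy := hk.integrable_pairForm hl hyc hyS hyb
  have iz := fun i => hk.integrable_pairForm hl (hzc i) (hzS i) (hzb i)
  have e : pairForm α b l (fun z y => 2 * sumFun (fisherPotential l) z y)
      = fun p => pairForm α b l hy p + ∑ i, pairForm α b l (hz i) p := by
    funext p
    rw [hsplit, hk.pairForm_add hs hyS (h' := fun z y => ∑ i, hz i z y)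
      (fun z => SmoothEven.sum fun i _ => hzS i z), hk.pairForm_sum hs _ hzS]
  rw [e, integral_add iy (integrable_finsetSum _ fun i _ => iz i),
    integral_finsetSum _ fun i _ => iz i]
  have ny : ∫ p, pairForm α b l hy p ∂((expMeasure d).prod volume) ≤ 0 := by
    rw [integral_prod_symm _ iy]
    exact integral_nonpos fun z => hk.integral_radial_nonpos hl hN hα z
  have nz : ∀ i, ∫ p, pairForm α b l (hz i) p ∂((expMeasure d).prod volume) ≤ 0 := fun i => by
    rw [integral_prod _ (iz i)]
    exact integral_nonpos fun s => hk.integral_centre_nonpos hl s i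
  linarith [Finset.sum_nonpos fun i (_ : i ∈ Finset.univ) => nz i]

/-- The collision operator dissipates the Fisher information. -/
theorem integral_fisherPotential_mul_nonneg (hd : 1 ≤ d) {l : Vel d → ℝ} {M A B : ℝ}
    (hl : LogBound l M A) (hf : DecayBound (fun v => Real.exp (l v)) B) {N : ℝ}
    (hN : ∀ r, 0 < r → r * |deriv α r| ≤ N * α r)
    (hα : ∀ r, 0 < r →
      ENNReal.ofReal (r * |deriv α r| / (2 * α r)) ≤ bestLogSobolev d b ^ (1 / 2 : ℝ))
    {K : ℝ} (hK : ∀ v, |fisherPotential l v| ≤ K) :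
    0 ≤ ∫ p : Vel d × Vel d, fisherPotential l p.1 *
      pairCollision α b (fun v => Real.exp (l v)) (fun v => Real.exp (l v)) p := by
  have hs := hl.smooth
  have hθ : ContDiff ℝ (⊤ : ℕ∞) (fisherPotential l) := (contDiff_const.mul hs.lap).add hs.gradSq
  have h1 := hk.integral_mul_pairCollision hd hf hf hθ.continuous hK
  set f : Vel d → ℝ := fun v => Real.exp (l v) with hfdef
  set q : Vel d × Vel d → ℝ := fun p =>
    (fisherPotential l p.1 + fisherPotential l p.2) * pairCollision α b f f p with hq
  have hqi : Integrable q := by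
    refine (hk.integrable_pairCollision hd hf hf).bdd_mul
      ((hθ.continuous.comp continuous_fst).add
        (hθ.continuous.comp continuous_snd)).aestronglyMeasurable (c := 2 * K)
      (Filter.Eventually.of_forall fun p => ?_)
    rw [Real.norm_eq_abs]
    exact (abs_add_le _ _).trans (by linarith [hK p.1, hK p.2])
  have h2 := integral_comp_coordMap hd q
  have h3 : ∫ p, q (coordMap p) ∂(coordMeasure d)
      = ∫ p, -pairForm α b l (fun z y => 2 * sumFun (fisherPotential l) z y) p
        ∂((expMeasure d).prod volume) := by
    rw [coordMeasure, integral_prod _ ((integrable_comp_coordMap hd).2 hqi)]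
    congr 1; funext ⟨s, z⟩
    have e1 : ∀ σ : Sph d, q (coordMap ((s, z), σ)) = α (Real.exp s) *
        (2 * (sumFun (fisherPotential l) z (Real.exp s • (σ : Vel d))) *
          sphBoltzmann b (fun x => 2 * Real.exp (sumFun l z (Real.exp s • x))) σ) / 2 := fun σ => by
      simp only [hq]
      rw [pairCollision_coordMap]
      have e2 : (fun x => pairFun f f z (Real.exp s • x))
          = fun x => 2 * Real.exp (sumFun l z (Real.exp s • x)) := by
        funext x; simp only [pairFun, hfdef, sumFun, Real.exp_add]; ring
      rw [e2]
      simp only [coordMap, sumFun]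
      ring
    have sF : SmoothEven fun x => Real.exp (sumFun l z (Real.exp s • x)) :=
      ((SmoothEven.sumFun hs z).comp_smul _).exp
    have sθ : SmoothEven fun x => 2 * sumFun (fisherPotential l) z (Real.exp s • x) :=
      ((SmoothEven.sumFun hθ z).comp_smul _).const_mul 2
    simp only [e1, sphBoltzmann_const_mul]
    have h4 := (hk.angular.integral_mul_sphBoltzmann sθ sF).2
    rw [pairForm, ← mul_neg, ← h4, ← integral_const_mul]
    congr 1; funext σ; ring
  rw [h3, integral_neg] at h2
  have h5 := hk.integral_pairForm_nonpos hl hN hα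
  have h6 := pairScale_pos (d := d)
  have h7 : 0 ≤ ∫ p, q p := by
    by_contra hneg
    rw [not_le] at hneg
    have := mul_neg_of_pos_of_neg h6 hneg
    linarith
  linarith

end CollisionKernel

/-! ### Bounds in terms of the weight -/

theorem contDiff_one_add_norm_sq : ContDiff ℝ (⊤ : ℕ∞) fun v : Vel d => 1 + ‖v‖ ^ 2 :=
  contDiff_const.add (contDiff_norm_sq ℝ)

theorem one_add_norm_sq_pos (v : Vel d) : 0 < 1 + ‖v‖ ^ 2 := by positivity

theorem norm_fderiv_one_add_norm_sq (v : Vel d) :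
    ‖fderiv ℝ (fun v : Vel d => 1 + ‖v‖ ^ 2) v‖ = 2 * ‖v‖ := by
  rw [fderiv_const_add, fderiv_norm_sq_apply, ← Nat.cast_smul_eq_nsmul ℝ, norm_smul, innerSL_apply_norm]
  simp

theorem norm_fderiv_fderiv_one_add_norm_sq_le (v : Vel d) :
    ‖fderiv ℝ (fderiv ℝ fun v : Vel d => 1 + ‖v‖ ^ 2) v‖ ≤ 2 := by
  have e : (fderiv ℝ fun v : Vel d => 1 + ‖v‖ ^ 2) = fun v => (2 : ℝ) • innerSL ℝ v := by
    funext v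
    rw [fderiv_const_add, fderiv_norm_sq_apply, ← Nat.cast_smul_eq_nsmul ℝ]; norm_num
  rw [e]
  refine ContinuousLinearMap.opNorm_le_bound _ (by norm_num) fun w => ?_
  have : HasFDerivAt (fun v : Vel d => (2 : ℝ) • innerSL ℝ v) ((2 : ℝ) • innerSL ℝ (E := Vel d)) v :=
    ((innerSL ℝ (E := Vel d)).hasFDerivAt).const_smul (2 : ℝ)
  rw [this.fderiv, smul_apply, norm_smul, innerSL_apply_norm]
  simp

/-- The logarithm of the weight. -/
def logWeight (v : Vel d) : ℝ := -(3 * (d : ℝ) + 5) / 2 * Real.log (1 + ‖v‖ ^ 2)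

theorem exp_logWeight (v : Vel d) : Real.exp (logWeight v) = weight v := by
  rw [weight, polyWeight, Real.rpow_def_of_pos (one_add_norm_sq_pos v), logWeight, mul_comm]

theorem logBound_logWeight : LogBound (logWeight (d := d)) (9 * d + 15) 1 := by
  have h1 : ContDiff ℝ (⊤ : ℕ∞) fun v : Vel d => Real.log (1 + ‖v‖ ^ 2) :=
    contDiff_one_add_norm_sq.log fun v => (one_add_norm_sq_pos v).ne'
  have hd1 := h1.differentiable (by simp)
  have hd2 := h1.fderiv_infty.differentiable (by simp)
  have hc : |-(3 * (d : ℝ) + 5) / 2| = (3 * d + 5) / 2 := by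
    rw [abs_div, abs_neg, abs_of_nonneg (by positivity), abs_two]
  have e : fderiv ℝ (logWeight (d := d))
      = fun v => (-(3 * (d : ℝ) + 5) / 2) • fderiv ℝ (fun v : Vel d => Real.log (1 + ‖v‖ ^ 2)) v :=
    funext fun v => fderiv_const_mul (hd1 v) _
  have hn : ∀ v : Vel d, (1 + ‖v‖ ^ 2)⁻¹ * (2 * ‖v‖) ≤ 1 := fun v => by
    rw [inv_mul_le_iff₀ (one_add_norm_sq_pos v)]
    nlinarith [sq_nonneg (‖v‖ - 1)]
  refine ⟨contDiff_const.mul h1, fun v => ?_, fun v => ?_, fun v => ?_⟩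
  · rw [e, norm_smul, Real.norm_eq_abs, hc, norm_fderiv_log
      (contDiff_one_add_norm_sq.differentiable (by simp)) one_add_norm_sq_pos,
      norm_fderiv_one_add_norm_sq]
    nlinarith [hn v]
  · rw [e, fderiv_fun_const_smul (hd2 v)]
    refine (ContinuousLinearMap.opNorm_smul_le _ _).trans ?_
    rw [Real.norm_eq_abs, hc]
    have h2 := norm_fderiv_fderiv_log_le (contDiff_one_add_norm_sq.of_le two_le_infty)
      one_add_norm_sq_pos v
    rw [norm_fderiv_one_add_norm_sq] at h2
    have h3 : (1 + ‖v‖ ^ 2)⁻¹ * ‖fderiv ℝ (fderiv ℝ fun v : Vel d => 1 + ‖v‖ ^ 2) v‖ ≤ 1 * 2 :=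
      mul_le_mul (inv_le_one_of_one_le₀ (by nlinarith [sq_nonneg ‖v‖]))
        (norm_fderiv_fderiv_one_add_norm_sq_le v) (ContinuousLinearMap.opNorm_nonneg _) zero_le_one
    have h4 : ((1 + ‖v‖ ^ 2)⁻¹ * (2 * ‖v‖)) ^ 2 ≤ 1 :=
      pow_le_one₀ (by positivity) (hn v)
    have h5 : ‖fderiv ℝ (fderiv ℝ fun v : Vel d => Real.log (1 + ‖v‖ ^ 2)) v‖ ≤ 3 := by linarith
    have h6 : (0 : ℝ) ≤ (3 * d + 5) / 2 := by positivity
    nlinarith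
  · rw [exp_logWeight, one_mul]

theorem LogBound.decayBound {l : Vel d → ℝ} {M A : ℝ} (h : LogBound l M A) :
    DecayBound (fun v => Real.exp (l v)) (A * (1 + M + M ^ 2)) := by
  have hM := h.nonneg
  have hA : ∀ v : Vel d, 0 ≤ A * weight v := fun v => (Real.exp_pos _).le.trans (h.exp_le v)
  have h1 := h.smooth.differentiable (by simp)
  refine ⟨h.smooth.exp, fun v => ?_, fun v => ?_, fun v => ?_⟩
  · rw [abs_of_pos (Real.exp_pos _)]
    nlinarith [h.exp_le v, hA v, mul_nonneg (hA v) hM, mul_nonneg (hA v) (sq_nonneg M)]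
  · rw [norm_fderiv_exp h1]
    have := mul_le_mul (h.exp_le v) (h.le_fderiv v) (norm_nonneg _) (hA v)
    nlinarith [hA v, mul_nonneg (hA v) (sq_nonneg M)]
  · refine (norm_fderiv_fderiv_exp_le (h.smooth.of_le two_le_infty) v).trans ?_
    have h2 : ‖fderiv ℝ (fderiv ℝ l) v‖ + ‖fderiv ℝ l v‖ ^ 2 ≤ M + M ^ 2 :=
      add_le_add (h.le_fderiv_two v) (pow_le_pow_left₀ (norm_nonneg _) (h.le_fderiv v) 2)
    have := mul_le_mul (h.exp_le v) h2 (by positivity) (hA v)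
    nlinarith [hA v]

/-- The bound of the derivatives of the weight, relative to the weight. -/
def weightConst (d : ℕ) : ℝ := 1 + (9 * d + 15) + (9 * d + 15) ^ 2

theorem decayBound_weight : DecayBound (weight (d := d)) (weightConst d) := by
  have := (logBound_logWeight (d := d)).decayBound
  simp only [exp_logWeight, one_mul] at this
  exact this

theorem integrable_weight : Integrable (weight (d := d)) := by
  refine integrable_rpow_neg_one_add_norm_sq (r := 3 * (d : ℝ) + 5) ?_
  rw [finrank_euclideanSpace_fin]
  have : (0 : ℝ) ≤ d := Nat.cast_nonneg d
  linarith

/-- The weight varies by a bounded factor on unit balls. -/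
theorem weight_add_le {v h : Vel d} (hh : ‖h‖ ≤ 1) :
    weight (v + h) ≤ Real.exp (9 * d + 15) * weight v := by
  have hl := logBound_logWeight (d := d)
  have := convex_univ.norm_image_sub_le_of_norm_fderiv_le (f := logWeight (d := d))
    (C := 9 * d + 15) (fun x _ => hl.smooth.differentiable (by simp) x) (fun x _ => hl.le_fderiv x)
    (mem_univ v) (mem_univ (v + h))
  rw [add_sub_cancel_left, Real.norm_eq_abs] at this
  have h1 := (le_abs_self _).trans this
  rw [← exp_logWeight, ← exp_logWeight, ← Real.exp_add]
  refine Real.exp_le_exp.2 ?_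
  have h2 : (9 * (d : ℝ) + 15) * ‖h‖ ≤ 9 * d + 15 := mul_le_of_le_one_right (by positivity) hh
  linarith

theorem DecayBound.norm_fderiv_pd_le {u : Vel d → ℝ} {C : ℝ} (hu : DecayBound u C) (i : Fin d)
    (v : Vel d) : ‖fderiv ℝ (pd i u) v‖ ≤ C * weight v := by
  refine ContinuousLinearMap.opNorm_le_bound _ ((abs_nonneg _).trans (hu.le v)) fun w => ?_
  rw [fderiv_pd hu.smooth]
  refine (ContinuousLinearMap.le_opNorm₂ _ _ _).trans ?_
  rw [norm_bvec, mul_one]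
  exact mul_le_mul_of_nonneg_right (hu.le_fderiv_two v) (norm_nonneg w)

theorem DecayBound.abs_pd_le {u : Vel d → ℝ} {C : ℝ} (hu : DecayBound u C) (i : Fin d)
    (v : Vel d) : |pd i u v| ≤ C * weight v := by
  have := (fderiv ℝ u v).le_of_opNorm_le (hu.le_fderiv v) (bvec i)
  rwa [norm_bvec, mul_one] at this

theorem DecayBound.abs_pd_pd_le {u : Vel d → ℝ} {C : ℝ} (hu : DecayBound u C) (i : Fin d)
    (v : Vel d) : |pd i (pd i u) v| ≤ C * weight v := by
  have := (fderiv ℝ (pd i u) v).le_of_opNorm_le (hu.norm_fderiv_pd_le i v) (bvec i)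
  rwa [norm_bvec, mul_one] at this

/-- The first derivatives of a nonnegative function `u` are of the order `√u`. -/
theorem DecayBound.pd_sq_le {u : Vel d → ℝ} {C : ℝ} (hu : DecayBound u C) (h0 : ∀ v, 0 ≤ u v)
    (i : Fin d) (v : Vel d) :
    pd i u v ^ 2 ≤ 4 * Real.exp (9 * d + 15) * C * weight v * u v := by
  have hC := hu.nonneg
  have hw := weight_pos v
  have hκ : 1 ≤ Real.exp (9 * (d : ℝ) + 15) := Real.one_le_exp (by positivity)
  set κ := Real.exp (9 * (d : ℝ) + 15)
  rcases hC.eq_or_lt with hC | hC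
  · have := hu.abs_pd_le i v
    rw [← hC, zero_mul] at this
    have := abs_nonpos_iff.1 this
    rw [this, ← hC]; simp
  set K := κ * C * weight v with hK
  have hK0 : 0 < K := by positivity
  have hp : |pd i u v| ≤ K := (hu.abs_pd_le i v).trans (by
    rw [hK, mul_assoc]; exact le_mul_of_one_le_left (by positivity) hκ)
  set p := pd i u v with hpdef
  set h : Vel d := (-(p / (2 * K))) • bvec i with hh
  have hn : ‖h‖ = |p| / (2 * K) := by
    rw [hh, norm_smul, norm_bvec, mul_one, norm_neg, norm_div, Real.norm_eq_abs,
      Real.norm_of_nonneg (by positivity : (0 : ℝ) ≤ 2 * K)]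
  have hn1 : ‖h‖ ≤ 1 := by
    rw [hn, div_le_one (by positivity)]; linarith
  have hD2 : ∀ x ∈ closedBall v ‖h‖, ‖fderiv ℝ (fderiv ℝ u) x‖ ≤ K := fun x hx => by
    refine (hu.le_fderiv_two x).trans ?_
    have hx1 : ‖x - v‖ ≤ 1 := (mem_closedBall_iff_norm.1 hx).trans hn1
    have := weight_add_le (v := v) hx1
    rw [add_sub_cancel] at this
    calc C * weight x ≤ C * (κ * weight v) := by gcongr
      _ = K := by rw [hK]; ring
  have hd2 := hu.smooth.fderiv_infty.differentiable (by simp)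
  have hd1 := hu.smooth.differentiable (by simp)
  have hD1 : ∀ x ∈ closedBall v ‖h‖, ‖fderiv ℝ u x - fderiv ℝ u v‖ ≤ K * ‖h‖ := fun x hx => by
    refine ((convex_closedBall v ‖h‖).norm_image_sub_le_of_norm_fderiv_le (fun x _ => hd2 x) hD2
      (mem_closedBall_self (norm_nonneg h)) hx).trans ?_
    gcongr
    exact mem_closedBall_iff_norm.1 hx
  have h2 := (convex_closedBall v ‖h‖).norm_image_sub_le_of_norm_hasFDerivWithin_le'
    (fun x _ => (hd1 x).hasFDerivAt.hasFDerivWithinAt) hD1 (mem_closedBall_self (norm_nonneg h))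
    (y := v + h) (by simp)
  rw [add_sub_cancel_left, Real.norm_eq_abs] at h2
  have h3 := (le_abs_self _).trans h2
  have h4 : fderiv ℝ u v h = -(p ^ 2 / (2 * K)) := by
    rw [hh, map_smul, smul_eq_mul, ← pd, ← hpdef]; ring
  have h5 : K * ‖h‖ * ‖h‖ = p ^ 2 / (4 * K) := by
    rw [hn]
    have := sq_abs p
    field_simp
    nlinarith
  rw [h4, h5] at h3
  have h6 := h0 (v + h)
  have h7 : p ^ 2 / (2 * K) - p ^ 2 / (4 * K) = p ^ 2 / (4 * K) := by field_simp; ring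
  have h8 : p ^ 2 / (4 * K) ≤ u v := by linarith
  rw [div_le_iff₀ (by positivity)] at h8
  linarith

theorem abs_lap_le {u : Vel d → ℝ} {C : ℝ} (hu : DecayBound u C) (v : Vel d) :
    |lap u v| ≤ d * (C * weight v) := by
  refine (Finset.abs_sum_le_sum_abs _ _).trans
    ((Finset.sum_le_sum fun i _ => hu.abs_pd_pd_le i v).trans ?_)
  simp

theorem gradSq_le {u : Vel d → ℝ} {C : ℝ} (hu : DecayBound u C) (h0 : ∀ v, 0 ≤ u v) (v : Vel d) :
    gradSq u v ≤ d * (4 * Real.exp (9 * d + 15) * C * weight v * u v) := by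
  refine (Finset.sum_le_sum fun i _ => hu.pd_sq_le h0 i v).trans ?_
  simp

theorem gradSq_nonneg (u : Vel d → ℝ) (v : Vel d) : 0 ≤ gradSq u v :=
  Finset.sum_nonneg fun _ _ => sq_nonneg _

/-! ### Logarithms of positive distribution functions -/

section log

variable {u : Vel d → ℝ} {C c : ℝ}

theorem DecayBound.logBound (hu : DecayBound u C) (hc : 0 < c) (h : ∀ v, c * weight v ≤ u v) :
    LogBound (fun v => Real.log (u v)) (C / c + (C / c) ^ 2) C := by
  have hC := hu.nonneg
  have hpos : ∀ v, 0 < u v := fun v => (mul_pos hc (weight_pos v)).trans_le (h v)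
  have hr : ∀ v, ∀ n, n ≤ C * weight v → (u v)⁻¹ * n ≤ C / c := fun v n hn => by
    rw [inv_mul_le_iff₀ (hpos v)]
    refine hn.trans ?_
    calc C * weight v = C / c * (c * weight v) := by field_simp
      _ ≤ C / c * u v := by have := h v; gcongr
      _ = u v * (C / c) := mul_comm _ _
  refine ⟨hu.smooth.log fun v => (hpos v).ne', fun v => ?_, fun v => ?_, fun v => ?_⟩
  · rw [norm_fderiv_log (hu.smooth.differentiable (by simp)) hpos]
    have := hr v _ (hu.le_fderiv v)
    nlinarith [sq_nonneg (C / c)]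
  · refine (norm_fderiv_fderiv_log_le (hu.smooth.of_le two_le_infty) hpos v).trans ?_
    refine add_le_add (hr v _ (hu.le_fderiv_two v))
      (pow_le_pow_left₀ (mul_nonneg (inv_pos.2 (hpos v)).le (norm_nonneg _))
        (hr v _ (hu.le_fderiv v)) 2)
  · rw [Real.exp_log (hpos v)]
    exact (le_abs_self _).trans (hu.le v)

variable (hu : ContDiff ℝ (⊤ : ℕ∞) u) (hpos : ∀ v, 0 < u v)
include hu hpos

theorem pd_log (i : Fin d) : pd i (fun v => Real.log (u v)) = fun v => (u v)⁻¹ * pd i u v := by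
  funext v
  rw [pd, fderiv.log (hu.differentiable (by simp) v) (hpos v).ne']; rfl

theorem pd_pd_log (i : Fin d) (v : Vel d) : pd i (pd i fun v => Real.log (u v)) v
    = (u v)⁻¹ * pd i (pd i u) v - ((u v)⁻¹ * pd i u v) ^ 2 := by
  rw [pd_log hu hpos]
  have h1 : HasFDerivAt (fun x => (u x)⁻¹) (-(u v ^ 2)⁻¹ • fderiv ℝ u v) v :=
    (hasDerivAt_inv (hpos v).ne').comp_hasFDerivAt v (hu.differentiable (by simp) v).hasFDerivAt
  have h2 := ((hu.pd i).differentiable (by simp) v).hasFDerivAt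
  rw [pd, (HasFDerivAt.fun_mul h1 h2).fderiv]
  have e1 : fderiv ℝ u v (bvec i) = pd i u v := rfl
  have e2 : fderiv ℝ (pd i u) v (bvec i) = pd i (pd i u) v := rfl
  simp only [add_apply, smul_apply, smul_eq_mul, e1, e2]
  rw [mul_pow, inv_pow]; ring

theorem gradSq_log (v : Vel d) :
    gradSq (fun v => Real.log (u v)) v = ((u v)⁻¹) ^ 2 * gradSq u v := by
  simp only [gradSq, pd_log hu hpos, mul_pow, Finset.mul_sum]

theorem fisherPotential_log (v : Vel d) : fisherPotential (fun v => Real.log (u v)) v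
    = 2 * ((u v)⁻¹ * lap u v) - ((u v)⁻¹) ^ 2 * gradSq u v := by
  rw [fisherPotential, gradSq_log hu hpos]
  simp only [lap, pd_pd_log hu hpos, Finset.sum_sub_distrib, gradSq, ← Finset.mul_sum, mul_pow]
  ring

end log

theorem DecayBound.pos_of_le {u : Vel d → ℝ} {c : ℝ} (hc : 0 < c) (h : ∀ v, c * weight v ≤ u v)
    (v : Vel d) : 0 < u v := (mul_pos hc (weight_pos v)).trans_le (h v)

/-- The constant in the bound of the Fisher potential. -/
def potentialConst (d : ℕ) (C : ℝ) : ℝ := 2 * (d * C) + d * (4 * Real.exp (9 * d + 15) * C)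

/-- The Fisher potential of `log u` is of the order `1/c` if `u ≥ c G` for the weight `G`: by
`DecayBound.pd_sq_le` the square `|∇u|²/u²` costs only one power of `1/u`. -/
theorem DecayBound.abs_fisherPotential_log_le {u : Vel d → ℝ} {C c : ℝ} (hu : DecayBound u C)
    (hc : 0 < c) (h : ∀ v, c * weight v ≤ u v) (v : Vel d) :
    c * |fisherPotential (fun v => Real.log (u v)) v| ≤ potentialConst d C := by
  have hC := hu.nonneg
  have hpos := DecayBound.pos_of_le hc h
  have hv := hpos v
  have hw := weight_pos v
  have hr : c * weight v * (u v)⁻¹ ≤ 1 := by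
    rw [← div_eq_mul_inv, div_le_one hv]; exact h v
  rw [fisherPotential_log hu.smooth hpos]
  have h1 := abs_lap_le hu v
  have h2 := gradSq_le hu (fun v => (hpos v).le) v
  have hui := inv_pos.2 hv
  have b1 : c * |2 * ((u v)⁻¹ * lap u v)| ≤ 2 * (d * C) := by
    rw [abs_mul, abs_two, abs_mul, abs_of_pos hui]
    calc c * (2 * ((u v)⁻¹ * |lap u v|)) ≤ c * (2 * ((u v)⁻¹ * (d * (C * weight v)))) := by gcongr
      _ = 2 * (d * C) * (c * weight v * (u v)⁻¹) := by ring
      _ ≤ 2 * (d * C) * 1 := by gcongr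
      _ = _ := mul_one _
  have b2 : c * |((u v)⁻¹) ^ 2 * gradSq u v| ≤ d * (4 * Real.exp (9 * d + 15) * C) := by
    rw [abs_of_nonneg (mul_nonneg (sq_nonneg _) (gradSq_nonneg _ _))]
    calc c * ((u v)⁻¹ ^ 2 * gradSq u v)
        ≤ c * ((u v)⁻¹ ^ 2 * (d * (4 * Real.exp (9 * d + 15) * C * weight v * u v))) := by gcongr
      _ = d * (4 * Real.exp (9 * d + 15) * C) * (c * weight v * (u v)⁻¹) * ((u v)⁻¹ * u v) := by ring
      _ = d * (4 * Real.exp (9 * d + 15) * C) * (c * weight v * (u v)⁻¹) := by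
          rw [inv_mul_cancel₀ hv.ne', mul_one]
      _ ≤ d * (4 * Real.exp (9 * d + 15) * C) * 1 := by gcongr
      _ = _ := mul_one _
  have := mul_le_mul_of_nonneg_left (abs_sub (2 * ((u v)⁻¹ * lap u v))
    (((u v)⁻¹) ^ 2 * gradSq u v)) hc.le
  rw [mul_add] at this
  unfold potentialConst
  linarith

theorem DecayBound.continuous_fisherPotential_log {u : Vel d → ℝ} {C : ℝ} (hu : DecayBound u C)
    (hpos : ∀ v, 0 < u v) : Continuous (fisherPotential fun v => Real.log (u v)) := by
  have hs : ContDiff ℝ (⊤ : ℕ∞) fun v => Real.log (u v) := hu.smooth.log fun v => (hpos v).ne'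
  exact ((contDiff_const.mul hs.lap).add hs.gradSq : ContDiff ℝ (⊤ : ℕ∞) _).continuous

/-! ### Convexity of the Fisher information -/

section convexity

variable {u u₁ u₂ : Vel d → ℝ} {C c : ℝ}

theorem gradSq_div_le (hu : DecayBound u C) (hpos : ∀ v, 0 < u v) (v : Vel d) :
    gradSq u v / u v ≤ d * (4 * Real.exp (9 * d + 15) * C) * weight v := by
  rw [div_le_iff₀ (hpos v)]
  refine (gradSq_le hu (fun v => (hpos v).le) v).trans (le_of_eq ?_)
  ring

theorem continuous_gradSq_div (hu : DecayBound u C) (hpos : ∀ v, 0 < u v) :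
    Continuous fun v => gradSq u v / u v :=
  hu.smooth.gradSq.continuous.div₀ hu.smooth.continuous fun v => (hpos v).ne'

theorem integrable_gradSq_div (hu : DecayBound u C) (hpos : ∀ v, 0 < u v) :
    Integrable fun v => gradSq u v / u v := by
  refine (integrable_weight.const_mul (d * (4 * Real.exp (9 * d + 15) * C))).mono'
    (continuous_gradSq_div hu hpos).aestronglyMeasurable (Filter.Eventually.of_forall fun v => ?_)
  rw [Real.norm_of_nonneg (div_nonneg (gradSq_nonneg _ _) (hpos v).le)]
  exact gradSq_div_le hu hpos v

/-- The Fisher information lies above its tangent: the function `(p, u) ↦ |p|²/u` is convex. -/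
theorem integral_gradSq_div_sub_le (h₁ : DecayBound u₁ C) (h₂ : DecayBound u₂ C) (hc : 0 < c)
    (hc₁ : ∀ v, c * weight v ≤ u₁ v) (hc₂ : ∀ v, c * weight v ≤ u₂ v) :
    (∫ v, gradSq u₁ v / u₁ v)
      - ∫ v, fisherPotential (fun v => Real.log (u₁ v)) v * (u₂ v - u₁ v)
      ≤ ∫ v, gradSq u₂ v / u₂ v := by
  have p₁ := DecayBound.pos_of_le hc hc₁
  have p₂ := DecayBound.pos_of_le hc hc₂
  have hl := h₁.logBound hc hc₁
  set l : Vel d → ℝ := fun v => Real.log (u₁ v) with hldef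
  set M := C / c + (C / c) ^ 2 with hM
  set w : Vel d → ℝ := fun v => u₂ v - u₁ v with hw
  have hws : ContDiff ℝ (⊤ : ℕ∞) w := h₂.smooth.sub h₁.smooth
  have hpw : ∀ i, pd i w = fun v => pd i u₂ v - pd i u₁ v := fun i => by
    funext v
    rw [pd, hw, fderiv_fun_sub (h₂.smooth.differentiable (by simp) v)
      (h₁.smooth.differentiable (by simp) v), sub_apply]; rfl
  have iw : Integrable w := by
    refine (integrable_weight.const_mul (2 * C)).mono' hws.continuous.aestronglyMeasurable
      (Filter.Eventually.of_forall fun v => ?_)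
    rw [Real.norm_eq_abs]
    exact (abs_sub _ _).trans (by linarith [h₁.le v, h₂.le v])
  have ipw : ∀ i, Integrable (pd i w) := fun i => by
    refine (integrable_weight.const_mul (2 * C)).mono' (hws.pd i).continuous.aestronglyMeasurable
      (Filter.Eventually.of_forall fun v => ?_)
    rw [Real.norm_eq_abs, hpw]
    exact (abs_sub _ _).trans (by linarith [h₁.abs_pd_le i v, h₂.abs_pd_le i v])
  have i1 : ∀ i, Integrable fun v => pd i l v * pd i w v := fun i =>
    (ipw i).bdd_mul (hl.smooth.pd i).continuous.aestronglyMeasurable (c := M)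
      (Filter.Eventually.of_forall fun v => hl.abs_pd_le i v)
  have i2 : ∀ i, Integrable fun v => pd i (pd i l) v * w v := fun i =>
    iw.bdd_mul ((hl.smooth.pd i).pd i).continuous.aestronglyMeasurable (c := M)
      (Filter.Eventually.of_forall fun v => hl.abs_pd_pd_le i v)
  have i3 : ∀ i, Integrable fun v => pd i l v * w v := fun i =>
    iw.bdd_mul (hl.smooth.pd i).continuous.aestronglyMeasurable (c := M)
      (Filter.Eventually.of_forall fun v => hl.abs_pd_le i v)
  have i4 : ∀ i, Integrable fun v => pd i l v ^ 2 * w v := fun i =>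
    iw.bdd_mul ((hl.smooth.pd i).continuous.pow 2).aestronglyMeasurable (c := M ^ 2)
      (Filter.Eventually.of_forall fun v => by
        rw [norm_pow]; exact pow_le_pow_left₀ (norm_nonneg _) (hl.abs_pd_le i v) 2)
  have ibp : ∀ i, ∫ v, pd i l v * pd i w v = -∫ v, pd i (pd i l) v * w v := fun i =>
    integral_mul_fderiv_eq_neg_fderiv_mul_of_integrable (i2 i) (i1 i) (i3 i)
      (fun v _ => (hl.smooth.pd i).differentiable (by simp) v)
      (fun v _ => hws.differentiable (by simp) v)
  have i5 : Integrable fun v => ∑ i, (2 * (pd i l v * pd i w v) - pd i l v ^ 2 * w v) :=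
    integrable_finsetSum _ fun i _ => ((i1 i).const_mul 2).sub (i4 i)
  have e1 : ∫ v, fisherPotential l v * w v
      = -∫ v, ∑ i, (2 * (pd i l v * pd i w v) - pd i l v ^ 2 * w v) := by
    have e2 : ∀ v, fisherPotential l v * w v
        = ∑ i, (2 * (pd i (pd i l) v * w v) + pd i l v ^ 2 * w v) := fun v => by
      rw [fisherPotential, lap, gradSq, Finset.mul_sum, ← Finset.sum_add_distrib, Finset.sum_mul]
      exact Finset.sum_congr rfl fun i _ => by ring
    have i8 : ∀ i, Integrable fun v => 2 * (pd i (pd i l) v * w v) + pd i l v ^ 2 * w v :=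
      fun i => ((i2 i).const_mul 2).add (i4 i)
    have i9 : ∀ i, Integrable fun v => 2 * (pd i l v * pd i w v) - pd i l v ^ 2 * w v :=
      fun i => ((i1 i).const_mul 2).sub (i4 i)
    simp only [e2]
    rw [integral_finsetSum _ fun i _ => i8 i, integral_finsetSum _ fun i _ => i9 i,
      ← Finset.sum_neg_distrib]
    refine Finset.sum_congr rfl fun i _ => ?_
    rw [integral_add ((i2 i).const_mul 2) (i4 i), integral_sub ((i1 i).const_mul 2) (i4 i),
      integral_const_mul, integral_const_mul, ibp]
    ring
  have i6 := integrable_gradSq_div h₁ p₁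
  have i7 := integrable_gradSq_div h₂ p₂
  rw [e1, sub_neg_eq_add, ← integral_add i6 i5]
  refine integral_mono (i6.add i5) i7 fun v => ?_
  have q₁ := p₁ v
  have q₂ := p₂ v
  simp only [gradSq, Finset.sum_div]
  rw [← Finset.sum_add_distrib]
  refine Finset.sum_le_sum fun i _ => ?_
  rw [hpw, hldef, pd_log h₁.smooth p₁, hw]
  have key : pd i u₂ v ^ 2 / u₂ v - (pd i u₁ v ^ 2 / u₁ v
      + (2 * ((u₁ v)⁻¹ * pd i u₁ v * (pd i u₂ v - pd i u₁ v))
        - ((u₁ v)⁻¹ * pd i u₁ v) ^ 2 * (u₂ v - u₁ v)))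
      = (pd i u₂ v - pd i u₁ v * u₂ v / u₁ v) ^ 2 / u₂ v := by
    field_simp; ring
  have : 0 ≤ (pd i u₂ v - pd i u₁ v * u₂ v / u₁ v) ^ 2 / u₂ v := by positivity
  linarith

end convexity

/-! ### The Fisher information along the flow -/

/-- A nonnegative solution of the Boltzmann equation on `[t₁, t₂]` with uniform decay. -/
structure Flow (α b : ℝ → ℝ) (f : ℝ → Vel d → ℝ) (t₁ t₂ C : ℝ) : Prop where
  decay : ∀ t ∈ Icc t₁ t₂, DecayBound (f t) C
  nonneg : ∀ t ∈ Icc t₁ t₂, ∀ v, 0 ≤ f t v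
  equation : ∀ t ∈ Icc t₁ t₂, ∀ v,
    HasDerivAt (fun s => f s v) (collision (fun r c => α (r / 2) * b c) (f t) v) t

/-- The regularisation of a distribution function by a multiple of the weight. -/
def lift (ε : ℝ) (f : Vel d → ℝ) (v : Vel d) : ℝ := f v + ε * weight v

theorem le_lift {ε : ℝ} {f : Vel d → ℝ} (h0 : ∀ v, 0 ≤ f v) (v : Vel d) :
    ε * weight v ≤ lift ε f v := by unfold lift; linarith [h0 v]

theorem DecayBound.lift {f : Vel d → ℝ} {C ε : ℝ} (h : DecayBound f C) (h0 : 0 ≤ ε) (h1 : ε ≤ 1) :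
    DecayBound (lift ε f) (C + weightConst d) := by
  refine (h.add_const_mul decayBound_weight h0).mono ?_
  have := (decayBound_weight (d := d)).nonneg
  nlinarith

namespace CollisionKernel

variable {α b : ℝ → ℝ} (hk : CollisionKernel d α b)
include hk

theorem exists_dominating_collision (hd : 1 ≤ d) (C : ℝ) : ∃ g : Vel d → ℝ, Integrable g ∧
    ∀ᵐ v, 0 ≤ g v ∧ ∀ f, DecayBound f C →
      |collision (fun r c => α (r / 2) * b c) f v| ≤ g v := by
  obtain ⟨q, hq, hqb⟩ := hk.exists_dominating hd (A := C)
  rw [Measure.volume_eq_prod] at hq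
  refine ⟨fun v => (1 / 2) * ∫ w, |q (v, w)|, (hq.norm.integral_prod_left).const_mul _, ?_⟩
  filter_upwards [hq.prod_right_ae] with v hv
  refine ⟨mul_nonneg (by norm_num) (integral_nonneg fun w => abs_nonneg _), fun f hf => ?_⟩
  rw [collision_eq, ← integral_const_mul, ← Real.norm_eq_abs]
  refine norm_integral_le_of_norm_le (hv.norm.const_mul _) (Filter.Eventually.of_forall fun w => ?_)
  rw [norm_mul, Real.norm_of_nonneg (by norm_num : (0 : ℝ) ≤ 1 / 2)]
  exact mul_le_mul_of_nonneg_left ((hqb f f hf hf (v, w)).trans (le_abs_self _)) (by norm_num)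

/-- The error in the dissipation of the Fisher information that the regularisation creates. -/
theorem dissipation_lift_le (hd : 1 ≤ d) {N : ℝ} (hN : ∀ r, 0 < r → r * |deriv α r| ≤ N * α r)
    (hα : ∀ r : ℝ, 0 < r →
      ENNReal.ofReal (r * |deriv α r| / (2 * α r)) ≤ (bestLogSobolev d b) ^ (1 / 2 : ℝ))
    {f : Vel d → ℝ} {C ε : ℝ} (hf : DecayBound f C) (h0 : ∀ v, 0 ≤ f v) (hε : 0 < ε) (hε1 : ε ≤ 1) :
    -∫ v, fisherPotential (fun v => Real.log (lift ε f v)) v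
        * collision (fun r c => α (r / 2) * b c) f v
      ≤ (1 / 2) * ∫ p : Vel d × Vel d, ε * fisherPotential (fun v => Real.log (lift ε f v)) p.1
        * pairCollision α b weight (fun v => 2 * f v + ε * weight v) p := by
  have hu := hf.lift hε.le hε1
  have hle := le_lift (ε := ε) h0
  have hpos := DecayBound.pos_of_le hε hle
  have hl := hu.logBound hε hle
  have hcont := hu.continuous_fisherPotential_log hpos
  have hK : ∀ v, |fisherPotential (fun v => Real.log (lift ε f v)) v|
      ≤ potentialConst d (C + weightConst d) / ε := fun v => by
    rw [le_div_iff₀ hε, mul_comm]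
    exact hu.abs_fisherPotential_log_le hε hle v
  set P := fisherPotential (fun v => Real.log (lift ε f v)) with hP
  have he : (fun v => Real.exp (Real.log (lift ε f v))) = lift ε f :=
    funext fun v => Real.exp_log (hpos v)
  have h1 := hk.integral_fisherPotential_mul_nonneg hd hl (by rw [he]; exact hu) hN hα hK
  rw [he, ← hP] at h1
  have h2f : DecayBound (fun v => 2 * f v + ε * weight v) (C + 1 * C + ε * weightConst d) := by
    have := (hf.add_const_mul hf zero_le_one).add_const_mul decayBound_weight hε.le
    refine (congrArg (fun g => DecayBound g _) (funext fun v => ?_)).mp this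
    ring
  have i1 : Integrable fun p : Vel d × Vel d => P p.1 * pairCollision α b f f p :=
    (hk.integrable_pairCollision hd hf hf).bdd_mul
      (hcont.comp continuous_fst).aestronglyMeasurable (Filter.Eventually.of_forall fun p => hK p.1)
  have i2 : Integrable fun p : Vel d × Vel d => ε * P p.1 *
      pairCollision α b weight (fun v => 2 * f v + ε * weight v) p :=
    (hk.integrable_pairCollision hd decayBound_weight h2f).bdd_mul
      (continuous_const.mul (hcont.comp continuous_fst)).aestronglyMeasurable
      (c := ε * (potentialConst d (C + weightConst d) / ε))
      (Filter.Eventually.of_forall fun p => by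
        rw [norm_mul, Real.norm_of_nonneg hε.le]; exact mul_le_mul_of_nonneg_left (hK p.1) hε.le)
  have e1 : ∀ p : Vel d × Vel d, P p.1 * pairCollision α b (lift ε f) (lift ε f) p
      = P p.1 * pairCollision α b f f p
        + ε * P p.1 * pairCollision α b weight (fun v => 2 * f v + ε * weight v) p := fun p => by
    have := hk.pairCollision_add_const_mul hf.smooth decayBound_weight.smooth ε p
    rw [show lift ε f = fun v => f v + ε * weight v from rfl, this]; ring
  simp only [e1] at h1
  rw [integral_add i1 i2] at h1
  rw [hk.integral_mul_collision hd hf hcont hK]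
  linarith

end CollisionKernel

/-! ### Removing the regularisation of the dissipation -/

/-- The derivative of a function vanishes almost everywhere on its zero set. -/
theorem ae_fderiv_eq_zero {φ : Vel d → ℝ} (hφ : ContDiff ℝ (⊤ : ℕ∞) φ) {e : Vel d} (he : ‖e‖ = 1) :
    ∀ᵐ v, φ v = 0 → fderiv ℝ φ v = 0 := by
  set s : Set (Vel d) := {v | φ v = 0} with hs
  have hsm : MeasurableSet s := (isClosed_singleton.preimage hφ.continuous).measurableSet
  have h1 : ApproximatesLinearOn (fun v => φ v • e) (0 : Vel d →L[ℝ] Vel d) s 0 := fun x hx y hy => by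
    have hx' : φ x = 0 := hx
    have hy' : φ y = 0 := hy
    simp [hx', hy']
  have h2 := h1.norm_fderiv_sub_le volume hsm (fun v => (fderiv ℝ φ v).smulRight e) fun v _ =>
    ((hφ.differentiable (by simp) v).hasFDerivAt.smul_const e).hasFDerivWithinAt
  rw [ae_restrict_iff' hsm] at h2
  filter_upwards [h2] with v hv hv0
  have h3 := hv hv0
  rw [sub_zero, nonpos_iff_eq_zero, nnnorm_eq_zero] at h3
  have h4 := congrArg norm h3
  rwa [ContinuousLinearMap.norm_smulRight_apply, he, mul_one, norm_zero, norm_eq_zero] at h4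

theorem pd_eq_zero_of_nonneg {f : Vel d → ℝ} (h0 : ∀ v, 0 ≤ f v) {v : Vel d} (hv : f v = 0)
    (i : Fin d) : pd i f v = 0 := by
  have : IsLocalMin f v := Filter.Eventually.of_forall fun w => hv ▸ h0 w
  rw [pd, this.fderiv_eq_zero, zero_apply]

theorem ae_lap_eq_zero {f : Vel d → ℝ} (hf : ContDiff ℝ (⊤ : ℕ∞) f) (h0 : ∀ v, 0 ≤ f v) :
    ∀ᵐ v, f v = 0 → lap f v = 0 := by
  have h := ae_all_iff.2 fun i => ae_fderiv_eq_zero (hf.pd i) (norm_bvec i)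
  filter_upwards [h] with v hv hv0
  refine Finset.sum_eq_zero fun i _ => ?_
  rw [pd, hv i (pd_eq_zero_of_nonneg h0 hv0 i), zero_apply]

theorem contDiff_lift {f : Vel d → ℝ} (hf : ContDiff ℝ (⊤ : ℕ∞) f) (ε : ℝ) :
    ContDiff ℝ (⊤ : ℕ∞) (lift ε f) := hf.add (contDiff_const.mul decayBound_weight.smooth)

theorem pd_lift {f : Vel d → ℝ} (hf : ContDiff ℝ (⊤ : ℕ∞) f) (ε : ℝ) (i : Fin d) :
    pd i (lift ε f) = fun v => pd i f v + ε * pd i weight v := by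
  funext v
  have h1 := (hf.differentiable (by simp) v).hasFDerivAt
  have h2 := ((decayBound_weight (d := d)).smooth.differentiable (by simp) v).hasFDerivAt
  have h3 : HasFDerivAt (lift ε f) (fderiv ℝ f v + ε • fderiv ℝ weight v) v :=
    h1.add (h2.const_mul ε)
  rw [pd, h3.fderiv]; rfl

theorem lap_lift {f : Vel d → ℝ} (hf : ContDiff ℝ (⊤ : ℕ∞) f) (ε : ℝ) (v : Vel d) :
    lap (lift ε f) v = lap f v + ε * lap weight v := by
  rw [lap, lap, lap, Finset.mul_sum, ← Finset.sum_add_distrib]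
  refine Finset.sum_congr rfl fun i _ => ?_
  rw [pd_lift hf]
  have h1 := ((hf.pd i).differentiable (by simp) v).hasFDerivAt
  have h2 := (((decayBound_weight (d := d)).smooth.pd i).differentiable (by simp) v).hasFDerivAt
  rw [pd, (h1.fun_add (h2.const_mul ε)).fderiv]; rfl

theorem gradSq_lift {f : Vel d → ℝ} (hf : ContDiff ℝ (⊤ : ℕ∞) f) (ε : ℝ) (v : Vel d) :
    gradSq (lift ε f) v = ∑ i, (pd i f v + ε * pd i weight v) ^ 2 := by
  simp only [gradSq, pd_lift hf]

theorem ae_tendsto_fisherPotential_lift {f : Vel d → ℝ} {C : ℝ} (hf : DecayBound f C)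
    (h0 : ∀ v, 0 ≤ f v) {ε : ℕ → ℝ} (hε : ∀ n, 0 < ε n)
    (hε0 : Filter.Tendsto ε Filter.atTop (nhds 0)) :
    ∀ᵐ v, Filter.Tendsto
      (fun n => ε n * fisherPotential (fun v => Real.log (lift (ε n) f v)) v)
      Filter.atTop (nhds 0) := by
  filter_upwards [ae_lap_eq_zero hf.smooth h0] with v hv
  have e1 : ∀ n, ε n * fisherPotential (fun v => Real.log (lift (ε n) f v)) v
      = ε n * (2 * ((f v + ε n * weight v)⁻¹ * (lap f v + ε n * lap weight v))
        - ((f v + ε n * weight v)⁻¹) ^ 2 * ∑ i, (pd i f v + ε n * pd i weight v) ^ 2) := fun n => by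
    rw [fisherPotential_log (contDiff_lift hf.smooth _)
      (DecayBound.pos_of_le (hε n) (le_lift h0)), lap_lift hf.smooth, gradSq_lift hf.smooth, lift]
  simp only [e1]
  have hw := weight_pos v
  rcases (h0 v).eq_or_lt with h | h
  · have hl := hv h.symm
    have e2 : ∀ n, ε n * (2 * ((f v + ε n * weight v)⁻¹ * (lap f v + ε n * lap weight v))
        - ((f v + ε n * weight v)⁻¹) ^ 2 * ∑ i, (pd i f v + ε n * pd i weight v) ^ 2)
        = ε n * (2 * ((weight v)⁻¹ * lap weight v)
          - ((weight v)⁻¹) ^ 2 * ∑ i, (pd i weight v) ^ 2) := fun n => by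
      have := (hε n).ne'
      simp only [pd_eq_zero_of_nonneg h0 h.symm, hl, ← h, zero_add, mul_pow, ← Finset.mul_sum,
        mul_inv]
      field_simp
    simp only [e2]
    simpa using hε0.mul_const _
  · have hc : ContinuousAt (fun x : ℝ => x * (2 * ((f v + x * weight v)⁻¹ * (lap f v + x * lap weight v))
        - ((f v + x * weight v)⁻¹) ^ 2 * ∑ i, (pd i f v + x * pd i weight v) ^ 2)) 0 := by
      have hi : ContinuousAt (fun x : ℝ => (f v + x * weight v)⁻¹) 0 :=
        ContinuousAt.inv₀ (by fun_prop) (by simpa using h.ne')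
      exact continuousAt_id.mul ((continuousAt_const.mul (hi.mul (by fun_prop))).sub
        ((hi.pow 2).mul (by fun_prop)))
    have := hc.tendsto.comp hε0
    simpa [Function.comp_def] using this

namespace CollisionKernel

variable {α b : ℝ → ℝ} (hk : CollisionKernel d α b)
include hk

/-- The error in the dissipation of the Fisher information is bounded and tends to `0` as the
regularisation is removed. -/
theorem exists_dissipation_error_bound (hd : 1 ≤ d) (C : ℝ) : ∃ K : ℝ, ∀ f : Vel d → ℝ,
    DecayBound f C → (∀ v, 0 ≤ f v) → ∀ ε : ℕ → ℝ, (∀ n, 0 < ε n) → (∀ n, ε n ≤ 1) →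
    Filter.Tendsto ε Filter.atTop (nhds 0) →
    (∀ n, (1 / 2) * ∫ p : Vel d × Vel d, ε n *
      fisherPotential (fun v => Real.log (lift (ε n) f v)) p.1
        * pairCollision α b weight (fun v => 2 * f v + ε n * weight v) p ≤ K) ∧
    Filter.Tendsto (fun n => (1 / 2) * ∫ p : Vel d × Vel d, ε n *
      fisherPotential (fun v => Real.log (lift (ε n) f v)) p.1
        * pairCollision α b weight (fun v => 2 * f v + ε n * weight v) p)
      Filter.atTop (nhds 0) := by
  set wC := weightConst d
  obtain ⟨q, hq, hqb⟩ := hk.exists_dominating hd (A := 2 * |C| + wC)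
  set P := potentialConst d (C + wC) with hP
  refine ⟨(1 / 2) * ∫ p, P * q p, fun f hf h0 ε hε hε1 hε0 => ?_⟩
  have hwC : 0 ≤ wC := (decayBound_weight (d := d)).nonneg
  have hC := hf.nonneg
  rw [abs_of_nonneg hC] at hqb
  have h2f : ∀ n, DecayBound (fun v => 2 * f v + ε n * weight v) (2 * C + wC) := fun n => by
    have := ((hf.add_const_mul hf zero_le_one).add_const_mul decayBound_weight (hε n).le).mono
      (C' := 2 * C + wC) (by
        have := mul_le_of_le_one_left hwC (hε1 n)
        linarith)
    refine (congrArg (fun g => DecayBound g _) (funext fun v => ?_)).mp this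
    ring
  have hG : DecayBound (weight (d := d)) (2 * C + wC) := decayBound_weight.mono (by linarith)
  have hu := fun n => hf.lift (hε n).le (hε1 n)
  have hle := fun n => le_lift (ε := ε n) h0
  have hPb : ∀ n v, |ε n * fisherPotential (fun v => Real.log (lift (ε n) f v)) v| ≤ P := fun n v => by
    rw [abs_mul, abs_of_pos (hε n)]
    exact (hu n).abs_fisherPotential_log_le (hε n) (hle n) v
  have hP0 : 0 ≤ P := (abs_nonneg _).trans (hPb 0 0)
  have hb : ∀ n (p : Vel d × Vel d), ‖ε n * fisherPotential (fun v => Real.log (lift (ε n) f v)) p.1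
        * pairCollision α b weight (fun v => 2 * f v + ε n * weight v) p‖ ≤ P * q p := fun n p => by
    rw [norm_mul]
    exact mul_le_mul (hPb n p.1) (hqb _ _ hG (h2f n) p) (norm_nonneg _) hP0
  have hi : ∀ n, Integrable fun p : Vel d × Vel d => ε n *
      fisherPotential (fun v => Real.log (lift (ε n) f v)) p.1
        * pairCollision α b weight (fun v => 2 * f v + ε n * weight v) p := fun n =>
    (hk.integrable_pairCollision hd hG (h2f n)).bdd_mul
      (continuous_const.mul (((hu n).continuous_fisherPotential_log
        (DecayBound.pos_of_le (hε n) (hle n))).comp continuous_fst)).aestronglyMeasurable (c := P)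
      (Filter.Eventually.of_forall fun p => hPb n p.1)
  constructor
  · intro n
    refine mul_le_mul_of_nonneg_left (integral_mono (hi n) (hq.const_mul P) fun p => ?_) (by norm_num)
    exact (le_abs_self _).trans (hb n p)
  · have hlim : Filter.Tendsto (fun n => ∫ p : Vel d × Vel d, ε n *
        fisherPotential (fun v => Real.log (lift (ε n) f v)) p.1
          * pairCollision α b weight (fun v => 2 * f v + ε n * weight v) p)
        Filter.atTop (nhds (∫ _p : Vel d × Vel d, (0 : ℝ))) := by
      refine tendsto_integral_of_dominated_convergence (fun p => P * q p)
        (fun n => (hi n).aestronglyMeasurable) (hq.const_mul P)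
        (fun n => Filter.Eventually.of_forall (hb n)) ?_
      have hae := ae_tendsto_fisherPotential_lift hf h0 hε hε0
      have hae2 : ∀ᵐ p : Vel d × Vel d, Filter.Tendsto
          (fun n => ε n * fisherPotential (fun v => Real.log (lift (ε n) f v)) p.1)
          Filter.atTop (nhds 0) := by
        rw [Measure.volume_eq_prod]
        exact Measure.quasiMeasurePreserving_fst.ae hae
      filter_upwards [hae2] with p hp
      refine squeeze_zero_norm (fun n => ?_) (a := fun n =>
        |ε n * fisherPotential (fun v => Real.log (lift (ε n) f v)) p.1| * q p) ?_
      · rw [norm_mul]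
        exact mul_le_mul_of_nonneg_left (hqb _ _ hG (h2f n) p) (norm_nonneg _)
      · simpa using (hp.abs).mul_const (q p)
    simpa using hlim.const_mul (1 / 2 : ℝ)

end CollisionKernel

/-! ### Monotonicity of the regularised Fisher information up to a small error -/

/-- The Fisher information of the regularised distribution function. -/
def liftFisher (ε : ℝ) (f : Vel d → ℝ) : ℝ := ∫ v, gradSq (lift ε f) v / lift ε f v

namespace Flow

variable {α b : ℝ → ℝ} {f : ℝ → Vel d → ℝ} {t₁ t₂ C : ℝ}

/-- Solutions are Lipschitz continuous in time, with an integrable constant. -/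
theorem exists_lipschitz (hk : CollisionKernel d α b) (hd : 1 ≤ d) (hf : Flow α b f t₁ t₂ C) :
    ∃ g : Vel d → ℝ, Integrable g ∧ ∀ᵐ v, 0 ≤ g v ∧
      ∀ s ∈ Icc t₁ t₂, ∀ t ∈ Icc t₁ t₂, |f s v - f t v| ≤ g v * |s - t| := by
  obtain ⟨g, hg, hgb⟩ := hk.exists_dominating_collision hd C
  refine ⟨g, hg, ?_⟩
  filter_upwards [hgb] with v hv
  refine ⟨hv.1, fun s hs t ht => ?_⟩
  exact (convex_Icc t₁ t₂).norm_image_sub_le_of_norm_hasDerivWithin_le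
    (fun x hx => (hf.equation x hx v).hasDerivWithinAt) (fun x hx => hv.2 _ (hf.decay x hx)) ht hs

section

variable (hf : Flow α b f t₁ t₂ C) {ε : ℝ} (hε : 0 < ε) (hε1 : ε ≤ 1)
include hf hε hε1

/-- The Fisher information lies above its tangent along the flow. -/
theorem liftFisher_sub_le {s t : ℝ} (hs : s ∈ Icc t₁ t₂) (ht : t ∈ Icc t₁ t₂) :
    liftFisher ε (f t) - ∫ v, fisherPotential (fun v => Real.log (lift ε (f t) v)) v
      * (f s v - f t v) ≤ liftFisher ε (f s) := by
  have h := integral_gradSq_div_sub_le ((hf.decay t ht).lift hε.le hε1)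
    ((hf.decay s hs).lift hε.le hε1) hε (le_lift (hf.nonneg t ht)) (le_lift (hf.nonneg s hs))
  have e : ∀ v, lift ε (f s) v - lift ε (f t) v = f s v - f t v := fun v => by
    simp only [lift]; ring
  simpa only [e, liftFisher] using h

theorem abs_potential_le {t : ℝ} (ht : t ∈ Icc t₁ t₂) (v : Vel d) :
    |fisherPotential (fun v => Real.log (lift ε (f t) v)) v|
      ≤ potentialConst d (C + weightConst d) / ε := by
  rw [le_div_iff₀ hε, mul_comm]
  exact ((hf.decay t ht).lift hε.le hε1).abs_fisherPotential_log_le hε (le_lift (hf.nonneg t ht)) v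

theorem continuous_potential {t : ℝ} (ht : t ∈ Icc t₁ t₂) :
    Continuous (fisherPotential fun v => Real.log (lift ε (f t) v)) :=
  ((hf.decay t ht).lift hε.le hε1).continuous_fisherPotential_log
    (DecayBound.pos_of_le hε (le_lift (hf.nonneg t ht)))

theorem exists_lipschitzOnWith (hk : CollisionKernel d α b) (hd : 1 ≤ d) :
    ∃ L : ℝ≥0, LipschitzOnWith L (fun t => liftFisher ε (f t)) (Icc t₁ t₂) := by
  obtain ⟨g, hg, hgb⟩ := hf.exists_lipschitz hk hd
  set K := potentialConst d (C + weightConst d) / ε with hK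
  have key : ∀ s ∈ Icc t₁ t₂, ∀ t ∈ Icc t₁ t₂,
      liftFisher ε (f t) - liftFisher ε (f s) ≤ (K * ∫ v, |g v|) * |s - t| := by
    intro s hs t ht
    have h1 := hf.liftFisher_sub_le hε hε1 hs ht
    have h2 : |∫ v, fisherPotential (fun v => Real.log (lift ε (f t) v)) v * (f s v - f t v)|
        ≤ ∫ v, K * (|g v| * |s - t|) := by
      rw [← Real.norm_eq_abs]
      refine norm_integral_le_of_norm_le ((hg.norm.mul_const _).const_mul _) ?_
      filter_upwards [hgb] with v hv
      rw [norm_mul]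
      have h3 := hf.abs_potential_le hε hε1 ht v
      refine mul_le_mul h3 ((hv.2 s hs t ht).trans ?_) (norm_nonneg _) ((abs_nonneg _).trans h3)
      exact mul_le_mul_of_nonneg_right (le_abs_self _) (abs_nonneg _)
    rw [integral_const_mul, integral_mul_const] at h2
    have := (le_abs_self _).trans h2
    linarith
  refine ⟨(K * ∫ v, |g v|).toNNReal, LipschitzOnWith.of_dist_le_mul fun s hs t ht => ?_⟩
  rw [Real.dist_eq, Real.dist_eq]
  refine le_trans ?_ (mul_le_mul_of_nonneg_right (Real.le_coe_toNNReal _) (abs_nonneg _))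
  rw [abs_le']
  refine ⟨?_, ?_⟩
  · rw [abs_sub_comm]; exact key t ht s hs
  · rw [neg_sub]; exact key s hs t ht

/-- The derivative of the Fisher information is at most the dissipation. The tangent inequality is
used at earlier times, so that only the difference quotients of the solution pass to the limit. -/
theorem deriv_liftFisher_le (hk : CollisionKernel d α b) (hd : 1 ≤ d) {t j : ℝ}
    (ht : t ∈ Ioc t₁ t₂) (hj : HasDerivAt (fun t => liftFisher ε (f t)) j t) :
    j ≤ -∫ v, fisherPotential (fun v => Real.log (lift ε (f t) v)) v
      * collision (fun r c => α (r / 2) * b c) (f t) v := by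
  obtain ⟨g, hg, hgb⟩ := hf.exists_lipschitz hk hd
  have htc := Ioc_subset_Icc_self ht
  set P := fisherPotential fun v => Real.log (lift ε (f t) v) with hP
  have hPc : Continuous P := hf.continuous_potential hε hε1 htc
  set K := potentialConst d (C + weightConst d) / ε with hK
  have hPb : ∀ v, |P v| ≤ K := hf.abs_potential_le hε hε1 htc
  have hmem : ∀ᶠ s in nhdsWithin t (Iio t), s ∈ Icc t₁ t₂ ∧ s < t := by
    filter_upwards [Ioo_mem_nhdsLT ht.1] with s hs
    exact ⟨⟨hs.1.le, hs.2.le.trans ht.2⟩, hs.2⟩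
  have h1 : Filter.Tendsto (slope (fun t => liftFisher ε (f t)) t) (nhdsWithin t (Iio t)) (nhds j) :=
    (hasDerivAt_iff_tendsto_slope.1 hj).mono_left (nhdsWithin_mono _ fun s hs => ne_of_lt hs)
  have h2 : Filter.Tendsto (fun s => ∫ v, P v * slope (fun s => f s v) t s) (nhdsWithin t (Iio t))
      (nhds (∫ v, P v * collision (fun r c => α (r / 2) * b c) (f t) v)) := by
    refine tendsto_integral_filter_of_dominated_convergence (fun v => K * g v) ?_ ?_
      (hg.const_mul K) ?_
    · filter_upwards [hmem] with s hs
      refine (hPc.mul ?_).aestronglyMeasurable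
      simp only [slope_def_field]
      exact ((hf.decay s hs.1).smooth.continuous.sub
        (hf.decay t htc).smooth.continuous).div_const _
    · filter_upwards [hmem] with s hs
      filter_upwards [hgb] with v hv
      rw [norm_mul]
      refine mul_le_mul (hPb v) ?_ (norm_nonneg _) ((abs_nonneg _).trans (hPb v))
      have hst : 0 < |s - t| := abs_pos.2 (sub_ne_zero.2 hs.2.ne)
      rw [slope_def_field, norm_div, Real.norm_eq_abs, Real.norm_eq_abs, div_le_iff₀ hst]
      exact hv.2 s hs.1 t htc
    · refine Filter.Eventually.of_forall fun v => Filter.Tendsto.const_mul _ ?_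
      exact (hasDerivAt_iff_tendsto_slope.1 (hf.equation t htc v)).mono_left
        (nhdsWithin_mono _ fun s hs => ne_of_lt hs)
  refine le_of_tendsto_of_tendsto h1 h2.neg ?_
  filter_upwards [hmem] with s hs
  have h3 := hf.liftFisher_sub_le hε hε1 hs.1 htc
  have hst : s - t < 0 := sub_neg.2 hs.2
  have e : ∀ v, P v * slope (fun s => f s v) t s = P v * (f s v - f t v) * (s - t)⁻¹ := fun v => by
    rw [slope_def_field, div_eq_mul_inv, mul_assoc]
  simp only [e]
  rw [integral_mul_const, slope_def_field, div_le_iff_of_neg hst, neg_mul, mul_assoc,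
    inv_mul_cancel₀ hst.ne, mul_one]
  linarith

end

/-- The regularised Fisher information increases at most by an error that vanishes with the
regularisation. -/
theorem exists_liftFisher_le (hk : CollisionKernel d α b) (hd : 1 ≤ d) {N : ℝ}
    (hN : ∀ r, 0 < r → r * |deriv α r| ≤ N * α r)
    (hα : ∀ r : ℝ, 0 < r →
      ENNReal.ofReal (r * |deriv α r| / (2 * α r)) ≤ (bestLogSobolev d b) ^ (1 / 2 : ℝ))
    (hf : Flow α b f t₁ t₂ C) (h12 : t₁ ≤ t₂) {ε : ℕ → ℝ} (hε : ∀ n, 0 < ε n)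
    (hε1 : ∀ n, ε n ≤ 1) (hε0 : Filter.Tendsto ε Filter.atTop (nhds 0)) :
    ∃ δ : ℕ → ℝ, Filter.Tendsto δ Filter.atTop (nhds 0) ∧
      ∀ n, liftFisher (ε n) (f t₂) ≤ liftFisher (ε n) (f t₁) + δ n := by
  obtain ⟨K, hK⟩ := hk.exists_dissipation_error_bound hd C
  set J' : ℕ → ℝ → ℝ := fun n => deriv fun t => liftFisher (ε n) (f t) with hJ'
  set E : ℕ → ℝ → ℝ := fun n t => (1 / 2) * ∫ p : Vel d × Vel d, ε n *
      fisherPotential (fun v => Real.log (lift (ε n) (f t) v)) p.1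
        * pairCollision α b weight (fun v => 2 * f t v + ε n * weight v) p with hE
  have hle : ∀ n, ∀ t ∈ Ioc t₁ t₂, max (J' n t) 0 ≤ max (E n t) 0 := fun n t ht => by
    by_cases hdf : DifferentiableAt ℝ (fun t => liftFisher (ε n) (f t)) t
    · have htc := Ioc_subset_Icc_self ht
      exact max_le_max ((hf.deriv_liftFisher_le (hε n) (hε1 n) hk hd ht hdf.hasDerivAt).trans
        (hk.dissipation_lift_le hd hN hα (hf.decay t htc) (hf.nonneg t htc) (hε n) (hε1 n))) le_rfl
    · simp only [hJ', deriv_zero_of_not_differentiableAt hdf, max_self, le_max_right]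
  have hEK : ∀ t ∈ Ioc t₁ t₂, ∀ n, E n t ≤ K := fun t ht =>
    (hK (f t) (hf.decay t (Ioc_subset_Icc_self ht)) (hf.nonneg t (Ioc_subset_Icc_self ht))
      ε hε hε1 hε0).1
  have hE0 : ∀ t ∈ Ioc t₁ t₂, Filter.Tendsto (fun n => E n t) Filter.atTop (nhds 0) := fun t ht =>
    (hK (f t) (hf.decay t (Ioc_subset_Icc_self ht)) (hf.nonneg t (Ioc_subset_Icc_self ht))
      ε hε hε1 hε0).2
  have hm : ∀ n, Measurable (J' n) := fun n => measurable_deriv _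
  have hb : ∀ n, ∀ t ∈ Ioc t₁ t₂, ‖max (J' n t) 0‖ ≤ max K 0 := fun n t ht => by
    rw [Real.norm_of_nonneg (le_max_right _ _)]
    exact (hle n t ht).trans (max_le_max (hEK t ht n) le_rfl)
  have hmeas : ∀ n, AEStronglyMeasurable (fun t => max (J' n t) 0)
      (volume.restrict (uIoc t₁ t₂)) := fun n =>
    ((hm n).max measurable_const).aestronglyMeasurable
  have hI : ∀ n, IntervalIntegrable (fun t => max (J' n t) 0) volume t₁ t₂ := fun n => by
    refine (intervalIntegrable_const (c := max K 0)).mono_fun (hmeas n) ?_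
    rw [uIoc_of_le h12]
    filter_upwards [ae_restrict_mem measurableSet_Ioc] with t ht
    exact (hb n t ht).trans (le_abs_self _)
  refine ⟨fun n => ∫ t in t₁..t₂, max (J' n t) 0, ?_, fun n => ?_⟩
  · have h0 : Filter.Tendsto (fun n => ∫ t in t₁..t₂, max (J' n t) 0) Filter.atTop
        (nhds (∫ _t in t₁..t₂, (0 : ℝ))) := by
      refine intervalIntegral.tendsto_integral_filter_of_dominated_convergence (fun _ => max K 0)
        (Filter.Eventually.of_forall hmeas) (Filter.Eventually.of_forall fun n =>
          Filter.Eventually.of_forall fun t ht => ?_) intervalIntegrable_const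
        (Filter.Eventually.of_forall fun t ht => ?_)
      · rw [uIoc_of_le h12] at ht
        exact hb n t ht
      · rw [uIoc_of_le h12] at ht
        refine squeeze_zero (fun n => le_max_right _ _) (fun n => hle n t ht) ?_
        simpa using (hE0 t ht).max (tendsto_const_nhds (x := (0 : ℝ)))
    simpa using h0
  · obtain ⟨L, hL⟩ := hf.exists_lipschitzOnWith (hε n) (hε1 n) hk hd
    rw [← uIcc_of_le h12] at hL
    have hac := hL.absolutelyContinuousOnInterval
    have h1 := hac.integral_deriv_eq_sub
    have h2 : ∫ t in t₁..t₂, J' n t ≤ ∫ t in t₁..t₂, max (J' n t) 0 :=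
      intervalIntegral.integral_mono_on h12 hac.intervalIntegrable_deriv (hI n)
        fun t _ => le_max_left _ _
    linarith

end Flow

/-! ### Monotonicity of the Fisher information -/

theorem norm_gradient_sq (g : Vel d → ℝ) (v : Vel d) : ‖gradient g v‖ ^ 2 = gradSq g v := by
  rw [EuclideanSpace.real_norm_sq_eq, gradSq]
  refine Finset.sum_congr rfl fun i _ => ?_
  rw [pd, ← inner_gradient_left, real_inner_comm, inner_bvec]

/-- At the zeros of `f` both integrands vanish. -/
theorem fisher_eq {f : Vel d → ℝ} (hf : Differentiable ℝ f) (h0 : ∀ v, 0 ≤ f v) :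
    fisher f = ∫⁻ v, ENNReal.ofReal (gradSq f v / f v) := by
  rw [fisher]
  congr 1; funext v
  rw [norm_gradient_sq]
  rcases (h0 v).eq_or_lt with h | h
  · rw [← h, mul_zero, div_zero]
  · congr 1
    have e : ∀ i, pd i (fun x => Real.log (f x)) v = (f v)⁻¹ * pd i f v := fun i => by
      rw [pd, fderiv.log (hf v) h.ne']; rfl
    simp only [gradSq, e, mul_pow, ← Finset.mul_sum]
    field_simp

theorem lift_pos {f : Vel d → ℝ} (h0 : ∀ v, 0 ≤ f v) {ε : ℝ} (hε : 0 < ε) (v : Vel d) :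
    0 < lift ε f v := DecayBound.pos_of_le hε (le_lift h0) v

theorem fisher_lift {f : Vel d → ℝ} {C ε : ℝ} (hf : DecayBound f C) (h0 : ∀ v, 0 ≤ f v)
    (hε : 0 < ε) (hε1 : ε ≤ 1) : fisher (lift ε f) = ENNReal.ofReal (liftFisher ε f) := by
  have hp := lift_pos h0 hε
  rw [fisher_eq ((contDiff_lift hf.smooth ε).differentiable (by simp)) fun v => (hp v).le, liftFisher,
    ofReal_integral_eq_lintegral_ofReal (integrable_gradSq_div (hf.lift hε.le hε1) hp)]
  exact Filter.Eventually.of_forall fun v => div_nonneg (gradSq_nonneg _ _) (hp v).le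

theorem fisher_weight_lt_top : fisher (weight (d := d)) < ∞ := by
  have hi := integrable_gradSq_div (decayBound_weight (d := d)) weight_pos
  rw [fisher_eq (decayBound_weight.smooth.differentiable (by simp)) fun v => (weight_pos v).le]
  exact hi.lintegral_lt_top

/-- The Fisher information is homogeneous and subadditive. -/
theorem fisher_lift_le {f : Vel d → ℝ} (hf : ContDiff ℝ (⊤ : ℕ∞) f) (h0 : ∀ v, 0 ≤ f v) {ε : ℝ}
    (hε : 0 < ε) : fisher (lift ε f) ≤ fisher f + ENNReal.ofReal ε * fisher (weight (d := d)) := by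
  have hp := lift_pos h0 hε
  rw [fisher_eq ((contDiff_lift hf ε).differentiable (by simp)) fun v => (hp v).le,
    fisher_eq (hf.differentiable (by simp)) h0,
    fisher_eq (decayBound_weight.smooth.differentiable (by simp)) fun v => (weight_pos v).le,
    ← lintegral_const_mul _ (by
      have := decayBound_weight (d := d)
      exact (continuous_gradSq_div this weight_pos).measurable.ennreal_ofReal),
    ← lintegral_add_left (by
      exact (hf.gradSq.continuous.measurable.div hf.continuous.measurable).ennreal_ofReal)]
  refine lintegral_mono fun v => ?_
  have hw := weight_pos v
  have hl : lift ε f v = f v + ε * weight v := rfl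
  rw [← ENNReal.ofReal_mul hε.le, ← ENNReal.ofReal_add (div_nonneg (gradSq_nonneg _ _) (h0 v))
    (mul_nonneg hε.le (div_nonneg (gradSq_nonneg _ _) hw.le))]
  refine ENNReal.ofReal_le_ofReal ?_
  rw [gradSq_lift hf, gradSq, gradSq, hl, Finset.sum_div, Finset.sum_div, Finset.sum_div,
    Finset.mul_sum, ← Finset.sum_add_distrib]
  refine Finset.sum_le_sum fun i _ => ?_
  rcases (h0 v).eq_or_lt with h | h
  · rw [pd_eq_zero_of_nonneg h0 h.symm, ← h]
    simp only [zero_add]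
    rw [div_zero, zero_add]
    refine le_of_eq ?_
    field_simp
  · have key : pd i f v ^ 2 / f v + ε * (pd i weight v ^ 2 / weight v)
        - (pd i f v + ε * pd i weight v) ^ 2 / (f v + ε * weight v)
        = ε * (pd i f v * weight v - pd i weight v * f v) ^ 2
          / (f v * weight v * (f v + ε * weight v)) := by
      field_simp; ring
    have : 0 ≤ ε * (pd i f v * weight v - pd i weight v * f v) ^ 2
          / (f v * weight v * (f v + ε * weight v)) := by positivity
    linarith

/-- Lower semicontinuity of the Fisher information. -/
theorem fisher_le_liminf {f : Vel d → ℝ} (hf : ContDiff ℝ (⊤ : ℕ∞) f) (h0 : ∀ v, 0 ≤ f v)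
    {ε : ℕ → ℝ} (hε : ∀ n, 0 < ε n) (hε0 : Filter.Tendsto ε Filter.atTop (nhds 0)) :
    fisher f ≤ Filter.liminf (fun n => fisher (lift (ε n) f)) Filter.atTop := by
  have e : ∀ n, fisher (lift (ε n) f)
      = ∫⁻ v, ENNReal.ofReal (gradSq (lift (ε n) f) v / lift (ε n) f v) := fun n =>
    fisher_eq ((contDiff_lift hf _).differentiable (by simp)) fun v => (lift_pos h0 (hε n) v).le
  simp only [e]
  rw [fisher_eq (hf.differentiable (by simp)) h0]
  refine le_trans (lintegral_mono fun v => ?_) (lintegral_liminf_le fun n =>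
    ((contDiff_lift hf _).gradSq.continuous.measurable.div
      (contDiff_lift hf _).continuous.measurable).ennreal_ofReal)
  rcases (h0 v).eq_or_lt with h | h
  · rw [← h, div_zero, ENNReal.ofReal_zero]; exact zero_le
  · have hc : ContinuousAt (fun x : ℝ => (∑ i, (pd i f v + x * pd i weight v) ^ 2)
        / (f v + x * weight v)) 0 :=
      ContinuousAt.div₀ (by fun_prop) (by fun_prop) (by simpa using h.ne')
    have h1 := ENNReal.tendsto_ofReal (hc.tendsto.comp hε0)
    simp only [zero_mul, add_zero] at h1
    have h2 := h1.liminf_eq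
    simp only [Function.comp_def] at h2
    rw [gradSq, ← h2]
    simp only [gradSq_lift hf, lift, le_refl]

theorem Flow.fisher_le {α b : ℝ → ℝ} {f : ℝ → Vel d → ℝ} {t₁ t₂ C : ℝ}
    (hf : Flow α b f t₁ t₂ C) (hk : CollisionKernel d α b) (hd : 1 ≤ d) {N : ℝ}
    (hN : ∀ r, 0 < r → r * |deriv α r| ≤ N * α r)
    (hα : ∀ r : ℝ, 0 < r →
      ENNReal.ofReal (r * |deriv α r| / (2 * α r)) ≤ (bestLogSobolev d b) ^ (1 / 2 : ℝ))
    (h12 : t₁ ≤ t₂) : fisher (f t₂) ≤ fisher (f t₁) := by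
  set ε : ℕ → ℝ := fun n => 1 / ((n : ℝ) + 1) with hεdef
  have hε : ∀ n, 0 < ε n := fun n => by positivity
  have hε1 : ∀ n, ε n ≤ 1 := fun n => by
    rw [hεdef, div_le_one (by positivity)]
    have : (0 : ℝ) ≤ n := Nat.cast_nonneg n
    linarith
  have hε0 : Filter.Tendsto ε Filter.atTop (nhds 0) := tendsto_one_div_add_atTop_nhds_zero_nat
  obtain ⟨δ, hδ, hle⟩ := hf.exists_liftFisher_le hk hd hN hα h12 hε hε1 hε0
  have m1 := left_mem_Icc.2 h12
  have m2 := right_mem_Icc.2 h12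
  have d1 := hf.decay t₁ m1
  have d2 := hf.decay t₂ m2
  have n1 := hf.nonneg t₁ m1
  have n2 := hf.nonneg t₂ m2
  have hb : ∀ n, fisher (lift (ε n) (f t₂)) ≤ fisher (f t₁)
      + ENNReal.ofReal (ε n) * fisher (weight (d := d)) + ENNReal.ofReal (δ n) := fun n => by
    calc fisher (lift (ε n) (f t₂)) = ENNReal.ofReal (liftFisher (ε n) (f t₂)) :=
          fisher_lift d2 n2 (hε n) (hε1 n)
      _ ≤ ENNReal.ofReal (liftFisher (ε n) (f t₁) + δ n) := ENNReal.ofReal_le_ofReal (hle n)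
      _ ≤ ENNReal.ofReal (liftFisher (ε n) (f t₁)) + ENNReal.ofReal (δ n) := ENNReal.ofReal_add_le
      _ ≤ _ := by
        rw [← fisher_lift d1 n1 (hε n) (hε1 n)]
        gcongr
        exact fisher_lift_le d1.smooth n1 (hε n)
  have hlim : Filter.Tendsto (fun n => fisher (f t₁)
      + ENNReal.ofReal (ε n) * fisher (weight (d := d)) + ENNReal.ofReal (δ n)) Filter.atTop
      (nhds (fisher (f t₁) + ENNReal.ofReal 0 * fisher (weight (d := d)) + ENNReal.ofReal 0)) :=
    (tendsto_const_nhds.add (ENNReal.Tendsto.mul_const (ENNReal.tendsto_ofReal hε0)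
      (Or.inr fisher_weight_lt_top.ne))).add (ENNReal.tendsto_ofReal hδ)
  rw [ENNReal.ofReal_zero, zero_mul, add_zero, add_zero] at hlim
  refine (fisher_le_liminf d2.smooth n2 hε hε0).trans ?_
  rw [← hlim.liminf_eq]
  exact Filter.liminf_le_liminf (Filter.Eventually.of_forall hb)

/-! ### Classical solutions -/

theorem Icc_subset_timeInterval {T : EReal} {t₁ t₂ : ℝ} (h₁ : t₁ ∈ timeInterval T)
    (h₂ : t₂ ∈ timeInterval T) : Icc t₁ t₂ ⊆ timeInterval T := fun _ ht =>
  ⟨h₁.1.trans_le ht.1, (EReal.coe_le_coe_iff.2 ht.2).trans_lt h₂.2⟩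

theorem one_le_mul_weight {q : ℝ} (hq : 3 * (d : ℝ) + 5 < q) (v : Vel d) :
    1 ≤ (1 + ‖v‖) ^ q * weight v := by
  have hv := norm_nonneg v
  have h1 : (1 + ‖v‖ ^ 2) ^ ((3 * (d : ℝ) + 5) / 2) ≤ (1 + ‖v‖) ^ q := by
    calc (1 + ‖v‖ ^ 2) ^ ((3 * (d : ℝ) + 5) / 2)
        ≤ ((1 + ‖v‖) ^ 2) ^ ((3 * (d : ℝ) + 5) / 2) :=
          Real.rpow_le_rpow (by positivity) (by nlinarith) (by positivity)
      _ = (1 + ‖v‖) ^ (3 * (d : ℝ) + 5) := by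
          rw [← Real.rpow_natCast, ← Real.rpow_mul (by positivity)]
          congr 1; push_cast; ring
      _ ≤ _ := Real.rpow_le_rpow_of_exponent_le (by linarith) hq.le
  have h2 : (1 + ‖v‖ ^ 2) ^ ((3 * (d : ℝ) + 5) / 2) * weight v = 1 := by
    rw [weight, polyWeight, ← Real.rpow_add (by positivity)]
    rw [show (3 * (d : ℝ) + 5) / 2 + -(3 * (d : ℝ) + 5) / 2 = 0 by ring, Real.rpow_zero]
  exact h2.symm.le.trans (mul_le_mul_of_nonneg_right h1 (weight_pos v).le)

theorem IsSolution.exists_flow {α b : ℝ → ℝ} {T : EReal} {f : ℝ → Vel d → ℝ}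
    (hf : IsSolution (fun r c => α (r / 2) * b c) T f) {t₁ t₂ : ℝ} (h₁ : t₁ ∈ timeInterval T)
    (h₂ : t₂ ∈ timeInterval T) : ∃ C, Flow α b f t₁ t₂ C := by
  have hsub := Icc_subset_timeInterval h₁ h₂
  obtain ⟨q, hq, hqk⟩ := hf.decay t₁ h₁ t₂ h₂
  choose C hC using hqk
  have key : ∀ k, ∀ t ∈ Icc t₁ t₂, ∀ v, ‖iteratedFDeriv ℝ k (f t) v‖
      ≤ (|C 0| + |C 1| + |C 2|) * weight v ∨ 2 < k := by
    intro k t ht v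
    by_cases hk : 2 < k
    · exact Or.inr hk
    left
    have h1 := hC k t ht v
    have h2 : ‖iteratedFDeriv ℝ k (f t) v‖ ≤ C k * weight v := by
      have hw := weight_pos v
      calc ‖iteratedFDeriv ℝ k (f t) v‖
          ≤ (1 + ‖v‖) ^ q * weight v * ‖iteratedFDeriv ℝ k (f t) v‖ :=
            le_mul_of_one_le_left (norm_nonneg _) (one_le_mul_weight hq v)
        _ = (1 + ‖v‖) ^ q * ‖iteratedFDeriv ℝ k (f t) v‖ * weight v := by ring
        _ ≤ _ := mul_le_mul_of_nonneg_right h1 hw.le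
    refine h2.trans (mul_le_mul_of_nonneg_right ?_ (weight_pos v).le)
    have a0 := abs_nonneg (C 0)
    have a1 := abs_nonneg (C 1)
    have a2 := abs_nonneg (C 2)
    interval_cases k
    · linarith [le_abs_self (C 0)]
    · linarith [le_abs_self (C 1)]
    · linarith [le_abs_self (C 2)]
  refine ⟨|C 0| + |C 1| + |C 2|, fun t ht => ⟨hf.smooth t (hsub ht), fun v => ?_, fun v => ?_,
    fun v => ?_⟩, fun t ht => hf.nonneg t (hsub ht), fun t ht => hf.equation t (hsub ht)⟩
  · have := (key 0 t ht v).resolve_right (by norm_num)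
    rwa [norm_iteratedFDeriv_zero, Real.norm_eq_abs] at this
  · have := (key 1 t ht v).resolve_right (by norm_num)
    rwa [norm_iteratedFDeriv_one] at this
  · have := (key 2 t ht v).resolve_right (by norm_num)
    rwa [← norm_fderiv_fderiv] at this

/-! ### Growth of the collision rate -/

theorem rate_exp_le {α : ℝ → ℝ} {N : ℝ} (hdiff : ∀ r, 0 < r → DifferentiableAt ℝ α r)
    (hN : ∀ r, 0 < r → r * |deriv α r| ≤ N * α r) {s : ℝ} (hs : 0 ≤ s) :
    α (Real.exp s) ≤ α 1 * Real.exp (N * s) := by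
  have hd : ∀ s, HasDerivAt (fun s => α (Real.exp s) * Real.exp (-N * s))
      (deriv α (Real.exp s) * Real.exp s * Real.exp (-N * s)
        + α (Real.exp s) * (Real.exp (-N * s) * (-N))) s := fun s => by
    have h1 := (hdiff _ (Real.exp_pos s)).hasDerivAt.comp s (Real.hasDerivAt_exp s)
    have h2 : HasDerivAt (fun s => Real.exp (-N * s)) (Real.exp (-N * s) * (-N)) s := by
      simpa using ((hasDerivAt_id s).const_mul (-N)).exp
    exact h1.mul h2
  have hanti : Antitone fun s => α (Real.exp s) * Real.exp (-N * s) := by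
    refine antitone_of_deriv_nonpos (fun s => (hd s).differentiableAt) fun s => ?_
    rw [(hd s).deriv]
    have h1 := hN _ (Real.exp_pos s)
    have h2 := mul_le_mul_of_nonneg_left (le_abs_self (deriv α (Real.exp s))) (Real.exp_pos s).le
    have h3 : deriv α (Real.exp s) * Real.exp s - N * α (Real.exp s) ≤ 0 := by linarith
    have := mul_nonpos_of_nonpos_of_nonneg h3 (Real.exp_pos (-N * s)).le
    linarith
  have h := hanti hs
  simp only [mul_zero, Real.exp_zero, mul_one] at h
  calc α (Real.exp s) = α (Real.exp s) * Real.exp (-N * s) * Real.exp (N * s) := by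
        rw [mul_assoc, ← Real.exp_add]; simp
    _ ≤ _ := mul_le_mul_of_nonneg_right h (Real.exp_pos _).le

theorem relWeight_exp_le (s : ℝ) : relWeight d (Real.exp s) ≤ Real.exp (-(2 * d + 9 / 2) * s) := by
  have h : Real.exp (-(2 * d + 9 / 2) * s) = (Real.exp s ^ 2) ^ (-(2 * (d : ℝ) + 9 / 2) / 2) := by
    rw [← Real.exp_nat_mul, ← Real.exp_mul]; congr 1; push_cast; ring
  rw [h, relWeight, polyWeight]
  refine Real.rpow_le_rpow_of_nonpos (by positivity) (by linarith) ?_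
  have : (0 : ℝ) ≤ d := Nat.cast_nonneg d
  linarith

/-- The collision rate grows at most like the power `N` at infinity, where the weights win. -/
theorem CollisionKernel.of_integrableOn {α b : ℝ → ℝ} {N : ℝ} (hb : AngularKernel d b)
    (hpos : ∀ r, 0 < r → 0 < α r) (hdiff : ∀ r, 0 < r → DifferentiableAt ℝ α r)
    (hN : ∀ r, 0 < r → r * |deriv α r| ≤ N * α r) (hNd : N ≤ d + 2)
    (hint : IntegrableOn (fun s => Real.exp (d * s) * (α (Real.exp s) * Real.exp s ^ 2)) (Iic 0)) :
    CollisionKernel d α b := by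
  refine ⟨hb, hpos, hdiff, integrable_expMeasure_iff.2 ?_⟩
  have hc : Continuous fun s => α (Real.exp s) := continuous_iff_continuousAt.2 fun s =>
    ((hdiff _ (Real.exp_pos s)).continuousAt.comp (f := Real.exp) Real.continuous_exp.continuousAt)
  have hw : Continuous fun s => relWeight d (Real.exp s) :=
    (continuous_polyWeight _).comp Real.continuous_exp
  have hm : Continuous fun s => Real.exp (d * s)
      * (α (Real.exp s) * (Real.exp s ^ 2 * relWeight d (Real.exp s))) :=
    (by fun_prop : Continuous fun s : ℝ => Real.exp (d * s)).mul
      (hc.mul ((Real.continuous_exp.pow 2).mul hw))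
  rw [← integrableOn_univ, ← Iic_union_Ioi (a := (0 : ℝ))]
  have hp : ∀ s, 0 ≤ Real.exp (d * s)
      * (α (Real.exp s) * (Real.exp s ^ 2 * relWeight d (Real.exp s))) := fun s => by
    have := hpos _ (Real.exp_pos s)
    have := relWeight_pos (d := d) (Real.exp s)
    positivity
  refine IntegrableOn.union ?_ ?_
  · refine hint.mono' hm.aestronglyMeasurable (Filter.Eventually.of_forall fun s => ?_)
    rw [Real.norm_of_nonneg (hp s)]
    have h1 := hpos _ (Real.exp_pos s)
    gcongr
    exact mul_le_of_le_one_right (by positivity) (relWeight_le_one _)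
  · refine ((exp_neg_integrableOn_Ioi 0 (by norm_num : (0 : ℝ) < 1 / 2)).const_mul (α 1)).mono'
      hm.aestronglyMeasurable ?_
    filter_upwards [ae_restrict_mem measurableSet_Ioi] with s hs
    rw [Real.norm_of_nonneg (hp s)]
    have hs' : (0 : ℝ) < s := hs
    have h1 := hpos 1 one_pos
    have h2 := rate_exp_le hdiff hN hs'.le
    have h3 := (relWeight_pos (d := d) (Real.exp s)).le
    have h4 := hpos _ (Real.exp_pos s)
    calc Real.exp (d * s) * (α (Real.exp s) * (Real.exp s ^ 2 * relWeight d (Real.exp s)))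
        ≤ Real.exp (d * s) * (α 1 * Real.exp (N * s)
          * (Real.exp s ^ 2 * Real.exp (-(2 * d + 9 / 2) * s))) := by
          gcongr; exact relWeight_exp_le s
      _ = α 1 * Real.exp ((N - d - 5 / 2) * s) := by
          rw [← Real.exp_nat_mul]
          have : ∀ a b c e x : ℝ, Real.exp a * (x * Real.exp b * (Real.exp c * Real.exp e))
              = x * Real.exp (a + b + c + e) := fun a b c e x => by
            rw [Real.exp_add, Real.exp_add, Real.exp_add]; ring
          rw [this]
          congr 2; push_cast; ring
      _ ≤ _ := by
          gcongr
          nlinarith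

/-! ### Trivial angular kernels -/

/-- The integrand of the collision operator is a principal value, which is `0` for kernels that do
not charge the pairs `σ' ≠ ± σ`. -/
theorem AngularKernel.collision_eq_zero {b : ℝ → ℝ} (hb : AngularKernel d b) (hd : 1 ≤ d)
    (h : ∀ᵐ p : Sph d × Sph d ∂((surf d).prod (surf d)), levyWeight b p = 0) (α : ℝ → ℝ)
    {f : Vel d → ℝ} (hf : ContDiff ℝ (⊤ : ℕ∞) f) (v : Vel d) :
    collision (fun r c => α (r / 2) * b c) f v = 0 := by
  obtain ⟨β, -, hβ⟩ := hb.exists_levyMass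
  have : NeZero d := ⟨by omega⟩
  have : IsFiniteMeasure (surf d) := by unfold surf; infer_instance
  have hne : NeZero (surf d) := ⟨by
    unfold surf
    exact Measure.toSphere_ne_zero _⟩
  have hβ0 : β = 0 := by
    obtain ⟨σ, hσ⟩ := (Measure.ae_ae_of_ae_prod h).exists
    rw [← hβ σ, integral_eq_zero_of_ae hσ]
  rw [collision_eq, ← integral_zero (Vel d) ℝ]
  congr 1; funext w
  by_cases hvw : v = w
  · rw [hvw, pairCollision_diag, mul_zero]
  obtain ⟨⟨⟨s, z⟩, σ⟩, hp⟩ := exists_coordMap_eq hvw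
  have hH := (SmoothEven.pairFun hf hf z).comp_smul (Real.exp s)
  obtain ⟨C, -, hC⟩ := hH.exists_bound
  have h1 := hb.abs_sphBoltzmann_le hβ hH (fun x hx => (hC x hx).2.1) (fun x hx => (hC x hx).2.2) σ
  rw [hβ0, mul_zero] at h1
  rw [← hp, pairCollision_coordMap, abs_nonpos_iff.1 h1, mul_zero, mul_zero]

/-! ### Distribution functions whose logarithm has a scalar Hessian -/

/-- The derivative in the direction `u`. -/
def dirDeriv (u : Vel d) (φ : Vel d → ℝ) (x : Vel d) : ℝ := fderiv ℝ φ x u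

theorem _root_.ContDiff.dirDeriv {φ : Vel d → ℝ} (h : ContDiff ℝ (⊤ : ℕ∞) φ) (u : Vel d) :
    ContDiff ℝ (⊤ : ℕ∞) (dirDeriv u φ) := h.fderiv_infty.clm_apply contDiff_const

theorem hasDerivAt_line {φ : Vel d → ℝ} (h : ContDiff ℝ (⊤ : ℕ∞) φ) (x e : Vel d) (t : ℝ) :
    HasDerivAt (fun t : ℝ => φ (x + t • e)) (dirDeriv e φ (x + t • e)) t := by
  have h1 : HasDerivAt (fun t : ℝ => x + t • e) e t := by
    simpa using ((hasDerivAt_id t).smul_const e).const_add x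
  exact (h.differentiable (by simp) _).hasFDerivAt.comp_hasDerivAt t h1

theorem dirDeriv_dirDeriv {φ : Vel d → ℝ} (h : ContDiff ℝ (⊤ : ℕ∞) φ) (u w x : Vel d) :
    dirDeriv u (dirDeriv w φ) x = fderiv ℝ (fderiv ℝ φ) x u w := by
  have := ((hasFDerivAt_fderiv h x).clm_apply (hasFDerivAt_const w x)).fderiv
  change fderiv ℝ (fun x => fderiv ℝ φ x w) x u = _
  rw [this]; simp

theorem dirDeriv_comm {φ : Vel d → ℝ} (h : ContDiff ℝ (⊤ : ℕ∞) φ) (u w : Vel d) :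
    dirDeriv u (dirDeriv w φ) = dirDeriv w (dirDeriv u φ) := by
  funext x
  rw [dirDeriv_dirDeriv h, dirDeriv_dirDeriv h]
  exact second_derivative_symmetric (fun y => (h.differentiable (by simp) y).hasFDerivAt)
    (hasFDerivAt_fderiv h x) u w

/-- The Hessian of `log f` is a multiple of the identity at all points where `f` does not vanish. -/
def ScalarLogHessian (f : Vel d → ℝ) : Prop := ∀ a e : Vel d, inner ℝ a e = (0 : ℝ) → ∀ x,
  f x * dirDeriv a (dirDeriv e f) x = dirDeriv a f x * dirDeriv e f x

theorem exists_orthogonal (hd : 2 ≤ d) (e : Vel d) :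
    ∃ a : Vel d, ‖a‖ = ‖e‖ ∧ inner ℝ a e = (0 : ℝ) := by
  set i : Fin d := ⟨0, by omega⟩
  set j : Fin d := ⟨1, by omega⟩
  obtain ⟨R, hR⟩ := exists_isometry_map_eq (x := ‖e‖ • bvec i) (y := e) (by
    rw [norm_smul, norm_norm, norm_bvec, mul_one])
  refine ⟨R (‖e‖ • bvec j), ?_, ?_⟩
  · rw [R.norm_map, norm_smul, norm_norm, norm_bvec, mul_one]
  · conv_lhs => rw [← hR]
    rw [R.inner_map_map, inner_smul_left, inner_smul_right, inner_bvec, bvec_apply,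
      if_neg (by simp [i, j])]
    simp

namespace ScalarLogHessian

variable {f : Vel d → ℝ} (hs : ScalarLogHessian f) (hf : ContDiff ℝ (⊤ : ℕ∞) f)
include hs hf

theorem diag_eq {a e : Vel d} (hae : inner ℝ a e = (0 : ℝ)) (hn : ‖a‖ = ‖e‖) (x : Vel d) :
    f x * dirDeriv e (dirDeriv e f) x - dirDeriv e f x ^ 2
      = f x * dirDeriv a (dirDeriv a f) x - dirDeriv a f x ^ 2 := by
  have h1 : inner ℝ (a + e) (a - e) = (0 : ℝ) := by
    rw [inner_add_left, inner_sub_right, inner_sub_right, real_inner_comm, hae,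
      real_inner_self_eq_norm_sq, real_inner_self_eq_norm_sq, hn, real_inner_comm, hae]
    ring
  have h2 := hs _ _ h1 x
  have h3 := congrFun (dirDeriv_comm hf a e) x
  rw [dirDeriv_dirDeriv hf] at h2 h3
  rw [dirDeriv_dirDeriv hf] at h3
  rw [dirDeriv_dirDeriv hf, dirDeriv_dirDeriv hf]
  simp only [dirDeriv, map_add, map_sub, add_apply] at h2 ⊢
  linear_combination (-1 : ℝ) * h2 - f x * h3

/-- The eigenvalue of the Hessian of `log f` is constant, as the third derivatives
`∂ₑ∂ₐ∂ₐ log f = ∂ₐ (∂ₐ∂ₑ log f)` vanish. -/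
theorem hasDerivAt_diag (hd : 2 ≤ d) (x e : Vel d) (t : ℝ) : ∃ n : ℝ,
    HasDerivAt (fun t : ℝ => f (x + t • e) * dirDeriv e (dirDeriv e f) (x + t • e)
      - dirDeriv e f (x + t • e) ^ 2) n t ∧
    f (x + t • e) * n = 2 * dirDeriv e f (x + t • e) *
      (f (x + t • e) * dirDeriv e (dirDeriv e f) (x + t • e) - dirDeriv e f (x + t • e) ^ 2) := by
  obtain ⟨a, hn, hae⟩ := exists_orthogonal hd e
  have fe : (fun t : ℝ => f (x + t • e) * dirDeriv e (dirDeriv e f) (x + t • e)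
      - dirDeriv e f (x + t • e) ^ 2) = fun t : ℝ =>
      f (x + t • e) * dirDeriv a (dirDeriv a f) (x + t • e) - dirDeriv a f (x + t • e) ^ 2 :=
    funext fun t => hs.diag_eq hf hae hn _
  have h1 := ((hasDerivAt_line hf x e t).mul (hasDerivAt_line ((hf.dirDeriv a).dirDeriv a) x e t)).sub
    ((hasDerivAt_line (hf.dirDeriv a) x e t).pow 2)
  refine ⟨_, by rw [fe]; exact h1, ?_⟩
  set y := x + t • e with hy
  have h2 : HasDerivAt (fun r : ℝ => f (y + r • a) * dirDeriv a (dirDeriv e f) (y + r • a)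
      - dirDeriv a f (y + r • a) * dirDeriv e f (y + r • a)) _ 0 :=
    ((hasDerivAt_line hf y a 0).mul (hasDerivAt_line ((hf.dirDeriv e).dirDeriv a) y a 0)).sub
      ((hasDerivAt_line (hf.dirDeriv a) y a 0).mul (hasDerivAt_line (hf.dirDeriv e) y a 0))
  have h3 : (fun r : ℝ => f (y + r • a) * dirDeriv a (dirDeriv e f) (y + r • a)
      - dirDeriv a f (y + r • a) * dirDeriv e f (y + r • a)) = fun _ => 0 :=
    funext fun r => sub_eq_zero.2 (hs a e hae _)
  rw [h3] at h2
  have h4 := h2.unique (hasDerivAt_const (0 : ℝ) (0 : ℝ))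
  simp only [zero_smul, add_zero] at h4
  have h5 : dirDeriv e (dirDeriv a (dirDeriv a f)) y = dirDeriv a (dirDeriv a (dirDeriv e f)) y := by
    rw [dirDeriv_comm (hf.dirDeriv a), dirDeriv_comm hf e a]
  have h6 : dirDeriv e (dirDeriv a f) y = dirDeriv a (dirDeriv e f) y := by rw [dirDeriv_comm hf e a]
  have h7 := hs a e hae y
  have h8 := hs.diag_eq hf hae hn y
  rw [h8, h5, h6]
  push_cast
  linear_combination (f y) * h4 - 2 * dirDeriv a f y * h7

/-- `log f` is a quadratic polynomial along the segments on which `f` is positive, hence `f` does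
not reach the value `0`. -/
theorem pos (hd : 2 ≤ d) (h0 : ∀ v, 0 ≤ f v) {x : Vel d} (hx : 0 < f x) (y : Vel d) : 0 < f y := by
  by_contra hy
  have hy0 : f y = 0 := le_antisymm (not_lt.1 hy) (h0 y)
  set e := y - x with he
  set g : ℝ → ℝ := fun t => f (x + t • e) with hg
  have hgc : Continuous g := hf.continuous.comp (by fun_prop)
  obtain ⟨τ, ⟨hτI, hτ0⟩, hτmin⟩ := (isCompact_Icc.inter_right
    (isClosed_singleton.preimage hgc) : IsCompact (Icc (0 : ℝ) 1 ∩ g ⁻¹' {0})).exists_isLeast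
    ⟨1, right_mem_Icc.2 zero_le_one, by simp [hg, he, hy0]⟩
  have hτ0' : g τ = 0 := hτ0
  have hpos : ∀ t ∈ Ico 0 τ, 0 < g t := fun t ht => (h0 _).lt_of_ne' fun h => by
    have := hτmin ⟨⟨ht.1, ht.2.le.trans hτI.2⟩, h⟩
    linarith [ht.2]
  set k : ℝ → ℝ := fun t => dirDeriv e f (x + t • e) with hk
  set n : ℝ → ℝ := fun t => f (x + t • e) * dirDeriv e (dirDeriv e f) (x + t • e)
    - dirDeriv e f (x + t • e) ^ 2 with hn
  have dg : ∀ t, HasDerivAt g (k t) t := hasDerivAt_line hf x e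
  have dk : ∀ t, HasDerivAt k (dirDeriv e (dirDeriv e f) (x + t • e)) t :=
    hasDerivAt_line (hf.dirDeriv e) x e
  have hconst : ∀ (h : ℝ → ℝ), (∀ t ∈ Ico 0 τ, HasDerivAt h 0 t) → ∀ t ∈ Ico 0 τ, h t = h 0 := by
    intro h hh t ht
    have := (convex_Ico 0 τ).norm_image_sub_le_of_norm_hasDerivWithin_le (C := 0)
      (fun t ht => (hh t ht).hasDerivWithinAt) (by simp) (left_mem_Ico.2 (ht.1.trans_lt ht.2)) ht
    rw [zero_mul] at this
    exact sub_eq_zero.1 (norm_le_zero_iff.1 this)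
  have c1 : ∀ t ∈ Ico 0 τ, n t / g t ^ 2 = n 0 / g 0 ^ 2 := by
    refine hconst (fun t => n t / g t ^ 2) fun t ht => ?_
    obtain ⟨n', hn', hn2⟩ := hs.hasDerivAt_diag hf hd x e t
    have hgt := (hpos t ht).ne'
    have := hn'.div ((dg t).pow 2) (pow_ne_zero 2 hgt)
    refine this.congr_deriv ?_
    rw [div_eq_zero_iff]
    left
    have e1 : g t * n' = 2 * k t * n t := hn2
    simp only [Pi.pow_apply]
    push_cast
    linear_combination g t * e1
  set κ := n 0 / g 0 ^ 2 with hκ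
  have c2 : ∀ t ∈ Ico 0 τ, k t / g t - κ * t = k 0 / g 0 - κ * 0 := by
    refine hconst (fun t => k t / g t - κ * t) fun t ht => ?_
    have hgt := (hpos t ht).ne'
    have := ((dk t).div (dg t) hgt).sub ((hasDerivAt_id t).const_mul κ)
    refine this.congr_deriv ?_
    have e1 := c1 t ht
    rw [div_eq_iff (pow_ne_zero 2 hgt)] at e1
    rw [mul_one, sub_eq_zero, div_eq_iff (pow_ne_zero 2 hgt), ← e1]
    simp only [hn, hg, hk]; ring
  set K := |k 0 / g 0| + |κ| * τ with hK
  have hkg : ∀ t ∈ Ico 0 τ, 0 ≤ k t + K * g t := fun t ht => by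
    have hgt := hpos t ht
    have e1 := c2 t ht
    have e2 : k t / g t = k 0 / g 0 + κ * t := by linarith
    rw [div_eq_iff hgt.ne'] at e2
    have h1 : |κ * t| ≤ |κ| * τ := by
      rw [abs_mul, abs_of_nonneg ht.1]
      exact mul_le_mul_of_nonneg_left ht.2.le (abs_nonneg κ)
    have h2 : 0 ≤ k 0 / g 0 + κ * t + K := by
      linarith [neg_abs_le (k 0 / g 0), neg_abs_le (κ * t)]
    rw [e2, ← add_mul]
    exact mul_nonneg h2 hgt.le
  have dh : ∀ t, HasDerivAt (fun t => g t * Real.exp (K * t))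
      (k t * Real.exp (K * t) + g t * (Real.exp (K * t) * K)) t := fun t => by
    have h2 : HasDerivAt (fun s => Real.exp (K * s)) (Real.exp (K * t) * K) t := by
      simpa using ((hasDerivAt_id t).const_mul K).exp
    exact (dg t).mul h2
  have hmono : MonotoneOn (fun t => g t * Real.exp (K * t)) (Icc 0 τ) := by
    refine monotoneOn_of_deriv_nonneg (convex_Icc 0 τ)
      (fun t _ => (dh t).continuousAt.continuousWithinAt)
      (fun t _ => (dh t).differentiableAt.differentiableWithinAt) fun t ht => ?_
    rw [interior_Icc] at ht
    rw [(dh t).deriv]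
    have := mul_nonneg (hkg t ⟨ht.1.le, ht.2⟩) (Real.exp_pos (K * t)).le
    linarith
  have h1 := hmono (left_mem_Icc.2 hτI.1) (right_mem_Icc.2 hτI.1) hτI.1
  simp only [hτ0', zero_mul, mul_zero, Real.exp_zero, mul_one] at h1
  have h2 : g 0 = f x := by simp [hg]
  linarith

section

variable (hpos : ∀ v, 0 < f v)
include hpos

theorem mul_dirDeriv_eq {p q : Vel d} (hpq : inner ℝ p q = (0 : ℝ)) (x : Vel d) :
    f x * dirDeriv q f (x + p) = f (x + p) * dirDeriv q f x := by
  have h1 : ∀ t : ℝ, HasDerivAt (fun t : ℝ => dirDeriv q f (x + t • p) / f (x + t • p)) 0 t :=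
    fun t => by
      have := (hasDerivAt_line (hf.dirDeriv q) x p t).div (hasDerivAt_line hf x p t) (hpos _).ne'
      refine this.congr_deriv ?_
      rw [div_eq_zero_iff]
      left
      have := hs p q hpq (x + t • p)
      linarith
  have h2 := is_const_of_deriv_eq_zero (fun t => (h1 t).differentiableAt) (fun t => (h1 t).deriv) 1 0
  simp only [one_smul, zero_smul, add_zero] at h2
  have := (hpos x).ne'
  have := (hpos (x + p)).ne'
  field_simp at h2
  linarith

/-- A pair of distribution functions depends on the centre of mass and on the relative speed only. -/
theorem mul_eq_mul {z y y' : Vel d} (hy : ‖y‖ = ‖y'‖) :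
    f (z + y) * f (z - y) = f (z + y') * f (z - y') := by
  set p := (1 / 2 : ℝ) • (y + y') with hp
  set q := (1 / 2 : ℝ) • (y - y') with hq
  have hpq : inner ℝ ((2 : ℝ) • p) q = (0 : ℝ) := by
    have : inner ℝ (y + y') (y - y') = (0 : ℝ) := by
      rw [inner_add_left, inner_sub_right, inner_sub_right, real_inner_comm y y',
        real_inner_self_eq_norm_sq, real_inner_self_eq_norm_sq, hy]
      ring
    rw [hp, hq, inner_smul_left, inner_smul_left, inner_smul_right, this]
    simp
  have h1 : ∀ t : ℝ, HasDerivAt (fun t : ℝ => f (z + p + t • q) / f (z - p + t • q)) 0 t :=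
    fun t => by
      have := (hasDerivAt_line hf (z + p) q t).div (hasDerivAt_line hf (z - p) q t) (hpos _).ne'
      refine this.congr_deriv ?_
      rw [div_eq_zero_iff]
      left
      have h2 := hs.mul_dirDeriv_eq hf hpos hpq (z - p + t • q)
      have h3 : z - p + t • q + (2 : ℝ) • p = z + p + t • q := by module
      rw [h3] at h2
      linarith
  have h2 := is_const_of_deriv_eq_zero (fun t => (h1 t).differentiableAt) (fun t => (h1 t).deriv)
    1 (-1)
  have e1 : z + p + (1 : ℝ) • q = z + y := by rw [hp, hq]; module
  have e2 : z - p + (1 : ℝ) • q = z - y' := by rw [hp, hq]; module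
  have e3 : z + p + (-1 : ℝ) • q = z + y' := by rw [hp, hq]; module
  have e4 : z - p + (-1 : ℝ) • q = z - y := by rw [hp, hq]; module
  simp only [e1, e2, e3, e4] at h2
  have := (hpos (z - y)).ne'
  have := (hpos (z - y')).ne'
  field_simp at h2
  linarith

end

/-- Collisions leave pairs of such distribution functions invariant. -/
theorem collision_eq_zero (hd : 2 ≤ d) (h0 : ∀ v, 0 ≤ f v) (B : ℝ → ℝ → ℝ) (v : Vel d) :
    collision B f v = 0 := by
  have hF : ∀ z y y' : Vel d, ‖y‖ = ‖y'‖ → f (z + y) * f (z - y) = f (z + y') * f (z - y') := by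
    intro z y y' hy
    by_cases h : ∃ x, 0 < f x
    · obtain ⟨x, hx⟩ := h
      exact hs.mul_eq_mul hf (hs.pos hf hd h0 hx) hy
    · have hz : ∀ x, f x = 0 := fun x => le_antisymm (not_lt.1 fun hx => h ⟨x, hx⟩) (h0 x)
      simp [hz]
  have hpost : ∀ w σ' : Vel d, (v ≠ w → ‖σ'‖ = 1) → postProd f v w σ' = f v * f w := by
    intro w σ' hσ'
    have hn : ‖(‖v - w‖ / 2) • σ'‖ = ‖(1 / 2 : ℝ) • (v - w)‖ := by
      rw [norm_smul, norm_smul]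
      by_cases hvw : v = w
      · simp [hvw]
      · rw [hσ' hvw, norm_div, norm_norm]; norm_num; ring
    have := hF ((1 / 2 : ℝ) • (v + w)) _ _ hn
    rw [postProd, this]
    congr 2 <;> module
  rw [collision, ← integral_zero (Vel d) ℝ]
  congr 1; funext w
  rw [← integral_zero (Sph d) ℝ]
  congr 1; funext σ'
  have hrel : v ≠ w → ‖relDir v w‖ = 1 := fun h => by
    rw [relDir, norm_smul, norm_inv, norm_norm, inv_mul_cancel₀ (norm_ne_zero_iff.2 (sub_ne_zero.2 h))]
  rw [collisionIntegrand, hpost w _ fun _ => Sph.norm_eq σ',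
    hpost w _ fun h => by rw [norm_axisRefl (hrel h), Sph.norm_eq σ']]
  ring

end ScalarLogHessian

/-! ### Collision rates that are too singular at small relative speed -/

theorem SmoothEven.bilinear (B : Vel d →L[ℝ] Vel d →L[ℝ] ℝ) : SmoothEven fun x => B x x :=
  ⟨B.contDiff.clm_apply contDiff_id, fun x => by simp⟩

namespace AngularKernel

variable {b : ℝ → ℝ} (hb : AngularKernel d b)
include hb

/-- A quadratic form on which the Dirichlet form vanishes is a multiple of the identity: its
difference with its reflection in a hyperplane is a multiple of a `prodForm`. -/
theorem bilinear_eq_zero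
    (hne : ¬ ∀ᵐ p : Sph d × Sph d ∂((surf d).prod (surf d)), levyWeight b p = 0)
    {B : Vel d →L[ℝ] Vel d →L[ℝ] ℝ} (hsym : ∀ x y, B x y = B y x)
    (hB : dirForm b (fun x => B x x) (fun x => B x x) = 0) {a e : Vel d}
    (hae : inner ℝ a e = (0 : ℝ)) : B a e = 0 := by
  have key : ∀ a : Vel d, ‖a‖ = 1 → inner ℝ a e = (0 : ℝ) → B a e = 0 := by
    intro a ha hae
    set m : Vel d := (InnerProductSpace.toDual ℝ (Vel d)).symm
      (B a - B a a • innerSL ℝ a) with hm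
    have hmx : ∀ x, inner ℝ m x = B a x - B a a * inner ℝ a x := fun x => by
      rw [hm, InnerProductSpace.toDual_symm_apply]; simp
    by_cases hm0 : m = 0
    · have := hmx e
      rw [hm0, inner_zero_left, hae, mul_zero, sub_zero] at this
      exact this.symm
    exfalso
    have hmn : ‖m‖ ≠ 0 := norm_ne_zero_iff.2 hm0
    set u := ‖m‖⁻¹ • m with hu
    have hu1 : ‖u‖ = 1 := by rw [hu, norm_smul, norm_inv, norm_norm, inv_mul_cancel₀ hmn]
    have hau : inner ℝ a u = (0 : ℝ) := by
      rw [hu, inner_smul_right, real_inner_comm, hmx, real_inner_self_eq_norm_sq, ha]; ring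
    have hdiff : ∀ x, B x x - B (axisIso a x) (axisIso a x) = 4 * ‖m‖ * prodForm a u x := fun x => by
      have h1 : inner ℝ u x = ‖m‖⁻¹ * (B a x - B a a * inner ℝ a x) := by
        rw [hu, inner_smul_left, hmx]; simp
      rw [axisIso_apply ha, axisRefl, prodForm, h1]
      simp only [map_sub, map_smul, sub_apply, smul_apply, smul_eq_mul]
      rw [hsym x a]
      field_simp; ring
    have h1 := hb.sub_sq_mul_ae_eq_zero (SmoothEven.bilinear B) hB
    have h2 := hb.sub_sq_mul_ae_eq_zero ((SmoothEven.bilinear B).comp_iso (axisIso a))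
      (by rw [dirForm_comp_iso b (fun x => B x x) (fun x => B x x), hB])
    refine hne (hb.levyWeight_ae_eq_zero ha hu1 hau ?_)
    rw [dirForm, integral_eq_zero_of_ae, mul_zero]
    filter_upwards [h1, h2] with p hp1 hp2
    rw [dirInt, Pi.zero_apply]
    rcases hp1 with hp1 | hp1
    · rw [hp1, mul_zero]
    rcases hp2 with hp2 | hp2
    · rw [hp2, mul_zero]
    have e1 := hdiff p.2
    have e2 := hdiff p.1
    have e3 : 4 * ‖m‖ * prodForm a u p.2 = 4 * ‖m‖ * prodForm a u p.1 := by
      rw [← e1, ← e2]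
      exact congrArg₂ (· - ·) hp1 hp2
    have e4 := mul_left_cancel₀ (mul_ne_zero four_ne_zero hmn) e3
    rw [e4]; ring
  by_cases ha0 : a = 0
  · simp [ha0]
  have hn : ‖a‖ ≠ 0 := norm_ne_zero_iff.2 ha0
  have h1 := key (‖a‖⁻¹ • a) (by rw [norm_smul, norm_inv, norm_norm, inv_mul_cancel₀ hn])
    (by rw [inner_smul_left, hae, mul_zero])
  rw [map_smul, smul_apply, smul_eq_mul] at h1
  exact (mul_eq_zero.1 h1).resolve_left (inv_ne_zero hn)

theorem dirForm_eq_zero_of_ae {φ : Vel d → ℝ} (hφ : SmoothEven φ)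
    (h : ∀ᵐ σ : Sph d ∂(surf d), ∀ᵐ σ' : Sph d ∂(surf d),
      mirrorDiff φ (σ : Vel d) σ' * b (inner ℝ (σ' : Vel d) (σ : Vel d)) = 0) :
    dirForm b φ φ = 0 := by
  have h1 := (hb.integral_mul_sphBoltzmann hφ hφ).2
  rw [integral_eq_zero_of_ae] at h1
  · linarith
  filter_upwards [h] with σ hσ
  rw [sphBoltzmann_eq, integral_eq_zero_of_ae hσ, mul_zero, Pi.zero_apply]

end AngularKernel

/-- The Hessian of `log f` times `f²`. -/
def logHessian (f : Vel d → ℝ) (v : Vel d) : Vel d →L[ℝ] Vel d →L[ℝ] ℝ :=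
  f v • fderiv ℝ (fderiv ℝ f) v - (fderiv ℝ f v).smulRight (fderiv ℝ f v)

theorem logHessian_apply (f : Vel d → ℝ) (v x y : Vel d) : logHessian f v x y
    = f v * fderiv ℝ (fderiv ℝ f) v x y - fderiv ℝ f v x * fderiv ℝ f v y := by
  simp [logHessian]

theorem logHessian_symm {f : Vel d → ℝ} (hf : ContDiff ℝ (⊤ : ℕ∞) f) (v x y : Vel d) :
    logHessian f v x y = logHessian f v y x := by
  rw [logHessian_apply, logHessian_apply, second_derivative_symmetric
    (fun y => (hf.differentiable (by simp) y).hasFDerivAt) (hasFDerivAt_fderiv hf v) x y]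
  ring

/-- The post-collisional product of a pair of velocities, one of which is `v`, where `r` is half of
the relative speed. -/
def rayProd (f : Vel d → ℝ) (v σ x : Vel d) (r : ℝ) : ℝ :=
  f (v + r • (x - σ)) * f (v + r • (-x - σ))

theorem exists_hasDerivAt_rayProd {f : Vel d → ℝ} (hf : ContDiff ℝ (⊤ : ℕ∞) f) (v σ x : Vel d) :
    ∃ g : ℝ → ℝ, (∀ r, HasDerivAt (rayProd f v σ x) (g r) r) ∧
      g 0 = -2 * (f v * fderiv ℝ f v σ) ∧
      HasDerivAt g (2 * logHessian f v x x
        + 2 * (f v * fderiv ℝ (fderiv ℝ f) v σ σ + fderiv ℝ f v σ ^ 2)) 0 := by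
  set p := x - σ with hp
  set m := -x - σ with hm
  refine ⟨fun r => dirDeriv p f (v + r • p) * f (v + r • m) + f (v + r • p) * dirDeriv m f (v + r • m),
    fun r => (hasDerivAt_line hf v p r).mul (hasDerivAt_line hf v m r), ?_, ?_⟩
  · simp only [zero_smul, add_zero, dirDeriv, hp, hm, map_sub, map_neg]; ring
  · have h := ((hasDerivAt_line (hf.dirDeriv p) v p 0).mul (hasDerivAt_line hf v m 0)).add
      ((hasDerivAt_line hf v p 0).mul (hasDerivAt_line (hf.dirDeriv m) v m 0))
    refine h.congr_deriv ?_
    simp only [zero_smul, add_zero, dirDeriv_dirDeriv hf, logHessian_apply]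
    simp only [dirDeriv, hp, hm, map_sub, map_neg, sub_apply, neg_apply]
    ring

/-- Second order expansion of the integrand of the collision operator at small relative speed. -/
theorem tendsto_rayProd {f : Vel d → ℝ} (hf : ContDiff ℝ (⊤ : ℕ∞) f) (v σ x y : Vel d) :
    Filter.Tendsto (fun r => ((rayProd f v σ x r + rayProd f v σ y r) / 2 - rayProd f v σ σ r) / r ^ 2)
      (nhdsWithin 0 (Ioi 0))
      (nhds ((1 / 2) * (logHessian f v x x + logHessian f v y y) - logHessian f v σ σ)) := by
  obtain ⟨g₁, h₁, z₁, k₁⟩ := exists_hasDerivAt_rayProd hf v σ x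
  obtain ⟨g₂, h₂, z₂, k₂⟩ := exists_hasDerivAt_rayProd hf v σ y
  obtain ⟨g₃, h₃, z₃, k₃⟩ := exists_hasDerivAt_rayProd hf v σ σ
  have hφ : ∀ r, HasDerivAt (fun r => (rayProd f v σ x r + rayProd f v σ y r) / 2 - rayProd f v σ σ r)
      ((g₁ r + g₂ r) / 2 - g₃ r) r := fun r => (((h₁ r).add (h₂ r)).div_const 2).sub (h₃ r)
  have hk := ((k₁.add k₂).div_const 2).sub k₃
  have hsq : ∀ r : ℝ, HasDerivAt (fun r : ℝ => r ^ 2) (2 * r) r := fun r => by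
    simpa using hasDerivAt_pow 2 r
  refine HasDerivAt.lhopital_zero_nhdsGT (Filter.Eventually.of_forall hφ)
    (Filter.Eventually.of_forall hsq) ?_ ?_ ?_ ?_
  · filter_upwards [self_mem_nhdsWithin] with r hr
    exact mul_ne_zero two_ne_zero (ne_of_gt hr)
  · have := ((hφ 0).continuousAt.tendsto).mono_left (nhdsWithin_le_nhds (s := Ioi 0))
    simpa [rayProd] using this
  · have := ((hsq 0).continuousAt.tendsto).mono_left (nhdsWithin_le_nhds (s := Ioi 0))
    simpa using this
  · have h := ((hasDerivAt_iff_tendsto_slope.1 hk).mono_left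
      (nhdsWithin_mono 0 fun r (hr : r ∈ Ioi 0) => ne_of_gt hr)).const_mul (1 / 2 : ℝ)
    have e : ∀ r : ℝ, (1 / 2) * slope ((fun r => (g₁ + g₂) r / 2) - g₃) 0 r
        = ((g₁ r + g₂ r) / 2 - g₃ r) / (2 * r) := fun r => by
      rw [slope_def_field]
      simp only [Pi.sub_apply, Pi.add_apply, z₁, z₂, z₃, sub_zero]
      rw [mul_comm 2 r, ← div_div]
      ring
    have h' := h.congr e
    refine (congrArg (fun c => Filter.Tendsto _ _ (nhds c)) ?_).mp h'
    ring

/-- The integrand of the collision operator in polar coordinates around the velocity `v`. -/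
theorem collisionIntegrand_polar (α b : ℝ → ℝ) (f : Vel d → ℝ) (v : Vel d) (σ : Sph d) (x : Vel d)
    (s : ℝ) :
    collisionIntegrand (fun r c => α (r / 2) * b c) f v (v - (2 : ℝ) • polarMap (σ, s)) x
      = ((rayProd f v σ x (Real.exp s) + rayProd f v σ (axisRefl (σ : Vel d) x) (Real.exp s)) / 2
        - rayProd f v σ σ (Real.exp s)) * (α (Real.exp s) * b (inner ℝ x (σ : Vel d))) := by
  have hs := Real.exp_pos s
  set w := v - (2 : ℝ) • polarMap (σ, s) with hw
  have e1 : v - w = (2 * Real.exp s) • (σ : Vel d) := by rw [hw, polarMap]; module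
  have e2 : ‖v - w‖ = 2 * Real.exp s := by
    rw [e1, norm_smul, Sph.norm_eq σ, mul_one, Real.norm_of_nonneg (by positivity)]
  have e3 : relDir v w = σ := by
    rw [relDir, e2, e1, smul_smul, inv_mul_cancel₀ (by positivity), one_smul]
  have e4 : 2 * Real.exp s / 2 = Real.exp s := by ring
  have e5 : ∀ y : Vel d, postProd f v w y = rayProd f v σ y (Real.exp s) := fun y => by
    rw [postProd, rayProd, e2, e4, hw, polarMap]
    congr 2 <;> module
  have e6 : f v * f w = rayProd f v σ σ (Real.exp s) := by
    rw [rayProd, hw, polarMap]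
    congr 2 <;> module
  rw [collisionIntegrand, e2, e3, e4, e5, e5, e6, real_inner_comm]

namespace AngularKernel

variable {b : ℝ → ℝ} (hb : AngularKernel d b)
include hb

/-- For a collision rate that is too singular at small relative speed, the collision integral
converges only if the Dirichlet form vanishes on the Hessian of `log f`. -/
theorem dirForm_logHessian_eq_zero (hd : 1 ≤ d) {α : ℝ → ℝ} (hpos : ∀ r, 0 < r → 0 < α r)
    (hdiff : ∀ r, 0 < r → DifferentiableAt ℝ α r)
    (hint : ¬ IntegrableOn (fun s => Real.exp (d * s) * (α (Real.exp s) * Real.exp s ^ 2)) (Iic 0))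
    {f : Vel d → ℝ} (hf : ContDiff ℝ (⊤ : ℕ∞) f) (v : Vel d)
    (hconv : Integrable (fun p : Vel d × Sph d =>
      collisionIntegrand (fun r c => α (r / 2) * b c) f v p.1 p.2) (volume.prod (surf d))) :
    dirForm b (fun x => logHessian f v x x) (fun x => logHessian f v x x) = 0 := by
  have hfin : IsFiniteMeasure (surf d) := by unfold surf; infer_instance
  set N : Vel d → ℝ := fun x => logHessian f v x x with hN
  have hNs : SmoothEven N := SmoothEven.bilinear _
  refine hb.dirForm_eq_zero_of_ae hNs ?_
  have hmeas : MeasurableSet {p : Sph d × Sph d |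
      mirrorDiff N (p.1 : Vel d) p.2 * b (inner ℝ (p.2 : Vel d) (p.1 : Vel d)) = 0} := by
    refine measurableSet_eq_fun ?_ measurable_const
    exact (measurable_mirrorDiff hNs.continuous).mul (hb.meas.comp (by fun_prop :
      Continuous fun q : Sph d × Sph d => (inner ℝ (q.2 : Vel d) (q.1 : Vel d) : ℝ)).measurable)
  refine (Measure.ae_ae_comm (p := fun σ σ' : Sph d =>
    mirrorDiff N (σ : Vel d) σ' * b (inner ℝ (σ' : Vel d) (σ : Vel d)) = 0) hmeas).2 ?_
  filter_upwards [hconv.prod_left_ae] with σ' hσ'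
  have h1 : Integrable (fun y : Vel d =>
      collisionIntegrand (fun r c => α (r / 2) * b c) f v (v - (2 : ℝ) • y) σ') :=
    (hσ'.comp_sub_left v).comp_smul two_ne_zero
  have h2 := ((measurePreserving_polarMap hd).integrable_comp_emb measurableEmbedding_polarMap).2 h1
  filter_upwards [h2.prod_right_ae] with σ hσ
  simp only [Function.comp_apply, collisionIntegrand_polar] at hσ
  by_contra hne
  obtain ⟨hD, hbne⟩ := mul_ne_zero_iff.1 hne
  set β := b (inner ℝ (σ' : Vel d) (σ : Vel d)) with hβ
  set D := mirrorDiff N (σ : Vel d) (σ' : Vel d) with hDdef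
  have hbpos : 0 < |β| := abs_pos.2 hbne
  have hDpos : 0 < |D| := abs_pos.2 hD
  set φ : ℝ → ℝ := fun r => (rayProd f v σ σ' r + rayProd f v σ (axisRefl (σ : Vel d) σ') r) / 2
    - rayProd f v σ σ r with hφ
  have hlim : Filter.Tendsto (fun r => |φ r / r ^ 2|) (nhdsWithin 0 (Ioi 0)) (nhds |D|) := by
    have := (tendsto_rayProd hf v σ σ' (axisRefl (σ : Vel d) σ')).abs
    rw [hDdef, mirrorDiff, smul_eq_mul]
    exact this
  have hev := hlim.eventually (lt_mem_nhds (half_lt_self hDpos))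
  obtain ⟨ρ, hρ0, hρ⟩ := (mem_nhdsGT_iff_exists_Ioo_subset).1 hev
  have hρ0' : (0 : ℝ) < ρ := hρ0
  have hc : Continuous fun s => α (Real.exp s) := continuous_iff_continuousAt.2 fun s =>
    ((hdiff _ (Real.exp_pos s)).continuousAt.comp (f := Real.exp) Real.continuous_exp.continuousAt)
  have hm : Continuous fun s => Real.exp (d * s) * (α (Real.exp s) * Real.exp s ^ 2) :=
    (by fun_prop : Continuous fun s : ℝ => Real.exp (d * s)).mul
      (hc.mul (Real.continuous_exp.pow 2))
  set s₀ := min 0 (Real.log ρ - 1) with hs₀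
  refine hint ?_
  rw [← Iic_union_Icc_eq_Iic (min_le_left 0 (Real.log ρ - 1))]
  refine IntegrableOn.union ?_ hm.continuousOn.integrableOn_Icc
  have h3 := (integrable_expMeasure_iff.1 hσ).norm.integrableOn (s := Iic s₀)
  refine (h3.const_mul (|β| * (|D| / 2))⁻¹).mono' hm.aestronglyMeasurable ?_
  filter_upwards [ae_restrict_mem measurableSet_Iic] with s hs
  have hse := Real.exp_pos s
  have hα := hpos _ hse
  have hsρ : Real.exp s < ρ := by
    rw [← Real.exp_log hρ0']
    refine Real.exp_lt_exp.2 ?_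
    have := (mem_Iic.1 hs).trans (min_le_right 0 (Real.log ρ - 1))
    linarith
  have h4 : |D| / 2 < |φ (Real.exp s) / Real.exp s ^ 2| := hρ ⟨hse, hsρ⟩
  rw [abs_div, abs_of_pos (by positivity : 0 < Real.exp s ^ 2), lt_div_iff₀ (by positivity)] at h4
  rw [Real.norm_of_nonneg (by positivity), norm_mul, Real.norm_of_nonneg (Real.exp_pos _).le,
    norm_mul, norm_mul, Real.norm_of_nonneg hα.le, Real.norm_eq_abs, Real.norm_eq_abs,
    ← div_eq_inv_mul, le_div_iff₀ (by positivity)]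
  calc Real.exp (d * s) * (α (Real.exp s) * Real.exp s ^ 2) * (|β| * (|D| / 2))
      = Real.exp (d * s) * (|D| / 2 * Real.exp s ^ 2 * (α (Real.exp s) * |β|)) := by ring
    _ ≤ Real.exp (d * s) * (|φ (Real.exp s)| * (α (Real.exp s) * |β|)) := by gcongr

end AngularKernel

/-! ### The monotonicity theorem -/

theorem IsSolution.fisher_eq_of_collision_eq_zero {B : ℝ → ℝ → ℝ} {T : EReal}
    {f : ℝ → Vel d → ℝ} (hf : IsSolution B T f)
    (h : ∀ t ∈ timeInterval T, ∀ v, collision B (f t) v = 0) {t₁ t₂ : ℝ}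
    (h₁ : t₁ ∈ timeInterval T) (h₂ : t₂ ∈ timeInterval T) (h12 : t₁ ≤ t₂) :
    fisher (f t₂) = fisher (f t₁) := by
  have hsub := Icc_subset_timeInterval h₁ h₂
  have : f t₂ = f t₁ := by
    funext v
    have := (convex_Icc t₁ t₂).norm_image_sub_le_of_norm_hasDerivWithin_le (C := 0)
      (fun t ht => (hf.equation t (hsub ht) v).hasDerivWithinAt)
      (fun t ht => by rw [h t (hsub ht) v, norm_zero]) (left_mem_Icc.2 h12) (right_mem_Icc.2 h12)
    rw [zero_mul] at this
    exact sub_eq_zero.1 (norm_le_zero_iff.1 this)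
  rw [this]

/-- The constant `Λ_b ≤ 2d` of nontrivial kernels bounds the logarithmic derivative of the collision
rate. -/
theorem rate_bound_of_bestLogSobolev_le {α b : ℝ → ℝ} (hpos : ∀ r, 0 < r → 0 < α r)
    (hα : ∀ r : ℝ, 0 < r →
      ENNReal.ofReal (r * |deriv α r| / (2 * α r)) ≤ (bestLogSobolev d b) ^ (1 / 2 : ℝ))
    (hΛ : bestLogSobolev d b ≤ ENNReal.ofReal (2 * d)) (r : ℝ) (hr : 0 < r) :
    r * |deriv α r| ≤ (d + 2) * α r := by
  have hd : (0 : ℝ) ≤ d := Nat.cast_nonneg d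
  have h1 := (hα r hr).trans (ENNReal.rpow_le_rpow hΛ (by norm_num : (0 : ℝ) ≤ 1 / 2))
  rw [ENNReal.ofReal_rpow_of_nonneg (by positivity) (by norm_num), ← Real.sqrt_eq_rpow,
    ENNReal.ofReal_le_ofReal_iff (Real.sqrt_nonneg _)] at h1
  have hp := hpos r hr
  have h2 : Real.sqrt (2 * d) ≤ (d + 2) / 2 := by
    rw [Real.sqrt_le_left (by positivity)]
    nlinarith [sq_nonneg ((d : ℝ) - 2)]
  have h3 := h1.trans h2
  rw [div_le_iff₀ (by positivity)] at h3
  linarith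

end Boltzmann

end

theorem theoremt (d : ℕ) (hd : 2 ≤ d) (α b : ℝ → ℝ)
    (hα_pos : ∀ r : ℝ, 0 < r → 0 < α r)
    (hα_diff : ∀ r : ℝ, 0 < r → DifferentiableAt ℝ α r)
    (hb_meas : Measurable b)
    (hb_nonneg : ∀ c ∈ Set.Icc (-1 : ℝ) 1, 0 ≤ b c)
    (hb_levy : Boltzmann.LevyCondition d b)
    (hα : ∀ r : ℝ, 0 < r →
      ENNReal.ofReal (r * |deriv α r| / (2 * α r)) ≤ (Boltzmann.bestLogSobolev d b) ^ (1 / 2 : ℝ))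
    (T : EReal) (f : ℝ → Boltzmann.Vel d → ℝ)
    (hf : Boltzmann.IsSolution (fun r c => α (r / 2) * b c) T f) :
    AntitoneOn (fun t => Boltzmann.fisher (f t)) (Boltzmann.timeInterval T) := by
  intro t₁ h₁ t₂ h₂ h12
  have hd1 : 1 ≤ d := by omega
  have hb : Boltzmann.AngularKernel d b := ⟨hb_meas, hb_nonneg, hb_levy⟩
  by_cases htriv : ∀ᵐ p : Boltzmann.Sph d × Boltzmann.Sph d
      ∂((Boltzmann.surf d).prod (Boltzmann.surf d)), Boltzmann.levyWeight b p = 0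
  · exact (hf.fisher_eq_of_collision_eq_zero
      (fun t ht v => hb.collision_eq_zero hd1 htriv α (hf.smooth t ht) v) h₁ h₂ h12).le
  have hae : inner ℝ (Boltzmann.bvec (⟨0, by omega⟩ : Fin d) : Boltzmann.Vel d)
      (Boltzmann.bvec ⟨1, by omega⟩) = (0 : ℝ) := by
    rw [Boltzmann.inner_bvec, Boltzmann.bvec_apply, if_neg (by simp)]
  have hΛ := hb.bestLogSobolev_le (Boltzmann.norm_bvec _) (Boltzmann.norm_bvec _) hae fun h =>
    htriv (hb.levyWeight_ae_eq_zero (Boltzmann.norm_bvec _) (Boltzmann.norm_bvec _) hae h)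
  have hN := Boltzmann.rate_bound_of_bestLogSobolev_le hα_pos hα hΛ
  by_cases hint : IntegrableOn
      (fun s => Real.exp (d * s) * (α (Real.exp s) * Real.exp s ^ 2)) (Iic 0)
  · have hk := Boltzmann.CollisionKernel.of_integrableOn hb hα_pos hα_diff hN le_rfl hint
    obtain ⟨C, hflow⟩ := hf.exists_flow h₁ h₂
    exact hflow.fisher_le hk hd1 hN hα h12
  · refine (hf.fisher_eq_of_collision_eq_zero (fun t ht v => ?_) h₁ h₂ h12).le
    have hs : Boltzmann.ScalarLogHessian (f t) := fun a e hae x => by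
      have h := hb.bilinear_eq_zero htriv (Boltzmann.logHessian_symm (hf.smooth t ht) x)
        (hb.dirForm_logHessian_eq_zero hd1 hα_pos hα_diff hint (hf.smooth t ht) x
          (hf.convergent t ht x)) hae
      rw [Boltzmann.logHessian_apply] at h
      rw [Boltzmann.dirDeriv_dirDeriv (hf.smooth t ht)]
      exact sub_eq_zero.1 h
    exact hs.collision_eq_zero (hf.smooth t ht) hd (hf.nonneg t ht) _ v
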